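/- Let $u,v$ be non-commuting variables (matrices of arbitrary size $m$). For $a_i,b_i,c_i,d_i,e_1,f_1,\kappa_i,z\in\mathbb C$ consider the autonomous system $$\begin{aligned} u'&=a_1u^3v+a_2u^2vu+a_3uvu^2+(2-a_1-a_2-a_3)vu^3+c_1u^2v+(-4-c_1-c_2)uvu+c_2vu^2\\&\quad-\kappa_1u^2+e_1uv+(2-e_1)vu+(\kappa_1+\kappa_2)u-\kappa_2+\kappa_4zu,\\ v'&=b_1u^2v^2+b_2uvuv+b_3uv^2u+b_4vu^2v+b_5vuvu+\Bigl(-3-\sum_{i=1}^5 b_i\Bigr)v^2u^2+d_1uv^2+(4-d_1-d_2)vuv+d_2v^2u\\&\quad-v^2+f_1uv+(2\kappa_1-f_1)vu-(\kappa_1+\kappa_2)v+\kappa_3-\kappa_4zv. \end{aligned}\tag{1}$$ For $m=1$ it is the Hamiltonian system $u'=\partial H/\partial v$, $v'=-\partial H/\partial u$ with $$H=u^3v^2-2u^2v^2+uv^2-\kappa_1u^2v+(\kappa_1+\kappa_2)uv-\kappa_2v-\kappa_3u+\kappa_4zuv .$$ A non-abelianization of a commutative polynomial $h(u,v)$ is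 a non-commutative polynomial over $\mathbb C$ of degree at most $\deg h$ that becomes $h$ when $u$ and $v$ commute. System (1) *admits a non-abelianization of the integral $h$* if $\operatorname{trace}S$ is a first integral of (1), for matrices of every size, for some non-abelianization $S$ of $h$. It *admits a non-abelianization of the symmetry of degree $9$* if there are non-abelianizations $G_1,G_2$ of $\frac{\partial H}{\partial v}H$ and $-\frac{\partial H}{\partial u}H$ such that $u_\tau=G_1$, $v_\tau=G_2$ is an infinitesimal symmetry of (1), that is, the flow commutes with (1) for matrices of every size. The transposition $u\mapsto u^T$, $v\mapsto v^T$ acts on systems by reversing the order of the factors in every monomial of the right-hand sides. **a)** System (1) admits non-abelianizations of both integrals $H$ and $H^2$ if and only if $$b_1=-a_1,\quad b_2=-a_1-a_2,\quad b_3=0,\quad b_4=1-a_2-a_3,\quad b_5=-2+a_1+a_2,\quad d_1=-c_1,\quad d_2=-c_2 .$$ **b)** Let $\kappa_4z\neq0$. If system (1) admits non-abelianizations of the integrals $H$ and $H^2$ and, in addition, of the symmetry of degree $9$, then, up to transposition, it is one of the following systems, in which $$T_u=-\kappa_1u^2+(\kappa_1+\kappa_2)u-\kappa_2+\kappa_4zu,\qquad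 T_v=-v^2-(\kappa_1+\kappa_2)v+\kappa_3-\kappa_4zv,$$ and, wherever $\hat\kappa_3$ occurs, $\hat\kappa_3\in\mathbb C$ satisfies $\kappa_3=\tfrac14(\hat\kappa_3^2-\kappa_1^2)$. (i) The Hamiltonian systems, with $c\in\mathbb C$ arbitrary: - $u'=u^2vu+uvu^2+c\,u^2v-(4+2c)uvu+c\,vu^2+uv+vu+T_u$, $\ v'=-uvuv-vu^2v-vuvu-c\,uv^2+(4+2c)vuv-c\,v^2u+\kappa_1uv+\kappa_1vu+T_v$. (ii) The systems with a generalized Okamoto integral: - $u'=u^3v+u^2vu-3u^2v-uvu+2uv+T_u$, $\ v'=-u^2v^2-2uvuv+3uv^2+vuv+2\kappa_1uv+T_v$; - $u'=u^3v+u^2vu-2u^2v-2uvu+uv+vu+T_u$, $\ v'=-u^2v^2-2uvuv+2uv^2+2vuv+2\kappa_1uv+T_v$; - $u'=2u^2vu-2u^2v-2uvu+2uv+T_u$, $\ v'=-2uvuv-vu^2v+2uv^2+2vuv+\tfrac12(3\kappa_1-\hat\kappa_3)uv+\tfrac12(\kappa_1+\hat\kappa_3)vu+T_v$; - $u'=2u^2vu-u^2v-3uvu+uv+vu+T_u$,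 $\ v'=-2uvuv-vu^2v+uv^2+3vuv+\tfrac12(3\kappa_1-\hat\kappa_3)uv+\tfrac12(\kappa_1+\hat\kappa_3)vu+T_v$; - $u'=u^2vu+uvu^2-u^2v-3uvu+2uv+T_u$, $\ v'=-uvuv-vu^2v-vuvu+uv^2+3vuv+\kappa_1uv+\kappa_1vu+T_v$. (iii) The systems - $u'=-u^3v+3u^2vu-4uvu+uv+vu+T_u$, $\ v'=u^2v^2-2uvuv-2vu^2v+4vuv+(\kappa_1-\hat\kappa_3)uv+(\kappa_1+\hat\kappa_3)vu+T_v$; - $u'=u^3v+u^2vu-4u^2v+3uv-vu+T_u$, $\ v'=-u^2v^2-2uvuv+4uv^2+2\kappa_1uv+T_v$; - $u'=2u^3v-4u^2v+2uv+T_u$, $\ v'=-2u^2v^2-2uvuv+vu^2v+4uv^2+\tfrac12(5\kappa_1-\hat\kappa_3)uv+\tfrac12(-\kappa_1+\hat\kappa_3)vu+T_v$; - $u'=2u^2vu-4uvu+2vu+T_u$, $\ v'=-2uvuv-vu^2v+4vuv+\tfrac12(3\kappa_1-\hat\kappa_3)uv+\tfrac12(\kappa_1+\hat\kappa_3)vu+T_v$.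 -/

import Mathlib

/-- Non-commutative polynomials over `ℂ` in two variables: the free associative unital algebra. -/
abbrev NCPoly : Type := FreeAlgebra ℂ (Fin 2)

namespace NCPoly

/-- The first non-commutative variable. -/
def u : NCPoly := FreeAlgebra.ι ℂ 0

/-- The second non-commutative variable. -/
def v : NCPoly := FreeAlgebra.ι ℂ 1

/-- The value of a non-commutative polynomial at a pair of square matrices of size `m`. -/
noncomputable def evalMatrix {m : ℕ} (U V : Matrix (Fin m) (Fin m) ℂ) :
    NCPoly →ₐ[ℂ] Matrix (Fin m) (Fin m) ℂ :=
  FreeAlgebra.lift ℂ ![U, V]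

/-- The commutative reduction (the case `m = 1`): `u`, `v` become the commuting variables
`X 0`, `X 1`. -/
noncomputable def abelianize : NCPoly →ₐ[ℂ] MvPolynomial (Fin 2) ℂ :=
  FreeAlgebra.lift ℂ MvPolynomial.X

/-- The non-commutative polynomials of degree at most `n`: the span of the words of length at
most `n`. -/
def degreeLE (n : ℕ) : Submodule ℂ NCPoly :=
  Submodule.span ℂ {w | ∃ l : List (Fin 2), l.length ≤ n ∧ w = (l.map (FreeAlgebra.ι ℂ)).prod}

/-- `S` is a non-abelianization of the commutative polynomial `h`: its commutative reduction is
`h` and its degree does not exceed that of `h`. -/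
def IsNonabelianization (S : NCPoly) (h : MvPolynomial (Fin 2) ℂ) : Prop :=
  abelianize S = h ∧ S ∈ degreeLE h.totalDegree

/-- The reversal of words. Since `(A B)ᵀ = Bᵀ Aᵀ`, this is the effect on a polynomial in `u`, `v`
of transposing its value and rewriting the result in terms of `uᵀ`, `vᵀ`. -/
noncomputable def transpose (p : NCPoly) : NCPoly :=
  MulOpposite.unop (FreeAlgebra.lift ℂ (fun i => MulOpposite.op (FreeAlgebra.ι ℂ i)) p)

end NCPoly

/-- An autonomous system `du/dt = rhsU (u, v)`, `dv/dt = rhsV (u, v)` with non-commutative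
polynomial right-hand sides. -/
@[ext]
structure NCSystem where
  /-- the right-hand side of the equation for `u` -/
  rhsU : NCPoly
  /-- the right-hand side of the equation for `v` -/
  rhsV : NCPoly

namespace NCSystem

open NCPoly

/-- The total derivative with respect to `t` by virtue of the system: the derivation of the free
algebra with `u ↦ rhsU`, `v ↦ rhsV`. It is the `ε`-part of the algebra homomorphism
`u ↦ u + ε rhsU`, `v ↦ v + ε rhsV`, `ε² = 0`. -/
noncomputable def timeDeriv (F : NCSystem) (p : NCPoly) : NCPoly :=
  (FreeAlgebra.lift ℂ
    (fun i : Fin 2 => (TrivSqZeroExt.inl (FreeAlgebra.ι ℂ i) +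
      TrivSqZeroExt.inr (![F.rhsU, F.rhsV] i) : TrivSqZeroExt NCPoly NCPoly)) p).snd

/-- `trace S` is a first integral of the matrix system, for matrices of every size `m`. -/
def IsTraceIntegral (F : NCSystem) (S : NCPoly) : Prop :=
  ∀ (m : ℕ) (U V : Matrix (Fin m) (Fin m) ℂ),
    (evalMatrix U V (F.timeDeriv S)).trace = 0

/-- `u_τ = G.rhsU`, `v_τ = G.rhsV` is an infinitesimal symmetry of the system `F`, for matrices
of every size `m`: the compatibility conditions `u_{tτ} = u_{τt}` and `v_{tτ} = v_{τt}` hold. -/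
def IsSymmetry (F G : NCSystem) : Prop :=
  ∀ (m : ℕ) (U V : Matrix (Fin m) (Fin m) ℂ),
    evalMatrix U V (F.timeDeriv G.rhsU) = evalMatrix U V (G.timeDeriv F.rhsU) ∧
    evalMatrix U V (F.timeDeriv G.rhsV) = evalMatrix U V (G.timeDeriv F.rhsV)

/-- The system has a first integral `trace S`, where `S` is a non-abelianization of `h`. -/
def AdmitsIntegral (F : NCSystem) (h : MvPolynomial (Fin 2) ℂ) : Prop :=
  ∃ S : NCPoly, S.IsNonabelianization h ∧ F.IsTraceIntegral S

/-- The system has an infinitesimal symmetry that is a non-abelianization of the symmetry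
`u_τ = (∂H/∂v) H ^ k`, `v_τ = -(∂H/∂u) H ^ k` of the scalar Hamiltonian system with
Hamiltonian `H`. -/
def AdmitsSymmetry (F : NCSystem) (H : MvPolynomial (Fin 2) ℂ) (k : ℕ) : Prop :=
  ∃ G : NCSystem,
    G.rhsU.IsNonabelianization (MvPolynomial.pderiv 1 H * H ^ k) ∧
    G.rhsV.IsNonabelianization (-MvPolynomial.pderiv 0 H * H ^ k) ∧
    F.IsSymmetry G

/-- The matrix transposition `τ(u) = uᵀ`, `τ(v) = vᵀ`. -/
noncomputable def transpose (F : NCSystem) : NCSystem :=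
  ⟨F.rhsU.transpose, F.rhsV.transpose⟩

end NCSystem

namespace PainleveFive

open NCPoly

/-- The parameters `κ₁, …, κ₄` of the scalar system. -/
structure Params where
  κ₁ : ℂ
  κ₂ : ℂ
  κ₃ : ℂ
  κ₄ : ℂ

/-- The coefficients of the general non-abelian ansatz. -/
structure Coeffs where
  a₁ : ℂ
  a₂ : ℂ
  a₃ : ℂ
  b₁ : ℂ
  b₂ : ℂ
  b₃ : ℂ
  b₄ : ℂ
  b₅ : ℂ
  c₁ : ℂ
  c₂ : ℂ
  d₁ : ℂ
  d₂ : ℂ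
  e₁ : ℂ
  f₁ : ℂ

/-- The scalar Hamiltonian; `X 0` is `u` and `X 1` is `v`. -/
noncomputable def hamiltonian (κ : Params) (z : ℂ) : MvPolynomial (Fin 2) ℂ :=
  let u : MvPolynomial (Fin 2) ℂ := MvPolynomial.X 0
  let v : MvPolynomial (Fin 2) ℂ := MvPolynomial.X 1
  u ^ 3 * v ^ 2 - 2 * u ^ 2 * v ^ 2 + u * v ^ 2 - κ.κ₁ • (u ^ 2 * v)
    + (κ.κ₁ + κ.κ₂) • (u * v) - κ.κ₂ • v - κ.κ₃ • u + (κ.κ₄ * z) • (u * v)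

/-- The general non-abelian autonomous system of Painlevé-5 type. -/
noncomputable def system (C : Coeffs) (κ : Params) (z : ℂ) : NCSystem where
  rhsU :=
    C.a₁ • (u ^ 3 * v) + C.a₂ • (u ^ 2 * v * u) + C.a₃ • (u * v * u ^ 2)
      + (2 - (C.a₁ + C.a₂ + C.a₃)) • (v * u ^ 3)
      + C.c₁ • (u ^ 2 * v) + (-4 - C.c₁ - C.c₂) • (u * v * u) + C.c₂ • (v * u ^ 2)
      - κ.κ₁ • u ^ 2 + C.e₁ • (u * v) + (2 - C.e₁) • (v * u)
      + (κ.κ₁ + κ.κ₂) • u - κ.κ₂ • 1 + (κ.κ₄ * z) • u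
  rhsV :=
    C.b₁ • (u ^ 2 * v ^ 2) + C.b₂ • (u * v * u * v) + C.b₃ • (u * v ^ 2 * u)
      + C.b₄ • (v * u ^ 2 * v) + C.b₅ • (v * u * v * u)
      + (-3 - (C.b₁ + C.b₂ + C.b₃ + C.b₄ + C.b₅)) • (v ^ 2 * u ^ 2)
      + C.d₁ • (u * v ^ 2) + (4 - C.d₁ - C.d₂) • (v * u * v) + C.d₂ • (v ^ 2 * u)
      - v ^ 2 + C.f₁ • (u * v) + (2 * κ.κ₁ - C.f₁) • (v * u)
      - (κ.κ₁ + κ.κ₂) • v + κ.κ₃ • 1 - (κ.κ₄ * z) • v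

/-- The part common to the right-hand sides for `u` of all the listed systems. -/
noncomputable def tailU (κ : Params) (z : ℂ) : NCPoly :=
  -(κ.κ₁ • u ^ 2) + (κ.κ₁ + κ.κ₂) • u - κ.κ₂ • 1 + (κ.κ₄ * z) • u

/-- The part common to the right-hand sides for `v` of all the listed systems. -/
noncomputable def tailV (κ : Params) (z : ℂ) : NCPoly :=
  -v ^ 2 - (κ.κ₁ + κ.κ₂) • v + κ.κ₃ • 1 - (κ.κ₄ * z) • v

/-- The Hamiltonian systems. The parameter `c` is the coefficient of the inner derivation
`p ↦ [p, [u, v]]`, which may be added freely since `[u, v]` is constant along the flow. -/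
noncomputable def hamiltonianSystem (c : ℂ) (κ : Params) (z : ℂ) : NCSystem where
  rhsU := u ^ 2 * v * u + u * v * u ^ 2 + c • (u ^ 2 * v) - (4 + 2 * c) • (u * v * u)
    + c • (v * u ^ 2) + u * v + v * u + tailU κ z
  rhsV := -(u * v * u * v) - v * u ^ 2 * v - v * u * v * u - c • (u * v ^ 2)
    + (4 + 2 * c) • (v * u * v) - c • (v ^ 2 * u)
    + κ.κ₁ • (u * v) + κ.κ₁ • (v * u) + tailV κ z

/-! The five systems with a generalized Okamoto integral. The number `h` is used by the systems
with `κ₃ = (h² - κ₁²) / 4`. -/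

noncomputable def okamotoSystem1 (κ : Params) (z : ℂ) : NCSystem where
  rhsU := u ^ 3 * v + u ^ 2 * v * u - 3 • (u ^ 2 * v) - u * v * u + 2 • (u * v) + tailU κ z
  rhsV := -(u ^ 2 * v ^ 2) - 2 • (u * v * u * v) + 3 • (u * v ^ 2) + v * u * v
    + (2 * κ.κ₁) • (u * v) + tailV κ z

noncomputable def okamotoSystem2 (κ : Params) (z : ℂ) : NCSystem where
  rhsU := u ^ 3 * v + u ^ 2 * v * u - 2 • (u ^ 2 * v) - 2 • (u * v * u) + u * v + v * u
    + tailU κ z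
  rhsV := -(u ^ 2 * v ^ 2) - 2 • (u * v * u * v) + 2 • (u * v ^ 2) + 2 • (v * u * v)
    + (2 * κ.κ₁) • (u * v) + tailV κ z

noncomputable def okamotoSystem3 (h : ℂ) (κ : Params) (z : ℂ) : NCSystem where
  rhsU := 2 • (u ^ 2 * v * u) - 2 • (u ^ 2 * v) - 2 • (u * v * u) + 2 • (u * v) + tailU κ z
  rhsV := -(2 • (u * v * u * v)) - v * u ^ 2 * v + 2 • (u * v ^ 2) + 2 • (v * u * v)
    + ((3 * κ.κ₁ - h) / 2) • (u * v) + ((κ.κ₁ + h) / 2) • (v * u) + tailV κ z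

noncomputable def okamotoSystem4 (h : ℂ) (κ : Params) (z : ℂ) : NCSystem where
  rhsU := 2 • (u ^ 2 * v * u) - u ^ 2 * v - 3 • (u * v * u) + u * v + v * u + tailU κ z
  rhsV := -(2 • (u * v * u * v)) - v * u ^ 2 * v + u * v ^ 2 + 3 • (v * u * v)
    + ((3 * κ.κ₁ - h) / 2) • (u * v) + ((κ.κ₁ + h) / 2) • (v * u) + tailV κ z

noncomputable def okamotoSystem5 (κ : Params) (z : ℂ) : NCSystem where
  rhsU := u ^ 2 * v * u + u * v * u ^ 2 - u ^ 2 * v - 3 • (u * v * u) + 2 • (u * v) + tailU κ z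
  rhsV := -(u * v * u * v) - v * u ^ 2 * v - v * u * v * u + u * v ^ 2 + 3 • (v * u * v)
    + κ.κ₁ • (u * v) + κ.κ₁ • (v * u) + tailV κ z

/-! The four remaining systems. The number `h` is used by the systems with
`κ₃ = (h² - κ₁²) / 4`. -/

noncomputable def newSystem1 (h : ℂ) (κ : Params) (z : ℂ) : NCSystem where
  rhsU := -(u ^ 3 * v) + 3 • (u ^ 2 * v * u) - 4 • (u * v * u) + u * v + v * u + tailU κ z
  rhsV := u ^ 2 * v ^ 2 - 2 • (u * v * u * v) - 2 • (v * u ^ 2 * v) + 4 • (v * u * v)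
    + (κ.κ₁ - h) • (u * v) + (κ.κ₁ + h) • (v * u) + tailV κ z

noncomputable def newSystem2 (κ : Params) (z : ℂ) : NCSystem where
  rhsU := u ^ 3 * v + u ^ 2 * v * u - 4 • (u ^ 2 * v) + 3 • (u * v) - v * u + tailU κ z
  rhsV := -(u ^ 2 * v ^ 2) - 2 • (u * v * u * v) + 4 • (u * v ^ 2)
    + (2 * κ.κ₁) • (u * v) + tailV κ z

noncomputable def newSystem3 (h : ℂ) (κ : Params) (z : ℂ) : NCSystem where
  rhsU := 2 • (u ^ 3 * v) - 4 • (u ^ 2 * v) + 2 • (u * v) + tailU κ z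
  rhsV := -(2 • (u ^ 2 * v ^ 2)) - 2 • (u * v * u * v) + v * u ^ 2 * v + 4 • (u * v ^ 2)
    + ((5 * κ.κ₁ - h) / 2) • (u * v) + ((-κ.κ₁ + h) / 2) • (v * u) + tailV κ z

noncomputable def newSystem4 (h : ℂ) (κ : Params) (z : ℂ) : NCSystem where
  rhsU := 2 • (u ^ 2 * v * u) - 4 • (u * v * u) + 2 • (v * u) + tailU κ z
  rhsV := -(2 • (u * v * u * v)) - v * u ^ 2 * v + 4 • (v * u * v)
    + ((3 * κ.κ₁ - h) / 2) • (u * v) + ((κ.κ₁ + h) / 2) • (v * u) + tailV κ z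

/-- The list of systems with given `κ` and `z`. -/
def IsListed (F : NCSystem) (κ : Params) (z : ℂ) : Prop :=
  (∃ c : ℂ, F = hamiltonianSystem c κ z) ∨
  F = okamotoSystem1 κ z ∨ F = okamotoSystem2 κ z ∨ F = okamotoSystem5 κ z ∨
  F = newSystem2 κ z ∨
  ∃ h : ℂ, κ.κ₃ = (h ^ 2 - κ.κ₁ ^ 2) / 4 ∧
    (F = okamotoSystem3 h κ z ∨ F = okamotoSystem4 h κ z ∨
      F = newSystem1 h κ z ∨ F = newSystem3 h κ z ∨ F = newSystem4 h κ z)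

end PainleveFive

/-! Matrices of arbitrary size see every word. Matrices attached to a path extract a single
coefficient of a non-commutative polynomial (`evalMatrix_pathMatrix`), and matrices attached to a
cycle extract the sum of the coefficients over the rotations of a word (`trace_cycleMatrix`). So the
symmetry condition becomes a system of linear equations for the coefficients of the unknown
symmetry, and the condition on a trace integral becomes one for the unknown sums over cyclic words.
The coefficients of these equations depend on the parameters of the system, and the prescribed
commutative reduction adds the inhomogeneous ones. The theorem asks for which parameters the
equations are solvable.

Sufficiency in a) comes from a Lax equation: a non-abelian Hamiltonian L satisfies L' = [L, M]
(`timeDeriv_lax`), so the traces of L and of its square are constant. For necessity, let p be the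
cyclic coefficient of uuuvv in the integral that reduces to H; that of uuvuv is then 1 - p. If p =
0, words of 8 and 7 letters give all conditions except the one that separates b₂ from b₅, and this
one follows from the leading part of the second integral (`b₂_eq_of_isTraceIntegral`). If p ≠ 0, the
leading part of the second integral cannot exist (`not_shift`, `not_half`).

For b), a system of the family found in a) is described by the element whose inner derivation
separates it from a Hamiltonian system; transposition exchanges al with -ga and mu with -nu and
changes the sign of be. Since the symmetry has degree 9 and the system degree 4, the longest words
in the commutator have 12 letters. They involve leading parts only and leave, up to transposition,
the points (0,0,0), (0,1,0), (0,2,0), (1,1,0), (-1,1,0), (2,1,0) for (al, be, ga). Words of 11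
letters bring in the cubic coefficients mu and nu, words of 10 letters the quadratic ones ep and ph,
and shorter words the remaining parameters. Solvability fixes mu, nu, ep and ph point by point, up
to the constant c of the Hamiltonian systems and a root of a quadratic equation for ph, which is
where the square in the formula for κ₃ comes from. The point (0,2,0), and one solution at the
origin, would force κ₄z = 0.

The origin is the hardest point. There [u, v] is constant for the leading part, so that the inner
derivation of [u, v]⁴ is an additional symmetry of degree 9 of this part. Its coefficient has to be
shown to vanish unless the system is Hamiltonian; what then remains is a nonlinear system that is
solved in `center_points`.

The linear algebra is done by certificates. A certificate lists the equations to be solved one after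
another, each with a single unknown left, together with the combinations in which no unknown is
left. Divisions are only by numbers or by expressions known to be nonzero. The kernel replays the
list, and by `check_sound` the resulting polynomial relations hold. A few unknowns may be kept as
variables in these relations; they are removed by short arguments with factorizations. -/

/-! ### Elimination of unknowns in systems of linear equations

The functions of this section are evaluated by the kernel; they are written with recursors. -/

namespace Elim

/-- Polynomials over `ℤ`. A term has the coefficient `p - n` and a monomial coded by a product of
primes, one for each variable. -/
inductive Poly
  | nil : Poly
  | cons : ℕ → ℕ → ℕ → Poly → Poly

namespace Poly

/-- A coefficient is never normalized as a difference; only equality of its two parts is tested, and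
then the term is dropped. All arithmetic is on natural numbers, which the kernel evaluates natively.
-/
noncomputable def addTerm (p n m : ℕ) (q : Poly) : Poly :=
  Poly.rec (Bool.rec (cons p n m nil) nil (Nat.beq p n))
    (fun p' n' m' t ih => Bool.rec (cons p' n' m' ih)
      (Bool.rec (cons (Nat.add p p') (Nat.add n n') m t) t
        (Nat.beq (Nat.add p p') (Nat.add n n'))) (Nat.beq m m')) q

noncomputable def add (p q : Poly) : Poly :=
  Poly.rec q (fun a b m _ ih => addTerm a b m ih) p

noncomputable def addMulTerm (p n m : ℕ) (q r : Poly) : Poly :=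
  Poly.rec r (fun a b k _ ih => addTerm (Nat.add (Nat.mul p a) (Nat.mul n b))
    (Nat.add (Nat.mul p b) (Nat.mul n a)) (Nat.mul m k) ih) q

/-- `p * q + r` -/
noncomputable def addMul (p q r : Poly) : Poly :=
  Poly.rec r (fun a b m _ ih => addMulTerm a b m q ih) p

noncomputable def neg (p : Poly) : Poly :=
  Poly.rec nil (fun a b m _ ih => cons b a m ih) p

/-- `(a - b) * p` -/
noncomputable def smul (a b : ℕ) (p : Poly) : Poly :=
  Poly.rec nil (fun a' b' m _ ih => cons (Nat.add (Nat.mul a a') (Nat.mul b b'))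
    (Nat.add (Nat.mul a b') (Nat.mul b a')) m ih) p

noncomputable def isNil (p : Poly) : Bool := Poly.rec true (fun _ _ _ _ _ => false) p

noncomputable def beq (p q : Poly) : Bool := isNil (add (neg p) q)

/-- Division of `n - p` by `c`. -/
noncomputable def divTerm (c p n m : ℕ) (q : Option Poly) : Option Poly :=
  Option.rec none (fun q =>
    Bool.rec
      (Bool.rec none (some (cons 0 (Nat.div (Nat.sub p n) c) m q))
        (Nat.beq (Nat.mul c (Nat.div (Nat.sub p n) c)) (Nat.sub p n)))
      (Bool.rec none (some (cons (Nat.div (Nat.sub n p) c) 0 m q))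
        (Nat.beq (Nat.mul c (Nat.div (Nat.sub n p) c)) (Nat.sub n p)))
      (Nat.ble p n)) q

noncomputable def divNeg (c : ℕ) (p : Poly) : Option Poly :=
  Poly.rec (some nil) (fun p n m _ ih => divTerm c p n m ih) p

/-- The solution `x` of `(a - b) * x + p = 0`. -/
noncomputable def solve (a b : ℕ) (p : Poly) : Option Poly :=
  Bool.rec (divNeg (Nat.sub a b) p) (divNeg (Nat.sub b a) (neg p)) (Nat.ble a b)

/-- The value of the monomial coded by `m`. -/
noncomputable def mev (x : ℕ → ℂ) (m : ℕ) : ℂ :=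
  -- The number 0 codes no monomial; with this default value `mev` is multiplicative on all of ℕ,
  -- and codes need not be checked to be nonzero.
  if m = 0 then 0 else m.factorization.prod fun p k => x p ^ k

/-- The value of a polynomial. -/
noncomputable def ev (x : ℕ → ℂ) : Poly → ℂ
  | nil => 0
  | cons p n m t => (p - n) * mev x m + ev x t

variable (x : ℕ → ℂ)

theorem mev_mul (m n : ℕ) : mev x (m * n) = mev x m * mev x n := by
  unfold mev
  rcases eq_or_ne m 0 with rfl | hm
  · simp
  rcases eq_or_ne n 0 with rfl | hn
  · simp
  rw [if_neg (mul_ne_zero hm hn), if_neg hm, if_neg hn, Nat.factorization_mul hm hn]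
  exact Finsupp.prod_add_index' (by simp) (by simp [pow_add])

theorem mev_one : mev x 1 = 1 := by simp [mev]

theorem mev_prime {p : ℕ} (hp : p.Prime) : mev x p = x p := by
  simp [mev, hp.ne_zero, hp.factorization]

theorem eq_of_beq {m n : ℕ} (h : Nat.beq m n = true) : m = n := Nat.eq_of_beq_eq_true h

theorem ev_addTerm (p n m : ℕ) (q : Poly) :
    ev x (addTerm p n m q) = (p - n) * mev x m + ev x q := by
  induction q with
  | nil =>
    change ev x (Bool.rec (cons p n m nil) nil (Nat.beq p n)) = _
    cases h : Nat.beq p n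
    · rfl
    · simp [ev, eq_of_beq h]
  | cons p' n' m' t ih =>
    change ev x (Bool.rec (cons p' n' m' (addTerm p n m t))
      (Bool.rec (cons (Nat.add p p') (Nat.add n n') m t) t
        (Nat.beq (Nat.add p p') (Nat.add n n'))) (Nat.beq m m')) = _
    cases h : Nat.beq m m'
    · simp only [ev, ih]; ring
    · have hm := eq_of_beq h
      cases h' : Nat.beq (Nat.add p p') (Nat.add n n')
      · simp only [ev, Nat.add_eq, Nat.cast_add, hm]; ring
      · have h0 : (p + p' : ℂ) = n + n' := by exact_mod_cast eq_of_beq h'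
        simp only [ev, hm]
        linear_combination (-mev x m') * h0

theorem ev_add (p q : Poly) : ev x (add p q) = ev x p + ev x q := by
  induction p with
  | nil => simp [add, ev]
  | cons a b m t ih =>
    change ev x (addTerm a b m (add t q)) = _
    rw [ev_addTerm, ih, ev]; ring

theorem ev_addMulTerm (p n m : ℕ) (q r : Poly) :
    ev x (addMulTerm p n m q r) = (p - n) * mev x m * ev x q + ev x r := by
  induction q with
  | nil => simp [addMulTerm, ev]
  | cons a b k t ih =>
    change ev x (addTerm _ _ (Nat.mul m k) (addMulTerm p n m t r)) = _
    rw [ev_addTerm, ih, ev]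
    simp only [Nat.add_eq, Nat.mul_eq, Nat.cast_add, Nat.cast_mul, mev_mul]
    ring

theorem ev_addMul (p q r : Poly) : ev x (addMul p q r) = ev x p * ev x q + ev x r := by
  induction p with
  | nil => simp [addMul, ev]
  | cons a b m t ih =>
    change ev x (addMulTerm a b m q (addMul t q r)) = _
    rw [ev_addMulTerm, ih, ev]; ring

theorem ev_neg (p : Poly) : ev x (neg p) = -ev x p := by
  induction p with
  | nil => simp [neg, ev]
  | cons a b m t ih =>
    change ev x (cons b a m (neg t)) = _
    rw [ev, ih, ev]; ring

theorem ev_smul (a b : ℕ) (p : Poly) : ev x (smul a b p) = (a - b) * ev x p := by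
  induction p with
  | nil => simp [smul, ev]
  | cons a' b' m t ih =>
    change ev x (cons _ _ m (smul a b t)) = _
    rw [ev, ih, ev]
    simp only [Nat.add_eq, Nat.mul_eq, Nat.cast_add, Nat.cast_mul]
    ring

theorem eq_nil_of_isNil {p : Poly} (h : isNil p = true) : p = nil := by
  cases p with
  | nil => rfl
  | cons => exact absurd h Bool.false_ne_true

theorem ev_eq_of_beq {p q : Poly} (h : beq p q = true) : ev x p = ev x q := by
  have h1 := ev_add x (neg p) q
  rw [eq_nil_of_isNil h, ev_neg, ev] at h1
  linear_combination h1

/-- Each quotient is multiplied back by `c` before it is accepted, so truncated division cannot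
produce a wrong value; an inexact division returns `none`. -/
theorem ev_divNeg {c : ℕ} {p q : Poly} (h : divNeg c p = some q) : c * ev x q = -ev x p := by
  induction p generalizing q with
  | nil => cases h; simp [ev]
  | cons p n m t ih =>
    change divTerm c p n m (divNeg c t) = some q at h
    cases ht : divNeg c t with
    | none => rw [ht] at h; cases h
    | some r =>
      have h1 := ih ht
      rw [ht] at h
      unfold divTerm at h
      cases hpn : Nat.ble p n with
      | true =>
        have hle : p ≤ n := Nat.le_of_ble_eq_true hpn
        cases hq : Nat.beq (Nat.mul c (Nat.div (Nat.sub n p) c)) (Nat.sub n p) with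
        | false => simp only [hpn, hq, reduceCtorEq] at h
        | true =>
          have h2 : ((c * ((n - p) / c) : ℕ) : ℂ) = ((n - p : ℕ) : ℂ) :=
            congrArg _ (eq_of_beq hq)
          simp only [hpn, hq, Option.some.injEq] at h
          rw [Nat.cast_sub hle, Nat.cast_mul] at h2
          rw [← h, ev, ev]
          change (c : ℂ) * ((((n - p) / c : ℕ) - (0 : ℕ)) * mev x m + ev x r) = _
          rw [Nat.cast_zero]
          linear_combination mev x m * h2 + h1
      | false =>
        have hle : n ≤ p := by
          by_contra hc
          rw [Nat.ble_eq_true_of_le (by omega)] at hpn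
          cases hpn
        cases hq : Nat.beq (Nat.mul c (Nat.div (Nat.sub p n) c)) (Nat.sub p n) with
        | false => simp only [hpn, hq, reduceCtorEq] at h
        | true =>
          have h2 : ((c * ((p - n) / c) : ℕ) : ℂ) = ((p - n : ℕ) : ℂ) :=
            congrArg _ (eq_of_beq hq)
          simp only [hpn, hq, Option.some.injEq] at h
          rw [Nat.cast_sub hle, Nat.cast_mul] at h2
          rw [← h, ev, ev]
          change (c : ℂ) * (((0 : ℕ) - ((p - n) / c : ℕ)) * mev x m + ev x r) = _
          rw [Nat.cast_zero]
          linear_combination (-mev x m) * h2 + h1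

theorem ev_solve {a b : ℕ} {p q : Poly} (h : solve a b p = some q) :
    (a - b) * ev x q + ev x p = 0 := by
  unfold solve at h
  cases hab : Nat.ble a b with
  | true =>
    rw [hab] at h
    have h1 := ev_divNeg x h
    rw [ev_neg, Nat.sub_eq, Nat.cast_sub (Nat.le_of_ble_eq_true hab)] at h1
    linear_combination -h1
  | false =>
    have hle : b ≤ a := by
      by_contra hc
      rw [Nat.ble_eq_true_of_le (by omega)] at hab
      cases hab
    rw [hab] at h
    have h1 := ev_divNeg x h
    rw [Nat.sub_eq, Nat.cast_sub hle] at h1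
    linear_combination h1

end Poly

/-! ### Tables of solved unknowns, linear equations, elimination scripts -/

/-- Finite maps from binary words to polynomials. -/
inductive Trie
  | nil : Trie
  | node : Option Poly → Trie → Trie → Trie

namespace Trie

noncomputable def get (t : Trie) : List Bool → Option Poly :=
  Trie.rec (fun _ => none) (fun v _ _ l r k =>
    List.rec v (fun a k _ => Bool.rec (l k) (r k) a) k) t

noncomputable def set (w : Poly) (k : List Bool) : Trie → Trie :=
  List.rec (fun t => Trie.rec (node (some w) nil nil) (fun _ l r _ _ => node (some w) l r) t)
    (fun a _ ih t => Bool.rec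
      (Trie.rec (node none (ih nil) nil) (fun v l r _ _ => node v (ih l) r) t)
      (Trie.rec (node none nil (ih nil)) (fun v l r _ _ => node v l (ih r)) t) a) k

theorem get_set_of_ne (w : Poly) {k j : List Bool} (h : j ≠ k) (t : Trie) :
    get (set w k t) j = get t j := by
  induction k generalizing j t with
  | nil =>
    cases j with
    | nil => exact absurd rfl h
    | cons b j => cases t <;> cases b <;> rfl
  | cons a k ih =>
    cases j with
    | nil => cases t <;> cases a <;> rfl
    | cons b j =>
      by_cases hab : a = b
      · subst hab
        have hjk : j ≠ k := fun e => h (by rw [e])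
        cases t <;> cases a <;> exact ih hjk _
      · cases t <;> cases a <;> cases b <;> first | rfl | exact absurd rfl hab

theorem get_set_self (w : Poly) (k : List Bool) (t : Trie) : get (set w k t) k = some w := by
  induction k generalizing t with
  | nil => cases t <;> rfl
  | cons a k ih => cases t <;> cases a <;> exact ih _

end Trie

/-- Linear combinations of unknowns. -/
inductive Lin
  | nil : Lin
  | cons : Poly → List Bool → Lin → Lin

noncomputable def kbeq (k : List Bool) : List Bool → Bool :=
  List.rec (fun j => List.rec true (fun _ _ _ => false) j)
    (fun a _ ih j => List.rec false (fun b j _ =>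
      Bool.rec (Bool.rec (ih j) false b) (Bool.rec false (ih j) b) a) j) k

/-- Zero coefficients are not recorded, since `step` recognizes an equation in one unknown by the
length of its list. -/
noncomputable def push (c : Poly) (k : List Bool) (L : Lin) : Lin :=
  Poly.rec L (fun _ _ _ _ _ => Lin.cons c k L) c

noncomputable def addUnknown (c : Poly) (k : List Bool) (L : Lin) : Lin :=
  Lin.rec (Lin.cons c k Lin.nil)
    (fun c' k' L ih => Bool.rec (Lin.cons c' k' ih) (push (Poly.add c c') k L) (kbeq k k')) L

/-- An equation: the constant term and the unknowns. -/
structure Row where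
  const : Poly
  lin : Lin

/-- Addition of `L`, the known unknowns being replaced by their values. -/
noncomputable def absorb (st : Trie) (L : Lin) : Poly → Lin → Row :=
  Lin.rec (fun p U => ⟨p, U⟩)
    (fun c k _ ih p U => Option.rec (ih p (addUnknown c k U)) (fun v => ih (Poly.addMul c v p) U)
      (st.get k)) L

noncomputable def scaleLin (a b : ℕ) (L : Lin) : Lin :=
  Lin.rec Lin.nil (fun c k _ ih => Lin.cons (Poly.smul a b c) k ih) L

/-- Combinations of equations: multipliers `a - b` and numbers of equations. -/
inductive Comb
  | nil : Comb
  | cons : ℕ → ℕ → ℕ → Comb → Comb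

/-- The table stores `D` times the value of an unknown, and constant terms are multiplied by `D`
accordingly. Thus values whose denominators divide `D` are represented with integral coefficients.
-/
noncomputable def combine (D : ℕ) (rows : ℕ → Row) (st : Trie) (C : Comb) : Row :=
  Comb.rec ⟨Poly.nil, Lin.nil⟩
    (fun a b n _ ih => Row.rec (fun p L => Row.rec (fun q M =>
      absorb st (scaleLin a b L) (Poly.add (Poly.smul (Nat.mul a D) (Nat.mul b D) p) q) M) ih)
      (rows n)) C

noncomputable def single (D : ℕ) (rows : ℕ → Row) (st : Trie) (n : ℕ) : Row :=
  Row.rec (fun p L => absorb st L (Poly.smul D 0 p) Lin.nil) (rows n)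

noncomputable def memPoly (p : Poly) (U : List Poly) : Bool :=
  List.rec false (fun q _ ih => Bool.rec ih true (Poly.beq p q)) U

/-- The new values if the only unknown of an equation has a constant coefficient. -/
noncomputable def solveConst (st : Trie) (p c : Poly) (k : List Bool) : Option Trie :=
  Poly.rec none (fun a b m t _ =>
    Bool.rec none
      (Bool.rec none
        (Bool.rec
          (Option.rec none (fun q => some (st.set q k)) (Poly.solve a b p)) none (Nat.beq a b))
        (Poly.isNil t))
      (Nat.beq m 1)) c

/-- The solution of an equation with a single unknown. -/
noncomputable def step (units : List Poly) (st : Trie) (r : Row) : Option Trie :=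
  Row.rec (fun p L => Lin.rec none (fun c k L _ => Lin.rec
    -- A non-constant coefficient from `units` is used only if the constant term is zero: the
    -- unknown then vanishes and no polynomial division is needed.
    (Bool.rec (solveConst st p c k) (Bool.rec none (some (st.set Poly.nil k)) (Poly.isNil p))
      (memPoly c units))
    (fun _ _ _ _ => none) L) L) r

/-- Scripts: the equations, and the combinations of equations, to be solved one after another. -/
inductive Script
  | nil : Script
  | row : ℕ → Script → Script
  | comb : Comb → Script → Script

noncomputable def Script.rows (L : List ℕ) (S : Script) : Script :=
  List.rec S (fun n _ ih => Script.row n ih) L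

noncomputable def run (D : ℕ) (rows : ℕ → Row) (units : List Poly) (S : Script) :
    Trie → Option Trie :=
  Script.rec (fun st => some st)
    (fun n _ ih st => Option.rec none (fun st => ih st) (step units st (single D rows st n)))
    (fun C _ ih st => Option.rec none (fun st => ih st) (step units st (combine D rows st C))) S

/-- The constraints that result from equations without unknowns agree with the given ones. -/
noncomputable def checkOut (D : ℕ) (rows : ℕ → Row) (st : Trie) (L : List (Comb × Poly)) : Bool :=
  List.rec true (fun s _ ih => Prod.rec (fun C q => Row.rec (fun p L =>
    Lin.rec (Bool.rec false ih (Poly.beq p q)) (fun _ _ _ _ => false) L)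
      (combine D rows st C)) s) L

/-- The initial values: selected unknowns are variables of the polynomials. -/
noncomputable def initTrie (D : ℕ) (L : List (List Bool × ℕ)) : Trie :=
  List.rec Trie.nil
    (fun s _ ih => Prod.rec (fun k i => ih.set (Poly.cons D 0 i Poly.nil) k) s) L

/-- A script that gets stuck makes the result `false`, so the data of a certificate need not be
trusted. -/
noncomputable def check (D : ℕ) (rows : ℕ → Row) (units : List Poly) (symb : List (List Bool × ℕ))
    (script : Script) (out : List (Comb × Poly)) : Bool :=
  Option.rec false (fun st => checkOut D rows st out) (run D rows units script (initTrie D symb))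

/-! ### Soundness of the elimination -/

section Soundness

open Elim.Poly

/-- The value of a linear combination of unknowns at `g`. -/
noncomputable def Lin.ev (x : ℕ → ℂ) (g : List Bool → ℂ) : Lin → ℂ
  | nil => 0
  | cons c k L => Poly.ev x c * g k + Lin.ev x g L

/-- The value of an equation at `g`. -/
noncomputable def Row.ev (x : ℕ → ℂ) (g : List Bool → ℂ) (r : Row) : ℂ :=
  Poly.ev x r.const + r.lin.ev x g

variable {x : ℕ → ℂ} {g : List Bool → ℂ} {D : ℕ} {rows : ℕ → Row} {units : List Poly}

theorem eq_of_kbeq {k j : List Bool} (h : kbeq k j = true) : k = j := by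
  induction k generalizing j with
  | nil =>
    cases j with
    | nil => rfl
    | cons => exact absurd h Bool.false_ne_true
  | cons a k ih =>
    cases j with
    | nil => exact absurd h Bool.false_ne_true
    | cons b j =>
      cases a <;> cases b
      · rw [ih h]
      · exact absurd h Bool.false_ne_true
      · exact absurd h Bool.false_ne_true
      · rw [ih h]

theorem ev_push (c : Poly) (k : List Bool) (L : Lin) :
    (push c k L).ev x g = Poly.ev x c * g k + L.ev x g := by
  cases c with
  | nil => simp [push, Poly.ev]
  | cons => rfl

theorem ev_addUnknown (c : Poly) (k : List Bool) (L : Lin) :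
    (addUnknown c k L).ev x g = Poly.ev x c * g k + L.ev x g := by
  induction L with
  | nil => rfl
  | cons c' k' L ih =>
    change (Bool.rec (Lin.cons c' k' (addUnknown c k L)) (push (Poly.add c c') k L)
      (kbeq k k') : Lin).ev x g = _
    cases h : kbeq k k'
    · simp only [Lin.ev, ih]; ring
    · simp only [ev_push, ev_add, Lin.ev, eq_of_kbeq h]; ring

/-- The values stored in a trie are `D` times the values of the unknowns. -/
def Valid (x : ℕ → ℂ) (g : List Bool → ℂ) (D : ℕ) (st : Trie) : Prop :=
  ∀ k v, st.get k = some v → D * g k = Poly.ev x v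

theorem Valid.set {st : Trie} (h : Valid x g D st) {k : List Bool} {v : Poly}
    (hk : D * g k = Poly.ev x v) : Valid x g D (st.set v k) := by
  intro j w hj
  by_cases hjk : j = k
  · subst hjk
    rw [Trie.get_set_self] at hj
    cases hj
    exact hk
  · rw [Trie.get_set_of_ne v hjk] at hj
    exact h j w hj

/-- The value of an equation whose constant term is scaled by `D`. -/
noncomputable def Row.scaledEv (x : ℕ → ℂ) (g : List Bool → ℂ) (D : ℕ) (r : Row) : ℂ :=
  Poly.ev x r.const + D * r.lin.ev x g

/-- Replacing a solved unknown `k` by its stored value `v` moves `c * v`, which is `D * c * g k` by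
validity, into the constant term, and this is the term already scaled by `D`. -/
theorem scaledEv_absorb {st : Trie} (h : Valid x g D st) (L : Lin) (p : Poly) (U : Lin) :
    (absorb st L p U).scaledEv x g D = D * L.ev x g + (Row.mk p U).scaledEv x g D := by
  induction L generalizing p U with
  | nil => simp [absorb, Lin.ev]
  | cons c k L ih =>
    change Row.scaledEv x g D (Option.rec (absorb st L p (addUnknown c k U))
      (fun v => absorb st L (Poly.addMul c v p) U) (st.get k)) = _
    cases hk : st.get k with
    | none =>
      simp only [ih]
      simp only [Row.scaledEv, ev_addUnknown, Lin.ev]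
      ring
    | some v =>
      simp only [ih]
      simp only [Row.scaledEv, ev_addMul, Lin.ev]
      linear_combination (-Poly.ev x c) * h k v hk

theorem ev_scaleLin (a b : ℕ) (L : Lin) : (scaleLin a b L).ev x g = (a - b) * L.ev x g := by
  induction L with
  | nil => simp [scaleLin, Lin.ev]
  | cons c k L ih =>
    change Poly.ev x (Poly.smul a b c) * g k + (scaleLin a b L).ev x g = _
    rw [ih, ev_smul, Lin.ev]; ring

theorem scaledEv_combine {st : Trie} (h : Valid x g D st) (hrows : ∀ n, (rows n).ev x g = 0)
    (C : Comb) : (combine D rows st C).scaledEv x g D = 0 := by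
  induction C with
  | nil => simp [combine, Row.scaledEv, Poly.ev, Lin.ev]
  | cons a b n C ih =>
    have hr := hrows n
    change Row.scaledEv x g D (absorb st (scaleLin a b (rows n).lin)
      (Poly.add (Poly.smul (Nat.mul a D) (Nat.mul b D) (rows n).const) (combine D rows st C).const)
      (combine D rows st C).lin) = 0
    rw [scaledEv_absorb h, ev_scaleLin]
    simp only [Row.scaledEv, Row.ev, ev_add, ev_smul, Nat.mul_eq, Nat.cast_mul] at *
    linear_combination ih + ((a : ℂ) - b) * D * hr

theorem scaledEv_single {st : Trie} (h : Valid x g D st) (hrows : ∀ n, (rows n).ev x g = 0)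
    (n : ℕ) : (single D rows st n).scaledEv x g D = 0 := by
  have hr := hrows n
  change Row.scaledEv x g D (absorb st (rows n).lin (Poly.smul D 0 (rows n).const) Lin.nil) = 0
  rw [scaledEv_absorb h]
  simp only [Row.scaledEv, Row.ev, ev_smul, Lin.ev, Nat.cast_zero] at *
  linear_combination (D : ℂ) * hr

theorem ev_ne_zero_of_memPoly {p : Poly} {L : List Poly} (hL : ∀ p ∈ L, Poly.ev x p ≠ 0)
    (h : memPoly p L = true) : Poly.ev x p ≠ 0 := by
  induction L with
  | nil => exact absurd h Bool.false_ne_true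
  | cons q L ih =>
    change (Bool.rec (memPoly p L) true (Poly.beq p q) : Bool) = true at h
    cases hq : Poly.beq p q
    · rw [hq] at h
      exact ih (fun r hr => hL r (List.mem_cons_of_mem _ hr)) h
    · rw [ev_eq_of_beq x hq]
      exact hL q List.mem_cons_self

theorem Valid.solveConst {st st' : Trie} (h : Valid x g D st) {p c : Poly} {k : List Bool}
    (hr : Poly.ev x p + D * (Poly.ev x c * g k) = 0) (hs : solveConst st p c k = some st') :
    Valid x g D st' := by
  cases c with
  | nil => cases hs
  | cons a b m t =>
    unfold Elim.solveConst at hs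
    cases hm : Nat.beq m 1 with
    | false => simp [hm] at hs
    | true =>
    cases ht : Poly.isNil t with
    | false => simp [hm, ht] at hs
    | true =>
    cases hab : Nat.beq a b with
    | true => simp [hm, ht, hab] at hs
    | false =>
    cases hq : Poly.solve a b p with
    | none => simp [hm, ht, hab, hq] at hs
    | some q =>
    simp only [hm, ht, hab, hq, Option.some.injEq] at hs
    rw [← hs]
    apply h.set
    have h1 := ev_solve x hq
    rw [Poly.ev, Poly.eq_of_beq hm, mev_one, Poly.eq_nil_of_isNil ht, Poly.ev] at hr
    have hne : (a : ℂ) - b ≠ 0 := by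
      intro h0
      have : a = b := by exact_mod_cast sub_eq_zero.1 h0
      rw [this] at hab
      simp at hab
    -- Only the numerical coefficient `a - b` is cancelled; `D` itself is never divided by and need
    -- not be nonzero.
    apply mul_left_cancel₀ hne
    linear_combination hr - h1

theorem Valid.step {st st' : Trie} (h : Valid x g D st) (hunits : ∀ p ∈ units, Poly.ev x p ≠ 0)
    {r : Row} (hr : r.scaledEv x g D = 0) (hs : step units st r = some st') :
    Valid x g D st' := by
  obtain ⟨p, L⟩ := r
  cases L with
  | nil => cases hs
  | cons c k L =>
    cases L with
    | cons => cases hs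
    | nil =>
      simp only [Row.scaledEv, Lin.ev, add_zero] at hr
      change (Bool.rec (Elim.solveConst st p c k)
        (Bool.rec none (some (st.set Poly.nil k)) (Poly.isNil p)) (memPoly c units) : Option Trie)
        = some st' at hs
      cases hc : memPoly c units with
      | false =>
        rw [hc] at hs
        exact h.solveConst hr hs
      | true =>
        rw [hc] at hs
        cases hp : Poly.isNil p with
        | false => rw [hp] at hs; cases hs
        | true =>
          rw [hp] at hs
          cases hs
          apply h.set
          apply mul_left_cancel₀ (ev_ne_zero_of_memPoly hunits hc)
          rw [Poly.eq_nil_of_isNil hp] at hr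
          simp only [Poly.ev] at hr ⊢
          linear_combination hr

theorem Valid.run (hrows : ∀ n, (rows n).ev x g = 0) (hunits : ∀ p ∈ units, Poly.ev x p ≠ 0)
    {S : Script} {st st' : Trie} (h : Valid x g D st)
    (hs : run D rows units S st = some st') : Valid x g D st' := by
  induction S generalizing st with
  | nil => cases hs; exact h
  | row n S ih =>
    change (Option.rec none (fun st => Elim.run D rows units S st)
      (Elim.step units st (single D rows st n)) : Option Trie) = some st' at hs
    cases h1 : Elim.step units st (single D rows st n) with
    | none => rw [h1] at hs; cases hs
    | some st1 =>
      rw [h1] at hs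
      exact ih (h.step hunits (scaledEv_single h hrows n) h1) hs
  | comb C S ih =>
    change (Option.rec none (fun st => Elim.run D rows units S st)
      (Elim.step units st (combine D rows st C)) : Option Trie) = some st' at hs
    cases h1 : Elim.step units st (combine D rows st C) with
    | none => rw [h1] at hs; cases hs
    | some st1 =>
      rw [h1] at hs
      exact ih (h.step hunits (scaledEv_combine h hrows C) h1) hs

theorem valid_initTrie {symb : List (List Bool × ℕ)} (hsymb : ∀ s ∈ symb, mev x s.2 = g s.1) :
    Valid x g D (initTrie D symb) := by
  induction symb with
  | nil => intro k v h; cases h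
  | cons s L ih =>
    apply Valid.set (ih fun t ht => hsymb t (List.mem_cons_of_mem _ ht))
    simp [Poly.ev, hsymb s List.mem_cons_self]

/-- Once every unknown of a combination has been replaced, what is left is its constant term, a
relation between the parameters and the unknowns that were kept as variables. -/
theorem checkOut_sound {st : Trie} (h : Valid x g D st) (hrows : ∀ n, (rows n).ev x g = 0)
    {out : List (Comb × Poly)} (ho : checkOut D rows st out = true) :
    ∀ s ∈ out, Poly.ev x s.2 = 0 := by
  induction out with
  | nil => simp
  | cons s L ih =>
    have hc := scaledEv_combine h hrows s.1
    change (Row.rec (fun p M => Lin.rec (Bool.rec false (checkOut D rows st L) (Poly.beq p s.2))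
      (fun _ _ _ _ => false) M) (combine D rows st s.1) : Bool) = true at ho
    cases hr : combine D rows st s.1 with
    | mk p M =>
      rw [hr] at ho hc
      cases M with
      | cons => exact absurd ho Bool.false_ne_true
      | nil =>
        change (Bool.rec false (checkOut D rows st L) (Poly.beq p s.2) : Bool) = true at ho
        cases hq : Poly.beq p s.2 with
        | false => rw [hq] at ho; exact absurd ho Bool.false_ne_true
        | true =>
          rw [hq] at ho
          intro q hmem
          rcases List.mem_cons.1 hmem with rfl | hmem
          · rw [← ev_eq_of_beq x hq]
            simpa [Row.scaledEv, Lin.ev] using hc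
          · exact ih ho q hmem

/-- The constraints found by elimination hold. -/
theorem check_sound (hrows : ∀ n, (rows n).ev x g = 0) (hunits : ∀ p ∈ units, Poly.ev x p ≠ 0)
    {symb : List (List Bool × ℕ)} (hsymb : ∀ s ∈ symb, mev x s.2 = g s.1)
    {script : Script} {out : List (Comb × Poly)}
    (hc : check D rows units symb script out = true) : ∀ s ∈ out, Poly.ev x s.2 = 0 := by
  unfold check at hc
  cases hst : Elim.run D rows units script (initTrie D symb) with
  | none => rw [hst] at hc; cases hc
  | some st =>
    rw [hst] at hc
    exact checkOut_sound ((valid_initTrie hsymb).run hrows hunits hst) hrows hc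

end Soundness

end Elim


/-! ### Coefficients of non-commutative polynomials -/

namespace NCPoly

/-- The generators, indexed by the letters `false` (for `u`) and `true` (for `v`). -/
noncomputable def gen (a : Bool) : NCPoly := FreeAlgebra.ι ℂ (bif a then 1 else 0)

/-- The monomial of a word. -/
noncomputable def word (w : List Bool) : NCPoly := (w.map gen).prod

@[simp] theorem word_nil : word [] = 1 := rfl

@[simp] theorem word_cons (a : Bool) (w : List Bool) : word (a :: w) = gen a * word w := by
  simp [word]

theorem word_append (v w : List Bool) : word (v ++ w) = word v * word w := by
  simp [word]

theorem u_eq_gen : u = gen false := rfl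

theorem v_eq_gen : v = gen true := rfl

/-- Left multiplication by a letter on functions of words. -/
noncomputable def shift (a : Bool) : (List Bool → ℂ) →ₗ[ℂ] (List Bool → ℂ) where
  toFun h w := List.rec 0 (fun b w _ => if a = b then h w else 0) w
  map_add' f g := by
    ext w
    cases w with
    | nil => simp
    | cons b w => by_cases h : a = b <;> simp [h]
  map_smul' c f := by
    ext w
    cases w with
    | nil => simp
    | cons b w => by_cases h : a = b <;> simp [h]

/-- The action of polynomials on functions of words by left multiplication. -/
noncomputable def action : NCPoly →ₐ[ℂ] Module.End ℂ (List Bool → ℂ) :=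
  FreeAlgebra.lift ℂ fun i => shift (i == 1)

/-- The coefficients of a polynomial. -/
noncomputable def coeff : NCPoly →ₗ[ℂ] (List Bool → ℂ) :=
  -- A word takes the delta function at the empty word to the delta function at that word, so the
  -- image of this vector displays all coefficients.
  (LinearMap.applyₗ (fun w : List Bool => if w = [] then (1 : ℂ) else 0)).comp action.toLinearMap

theorem coeff_apply (p : NCPoly) :
    coeff p = action p (fun w : List Bool => if w = [] then (1 : ℂ) else 0) := rfl

theorem action_gen (a : Bool) : action (gen a) = shift a := by
  cases a <;> simp [action, gen]

theorem coeff_one (w : List Bool) : coeff 1 w = if w = [] then 1 else 0 := by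
  simp [coeff_apply]

theorem coeff_gen_mul (a : Bool) (p : NCPoly) : coeff (gen a * p) = shift a (coeff p) := by
  rw [coeff_apply, coeff_apply, map_mul, action_gen]; rfl

@[simp] theorem coeff_gen_mul_nil (a : Bool) (p : NCPoly) : coeff (gen a * p) [] = 0 := by
  rw [coeff_gen_mul]; rfl

@[simp] theorem coeff_gen_mul_cons (a b : Bool) (p : NCPoly) (w : List Bool) :
    coeff (gen a * p) (b :: w) = if a = b then coeff p w else 0 := by
  rw [coeff_gen_mul]; rfl

theorem coeff_word (v w : List Bool) : coeff (word v) w = if v = w then 1 else 0 := by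
  induction v generalizing w with
  | nil => simp [coeff_one, eq_comm]
  | cons a v ih =>
    cases w with
    | nil => simp
    | cons b w =>
      rw [word_cons, coeff_gen_mul_cons, ih]
      by_cases h : a = b <;> simp [h]

theorem span_word : Submodule.span ℂ (Set.range word) = ⊤ := by
  rw [eq_top_iff]
  intro p hp
  clear hp
  -- With an arbitrary right factor `q` the induction on `p` never multiplies two sums; the claim is
  -- the case `q = 1`.
  suffices h : ∀ q ∈ Submodule.span ℂ (Set.range word), p * q ∈ Submodule.span ℂ (Set.range word) by
    simpa using h 1 (Submodule.subset_span ⟨[], rfl⟩)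
  induction p using FreeAlgebra.induction with
  | grade0 r =>
    intro q hq
    rw [← Algebra.smul_def]
    exact Submodule.smul_mem _ _ hq
  | grade1 i =>
    intro q hq
    have hi : FreeAlgebra.ι ℂ i = gen (i == 1) := by fin_cases i <;> rfl
    induction hq using Submodule.span_induction with
    | mem q hq =>
      obtain ⟨w, rfl⟩ := hq
      exact Submodule.subset_span ⟨(i == 1) :: w, by rw [word_cons, hi]⟩
    | zero => simp
    | add p q _ _ hp hq => rw [mul_add]; exact Submodule.add_mem _ hp hq
    | smul c q _ hq => rw [mul_smul_comm]; exact Submodule.smul_mem _ _ hq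
  | mul a b ha hb =>
    intro q hq
    rw [mul_assoc]
    exact ha _ (hb _ hq)
  | add a b ha hb =>
    intro q hq
    rw [add_mul]
    exact Submodule.add_mem _ (ha _ hq) (hb _ hq)

/-- Two linear maps that agree on words are equal. -/
theorem linearMap_ext {M : Type*} [AddCommMonoid M] [Module ℂ M] {f g : NCPoly →ₗ[ℂ] M}
    (h : ∀ w, f (word w) = g (word w)) : f = g := by
  apply LinearMap.ext_on_range span_word
  exact h

/-- The product of functions of words. -/
noncomputable def conv : (List Bool → ℂ) → (List Bool → ℂ) → List Bool → ℂ
  | f, h, [] => f [] * h []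
  | f, h, a :: w => f [] * h (a :: w) + conv (fun y => f (a :: y)) h w

theorem conv_zero_left (h : List Bool → ℂ) (w : List Bool) : conv (fun _ => 0) h w = 0 := by
  induction w with
  | nil => simp [conv]
  | cons a w ih => simp [conv, ih]

theorem conv_zero_right (f : List Bool → ℂ) (w : List Bool) : conv f (fun _ => 0) w = 0 := by
  induction w generalizing f with
  | nil => simp [conv]
  | cons a w ih => simp [conv, ih]

theorem conv_add_left (f g h : List Bool → ℂ) (w : List Bool) :
    conv (fun y => f y + g y) h w = conv f h w + conv g h w := by
  induction w generalizing f g with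
  | nil => simp [conv]; ring
  | cons a w ih => simp [conv, ih]; ring

theorem conv_smul_left (c : ℂ) (f h : List Bool → ℂ) (w : List Bool) :
    conv (fun y => c * f y) h w = c * conv f h w := by
  induction w generalizing f with
  | nil => simp [conv]; ring
  | cons a w ih => simp [conv, ih]; ring

theorem conv_add_right (f g h : List Bool → ℂ) (w : List Bool) :
    conv f (fun y => g y + h y) w = conv f g w + conv f h w := by
  induction w generalizing f with
  | nil => simp [conv]; ring
  | cons a w ih => simp [conv, ih]; ring

theorem conv_smul_right (c : ℂ) (f h : List Bool → ℂ) (w : List Bool) :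
    conv f (fun y => c * h y) w = c * conv f h w := by
  induction w generalizing f with
  | nil => simp [conv]; ring
  | cons a w ih => simp [conv, ih]; ring

/-- By linearity the left factor may be a word; its letters are then compared with those of `w` from
the front, and `conv` strips the same letter on both sides. -/
theorem coeff_mul (p q : NCPoly) (w : List Bool) :
    coeff (p * q) w = conv (coeff p) (coeff q) w := by
  have hlin : (LinearMap.proj w ∘ₗ coeff ∘ₗ LinearMap.mulRight ℂ q : NCPoly →ₗ[ℂ] ℂ) =
      { toFun := fun p => conv (coeff p) (coeff q) w
        map_add' := fun a b => by
          rw [map_add]; exact conv_add_left _ _ _ _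
        map_smul' := fun c a => by
          rw [map_smul]; exact conv_smul_left _ _ _ _ } := by
    apply linearMap_ext
    intro v
    simp only [LinearMap.comp_apply, LinearMap.mulRight_apply, LinearMap.proj_apply,
      LinearMap.coe_mk, AddHom.coe_mk]
    induction v generalizing w with
    | nil =>
      rw [word_nil, one_mul]
      cases w with
      | nil => simp [conv, coeff_one]
      | cons a w => simp [conv, coeff_one, conv_zero_left]
    | cons a v ih =>
      rw [word_cons, mul_assoc]
      cases w with
      | nil => simp [conv]
      | cons b w =>
        rw [coeff_gen_mul_cons, conv]
        simp only [coeff_gen_mul_nil, zero_mul, zero_add, coeff_gen_mul_cons]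
        by_cases h : a = b
        · simp [h, ih]
        · simp [h, conv_zero_left]
  exact LinearMap.congr_fun hlin p

/-- The derivation of functions of words that takes the letter `l` to `F l`. -/
noncomputable def der (F : Bool → List Bool → ℂ) : (List Bool → ℂ) → List Bool → ℂ
  | p, [] => conv (F false) (fun y => p (false :: y)) [] + conv (F true) (fun y => p (true :: y)) []
  | p, a :: w => conv (F false) (fun y => p (false :: y)) (a :: w) +
      conv (F true) (fun y => p (true :: y)) (a :: w) + der F (fun y => p (a :: y)) w

theorem der_add (F : Bool → List Bool → ℂ) (p q : List Bool → ℂ) (w : List Bool) :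
    der F (fun y => p y + q y) w = der F p w + der F q w := by
  induction w generalizing p q with
  | nil => simp only [der, conv_add_right]; ring
  | cons a w ih => simp only [der, conv_add_right, ih]; ring

theorem der_smul (F : Bool → List Bool → ℂ) (c : ℂ) (p : List Bool → ℂ) (w : List Bool) :
    der F (fun y => c * p y) w = c * der F p w := by
  induction w generalizing p with
  | nil => simp only [der, conv_smul_right]; ring
  | cons a w ih => simp only [der, conv_smul_right, ih]; ring

theorem der_zero (F : Bool → List Bool → ℂ) (w : List Bool) : der F (fun _ => 0) w = 0 := by
  simpa using der_smul F 0 (fun _ => 0) w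

end NCPoly

/-! ### The total derivative in terms of coefficients -/

namespace NCSystem

open NCPoly

/-- The right-hand sides, indexed by letters. -/
noncomputable def rhs (F : NCSystem) (a : Bool) : NCPoly := bif a then F.rhsV else F.rhsU

/-- The coefficients of the right-hand sides. -/
noncomputable def cf (F : NCSystem) (a : Bool) : List Bool → ℂ := coeff (F.rhs a)

theorem timeDeriv_add (F : NCSystem) (p q : NCPoly) :
    F.timeDeriv (p + q) = F.timeDeriv p + F.timeDeriv q := by
  simp [timeDeriv]

theorem timeDeriv_smul (F : NCSystem) (c : ℂ) (p : NCPoly) :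
    F.timeDeriv (c • p) = c • F.timeDeriv p := by
  simp [timeDeriv]

/-- The first component is an algebra homomorphism that fixes the generators. This identifies the
factors in the product formula for square-zero extensions and gives the Leibniz rule. -/
theorem fst_lift (F : NCSystem) (p : NCPoly) :
    (FreeAlgebra.lift ℂ (fun i : Fin 2 => (TrivSqZeroExt.inl (FreeAlgebra.ι ℂ i) +
      TrivSqZeroExt.inr (![F.rhsU, F.rhsV] i) : TrivSqZeroExt NCPoly NCPoly)) p).fst = p := by
  have h : (TrivSqZeroExt.fstHom ℂ NCPoly NCPoly).comp (FreeAlgebra.lift ℂ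
      (fun i : Fin 2 => (TrivSqZeroExt.inl (FreeAlgebra.ι ℂ i) +
        TrivSqZeroExt.inr (![F.rhsU, F.rhsV] i) : TrivSqZeroExt NCPoly NCPoly))) =
      AlgHom.id ℂ NCPoly := by
    apply FreeAlgebra.hom_ext
    funext i
    simp
  exact AlgHom.congr_fun h p

theorem timeDeriv_mul (F : NCSystem) (p q : NCPoly) :
    F.timeDeriv (p * q) = F.timeDeriv p * q + p * F.timeDeriv q := by
  simp only [timeDeriv, map_mul, TrivSqZeroExt.snd_mul, fst_lift]
  simp [add_comm]

theorem timeDeriv_one (F : NCSystem) : F.timeDeriv 1 = 0 := by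
  simp [timeDeriv]

theorem timeDeriv_gen (F : NCSystem) (a : Bool) : F.timeDeriv (gen a) = F.rhs a := by
  cases a <;> simp [timeDeriv, gen, rhs]

/-- The total derivative as a linear map. -/
noncomputable def derivL (F : NCSystem) : NCPoly →ₗ[ℂ] NCPoly where
  toFun := F.timeDeriv
  map_add' := F.timeDeriv_add
  map_smul' := F.timeDeriv_smul

@[simp] theorem derivL_apply (F : NCSystem) (p : NCPoly) : F.derivL p = F.timeDeriv p := rfl

/-- A word w arises when the letter l of some word k l y is replaced by a word s of the right-hand
side for l, so the coefficient is a sum over factorizations w = k s y. The recursion in `der` runs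
through k and leaves the splitting into s and y to `conv`. -/
theorem coeff_timeDeriv (F : NCSystem) (p : NCPoly) (w : List Bool) :
    coeff (F.timeDeriv p) w = der F.cf (coeff p) w := by
  have hlin : (LinearMap.proj w ∘ₗ coeff ∘ₗ F.derivL : NCPoly →ₗ[ℂ] ℂ) =
      { toFun := fun p => der F.cf (coeff p) w
        map_add' := fun a b => by
          rw [map_add]; exact der_add _ _ _ _
        map_smul' := fun c a => by
          rw [map_smul]; exact der_smul _ _ _ _ } := by
    apply linearMap_ext
    intro v
    simp only [LinearMap.comp_apply, LinearMap.proj_apply, derivL_apply,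
      LinearMap.coe_mk, AddHom.coe_mk]
    induction v generalizing w with
    | nil =>
      rw [word_nil, timeDeriv_one]
      cases w with
      | nil => simp [der, conv, coeff_one]
      | cons a w => simp [der, coeff_one, conv_zero_right, der_zero]
    | cons a v ih =>
      rw [word_cons, timeDeriv_mul, timeDeriv_gen, map_add, Pi.add_apply, coeff_mul]
      change conv (F.cf a) (coeff (word v)) w + _ = _
      cases w with
      | nil => cases a <;> simp [der, conv]
      | cons b w =>
        rw [coeff_gen_mul_cons, ih, der]
        simp only [coeff_gen_mul_cons]
        cases a <;> cases b <;> simp [conv_zero_right, der_zero]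
  exact LinearMap.congr_fun hlin p

end NCSystem


namespace NCPoly

/-! ### Extraction of coefficients by matrices -/

/-- The matrix of the letter `a` on the path labelled by the word `w`. -/
noncomputable def pathMatrix (w : List Bool) (a : Bool) :
    Matrix (Fin (w.length + 1)) (Fin (w.length + 1)) ℂ :=
  fun i j => if j.val = i.val + 1 ∧ w[i.val]? = some a then 1 else 0

theorem evalMatrix_gen {m : ℕ} (M : Bool → Matrix (Fin m) (Fin m) ℂ) (a : Bool) :
    evalMatrix (M false) (M true) (gen a) = M a := by
  cases a <;> simp [evalMatrix, gen]

/-- Exactly one path leads from the vertex `i` to the last vertex, and its labels form the suffix of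
`w` that starts at `i`. Every other word has a zero entry there. -/
theorem evalMatrix_pathMatrix (w : List Bool) (p : NCPoly) (i : Fin (w.length + 1)) :
    evalMatrix (pathMatrix w false) (pathMatrix w true) p i (Fin.last _) =
      coeff p (w.drop i) := by
  have hlin : (LinearMap.proj (Fin.last _) ∘ₗ LinearMap.proj i ∘ₗ
      (Matrix.ofLinearEquiv ℂ).symm.toLinearMap ∘ₗ
      (evalMatrix (pathMatrix w false) (pathMatrix w true)).toLinearMap : NCPoly →ₗ[ℂ] ℂ) =
      LinearMap.proj (w.drop i) ∘ₗ coeff := by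
    apply linearMap_ext
    intro v
    change evalMatrix (pathMatrix w false) (pathMatrix w true) (word v) i (Fin.last _) =
      coeff (word v) (w.drop i)
    induction v generalizing i with
    | nil =>
      rw [word_nil, map_one, coeff_one, Matrix.one_apply]
      congr 1
      rw [List.drop_eq_nil_iff, Fin.ext_iff, Fin.val_last, eq_iff_iff]
      omega
    | cons a v ih =>
      rw [word_cons, map_mul, Matrix.mul_apply, evalMatrix_gen (pathMatrix w)]
      simp only [ih]
      by_cases hi : i.val < w.length
      · rw [Finset.sum_eq_single ⟨i.val + 1, by omega⟩]
        · rw [List.drop_eq_getElem_cons hi, coeff_gen_mul_cons]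
          by_cases ha : a = w[i.val]
          · simp [pathMatrix, ha]
          · simp [pathMatrix, ha, List.getElem?_eq_getElem hi, Ne.symm ha]
        · intro j _ hj
          have : j.val ≠ i.val + 1 := fun h => hj (Fin.ext h)
          simp [pathMatrix, this]
        · simp
      · rw [List.drop_eq_nil_of_le (by omega), coeff_gen_mul_nil]
        apply Finset.sum_eq_zero
        intro j _
        have : j.val ≠ i.val + 1 := by omega
        simp [pathMatrix, this]
  exact LinearMap.congr_fun hlin p

/-- The corner entry at the path matrices of `w` is the coefficient of `w`; the size of the matrices
has to grow with the word. -/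
theorem coeff_eq_of_evalMatrix_eq {p q : NCPoly}
    (h : ∀ (m : ℕ) (U V : Matrix (Fin m) (Fin m) ℂ), evalMatrix U V p = evalMatrix U V q)
    (w : List Bool) : coeff p w = coeff q w := by
  have h1 := evalMatrix_pathMatrix w p 0
  have h2 := evalMatrix_pathMatrix w q 0
  rw [h] at h1
  rw [h1] at h2
  simpa using h2

theorem prod_map_ι (l : List (Fin 2)) :
    (l.map (FreeAlgebra.ι ℂ)).prod = word (l.map (· == 1)) := by
  rw [word, List.map_map]
  congr 2
  funext i
  fin_cases i <;> rfl

theorem coeff_eq_zero_of_mem_degreeLE {n : ℕ} {p : NCPoly} (hp : p ∈ degreeLE n) {w : List Bool}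
    (hw : n < w.length) : coeff p w = 0 := by
  induction hp using Submodule.span_induction with
  | mem q hq =>
    obtain ⟨l, hl, rfl⟩ := hq
    rw [prod_map_ι, coeff_word, if_neg]
    rintro rfl
    simp at hw
    omega
  | zero => simp
  | add p q _ _ hp hq => simp [hp, hq]
  | smul c q _ hq => simp [hq]

theorem degreeLE_mono {m n : ℕ} (h : m ≤ n) : degreeLE m ≤ degreeLE n :=
  Submodule.span_mono fun _ ⟨l, hl, e⟩ => ⟨l, hl.trans h, e⟩

theorem word_mem_degreeLE {n : ℕ} {w : List Bool} (h : w.length ≤ n) : word w ∈ degreeLE n := by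
  apply Submodule.subset_span
  refine ⟨w.map (fun b => bif b then 1 else 0), by simpa using h, ?_⟩
  rw [prod_map_ι, List.map_map]
  congr 1
  conv_lhs => rw [← List.map_id w]
  congr 1
  funext b
  cases b <;> rfl

/-! ### Commutative reduction -/

/-- The words of length `n` with `j` letters `v`. -/
def wordsOf : ℕ → ℕ → List (List Bool)
  | 0, 0 => [[]]
  | 0, _ + 1 => []
  | n + 1, 0 => (wordsOf n 0).map (false :: ·)
  | n + 1, j + 1 => (wordsOf n (j + 1)).map (false :: ·) ++ (wordsOf n j).map (true :: ·)

theorem mem_wordsOf {n j : ℕ} {w : List Bool} :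
    w ∈ wordsOf n j ↔ w.length = n ∧ w.count true = j := by
  induction n generalizing j w with
  | zero =>
    cases j with
    | zero => simp [wordsOf]; rintro rfl; rfl
    | succ j => simp [wordsOf]; rintro rfl; simp
  | succ n ih =>
    cases j with
    | zero =>
      cases w with
      | nil => simp [wordsOf]
      | cons a w => cases a <;> simp [wordsOf, ih]
    | succ j =>
      cases w with
      | nil => simp [wordsOf]
      | cons a w => cases a <;> simp [wordsOf, ih]

theorem nodup_wordsOf (n j : ℕ) : (wordsOf n j).Nodup := by
  have hinj : ∀ a : Bool, Function.Injective (fun w : List Bool => a :: w) :=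
    fun a _ _ h => (List.cons.inj h).2
  induction n generalizing j with
  | zero => cases j <;> simp [wordsOf]
  | succ n ih =>
    cases j with
    | zero => exact (ih 0).map (hinj _)
    | succ j =>
      refine ((ih _).map (hinj _)).append ((ih _).map (hinj _)) ?_
      intro w h1 h2
      simp only [List.mem_map] at h1 h2
      obtain ⟨a, _, rfl⟩ := h1
      obtain ⟨b, _, h⟩ := h2
      simp at h

theorem abelianize_gen (a : Bool) : abelianize (gen a) = MvPolynomial.X (bif a then 1 else 0) := by
  simp [abelianize, gen]

/-- The exponent vector of `u ^ i * v ^ j`. -/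
noncomputable def expo (i j : ℕ) : Fin 2 →₀ ℕ := Finsupp.single 0 i + Finsupp.single 1 j

theorem expo_inj {i j k l : ℕ} : expo i j = expo k l ↔ i = k ∧ j = l := by
  constructor
  · intro h
    exact ⟨by simpa [expo] using DFunLike.congr_fun h 0, by simpa [expo] using DFunLike.congr_fun h 1⟩
  · rintro ⟨rfl, rfl⟩; rfl

theorem abelianize_word (w : List Bool) :
    abelianize (word w) = MvPolynomial.monomial (expo (w.count false) (w.count true)) 1 := by
  induction w with
  | nil => simp [expo]
  | cons a w ih =>
    rw [word_cons, map_mul, ih, abelianize_gen, MvPolynomial.X, MvPolynomial.monomial_mul, one_mul]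
    congr 2
    cases a <;> simp [expo] <;> ext k <;> fin_cases k <;> simp <;> ring

/-- The words with `i` letters u and `j` letters v are precisely those that become the monomial with
these exponents when the variables commute. -/
theorem sum_wordsOf (p : NCPoly) (i j : ℕ) :
    ((wordsOf (i + j) j).map (coeff p)).sum =
      MvPolynomial.coeff (expo i j) (abelianize p) := by
  have hlin : ({ toFun := fun p => ((wordsOf (i + j) j).map (coeff p)).sum
                 map_add' := fun p q => by rw [map_add, ← List.sum_map_add]; rfl
                 map_smul' := fun c p => by rw [map_smul]; exact List.sum_map_mul_left .. } : NCPoly →ₗ[ℂ] ℂ) =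
      MvPolynomial.lcoeff ℂ (expo i j) ∘ₗ abelianize.toLinearMap := by
    apply linearMap_ext
    intro v
    simp only [LinearMap.comp_apply, LinearMap.coe_mk, AddHom.coe_mk, AlgHom.toLinearMap_apply,
      MvPolynomial.lcoeff_apply, abelianize_word, MvPolynomial.coeff_monomial, expo_inj]
    have h1 : ((wordsOf (i + j) j).map (coeff (word v))).sum =
        (((wordsOf (i + j) j).count v : ℕ) : ℂ) := by
      generalize wordsOf (i + j) j = L
      induction L with
      | nil => simp
      | cons w L ih =>
        rw [List.map_cons, List.sum_cons, ih, coeff_word, List.count_cons]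
        by_cases h : v = w
        · simp [h, add_comm]
        · simp [h, Ne.symm h]
    have h2 := List.count_true_add_count_false v
    rw [h1, (nodup_wordsOf _ _).count]
    by_cases h : v.count false = i ∧ v.count true = j
    · rw [if_pos h, if_pos (mem_wordsOf.2 ⟨by omega, h.2⟩)]; simp
    · rw [if_neg h, if_neg (mt mem_wordsOf.1 (by omega))]; simp
  exact LinearMap.congr_fun hlin p

/-! ### Transposition -/

theorem transpose_add (p q : NCPoly) : (p + q).transpose = p.transpose + q.transpose := by
  simp [transpose]

theorem transpose_smul (c : ℂ) (p : NCPoly) : (c • p).transpose = c • p.transpose := by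
  simp [transpose]

theorem transpose_mul (p q : NCPoly) : (p * q).transpose = q.transpose * p.transpose := by
  simp [transpose]

theorem transpose_one : (1 : NCPoly).transpose = 1 := by
  simp [transpose]

theorem transpose_gen (a : Bool) : (gen a).transpose = gen a := by
  simp [transpose, gen]

/-- Transposition as a linear map. -/
noncomputable def transposeL : NCPoly →ₗ[ℂ] NCPoly where
  toFun := transpose
  map_add' := transpose_add
  map_smul' := transpose_smul

@[simp] theorem transposeL_apply (p : NCPoly) : transposeL p = p.transpose := rfl

theorem transpose_transpose (p : NCPoly) : p.transpose.transpose = p := by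
  have h : transposeL ∘ₗ transposeL = LinearMap.id := by
    apply linearMap_ext
    intro w
    simp only [LinearMap.comp_apply, transposeL_apply, LinearMap.id_apply]
    induction w with
    | nil => simp [transpose_one]
    | cons a w ih => rw [word_cons, transpose_mul, transpose_mul, transpose_gen, transpose_gen, ih]
  exact LinearMap.congr_fun h p

theorem transpose_word (w : List Bool) : (word w).transpose = word w.reverse := by
  induction w with
  | nil => simp [transpose_one]
  | cons a w ih =>
    rw [word_cons, transpose_mul, ih, transpose_gen, List.reverse_cons, word_append]
    simp

theorem evalMatrix_transpose {m : ℕ} (U V : Matrix (Fin m) (Fin m) ℂ) (p : NCPoly) :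
    evalMatrix U V p.transpose = (evalMatrix U.transpose V.transpose p).transpose := by
  have h : (evalMatrix U V).toLinearMap ∘ₗ transposeL =
      (Matrix.transposeLinearEquiv (Fin m) (Fin m) ℂ ℂ).toLinearMap ∘ₗ
        (evalMatrix U.transpose V.transpose).toLinearMap := by
    apply linearMap_ext
    intro w
    change evalMatrix U V (word w).transpose =
      (evalMatrix U.transpose V.transpose (word w)).transpose
    induction w with
    | nil => simp [transpose_one]
    | cons a w ih =>
      rw [word_cons, transpose_mul, map_mul, map_mul, Matrix.transpose_mul, ih, transpose_gen]
      cases a <;> simp [evalMatrix, gen]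
  exact LinearMap.congr_fun h p

theorem abelianize_transpose (p : NCPoly) : abelianize p.transpose = abelianize p := by
  have h : abelianize.toLinearMap ∘ₗ transposeL = abelianize.toLinearMap := by
    apply linearMap_ext
    intro w
    change abelianize (word w).transpose = abelianize (word w)
    rw [transpose_word, abelianize_word, abelianize_word, List.count_reverse, List.count_reverse]
  exact LinearMap.congr_fun h p

theorem transpose_mem_degreeLE {n : ℕ} {p : NCPoly} (hp : p ∈ degreeLE n) :
    p.transpose ∈ degreeLE n := by
  induction hp using Submodule.span_induction with
  | mem q hq =>
    obtain ⟨l, hl, rfl⟩ := hq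
    rw [prod_map_ι, transpose_word]
    exact word_mem_degreeLE (by simpa using hl)
  | zero => rw [← transposeL_apply, map_zero]; exact Submodule.zero_mem _
  | add p q _ _ hp hq => rw [transpose_add]; exact Submodule.add_mem _ hp hq
  | smul c q _ hq => rw [transpose_smul]; exact Submodule.smul_mem _ _ hq

theorem IsNonabelianization.transpose {p : NCPoly} {h : MvPolynomial (Fin 2) ℂ}
    (hp : p.IsNonabelianization h) : p.transpose.IsNonabelianization h :=
  ⟨by rw [abelianize_transpose, hp.1], transpose_mem_degreeLE hp.2⟩

end NCPoly

/-! ### Transposed systems and their symmetries -/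

namespace NCSystem

open NCPoly

theorem transpose_transpose (F : NCSystem) : F.transpose.transpose = F := by
  ext <;> simp [transpose, NCPoly.transpose_transpose]

theorem rhs_transpose (F : NCSystem) (a : Bool) : F.transpose.rhs a = (F.rhs a).transpose := by
  cases a <;> rfl

/-- Reversal of words is an anti-automorphism fixing the generators, so it carries the Leibniz rule
for one system into that for the transposed one; on words this is an induction. -/
theorem timeDeriv_transpose (F : NCSystem) (p : NCPoly) :
    F.transpose.timeDeriv p.transpose = (F.timeDeriv p).transpose := by
  have h : F.transpose.derivL ∘ₗ transposeL = transposeL ∘ₗ F.derivL := by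
    apply linearMap_ext
    intro w
    simp only [LinearMap.comp_apply, transposeL_apply, derivL_apply]
    induction w with
    | nil => rw [word_nil, transpose_one, timeDeriv_one, timeDeriv_one, ← transposeL_apply, map_zero]
    | cons a w ih =>
      rw [word_cons, transpose_mul, timeDeriv_mul, timeDeriv_mul, transpose_add, transpose_mul,
        transpose_mul, ih, transpose_gen, timeDeriv_gen, timeDeriv_gen, rhs_transpose, add_comm]
  exact LinearMap.congr_fun h p

theorem IsSymmetry.transpose {F G : NCSystem} (h : F.IsSymmetry G) :
    F.transpose.IsSymmetry G.transpose := by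
  intro m U V
  obtain ⟨h1, h2⟩ := h m U.transpose V.transpose
  constructor
  · change evalMatrix U V (F.transpose.timeDeriv G.rhsU.transpose) =
      evalMatrix U V (G.transpose.timeDeriv F.rhsU.transpose)
    rw [timeDeriv_transpose, timeDeriv_transpose, evalMatrix_transpose, evalMatrix_transpose, h1]
  · change evalMatrix U V (F.transpose.timeDeriv G.rhsV.transpose) =
      evalMatrix U V (G.transpose.timeDeriv F.rhsV.transpose)
    rw [timeDeriv_transpose, timeDeriv_transpose, evalMatrix_transpose, evalMatrix_transpose, h2]

theorem AdmitsSymmetry.transpose {F : NCSystem} {H : MvPolynomial (Fin 2) ℂ} {k : ℕ}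
    (h : F.AdmitsSymmetry H k) : F.transpose.AdmitsSymmetry H k := by
  obtain ⟨G, h1, h2, h3⟩ := h
  exact ⟨G.transpose, h1.transpose, h2.transpose, h3.transpose⟩

/-- The coefficients of the commutator with a symmetry vanish. -/
theorem IsSymmetry.der_cf {F G : NCSystem} (h : F.IsSymmetry G) (a : Bool) (w : List Bool) :
    der F.cf (G.cf a) w = der G.cf (F.cf a) w := by
  change der F.cf (coeff (G.rhs a)) w = der G.cf (coeff (F.rhs a)) w
  rw [← coeff_timeDeriv, ← coeff_timeDeriv]
  apply coeff_eq_of_evalMatrix_eq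
  intro m U V
  cases a
  · exact (h m U V).1
  · exact (h m U V).2

end NCSystem


namespace Elim

open NCPoly

/-! ### The equations for the coefficients of a symmetry -/

/-- Right-hand sides of a system, arranged by words: the coefficients of the empty word in both
components, then the words that begin with `u` and those that begin with `v`. -/
inductive WTrie
  | nil : WTrie
  | node : Poly → Poly → WTrie → WTrie → WTrie

noncomputable def WTrie.coeff (b : Bool) (T : WTrie) : List Bool → Poly :=
  WTrie.rec (fun _ => Poly.nil)
    (fun cu cv _ _ ihl ihr w =>
      List.rec (Bool.rec cu cv b) (fun a w' _ => Bool.rec (ihl w') (ihr w') a) w) T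

/-- The terms `F l s * g (f (l :: y))` for the splittings `w = s ++ y`, except for the shortest
`s`, whose number is the length of `n`. -/
noncomputable def walk (T : WTrie) (f : List Bool → List Bool) :
    List Bool → List Bool → Lin → Lin :=
  WTrie.rec (fun _ _ R => R)
    (fun cu cv _ _ ihl ihr n w R =>
      List.rec
        (push cu (f (false :: w)) (push cv (f (true :: w))
          (List.rec R (fun a w' _ => Bool.rec (ihl [] w' R) (ihr [] w' R) a) w)))
        (fun _ m _ => List.rec R (fun a w' _ => Bool.rec (ihl m w' R) (ihr m w' R) a) w) n) T

/-- The terms in which the known system acts on the unknown one. The function accumulates the prefix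
already read. -/
noncomputable def outer (T : WTrie) (n : List Bool) (w : List Bool) :
    (List Bool → List Bool) → Lin → Lin :=
  List.rec (fun f R => walk T f n [] R)
    (fun a w' ih f R => walk T f n (a :: w') (ih (fun k => f (a :: k)) R)) w

noncomputable def tl (w : List Bool) : List Bool := List.rec [] (fun _ w _ => w) w

noncomputable def tl3 (w : List Bool) : List Bool := tl (tl (tl w))

/-- Lists serve as unary numbers. The length |w| - 8 is the least length of an inserted word for
which the unknown word it comes from has at most 9 letters. -/
noncomputable def tl8 (w : List Bool) : List Bool := tl (tl (tl3 (tl3 w)))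

/-- Addition of `-c * g (l :: m)` if the length of `m` is at most 9. -/
noncomputable def pushShort (c : Poly) (l : Bool) (m : List Bool) (L : Lin) : Lin :=
  Poly.rec L (fun _ _ _ _ _ =>
    List.rec (Lin.cons (Poly.neg c) (l :: m) L) (fun _ _ _ => L) (tl (tl8 m))) c

/-- Splittings of a word. -/
inductive Splits
  | nil : Splits
  | cons : List Bool → List Bool → Splits → Splits

namespace Splits

noncomputable def prep (a : Bool) (S : Splits) : Splits :=
  Splits.rec nil (fun m y _ ih => cons (a :: m) y ih) S

noncomputable def tail (S : Splits) : Splits :=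
  Splits.rec nil (fun m y _ ih => List.rec ih (fun _ m' _ => cons m' y ih) m) S

/-- The splittings of `w`, except for the first ones, whose number is the length of `n`. -/
noncomputable def last (w : List Bool) : List Bool → Splits :=
  List.rec (fun n => List.rec (cons [] [] nil) (fun _ _ _ => nil) n)
    (fun a w ih n => List.rec (cons [] (a :: w) (prep a (ih []))) (fun _ n _ => prep a (ih n)) n) w

end Splits

noncomputable def lookups (b : Bool) (T : WTrie) (l : Bool) (S : Splits) (R : Lin) : Lin :=
  WTrie.rec R (fun _ _ _ _ _ _ => Splits.rec R (fun m y _ ih => pushShort (T.coeff b y) l m ih) S) T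

/-- The terms in which the unknown system acts on the known one. Descending simultaneously in `T`
and in the word reads the prefix k; the rest is split into a word m of the unknown component l and a
word y, and the known coefficient is that of k l y. -/
noncomputable def inner (b : Bool) (T : WTrie) : List Bool → Splits → Lin → Lin :=
  WTrie.rec (fun _ _ R => R)
    (fun _ _ l r ihl ihr w S R =>
      lookups b l false S (lookups b r true S
        (List.rec R (fun a w' _ => Bool.rec (ihl w' S.tail R) (ihr w' S.tail R) a) w))) T

/-- The coefficient of `w` in the commutator of a known and an unknown system. -/
noncomputable def symRow (T : WTrie) (comp : Bool) (w : List Bool) : Lin :=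
  -- The words of the known system have at most four letters, so at most three remain behind the
  -- replaced one; `tl3` discards the splittings with a longer tail.
  outer T (tl8 w) w (fun k => comp :: k) (inner comp T w (Splits.last w (tl3 w)) Lin.nil)

/-- The binary digits of a number after the leading one, in front of a list. -/
noncomputable def bits (f : ℕ) : ℕ → List Bool → List Bool :=
  Nat.rec (fun _ l => l) (fun _ ih n l => Bool.rec
    (Bool.rec (ih (Nat.div n 2) (false :: l)) (ih (Nat.div n 2) (true :: l))
      (Nat.beq (Nat.mod n 2) 1))
      l (Nat.ble n 1)) f

/-- The sum of `g (f w)` over the words `w` of length `n` with `j` letters `v`. -/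
noncomputable def sumWords (n : ℕ) : ℕ → (List Bool → List Bool) → Lin → Lin :=
  Nat.rec
    (fun j f R => Nat.rec (Lin.cons (Poly.cons 1 0 1 Poly.nil) (f []) R) (fun _ _ => R) j)
    (fun _ ih j f R => ih j (fun k => f (false :: k))
      (Nat.rec R (fun j' _ => ih j' (fun k => f (true :: k)) R) j)) n

/-- Commutative polynomials: exponents and coefficients. -/
inductive CTab
  | nil : CTab
  | cons : ℕ → ℕ → Poly → CTab → CTab

/-- The coefficient of `u ^ i * v ^ j` in a product. -/
noncomputable def coeffProd (i j : ℕ) (S T : CTab) : Poly :=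
  CTab.rec Poly.nil (fun a b p _ ih => CTab.rec ih (fun c d q _ ih' =>
    Bool.rec ih' (Bool.rec ih' (Poly.addMul p q ih') (Nat.beq (Nat.add b d) j))
      (Nat.beq (Nat.add a c) i)) T) S

noncomputable def countLetters (w : List Bool) : ℕ → ℕ → (ℕ → ℕ → Row) → Row :=
  List.rec (fun i j f => f i j)
    (fun a _ ih i j f => Bool.rec (ih (Nat.add i 1) j f) (ih i (Nat.add j 1) f) a) w

/-- The commutative reduction fixes the sum of the unknowns over all words with given numbers of
letters. These are the only inhomogeneous equations for a symmetry. -/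
noncomputable def abRow (A : CTab) (H : CTab) (comp : Bool) (i j : ℕ) : Row :=
  ⟨Poly.neg (coeffProd i j A H), sumWords (Nat.add i j) j (fun k => comp :: k) Lin.nil⟩

/-- The equations for a symmetry of the system `T` that reduces to the commutative system with the
right-hand sides `A * H` and `B * H`. -/
noncomputable def symRows (T : WTrie) (A B H : CTab) (n : ℕ) : Row :=
  -- The binary digits of `n` after the leading one are the kind of the equation, the component, and
  -- a word. For a commutator equation the word is the one compared; for the commutative reduction
  -- only its numbers of letters matter.
  List.rec ⟨Poly.nil, Lin.nil⟩ (fun a l _ =>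
    List.rec ⟨Poly.nil, Lin.nil⟩ (fun c w _ =>
      Bool.rec ⟨Poly.nil, symRow T c w⟩
        (countLetters w 0 0 (abRow (Bool.rec A B c) H c)) a) l) (bits 20 n [])

/-! ### Soundness of the equations for a symmetry -/

section Soundness

variable {x : ℕ → ℂ} {g : List Bool → ℂ}

/-- The values of the coefficients. -/
noncomputable def WTrie.val (x : ℕ → ℂ) (T : WTrie) (b : Bool) (w : List Bool) : ℂ :=
  (T.coeff b w).ev x

theorem val_nil (b : Bool) (w : List Bool) : WTrie.nil.val x b w = 0 := rfl

theorem val_node_cons (cu cv : Poly) (l r : WTrie) (b a : Bool) (w : List Bool) :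
    (WTrie.node cu cv l r).val x b (a :: w) = (bif a then r else l).val x b w := by
  cases a <;> rfl

theorem length_tl (w : List Bool) : (tl w).length = w.length - 1 := by
  cases w <;> simp [tl]

/-- The omitted splittings have a short first part, hence a long second part, and the unknown
attached to the latter is zero by `hg`. -/
theorem ev_walk (T : WTrie) (f : List Bool → List Bool) (n w : List Bool) (R : Lin)
    (hg : ∀ l y, n ≠ [] → w.length < y.length + n.length → g (f (l :: y)) = 0) :
    (walk T f n w R).ev x g = conv (T.val x false) (fun y => g (f (false :: y))) w +
      conv (T.val x true) (fun y => g (f (true :: y))) w + R.ev x g := by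
  induction T generalizing n w with
  | nil =>
    change R.ev x g = conv (fun _ => 0) _ w + conv (fun _ => 0) _ w + _
    rw [conv_zero_left, conv_zero_left]
    ring
  | node cu cv l r ihl ihr =>
    cases n with
    | nil =>
      cases w with
      | nil =>
        change (push cu (f [false]) (push cv (f [true]) R)).ev x g =
          cu.ev x * g (f [false]) + cv.ev x * g (f [true]) + _
        rw [ev_push, ev_push]; ring
      | cons a w =>
        change (push cu (f (false :: a :: w)) (push cv (f (true :: a :: w))
          (Bool.rec (walk l f [] w R) (walk r f [] w R) a))).ev x g = _
        rw [ev_push, ev_push]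
        have hl := ihl [] w (fun _ _ h => absurd rfl h)
        have hr := ihr [] w (fun _ _ h => absurd rfl h)
        simp only [conv, val_node_cons]
        cases a
        · simp only [hl]
          change cu.ev x * _ + (cv.ev x * _ + _) = cu.ev x * _ + conv (l.val x false) _ w +
            (cv.ev x * _ + conv (l.val x true) _ w) + _
          ring
        · simp only [hr]
          change cu.ev x * _ + (cv.ev x * _ + _) = cu.ev x * _ + conv (r.val x false) _ w +
            (cv.ev x * _ + conv (r.val x true) _ w) + _
          ring
    | cons c m =>
      cases w with
      | nil =>
        change R.ev x g = cu.ev x * g (f [false]) + cv.ev x * g (f [true]) + _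
        rw [hg false [] (by simp) (by simp), hg true [] (by simp) (by simp)]
        ring
      | cons a w =>
        change (Bool.rec (walk l f m w R) (walk r f m w R) a : Lin).ev x g = _
        have hm : ∀ b y, m ≠ [] → w.length < y.length + m.length → g (f (b :: y)) = 0 := by
          intro b y _ h
          apply hg b y (by simp)
          simp only [List.length_cons]
          omega
        have hl := ihl m w hm
        have hr := ihr m w hm
        simp only [conv, val_node_cons]
        rw [hg false (a :: w) (by simp) (by simp), hg true (a :: w) (by simp) (by simp)]
        cases a
        · simp only [hl, cond_false]; ring
        · simp only [hr, cond_true]; ring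

theorem ev_outer (T : WTrie) (n w : List Bool) (f : List Bool → List Bool) (R : Lin)
    (hg : ∀ k, n ≠ [] → w.length + 1 < k.length + n.length → g (f k) = 0) :
    (outer T n w f R).ev x g = der (T.val x) (fun k => g (f k)) w + R.ev x g := by
  induction w generalizing f with
  | nil =>
    change (walk T f n [] R).ev x g = _
    rw [ev_walk]
    · rfl
    · intro l y hn h
      apply hg _ hn
      simp only [List.length_cons, List.length_nil] at *
      omega
  | cons a w ih =>
    change (walk T f n (a :: w) (outer T n w (fun k => f (a :: k)) R)).ev x g = _
    rw [ev_walk, ih]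
    · simp only [der]; ring
    · intro k hn h
      apply hg _ hn
      simp only [List.length_cons] at *
      omega
    · intro l y hn h
      apply hg _ hn
      simp only [List.length_cons] at *
      omega

theorem ev_pushShort (hg : ∀ k, 10 < k.length → g k = 0) (c : Poly) (l : Bool) (m : List Bool)
    (L : Lin) : (pushShort c l m L).ev x g = -(g (l :: m) * c.ev x) + L.ev x g := by
  cases c with
  | nil => simp [pushShort, Poly.ev]
  | cons a b k t =>
    change Lin.ev x g (List.rec (Lin.cons (Poly.neg (Poly.cons a b k t)) (l :: m) L)
      (fun _ _ _ => L) (tl (tl8 m))) = _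
    cases h : tl (tl8 m) with
    | nil =>
      simp only [Lin.ev, Poly.ev_neg]; ring
    | cons b' k' =>
      have h1 : (tl (tl8 m)).length = m.length - 9 := by
        simp only [tl8, tl3, length_tl]; omega
      rw [h, List.length_cons] at h1
      rw [hg (l :: m) (by rw [List.length_cons]; omega)]
      simp

/-- The sum of `f m * h y` over splittings `(m, y)`. -/
noncomputable def Splits.sum (f h : List Bool → ℂ) : Splits → ℂ
  | nil => 0
  | cons m y S => f m * h y + Splits.sum f h S

theorem Splits.sum_prep (a : Bool) (f h : List Bool → ℂ) (S : Splits) :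
    (prep a S).sum f h = S.sum (fun m => f (a :: m)) h := by
  induction S with
  | nil => rfl
  | cons m y S ih =>
    change f (a :: m) * h y + (prep a S).sum f h = _
    rw [ih, Splits.sum]

theorem Splits.sum_tail (f h : List Bool → ℂ) (S : Splits) :
    S.tail.sum f h = S.sum (fun m => List.rec 0 (fun _ m' _ => f m') m) h := by
  induction S with
  | nil => rfl
  | cons m y S ih =>
    cases m with
    | nil =>
      change S.tail.sum f h = _
      rw [ih, Splits.sum]; simp
    | cons b m =>
      change f m * h y + S.tail.sum f h = _
      rw [ih, Splits.sum]

theorem Splits.sum_last (w n : List Bool) (f h : List Bool → ℂ)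
    (hh : ∀ y, n ≠ [] → w.length < y.length + n.length → h y = 0) :
    (last w n).sum f h = conv f h w := by
  induction w generalizing n f with
  | nil =>
    cases n with
    | nil => simp [last, Splits.sum, conv]
    | cons b n => simp [last, Splits.sum, conv, hh [] (by simp) (by simp)]
  | cons a w ih =>
    cases n with
    | nil =>
      change f [] * h (a :: w) + (prep a (last w [])).sum f h = _
      rw [sum_prep, ih [] _ (fun _ hn => absurd rfl hn), conv]
    | cons b n =>
      change (prep a (last w n)).sum f h = _
      rw [sum_prep, ih n, conv, hh (a :: w) (by simp) (by simp)]
      · ring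
      · intro y _ hy
        apply hh _ (by simp)
        simp only [List.length_cons]
        omega

/-- The splittings `S` contain all splittings `(m, y)` of `w` with `y` of length at most 3. -/
def Splits.Good (w : List Bool) (S : Splits) : Prop :=
  ∀ f h : List Bool → ℂ, (∀ y, 3 < y.length → h y = 0) → S.sum f h = conv f h w

/-- The hypothesis is applied to the function that vanishes on the empty word and ignores the first
letter of any other word. This is why `Good` quantifies over all functions. -/
theorem Splits.Good.tail {a : Bool} {w : List Bool} {S : Splits} (hS : Good (a :: w) S) :
    Good w S.tail := by
  intro f h hh
  rw [sum_tail, hS _ _ hh, conv]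
  simp

theorem Splits.good_last (w : List Bool) : Good w (last w (tl3 w)) := by
  intro f h hh
  apply sum_last
  intro y hn hy
  apply hh
  have h1 : (tl3 w).length = w.length - 3 := by simp only [tl3, length_tl]; omega
  have h2 : 0 < (tl3 w).length := List.length_pos_iff.2 hn
  omega

theorem ev_lookups (hg : ∀ k, 10 < k.length → g k = 0) (b : Bool) (T : WTrie) (l : Bool)
    (S : Splits) (R : Lin) :
    (lookups b T l S R).ev x g = -S.sum (fun m => g (l :: m)) (T.val x b) + R.ev x g := by
  cases T with
  | nil =>
    have h0 : S.sum (fun m => g (l :: m)) (WTrie.nil.val x b) = 0 := by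
      induction S with
      | nil => rfl
      | cons m y S ih => rw [Splits.sum, ih, val_nil]; ring
    rw [h0]
    change R.ev x g = _
    ring
  | node cu cv l' r' =>
    change Lin.ev x g (Splits.rec R (fun m y _ ih =>
      pushShort ((WTrie.node cu cv l' r').coeff b y) l m ih) S) = _
    induction S with
    | nil => simp [Splits.sum]
    | cons m y S ih =>
      simp only [ev_pushShort hg, ih, Splits.sum, WTrie.val]
      ring

/-- Below the root one letter of the known word has been used up, so its subtries vanish on tails of
more than three letters, which is the range in which the retained splittings compute `conv`. -/
theorem ev_inner (hg : ∀ k, 10 < k.length → g k = 0) (b : Bool) (T : WTrie)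
    (hT : ∀ w, 4 < w.length → T.val x b w = 0) (w : List Bool) (S : Splits) (hS : S.Good w)
    (R : Lin) : (inner b T w S R).ev x g =
      -der (fun l m => g (l :: m)) (T.val x b) w + R.ev x g := by
  induction T generalizing w S with
  | nil =>
    change R.ev x g = -der _ (fun _ => 0) w + _
    rw [der_zero]; ring
  | node cu cv l r ihl ihr =>
    have hTl : ∀ w, 3 < w.length → l.val x b w = 0 := fun w hw => by
      rw [← hT (false :: w) (by rw [List.length_cons]; omega)]; rfl
    have hTr : ∀ w, 3 < w.length → r.val x b w = 0 := fun w hw => by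
      rw [← hT (true :: w) (by rw [List.length_cons]; omega)]; rfl
    change (lookups b l false S (lookups b r true S (List.rec R
      (fun a w' _ => Bool.rec (inner b l w' S.tail R) (inner b r w' S.tail R) a) w))).ev x g = _
    rw [ev_lookups hg, ev_lookups hg, hS _ _ hTl, hS _ _ hTr]
    have e1 : ∀ y, (WTrie.node cu cv l r).val x b (false :: y) = l.val x b y := fun _ => rfl
    have e2 : ∀ y, (WTrie.node cu cv l r).val x b (true :: y) = r.val x b y := fun _ => rfl
    cases w with
    | nil => simp only [der, e1, e2]; ring
    | cons a w =>
      have hl := ihl (fun w hw => hTl w (by omega)) w S.tail hS.tail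
      have hr := ihr (fun w hw => hTr w (by omega)) w S.tail hS.tail
      cases a
      · simp only [der, e1, e2, hl]; ring
      · simp only [der, e1, e2, hr]; ring

theorem ev_symRow (hg : ∀ k, 10 < k.length → g k = 0) (T : WTrie)
    (hT : ∀ b w, 4 < w.length → T.val x b w = 0) (comp : Bool) (w : List Bool) :
    (symRow T comp w).ev x g = der (T.val x) (fun k => g (comp :: k)) w -
      der (fun l m => g (l :: m)) (T.val x comp) w := by
  unfold symRow
  rw [ev_outer, ev_inner hg comp T (hT comp) w _ (Splits.good_last w), Lin.ev]
  · ring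
  · intro k hn hk
    apply hg
    have h1 : (tl8 w).length = w.length - 8 := by simp only [tl8, tl3, length_tl]; omega
    have h2 : 0 < (tl8 w).length := List.length_pos_iff.2 hn
    simp only [List.length_cons]
    omega

theorem ev_sumWords (n j : ℕ) (f : List Bool → List Bool) (R : Lin) :
    (sumWords n j f R).ev x g = ((wordsOf n j).map fun w => g (f w)).sum + R.ev x g := by
  induction n generalizing j f R with
  | zero =>
    cases j with
    | zero =>
      change (Poly.cons 1 0 1 Poly.nil).ev x * g (f []) + R.ev x g = _
      simp [Poly.ev, Poly.mev_one, wordsOf]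
    | succ j => simp [wordsOf, sumWords]
  | succ n ih =>
    cases j with
    | zero =>
      change (sumWords n 0 (fun k => f (false :: k)) R).ev x g = _
      rw [ih, wordsOf, List.map_map]; rfl
    | succ j =>
      change (sumWords n (j + 1) (fun k => f (false :: k))
        (sumWords n j (fun k => f (true :: k)) R)).ev x g = _
      rw [ih, ih, wordsOf, List.map_append, List.sum_append, List.map_map, List.map_map, add_assoc]
      rfl

/-- The commutative polynomial given by a table. -/
noncomputable def CTab.toMv (x : ℕ → ℂ) : CTab → MvPolynomial (Fin 2) ℂ
  | nil => 0
  | cons i j p T => MvPolynomial.monomial (expo i j) (p.ev x) + CTab.toMv x T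

theorem expo_add (a b c d : ℕ) : expo a b + expo c d = expo (a + c) (b + d) := by
  simp only [expo, Finsupp.single_add]; abel

theorem ev_coeffProd (i j : ℕ) (S T : CTab) :
    (coeffProd i j S T).ev x = MvPolynomial.coeff (expo i j) (S.toMv x * T.toMv x) := by
  induction S with
  | nil => simp [coeffProd, CTab.toMv, Poly.ev]
  | cons a b p S ih =>
    have key : ∀ (U : CTab) (r : Poly), (CTab.rec r (fun c d q _ ih' =>
        Bool.rec ih' (Bool.rec ih' (Poly.addMul p q ih') (Nat.beq (Nat.add b d) j))
          (Nat.beq (Nat.add a c) i)) U : Poly).ev x =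
        MvPolynomial.coeff (expo i j) (MvPolynomial.monomial (expo a b) (p.ev x) * U.toMv x) +
          r.ev x := by
      intro U r
      induction U with
      | nil => simp [CTab.toMv]
      | cons c d q U ih' =>
        rw [CTab.toMv, mul_add, MvPolynomial.coeff_add, MvPolynomial.monomial_mul, expo_add,
          MvPolynomial.coeff_monomial, add_assoc, ← ih']
        cases h1 : Nat.beq (Nat.add a c) i with
        | false =>
          have h : ¬(a + c = i) := Nat.ne_of_beq_eq_false h1
          rw [if_neg fun e => h (expo_inj.1 e).1, zero_add]
          simp only [h1]
        | true =>
          have h1' : a + c = i := Nat.eq_of_beq_eq_true h1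
          cases h2 : Nat.beq (Nat.add b d) j with
          | false =>
            have h : ¬(b + d = j) := Nat.ne_of_beq_eq_false h2
            rw [if_neg fun e => h (expo_inj.1 e).2, zero_add]
            simp only [h1, h2]
          | true =>
            have h2' : b + d = j := Nat.eq_of_beq_eq_true h2
            rw [if_pos (expo_inj.2 ⟨h1', h2'⟩)]
            simp only [h1, h2, Poly.ev_addMul]
    rw [CTab.toMv, add_mul, MvPolynomial.coeff_add, ← ih]
    exact key T (coeffProd i j S T)

theorem ev_countLetters (w : List Bool) (i j : ℕ) (f : ℕ → ℕ → Row)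
    (hf : ∀ i j, (f i j).ev x g = 0) : (countLetters w i j f).ev x g = 0 := by
  induction w generalizing i j with
  | nil => exact hf i j
  | cons a w ih => cases a <;> exact ih _ _

/-- The coefficients of a symmetry satisfy the equations. -/
theorem ev_symRows {T : WTrie} {A B H : CTab} {F G : NCSystem}
    (hT : ∀ b w, T.val x b w = F.cf b w)
    (hF : ∀ b w, 4 < w.length → F.cf b w = 0)
    (hA : abelianize G.rhsU = A.toMv x * H.toMv x) (hB : abelianize G.rhsV = B.toMv x * H.toMv x)
    (hG : ∀ b w, 9 < w.length → G.cf b w = 0) (h : F.IsSymmetry G) (n : ℕ) :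
    (symRows T A B H n).ev x (fun k => List.rec 0 (fun a w _ => G.cf a w) k) = 0 := by
  set g : List Bool → ℂ := fun k => List.rec 0 (fun a w _ => G.cf a w) k with hg
  have hg10 : ∀ k, 10 < k.length → g k = 0 := by
    intro k hk
    cases k with
    | nil => rfl
    | cons a k => exact hG a k (by rw [List.length_cons] at hk; omega)
  have hTF : T.val x = F.cf := by funext b w; exact hT b w
  have h0 : (Row.mk Poly.nil Lin.nil).ev x g = 0 := by simp [Row.ev, Poly.ev, Lin.ev]
  unfold symRows
  rcases bits 20 n [] with _ | ⟨_ | _, _ | ⟨c, w⟩⟩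
  · exact h0
  · exact h0
  · change (Row.mk Poly.nil (symRow T c w)).ev x g = 0
    have h1 := ev_symRow (x := x) hg10 T (by simpa [hTF] using hF) c w
    simp only [Row.ev, h1, Poly.ev, hTF, zero_add]
    exact sub_eq_zero.2 (h.der_cf c w)
  · exact h0
  · apply ev_countLetters
    intro i j
    have h1 := ev_coeffProd (x := x) i j (bif c then B else A) H
    have h2 := sum_wordsOf (G.rhs c) i j
    have h3 : abelianize (G.rhs c) = (bif c then B else A).toMv x * H.toMv x := by
      cases c
      · exact hA
      · exact hB
    rw [h3, ← h1] at h2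
    have e : (Bool.rec A B c : CTab) = bif c then B else A := by cases c <;> rfl
    simp only [Row.ev, abRow, Poly.ev_neg, ev_sumWords, Lin.ev, e, add_zero]
    change -_ + ((wordsOf (i + j) j).map (coeff (G.rhs c))).sum = 0
    rw [h2]
    ring

end Soundness

end Elim


namespace Elim

open NCPoly PainleveFive

/-! ### The table of the general system -/

/-- A node, or the empty trie if there are no coefficients. -/
noncomputable def WTrie.mk (cu cv : Poly) (l r : WTrie) : WTrie :=
  Poly.rec (Poly.rec (WTrie.rec (WTrie.rec .nil (fun a b s t _ _ => .node cu cv l (.node a b s t)) r)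
    (fun _ _ _ _ _ _ => .node cu cv l r) l) (fun _ _ _ _ _ => .node cu cv l r) cv)
    (fun _ _ _ _ _ => .node cu cv l r) cu

theorem val_mk (x : ℕ → ℂ) (cu cv : Poly) (l r : WTrie) (b : Bool) (w : List Bool) :
    (WTrie.mk cu cv l r).val x b w = (WTrie.node cu cv l r).val x b w := by
  cases cu
  · cases cv
    · cases l
      · cases r
        · rcases w with _ | ⟨_ | _, w⟩
          · cases b <;> rfl
          · rfl
          · rfl
        · rfl
      · rfl
    · rfl
  · rfl

@[simp] theorem val_mk_nil_false (x : ℕ → ℂ) (cu cv : Poly) (l r : WTrie) :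
    (WTrie.mk cu cv l r).val x false [] = cu.ev x := val_mk ..

@[simp] theorem val_mk_nil_true (x : ℕ → ℂ) (cu cv : Poly) (l r : WTrie) :
    (WTrie.mk cu cv l r).val x true [] = cv.ev x := val_mk ..

@[simp] theorem val_mk_false (x : ℕ → ℂ) (cu cv : Poly) (l r : WTrie) (b : Bool) (w : List Bool) :
    (WTrie.mk cu cv l r).val x b (false :: w) = l.val x b w := val_mk ..

@[simp] theorem val_mk_true (x : ℕ → ℂ) (cu cv : Poly) (l r : WTrie) (b : Bool) (w : List Bool) :
    (WTrie.mk cu cv l r).val x b (true :: w) = r.val x b w := val_mk ..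

@[simp] theorem val_mk_nil_nil (x : ℕ → ℂ) (cu cv : Poly) (b a : Bool) (w : List Bool) :
    (WTrie.mk cu cv .nil .nil).val x b (a :: w) = 0 := by
  rw [val_mk]; cases a <;> rfl

/-- The general system. -/
noncomputable def sysTab (a₁ a₂ a₃ a₄ b₁ b₂ b₃ b₄ b₅ b₆ c₁ c₁₂ c₂ d₁ d₁₂ d₂ e e' f f' k₁ k₂ k₃ l :
    Poly) : WTrie :=
  .mk (.neg k₂) k₃
    (.mk l .nil
      (.mk (.neg k₁) .nil
        (.mk .nil .nil .nil (.mk a₁ .nil .nil .nil))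
        (.mk c₁ .nil (.mk a₂ .nil .nil .nil) (.mk .nil b₁ .nil .nil)))
      (.mk e f
        (.mk c₁₂ .nil (.mk a₃ .nil .nil .nil) (.mk .nil b₂ .nil .nil))
        (.mk .nil d₁ (.mk .nil b₃ .nil .nil) .nil)))
    (.mk .nil (.neg l)
      (.mk e' f'
        (.mk c₂ .nil (.mk a₄ .nil .nil .nil) (.mk .nil b₄ .nil .nil))
        (.mk .nil d₁₂ (.mk .nil b₅ .nil .nil) .nil))
      (.mk .nil (.cons 0 1 1 .nil) (.mk .nil d₂ (.mk .nil b₆ .nil .nil) .nil) .nil))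

theorem rhs_system_false (C : Coeffs) (κ : Params) (z : ℂ) :
    (system C κ z).rhs false =
      C.a₁ • word [false, false, false, true] + C.a₂ • word [false, false, true, false] +
      C.a₃ • word [false, true, false, false] +
      (2 - (C.a₁ + C.a₂ + C.a₃)) • word [true, false, false, false] +
      C.c₁ • word [false, false, true] + (-4 - C.c₁ - C.c₂) • word [false, true, false] +
      C.c₂ • word [true, false, false] - κ.κ₁ • word [false, false] + C.e₁ • word [false, true] +
      (2 - C.e₁) • word [true, false] + (κ.κ₁ + κ.κ₂) • word [false] - κ.κ₂ • word [] +
      (κ.κ₄ * z) • word [false] := by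
  simp [NCSystem.rhs, system, u_eq_gen, v_eq_gen, pow_succ, mul_assoc]

theorem cf_system_false (C : Coeffs) (κ : Params) (z : ℂ) (w : List Bool) :
    (system C κ z).cf false w =
      C.a₁ * (if [false, false, false, true] = w then 1 else 0) +
      C.a₂ * (if [false, false, true, false] = w then 1 else 0) +
      C.a₃ * (if [false, true, false, false] = w then 1 else 0) +
      (2 - (C.a₁ + C.a₂ + C.a₃)) * (if [true, false, false, false] = w then 1 else 0) +
      C.c₁ * (if [false, false, true] = w then 1 else 0) +
      (-4 - C.c₁ - C.c₂) * (if [false, true, false] = w then 1 else 0) +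
      C.c₂ * (if [true, false, false] = w then 1 else 0) -
      κ.κ₁ * (if [false, false] = w then 1 else 0) +
      C.e₁ * (if [false, true] = w then 1 else 0) +
      (2 - C.e₁) * (if [true, false] = w then 1 else 0) +
      (κ.κ₁ + κ.κ₂) * (if [false] = w then 1 else 0) -
      κ.κ₂ * (if [] = w then 1 else 0) + κ.κ₄ * z * (if [false] = w then 1 else 0) := by
  rw [NCSystem.cf, rhs_system_false]
  simp only [map_add, map_sub, map_smul, Pi.add_apply, Pi.sub_apply, Pi.smul_apply, coeff_word,
    smul_eq_mul]

theorem rhs_system_true (C : Coeffs) (κ : Params) (z : ℂ) :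
    (system C κ z).rhs true =
      C.b₁ • word [false, false, true, true] + C.b₂ • word [false, true, false, true] +
      C.b₃ • word [false, true, true, false] + C.b₄ • word [true, false, false, true] +
      C.b₅ • word [true, false, true, false] +
      (-3 - (C.b₁ + C.b₂ + C.b₃ + C.b₄ + C.b₅)) • word [true, true, false, false] +
      C.d₁ • word [false, true, true] + (4 - C.d₁ - C.d₂) • word [true, false, true] +
      C.d₂ • word [true, true, false] - word [true, true] + C.f₁ • word [false, true] +
      (2 * κ.κ₁ - C.f₁) • word [true, false] - (κ.κ₁ + κ.κ₂) • word [true] + κ.κ₃ • word [] -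
      (κ.κ₄ * z) • word [true] := by
  simp [NCSystem.rhs, system, u_eq_gen, v_eq_gen, pow_succ, mul_assoc]

theorem cf_system_true (C : Coeffs) (κ : Params) (z : ℂ) (w : List Bool) :
    (system C κ z).cf true w =
      C.b₁ * (if [false, false, true, true] = w then 1 else 0) +
      C.b₂ * (if [false, true, false, true] = w then 1 else 0) +
      C.b₃ * (if [false, true, true, false] = w then 1 else 0) +
      C.b₄ * (if [true, false, false, true] = w then 1 else 0) +
      C.b₅ * (if [true, false, true, false] = w then 1 else 0) +
      (-3 - (C.b₁ + C.b₂ + C.b₃ + C.b₄ + C.b₅)) *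
        (if [true, true, false, false] = w then 1 else 0) +
      C.d₁ * (if [false, true, true] = w then 1 else 0) +
      (4 - C.d₁ - C.d₂) * (if [true, false, true] = w then 1 else 0) +
      C.d₂ * (if [true, true, false] = w then 1 else 0) -
      (if [true, true] = w then 1 else 0) +
      C.f₁ * (if [false, true] = w then 1 else 0) +
      (2 * κ.κ₁ - C.f₁) * (if [true, false] = w then 1 else 0) -
      (κ.κ₁ + κ.κ₂) * (if [true] = w then 1 else 0) +
      κ.κ₃ * (if [] = w then 1 else 0) - κ.κ₄ * z * (if [true] = w then 1 else 0) := by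
  rw [NCSystem.cf, rhs_system_true]
  simp only [map_add, map_sub, map_smul, Pi.add_apply, Pi.sub_apply, Pi.smul_apply, coeff_word,
    smul_eq_mul]

theorem cf_system_eq_zero (C : Coeffs) (κ : Params) (z : ℂ) (b : Bool) {w : List Bool}
    (hw : 4 < w.length) : (system C κ z).cf b w = 0 := by
  have h : ∀ v : List Bool, v.length ≤ 4 → (if v = w then (1 : ℂ) else 0) = 0 := by
    intro v hv
    rw [if_neg]
    rintro rfl
    omega
  have hne : w ≠ [] := by rintro rfl; simp at hw
  cases b
  · rw [cf_system_false]
    simp [h, hne]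
  · rw [cf_system_true]
    simp [h, hne]

theorem val_sysTab (C : Coeffs) (κ : Params) (z : ℂ) (x : ℕ → ℂ)
    {a₁ a₂ a₃ a₄ b₁ b₂ b₃ b₄ b₅ b₆ c₁ c₁₂ c₂ d₁ d₁₂ d₂ e e' f f' k₁ k₂ k₃ l : Poly}
    (ha₁ : a₁.ev x = C.a₁) (ha₂ : a₂.ev x = C.a₂) (ha₃ : a₃.ev x = C.a₃)
    (ha₄ : a₄.ev x = 2 - (C.a₁ + C.a₂ + C.a₃)) (hb₁ : b₁.ev x = C.b₁) (hb₂ : b₂.ev x = C.b₂)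
    (hb₃ : b₃.ev x = C.b₃) (hb₄ : b₄.ev x = C.b₄) (hb₅ : b₅.ev x = C.b₅)
    (hb₆ : b₆.ev x = -3 - (C.b₁ + C.b₂ + C.b₃ + C.b₄ + C.b₅)) (hc₁ : c₁.ev x = C.c₁)
    (hc₁₂ : c₁₂.ev x = -4 - C.c₁ - C.c₂) (hc₂ : c₂.ev x = C.c₂) (hd₁ : d₁.ev x = C.d₁)
    (hd₁₂ : d₁₂.ev x = 4 - C.d₁ - C.d₂) (hd₂ : d₂.ev x = C.d₂) (he : e.ev x = C.e₁)
    (he' : e'.ev x = 2 - C.e₁) (hf : f.ev x = C.f₁) (hf' : f'.ev x = 2 * κ.κ₁ - C.f₁)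
    (hk₁ : k₁.ev x = κ.κ₁) (hk₂ : k₂.ev x = κ.κ₂) (hk₃ : k₃.ev x = κ.κ₃)
    (hl : l.ev x = κ.κ₁ + κ.κ₂ + κ.κ₄ * z) (b : Bool) (w : List Bool) :
    (sysTab a₁ a₂ a₃ a₄ b₁ b₂ b₃ b₄ b₅ b₆ c₁ c₁₂ c₂ d₁ d₁₂ d₂ e e' f f' k₁ k₂ k₃ l).val x b w =
      (system C κ z).cf b w := by
  have hnil : Poly.ev x .nil = 0 := rfl
  cases b
  · rw [cf_system_false]
    rcases w with _ | ⟨_ | _, _ | ⟨_ | _, _ | ⟨_ | _, _ | ⟨_ | _, _ | ⟨_, w⟩⟩⟩⟩⟩ <;>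
      simp [sysTab, val_nil, Poly.ev_neg, *]
  · rw [cf_system_true]
    rcases w with _ | ⟨_ | _, _ | ⟨_ | _, _ | ⟨_ | _, _ | ⟨_ | _, _ | ⟨_, w⟩⟩⟩⟩⟩ <;>
      simp [sysTab, val_nil, Poly.ev_neg, Poly.ev, Poly.mev_one, *]
    ring

end Elim


namespace Elim

open NCPoly PainleveFive

/-! ### The family of systems with two trace integrals -/

/-- The conditions for the existence of the integrals. -/
def HasIntegrals (C : Coeffs) : Prop :=
  C.b₁ = -C.a₁ ∧ C.b₂ = -C.a₁ - C.a₂ ∧ C.b₃ = 0 ∧ C.b₄ = 1 - C.a₂ - C.a₃ ∧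
    C.b₅ = -2 + C.a₁ + C.a₂ ∧ C.d₁ = -C.c₁ ∧ C.d₂ = -C.c₂

/-- The systems in the family differ from a Hamiltonian one by the inner derivation with the
element `al u²v + be uvu + ga vu² + mu uv + nu vu + ep v + ph u`. -/
structure Pars (R : Type) where
  al : R
  be : R
  ga : R
  mu : R
  nu : R
  ep : R
  ph : R
  k₁ : R
  k₂ : R
  k₃ : R
  la : R

/-- The parameters of a system. -/
noncomputable def parsOf (C : Coeffs) (κ : Params) (z : ℂ) : Pars ℂ where
  al := C.a₁
  be := C.a₁ + C.a₂ - 1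
  ga := C.a₁ + C.a₂ + C.a₃ - 2
  mu := C.c₁
  nu := -C.c₂
  ep := C.e₁ - 1
  ph := κ.κ₁ - C.f₁
  k₁ := κ.κ₁
  k₂ := κ.κ₂
  k₃ := κ.κ₃
  la := κ.κ₁ + κ.κ₂ + κ.κ₄ * z

/-- A constant polynomial. -/
noncomputable def Poly.const (p n : ℕ) : Poly := .cons p n 1 .nil

/-- A variable. -/
noncomputable def Poly.var (i : ℕ) : Poly := .cons 1 0 i .nil

/-- The table of a system in the family. -/
noncomputable def famTab (P : Pars Poly) : WTrie :=
  sysTab P.al (.add (.const 1 0) (.add P.be (.neg P.al))) (.add (.const 1 0) (.add P.ga (.neg P.be)))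
    (.neg P.ga) (.neg P.al) (.add (.const 0 1) (.neg P.be)) .nil
    (.add (.const 0 1) (.add (.neg P.ga) P.al)) (.add (.const 0 1) P.be) P.ga
    P.mu (.add (.const 0 4) (.add (.neg P.mu) P.nu)) (.neg P.nu)
    (.neg P.mu) (.add (.const 4 0) (.add P.mu (.neg P.nu))) P.nu
    (.add (.const 1 0) P.ep) (.add (.const 1 0) (.neg P.ep))
    (.add P.k₁ (.neg P.ph)) (.add P.k₁ P.ph) P.k₁ P.k₂ P.k₃ P.la

/-- The scalar Hamiltonian. -/
noncomputable def hamTab (P : Pars Poly) : CTab :=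
  .cons 3 2 (.const 1 0) <| .cons 2 2 (.const 0 2) <| .cons 1 2 (.const 1 0) <|
    .cons 2 1 (.neg P.k₁) <| .cons 1 1 P.la <| .cons 0 1 (.neg P.k₂) <| .cons 1 0 (.neg P.k₃) .nil

/-- The derivative of the scalar Hamiltonian with respect to `v`. -/
noncomputable def hamTabV (P : Pars Poly) : CTab :=
  .cons 3 1 (.const 2 0) <| .cons 2 1 (.const 0 4) <| .cons 1 1 (.const 2 0) <|
    .cons 2 0 (.neg P.k₁) <| .cons 1 0 P.la <| .cons 0 0 (.neg P.k₂) .nil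

/-- Minus the derivative of the scalar Hamiltonian with respect to `u`. -/
noncomputable def hamTabU (P : Pars Poly) : CTab :=
  .cons 2 2 (.const 0 3) <| .cons 1 2 (.const 4 0) <| .cons 0 2 (.const 0 1) <|
    .cons 1 1 (.add P.k₁ P.k₁) <| .cons 0 1 (.neg P.la) <| .cons 0 0 P.k₃ .nil

/-- The equations for the symmetries of a system in the family. -/
noncomputable def famRows (P : Pars Poly) : ℕ → Row :=
  symRows (famTab P) (hamTabV P) (hamTabU P) (hamTab P)

/-- The parameters given by polynomials have the values `V`. -/
def Pars.Ev (x : ℕ → ℂ) (P : Pars Poly) (V : Pars ℂ) : Prop :=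
  P.al.ev x = V.al ∧ P.be.ev x = V.be ∧ P.ga.ev x = V.ga ∧ P.mu.ev x = V.mu ∧ P.nu.ev x = V.nu ∧
    P.ep.ev x = V.ep ∧ P.ph.ev x = V.ph ∧ P.k₁.ev x = V.k₁ ∧ P.k₂.ev x = V.k₂ ∧
    P.k₃.ev x = V.k₃ ∧ P.la.ev x = V.la

/-- The numbers `g` are the coefficients of a symmetry of the system with the parameters `V`. -/
def Sol (V : Pars ℂ) (g : List Bool → ℂ) : Prop :=
  -- With `x` and `P` quantified, one solution can be used in several certificates, each with its
  -- own special values of the parameters and its own unknowns kept as variables.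
  ∀ (x : ℕ → ℂ) (P : Pars Poly), P.Ev x V → ∀ n, (famRows P n).ev x g = 0

theorem ev_const (x : ℕ → ℂ) (p n : ℕ) : (Poly.const p n).ev x = p - n := by
  simp [Poly.const, Poly.ev, Poly.mev_one]

theorem val_famTab {C : Coeffs} {κ : Params} {z : ℂ} (hC : HasIntegrals C) {x : ℕ → ℂ}
    {P : Pars Poly} (hP : P.Ev x (parsOf C κ z)) (b : Bool) (w : List Bool) :
    (famTab P).val x b w = (system C κ z).cf b w := by
  obtain ⟨h1, h2, h3, h4, h5, h6, h7⟩ := hC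
  obtain ⟨hal, hbe, hga, hmu, hnu, hep, hph, hk₁, hk₂, hk₃, hla⟩ := hP
  simp only [parsOf] at *
  have hnil : Poly.ev x .nil = 0 := rfl
  apply val_sysTab <;> simp only [Poly.ev_add, Poly.ev_neg, ev_const, *] <;> push_cast <;> ring

theorem monomial_expo (i j : ℕ) (c : ℂ) : MvPolynomial.monomial (expo i j) c =
    c • ((MvPolynomial.X 0 : MvPolynomial (Fin 2) ℂ) ^ i * MvPolynomial.X 1 ^ j) := by
  rw [MvPolynomial.X_pow_eq_monomial, MvPolynomial.X_pow_eq_monomial, MvPolynomial.monomial_mul,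
    MvPolynomial.smul_monomial]
  simp [expo]

theorem toMv_hamTab {C : Coeffs} {κ : Params} {z : ℂ} {x : ℕ → ℂ} {P : Pars Poly}
    (hP : P.Ev x (parsOf C κ z)) : (hamTab P).toMv x = hamiltonian κ z := by
  obtain ⟨hal, hbe, hga, hmu, hnu, hep, hph, hk₁, hk₂, hk₃, hla⟩ := hP
  simp only [parsOf] at *
  simp only [hamTab, CTab.toMv, monomial_expo, ev_const, Poly.ev_neg, hamiltonian, *]
  simp only [MvPolynomial.smul_eq_C_mul, map_add, map_sub, map_neg, map_mul, map_natCast]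
  push_cast
  ring

theorem toMv_hamTabV (x : ℕ → ℂ) (P : Pars Poly) :
    (hamTabV P).toMv x = MvPolynomial.pderiv 1 ((hamTab P).toMv x) := by
  simp only [hamTab, hamTabV, CTab.toMv, map_add, ev_const, Poly.ev_neg,
    map_zero, monomial_expo]
  simp only [MvPolynomial.smul_eq_C_mul]
  have c2 : (MvPolynomial.C 2 : MvPolynomial (Fin 2) ℂ) = 2 := map_ofNat _ 2
  have c4 : (MvPolynomial.C 4 : MvPolynomial (Fin 2) ℂ) = 4 := map_ofNat _ 4
  norm_num
  simp only [c2, c4]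
  ring

theorem toMv_hamTabU (x : ℕ → ℂ) (P : Pars Poly) :
    (hamTabU P).toMv x = -MvPolynomial.pderiv 0 ((hamTab P).toMv x) := by
  simp only [hamTab, hamTabU, CTab.toMv, map_add, ev_const, Poly.ev_neg,
    map_zero, monomial_expo, Poly.ev_add]
  simp only [MvPolynomial.smul_eq_C_mul]
  have c2 : (MvPolynomial.C 2 : MvPolynomial (Fin 2) ℂ) = 2 := map_ofNat _ 2
  have c3 : (MvPolynomial.C 3 : MvPolynomial (Fin 2) ℂ) = 3 := map_ofNat _ 3
  have c4 : (MvPolynomial.C 4 : MvPolynomial (Fin 2) ℂ) = 4 := map_ofNat _ 4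
  norm_num
  simp only [c2, c3, c4]
  ring

/-- The total degree of a table. -/
def CTab.deg : CTab → ℕ
  | nil => 0
  | cons i j _ T => max (i + j) T.deg

theorem totalDegree_toMv_le (x : ℕ → ℂ) (T : CTab) : (T.toMv x).totalDegree ≤ T.deg := by
  induction T with
  | nil => simp [CTab.toMv]
  | cons i j p T ih =>
    rw [CTab.toMv, CTab.deg]
    refine (MvPolynomial.totalDegree_add _ _).trans (max_le_max ?_ ih)
    refine (MvPolynomial.totalDegree_monomial_le _ _).trans (le_of_eq ?_)
    rw [expo, Finsupp.sum_add_index' (by simp) (by simp)]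
    simp

/-- The assignment of values to the variables: the parameters belong to the first primes, then
follow the selected unknowns. -/
noncomputable def asg (V : Pars ℂ) (s : ℕ → ℂ) : ℕ → ℂ
  | 2 => V.al
  | 3 => V.be
  | 5 => V.ga
  | 7 => V.mu
  | 11 => V.nu
  | 13 => V.ep
  | 17 => V.ph
  | 19 => V.k₁
  | 23 => V.k₂
  | 29 => V.k₃
  | 31 => V.la
  | 37 => s 0
  | 41 => s 1
  | 43 => s 2
  | 47 => s 3
  | 53 => s 4
  | 59 => s 5
  | 61 => s 6
  | 67 => s 7
  | _ => 0

/-- The selected unknowns with their primes. -/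
def symbols (ks : List (List Bool)) : List (List Bool × ℕ) :=
  ks.zip [37, 41, 43, 47, 53, 59, 61, 67]

theorem mev_symbols (V : Pars ℂ) (g : List Bool → ℂ) (ks : List (List Bool)) :
    ∀ s ∈ symbols ks, Poly.mev (asg V fun i => g (ks.getD i [])) s.2 = g s.1 := by
  intro s hs
  obtain ⟨i, hi, rfl⟩ := List.getElem_of_mem hs
  simp only [symbols, List.length_zip, List.length_cons, List.length_nil] at hi
  have h8 : i < 8 := by omega
  have hk : i < ks.length := by omega
  simp only [symbols, List.getElem_zip]
  interval_cases i <;> (rw [Poly.mev_prime _ (by norm_num)]; simp [asg, hk])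

/-- A monomial. -/
noncomputable def mon (l : List ℕ) : ℕ := List.rec 1 (fun i _ ih => Nat.mul i ih) l

theorem mev_mon_nil (x : ℕ → ℂ) : Poly.mev x (mon []) = 1 := Poly.mev_one x

theorem mev_mon_cons (x : ℕ → ℂ) {i : ℕ} (hi : i.Prime) (l : List ℕ) :
    Poly.mev x (mon (i :: l)) = x i * Poly.mev x (mon l) := by
  change Poly.mev x (i * mon l) = _
  rw [Poly.mev_mul, Poly.mev_prime x hi]

/-- The parameters as variables. -/
noncomputable def Pars.gen : Pars Poly :=
  ⟨.var 2, .var 3, .var 5, .var 7, .var 11, .var 13, .var 17, .var 19, .var 23, .var 29, .var 31⟩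

theorem ev_var (x : ℕ → ℂ) {i : ℕ} (hi : i.Prime) : (Poly.var i).ev x = x i := by
  simp [Poly.var, Poly.ev, Poly.mev_prime x hi]

theorem ev_gen (V : Pars ℂ) (s : ℕ → ℂ) : Pars.gen.Ev (asg V s) V := by
  refine ⟨?_, ?_, ?_, ?_, ?_, ?_, ?_, ?_, ?_, ?_, ?_⟩ <;> exact ev_var _ (by norm_num)

theorem exists_sol {C : Coeffs} {κ : Params} {z : ℂ} (hC : HasIntegrals C)
    (h : (system C κ z).AdmitsSymmetry (hamiltonian κ z) 1) : ∃ g, Sol (parsOf C κ z) g := by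
  obtain ⟨G, h1, h2, hs⟩ := h
  refine ⟨fun k => List.rec 0 (fun a w _ => G.cf a w) k, fun x P hP n => ?_⟩
  have hH := toMv_hamTab hP
  have e1 : MvPolynomial.pderiv 1 (hamiltonian κ z) * hamiltonian κ z ^ 1 =
      (hamTabV P).toMv x * (hamTab P).toMv x := by
    rw [toMv_hamTabV, hH, pow_one]
  have e2 : -MvPolynomial.pderiv 0 (hamiltonian κ z) * hamiltonian κ z ^ 1 =
      (hamTabU P).toMv x * (hamTab P).toMv x := by
    rw [toMv_hamTabU, hH, pow_one]
  rw [e1] at h1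
  rw [e2] at h2
  -- Upper bounds for the degrees suffice: 4 + 5 = 9 bounds the length of the words in the symmetry,
  -- and longer unknowns are zero.
  have d : (hamTab P).deg = 5 ∧ (hamTabV P).deg = 4 ∧ (hamTabU P).deg = 4 := ⟨rfl, rfl, rfl⟩
  have t0 := totalDegree_toMv_le x (hamTab P)
  have t1 := totalDegree_toMv_le x (hamTabV P)
  have t2 := totalDegree_toMv_le x (hamTabU P)
  have m1 := MvPolynomial.totalDegree_mul ((hamTabV P).toMv x) ((hamTab P).toMv x)
  have m2 := MvPolynomial.totalDegree_mul ((hamTabU P).toMv x) ((hamTab P).toMv x)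
  refine ev_symRows (F := system C κ z) (val_famTab hC hP) (fun b w => cf_system_eq_zero C κ z b)
    h1.1 h2.1 ?_ hs n
  intro b w hw
  cases b
  · exact coeff_eq_zero_of_mem_degreeLE h1.2 (by omega)
  · exact coeff_eq_zero_of_mem_degreeLE h2.2 (by omega)

theorem mev_asg (V : Pars ℂ) (s : ℕ → ℂ) (l : List ℕ) :
    Poly.mev (asg V s) (mon (2 :: l)) = V.al * Poly.mev (asg V s) (mon l) ∧
    Poly.mev (asg V s) (mon (3 :: l)) = V.be * Poly.mev (asg V s) (mon l) ∧
    Poly.mev (asg V s) (mon (5 :: l)) = V.ga * Poly.mev (asg V s) (mon l) ∧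
    Poly.mev (asg V s) (mon (7 :: l)) = V.mu * Poly.mev (asg V s) (mon l) ∧
    Poly.mev (asg V s) (mon (11 :: l)) = V.nu * Poly.mev (asg V s) (mon l) ∧
    Poly.mev (asg V s) (mon (13 :: l)) = V.ep * Poly.mev (asg V s) (mon l) ∧
    Poly.mev (asg V s) (mon (17 :: l)) = V.ph * Poly.mev (asg V s) (mon l) ∧
    Poly.mev (asg V s) (mon (19 :: l)) = V.k₁ * Poly.mev (asg V s) (mon l) ∧
    Poly.mev (asg V s) (mon (23 :: l)) = V.k₂ * Poly.mev (asg V s) (mon l) ∧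
    Poly.mev (asg V s) (mon (29 :: l)) = V.k₃ * Poly.mev (asg V s) (mon l) ∧
    Poly.mev (asg V s) (mon (31 :: l)) = V.la * Poly.mev (asg V s) (mon l) ∧
    Poly.mev (asg V s) (mon (37 :: l)) = s 0 * Poly.mev (asg V s) (mon l) ∧
    Poly.mev (asg V s) (mon (41 :: l)) = s 1 * Poly.mev (asg V s) (mon l) ∧
    Poly.mev (asg V s) (mon (43 :: l)) = s 2 * Poly.mev (asg V s) (mon l) ∧
    Poly.mev (asg V s) (mon (47 :: l)) = s 3 * Poly.mev (asg V s) (mon l) ∧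
    Poly.mev (asg V s) (mon (53 :: l)) = s 4 * Poly.mev (asg V s) (mon l) ∧
    Poly.mev (asg V s) (mon (59 :: l)) = s 5 * Poly.mev (asg V s) (mon l) ∧
    Poly.mev (asg V s) (mon (61 :: l)) = s 6 * Poly.mev (asg V s) (mon l) ∧
    Poly.mev (asg V s) (mon (67 :: l)) = s 7 * Poly.mev (asg V s) (mon l) := by
  refine ⟨?_, ?_, ?_, ?_, ?_, ?_, ?_, ?_, ?_, ?_, ?_, ?_, ?_, ?_, ?_, ?_, ?_, ?_, ?_⟩ <;>
    exact mev_mon_cons _ (by norm_num) l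

/-- The constraints hold. -/
def AllZero (x : ℕ → ℂ) : List (Comb × Poly) → Prop
  | [] => True
  | s :: L => s.2.ev x = 0 ∧ AllZero x L

theorem allZero_iff {x : ℕ → ℂ} {L : List (Comb × Poly)} :
    AllZero x L ↔ ∀ s ∈ L, s.2.ev x = 0 := by
  induction L with
  | nil => simp [AllZero]
  | cons s L ih => simp [AllZero, ih]

/-- The results of elimination in the equations for a symmetry. -/
theorem Sol.elim {V : Pars ℂ} {g : List Bool → ℂ} (h : Sol V g) {P : Pars Poly}
    {ks : List (List Bool)} {D : ℕ} {units : List Poly} {script : Script}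
    {out : List (Comb × Poly)}
    (hc : check D (famRows P) units (symbols ks) script out = true)
    (hP : ∀ s, P.Ev (asg V s) V) (hunits : ∀ s, ∀ p ∈ units, p.ev (asg V s) ≠ 0) :
    AllZero (asg V fun i => g (ks.getD i [])) out :=
  allZero_iff.2 (check_sound (h _ P (hP _)) (hunits _) (mev_symbols V g ks) hc)

theorem Sol.elim_exists {V : Pars ℂ} {g : List Bool → ℂ} (h : Sol V g) {P : Pars Poly}
    {ks : List (List Bool)} {D : ℕ} {units : List Poly} {script : Script}
    {out : List (Comb × Poly)}
    (hc : check D (famRows P) units (symbols ks) script out = true)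
    (hP : ∀ s, P.Ev (asg V s) V) (hunits : ∀ s, ∀ p ∈ units, p.ev (asg V s) ≠ 0) :
    ∃ s, AllZero (asg V s) out :=
  ⟨_, h.elim hc hP hunits⟩

/-- The equations for a symmetry and one more: the unknown `k` vanishes. -/
noncomputable def zeroRows (k : List Bool) (P : Pars Poly) (n : ℕ) : Row :=
  -- The number 0 has no digits after a leading one and codes only the trivial equation, so its
  -- place is free.
  Nat.rec ⟨.nil, .cons (.const 1 0) k .nil⟩ (fun _ _ => famRows P n) n

theorem Sol.elim_zero {V : Pars ℂ} {g : List Bool → ℂ} (h : Sol V g) {k : List Bool}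
    (hk : g k = 0) {P : Pars Poly}
    {ks : List (List Bool)} {D : ℕ} {units : List Poly} {script : Script}
    {out : List (Comb × Poly)}
    (hc : check D (zeroRows k P) units (symbols ks) script out = true)
    (hP : ∀ s, P.Ev (asg V s) V) (hunits : ∀ s, ∀ p ∈ units, p.ev (asg V s) ≠ 0) :
    ∃ s, AllZero (asg V s) out := by
  refine ⟨_, allZero_iff.2 (check_sound ?_ (hunits _) (mev_symbols V g ks) hc)⟩
  rintro (_ | n)
  · simp [zeroRows, Row.ev, Lin.ev, Poly.ev, hk]
  · exact h _ P (hP _) (n + 1)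

end Elim


/-! ### Certificates for the leading coefficients -/

namespace Elim

/-- While al, ga and 1 - ga are invertible, the equations for words of 12 letters can be solved
until one of them reads -2 = 0. The inhomogeneity enters through the single equation 3079, for the
monomial of degree (6, 3) in the u component. -/
theorem genericAlGa_check :
    check 1 (famRows Pars.gen)
    [(.cons 0 1 (mon [5]) .nil), (.cons 1 0 (mon []) (.cons 0 1 (mon [5]) .nil)), (.cons 0 1 (mon
    [2]) .nil), (.cons 1 0 (mon [2]) .nil), (.cons 1 0 (mon [5]) .nil)]
    (symbols [])
    (.rows [17415, 17419, 17539, 17925, 18049, 18177, 18451, 18469, 18505, 18577, 18721, 18753,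
    21070, 21322, 21702, 22162, 22164, 20511, 16647, 18694, 17427, 17475, 17443, 17793, 18178,
    17421, 23566, 17430, 17429, 17541, 18050, 19480, 18482, 20559, 17542, 16455, 23578, 17436,
    16651, 17477, 17445, 16917, 23171, 23683, 23587, 21255, 23619, 23571, 16435, 22606, 16653,
    16921, 23686, 17478, 17446, 23596, 16523, 17450, 18514, 19776, 21891, 22915, 23608, 23604,
    17458, 18530, 23820, 17944, 16525, 16662, 17232, 16489, 20679, 23059, 23075, 23107, 21127,
    16579, 22035, 22051, 22083, 16666, 17496, 16804, 21273, 19728, 22851, 21827, 18626, 16993,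
    23656, 21603, 18628, 21043, 23692, 18992, 18824, 20875, 16777, 18632, 16675, 17688, 21091,
    16778, 19528, 22819, 23842, 20807, 21795, 19536, 18980, 18578, 23626, 17546, 18756, 21667,
    23634, 18724, 23848, 16549, 3079] .nil)
    [((.cons 1 0 17044 .nil), (.cons 0 2 (mon []) .nil))] = true := by
  decide +kernel

/-- The counterpart under transposition, which exchanges al with -ga: here al, ga and 1 + al are
inverted. -/
theorem genericGaAl_check :
    check 1 (famRows Pars.gen)
    [(.cons 0 1 (mon [5]) .nil), (.cons 0 1 (mon [2]) .nil), (.cons 1 0 (mon []) (.cons 1 0 (mon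
    [2]) .nil)), (.cons 1 0 (mon [2]) .nil), (.cons 1 0 (mon [5]) .nil)]
    (symbols [])
    (.rows [17415, 17419, 17925, 18049, 18177, 18451, 18469, 18505, 18577, 18721, 18753, 19474,
    21070, 21100, 21322, 21654, 21658, 21660, 21702, 21720, 22164, 17793, 24384, 24322, 18178,
    17421, 23566, 17430, 18962, 18050, 19074, 19586, 19976, 17157, 19522, 19490, 21094, 21674,
    21706, 21708, 21345, 18978, 19720, 19010, 17673, 19776, 16833, 21891, 18818, 21255, 17938,
    19728, 16801, 24208, 17569, 21329, 22177, 24160, 19480, 23683, 23587, 23619, 23571, 23573,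
    18820, 23940, 17730, 17954, 22035, 17986, 18056, 23760, 24144, 20931, 23578, 23577, 16455,
    18626, 22917, 17602, 17090, 19104, 16774, 20899, 22932, 16792, 20707, 19552, 24084, 23589,
    23621, 23685, 21841, 19504, 23590, 23622, 23686, 16485, 22924, 23593, 23594, 20835, 18530,
    21603, 23650, 21043, 23692, 18992, 18824, 20875, 16777, 18632, 16675, 17688, 21091, 16778,
    19528, 22819, 23842, 20807, 21795, 19536, 18980, 18578, 23626, 23690, 18756, 21667, 23634,
    18724, 23848, 16549, 3079] .nil)
    [((.cons 1 0 17044 .nil), (.cons 0 2 (mon []) .nil))] = true := by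
  decide +kernel

/-- The parameters with `al = -1`, `ga = 1`. -/
noncomputable def special : Pars Poly :=
  { Pars.gen with
    al := .const 0 1, ga := .const 1 0 }

/-- At al = -1, ga = 1 both 1 - ga and 1 + al vanish, so neither generic elimination applies. -/
theorem special_check :
    check 1 (famRows special)
    []
    (symbols [])
    (.rows [17415, 17419, 17541, 17667, 17925, 18049, 18177, 18469, 18505, 18577, 18753, 20790,
    21070, 21100, 21142, 21322, 21394, 21646, 21654, 21658, 21660, 21702, 21804, 21906, 22164,
    22290, 22308, 22543, 20527, 17421, 23566, 23299, 24193, 24322, 18178, 17430, 18050, 21094,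
    20697, 21670, 21674, 22840, 21708, 20937, 23776, 22872, 22952, 22984, 21105, 22936, 20793,
    20595, 20825, 20889, 22756, 20905, 16833, 23904, 24224, 20032, 16840, 22980, 19648, 20559,
    20567, 16435, 22812, 20587, 19976, 17729, 19588, 20000, 17427, 18470, 16915, 16455] (.comb
    (.cons 0 1 22828 (.cons 2 0 18784 (.cons 0 2 21193 (.cons 0 2 19232 (.cons 2 0 17185 (.cons 2
    0 19208 (.cons 0 2 16737 (.cons 0 2 17161 (.cons 4 0 16473 (.cons 0 4 18520 (.cons 4 0 16651
    (.cons 0 4 17445 (.cons 0 1 16459 .nil))))))))))))) (.rows [16459, 17445, 18506, 23589,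
    22828, 22603, 17477, 18514, 18784, 21081, 16684, 16467, 21187, 21193, 22860, 19208, 19232,
    19040, 18820, 17954, 22037, 18626, 16774, 19552, 23594, 19504, 23590, 23622, 23686, 22924,
    20651, 18530, 23602, 20635, 16653, 23820, 21603, 23650, 22836, 23604, 23059, 23075, 23107,
    21127, 21043, 23692, 18992, 22725, 18824, 16777, 23760, 22868, 19728, 24208, 22851, 21827,
    18632, 16675, 17688, 16778, 21091, 19528, 22819, 23842, 20807, 21795, 19536, 18980, 18578,
    23626, 23690, 18756, 21667, 23880, 23634, 18724, 23204, 3079] .nil)))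
    [((.cons 1 0 16553 .nil), (.cons 2 0 (mon []) .nil))] = true := by
  decide +kernel

/-- The parameters with `be = 2`, `ga = 0`. -/
noncomputable def edgeTwo : Pars Poly :=
  { Pars.gen with
    ga := .nil, be := .const 2 0 }

/-- The value be = 2 has to be treated separately because 2 - be is inverted in `face_check`; with
al invertible the equations are again contradictory. -/
theorem edgeTwo_check :
    check 1 (famRows edgeTwo)
    [(.cons 0 1 (mon [2]) .nil), (.cons 1 0 (mon [2]) .nil)]
    (symbols [])
    (.rows [16963, 17421, 17427, 17457, 17489, 17505, 17925, 18049, 18177, 18469, 18470, 18505,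
    18577, 18724, 18753, 18784, 18964, 18980, 19016, 19024, 19476, 19492, 19528, 19600, 21070,
    21322, 21394, 21654, 21658, 21660, 21906, 22162, 22164, 22308, 23844, 23848, 23686, 17541,
    18698, 23047, 23316, 18580, 18708, 18178, 17430, 16909, 17553, 23698, 16969, 18050, 18754,
    17673, 17729, 18768, 23589, 21094, 21674, 20793, 21321, 17224, 17232, 16808, 16647, 20511,
    17481, 23625, 20527, 16651, 22089, 17992, 23697, 23332, 17554, 22851, 21891, 23306, 16612,
    16804, 16910, 17956, 23062, 21285, 17185, 21193, 17096, 23113, 21651, 23174, 23061, 23059,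
    23075, 23107, 17730, 20709, 16489, 16786, 22930, 21283, 17186, 16785, 17602, 20659, 21161,
    17700, 22675, 17458, 20567, 16675, 22929, 21603, 16713, 23204, 21795, 17041, 17698, 20685,
    21091, 17548, 17484, 23185, 21833, 21667, 16709, 16721, 23109, 23077, 23178, 20819, 16677,
    17490, 23114] .nil)
    [((.cons 1 0 3079 .nil), (.cons 0 2 (mon []) .nil))] = true := by
  decide +kernel

/-- The parameters with `al = ga = 0`. -/
noncomputable def edge : Pars Poly :=
  { Pars.gen with
    ga := .nil, al := .nil }

/-- Away from be = 0, ±1, ±2 everything can be solved, and the remaining relation is -be = 0. -/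
theorem edge_check :
    check 1 (famRows edge)
    [(.cons 2 0 (mon []) (.cons 0 1 (mon [3]) .nil)), (.cons 0 1 (mon [3]) .nil), (.cons 0 1 (mon
    []) (.cons 0 1 (mon [3]) .nil)), (.cons 1 0 (mon [3]) .nil), (.cons 2 0 (mon []) (.cons 1 0
    (mon [3]) .nil)), (.cons 1 0 (mon []) (.cons 1 0 (mon [3]) .nil)), (.cons 1 0 (mon []) (.cons
    0 1 (mon [3]) .nil))]
    (symbols [])
    (.rows [16423, 16459, 16461, 16531, 16549, 16675, 16677, 16689, 16963, 16965, 16969, 16977,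
    16993, 17027, 17029, 17089, 17155, 17157, 17217, 17281, 17481, 17553, 17569, 18470, 18505,
    18514, 18532, 18577, 18578, 18584, 18596, 18721, 18722, 18724, 18754, 18784, 18818, 18848,
    18880, 18980, 19016, 19024, 19492, 19528, 19600, 20775, 21067, 21070, 21654, 21658, 21660,
    22162, 22164, 23844, 23848, 16537, 16681, 21651, 22819, 17446, 23625, 17482, 23698, 17554,
    18756, 17682, 18768, 17730, 16462, 16534, 16540, 22828, 16684, 21097, 16696, 17224, 18064,
    17232, 18080, 22822, 21069, 16678, 22675, 16966, 17956, 23689, 22805, 22089, 17992, 23332,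
    23113, 22821, 23177, 16984, 16804, 16972, 16538, 17484, 17170, 22053, 16938, 16786, 17808,
    17700, 23114, 17732, 21657, 22921, 23185, 16690, 21701, 21833, 16722] (.comb (.cons 1 0 22857
    (.cons 0 1 22825 (.cons 1 0 3079 .nil))) (.rows [3079, 22857] .nil)))
    [((.cons 1 0 16978 .nil), (.cons 0 1 (mon [3]) .nil))] = true := by
  decide +kernel

/-- The parameters with `be = 1`, `ga = 0`. -/
noncomputable def edgeOne : Pars Poly :=
  { Pars.gen with
    ga := .nil, be := .const 1 0 }

/-- Five unknowns cannot be eliminated linearly for all al and stay as variables; the six relations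
are nonlinear in al and are solved in `Sol.al_of_be_eq_one`. -/
theorem edgeOne_check :
    check 2 (famRows edgeOne)
    [(.cons 0 1 (mon [2]) .nil), (.cons 1 0 (mon [2]) .nil)]
    (symbols [[true, true, false, true, false, false, true, false, false, true], [true, true,
    false, false, true, false, true, false, false, true], [true, true, false, false, true, false,
    false, true, false, true], [true, true, false, false, false, true, false, true, false, true],
    [true, false, true, false, true, false, false, true, false, true]])
    (.rows [16903, 16907, 17427, 17457, 17484, 17489, 17505, 17584, 17616, 17632, 17824, 17856,
    17925, 17956, 17992, 18470, 18505, 18577, 18721, 18724, 18753, 18784, 18980, 19016, 19024,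
    19492, 19528, 19600, 20638, 20782, 20790, 20794, 20796, 21070, 21082, 21084, 21100, 21108,
    21112, 21142, 21322, 21394, 21646, 21654, 21658, 21660, 21684, 21688, 21702, 21720, 21736,
    21744, 21804, 21906, 22162, 22164, 22290, 22308, 22854, 22888, 22896, 22918, 22922, 22924,
    22960, 22992, 23008, 23128, 23314, 23332, 23698, 23826, 23844, 23848, 24082, 24100, 24136,
    17712, 17604, 17445, 18506, 17446, 16915, 17553, 17700, 18722, 21891, 17794, 17681, 18756,
    23075, 18978, 17732, 23171, 23589, 22051, 17169, 17954, 22606, 21094, 22678, 21670, 21674,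
    21706, 22682, 20793, 16540, 21708, 22684, 23192, 21169, 23233, 22872, 16728, 21857, 17072,
    17092, 22882, 23138, 21897, 23313, 16740, 21193, 22089, 22930, 17188, 23186, 23697, 22153,
    23825, 23202, 22946, 23714, 17220, 16804, 21321, 21639, 21795, 17041, 17572, 17545, 18706,
    17698, 23109, 16965, 17546, 20709, 20837, 22834, 16786, 16996, 21705, 17060, 22866, 23122,
    21833, 22085, 22929, 23185, 21283, 17186, 23689, 16785, 20901, 22663, 16654, 16519, 20751,
    21643, 22729, 16662, 16523, 22667, 20759, 21797, 16969, 21651, 20775, 21069, 16531, 16678,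
    22675, 21093, 22605, 16461, 16538, 16537, 20787, 20635, 21581, 21031, 22803, 16934, 16659,
    21157] (.comb (.cons 2 0 3079 (.cons 0 1 20821 (.cons 0 1 20653 (.cons 0 2 21669 (.cons 1 0
    21141 (.cons 1 0 20813 (.cons 0 1 21077 (.cons 0 1 20781 .nil)))))))) (.rows [20813, 16677,
    21067, 16661, 21035, 21589, 3599, 21141, 21653] .nil)))
    [((.cons 1 0 16714 .nil), (.cons 2 0 (mon [47]) .nil)), ((.cons 1 0 17554 .nil), (.cons 0 2
    (mon [37]) (.cons 0 2 (mon [2, 37]) .nil))), ((.cons 1 0 22821 .nil), (.cons 0 2 (mon [37])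
    (.cons 4 0 (mon [43]) (.cons 0 2 (mon [2, 43]) (.cons 2 0 (mon [2, 2, 37]) .nil))))), ((.cons
    1 0 16713 .nil), (.cons 2 0 (mon [2]) (.cons 0 1 (mon [2, 37]) (.cons 2 0 (mon [2, 41])
    (.cons 2 0 (mon [2, 53]) (.cons 1 0 (mon [2, 2, 37]) .nil)))))), ((.cons 1 0 22857 .nil),
    (.cons 0 2 (mon []) (.cons 2 0 (mon [2]) (.cons 0 1 (mon [37]) (.cons 0 2 (mon [53]) (.cons 0
    2 (mon [2, 37]) (.cons 2 0 (mon [2, 41]) (.cons 2 0 (mon [2, 53]) (.cons 1 0 (mon [2, 2, 37])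
    .nil))))))))), ((.cons 1 0 16681 .nil), (.cons 2 0 (mon []) (.cons 0 4 (mon [2]) (.cons 1 0
    (mon [37]) (.cons 2 0 (mon [41]) (.cons 0 1 (mon [2, 37]) (.cons 0 2 (mon [2, 41]) (.cons 0 1
    (mon [2, 43]) (.cons 0 2 (mon [2, 47]) (.cons 0 2 (mon [2, 53]) (.cons 0 3 (mon [2, 2, 37])
    (.cons 1 0 (mon [2, 2, 43]) (.cons 1 0 (mon [2, 2, 47]) (.cons 0 1 (mon [2, 2, 2, 37])
    .nil))))))))))))))] = true := by
  decide +kernel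

/-- The parameters with `ga = 0`. -/
noncomputable def face : Pars Poly :=
  { Pars.gen with
    ga := .nil }

/-- Eight unknowns stay as variables so that only al, 1 - be and 2 - be (up to sign) have to be
inverted. The relations among them are analysed in `Sol.be_eq_one`. -/
theorem face_check :
    check 1 (famRows face)
    [(.cons 0 1 (mon [2]) .nil), (.cons 0 1 (mon []) (.cons 1 0 (mon [3]) .nil)), (.cons 1 0 (mon
    []) (.cons 0 1 (mon [3]) .nil)), (.cons 1 0 (mon [2]) .nil), (.cons 2 0 (mon []) (.cons 0 1
    (mon [3]) .nil))]
    (symbols [[true, true, false, true, false, false, true, false, false, true], [true, true,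
    false, false, true, false, true, false, false, true], [true, true, false, false, true, false,
    false, true, false, true], [true, false, true, false, true, false, false, true, false, true],
    [true, false, true, false, false, true, false, true, false, true], [false, false, true,
    false, false, true, false, false, true, false], [false, false, false, true, false, true,
    false, false, true, false], [false, false, false, true, false, false, true, false, true,
    false]])
    (.rows [17421, 17427, 17457, 17489, 17505, 17925, 18049, 18177, 18469, 18470, 18505, 18577,
    18721, 18753, 18784, 18964, 19016, 19024, 19476, 19528, 19600, 20638, 20782, 20790, 20794,
    20796, 21070, 21082, 21084, 21100, 21108, 21112, 21142, 21322, 21394, 21646, 21654, 21658,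
    21660, 21684, 21688, 21702, 21720, 21736, 21744, 21804, 21906, 22162, 22164, 22290, 22308,
    23628, 23728, 23760, 23776, 23844, 23848, 24100, 24136, 23047, 17944, 18516, 23316, 18580,
    18708, 18178, 17430, 16909, 17445, 16963, 18050, 18978, 18754, 23817, 17673, 23171, 17729,
    18768, 19076, 24073, 23621, 21094, 21670, 21674, 21706, 20793, 21708, 22684, 21201, 21217,
    21321, 17224, 23716, 23842, 22948, 22161, 23874, 22177, 17232, 21329, 22952, 23720, 16808,
    16647, 20511, 17481, 23625, 18722, 20527, 16492, 16651, 21639, 23107, 16917, 16931, 17542,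
    16915, 21891, 23306, 20899, 21169, 20707, 16910, 17545, 23689, 23698, 23062, 20567, 16455,
    16653, 16921, 20559, 16659, 17161, 17796, 17730, 17954, 22037, 17986, 17512, 16489, 20901,
    23068, 20709, 16675, 16965, 22089, 23332, 16564, 21555, 17602, 17090, 23201, 23314, 22053,
    16966, 16933, 16523, 23109, 17546, 21193, 22884, 21905, 23137, 22922, 16525, 17548, 16934,
    23110, 20631, 16662, 17490, 23178, 16661, 20659, 16777, 22921, 21267, 17186, 21043, 21581,
    21587, 16709, 23177, 21779, 17698, 17492, 16689, 16786, 22929, 17570, 16721, 23204, 21589,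
    17560, 16537, 21605, 23188, 20819, 22865, 3599, 3079] .nil)
    [((.cons 1 0 16533 .nil), (.cons 0 1 (mon [2, 53]) (.cons 0 1 (mon [2, 67]) .nil))), ((.cons
    1 0 16549 .nil), (.cons 0 1 (mon [2, 47]) (.cons 0 1 (mon [2, 61]) .nil))), ((.cons 1 0 16681
    .nil), (.cons 0 1 (mon [2, 41]) (.cons 0 1 (mon [2, 67]) .nil))), ((.cons 1 0 16713 .nil),
    (.cons 0 1 (mon [2, 37]) (.cons 0 1 (mon [2, 61]) .nil))), ((.cons 1 0 16677 .nil), (.cons 0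
    2 (mon [2]) (.cons 0 1 (mon [2, 43]) (.cons 1 0 (mon [2, 61]) (.cons 1 0 (mon [2, 67])
    .nil))))), ((.cons 1 0 17572 .nil), (.cons 0 1 (mon [41]) (.cons 0 1 (mon [61]) (.cons 1 0
    (mon [3, 41]) (.cons 1 0 (mon [3, 61]) .nil))))), ((.cons 1 0 17700 .nil), (.cons 0 1 (mon
    [37]) (.cons 0 1 (mon [59]) (.cons 1 0 (mon [3, 37]) (.cons 1 0 (mon [3, 59]) .nil))))),
    ((.cons 1 0 16531 .nil), (.cons 1 0 (mon [2]) (.cons 1 0 (mon [2, 37]) (.cons 1 0 (mon [2,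
    41]) (.cons 1 0 (mon [2, 43]) (.cons 1 0 (mon [2, 47]) (.cons 1 0 (mon [2, 53]) (.cons 1 0
    (mon [2, 59]) (.cons 1 0 (mon [2, 61]) (.cons 1 0 (mon [2, 67]) .nil)))))))))), ((.cons 1 0
    16970 .nil), (.cons 0 4 (mon []) (.cons 2 0 (mon [2]) (.cons 0 1 (mon [43]) (.cons 1 0 (mon
    [59]) (.cons 2 0 (mon [61]) (.cons 3 0 (mon [67]) (.cons 1 0 (mon [2, 43]) (.cons 0 1 (mon
    [2, 61]) (.cons 0 1 (mon [2, 67]) (.cons 0 1 (mon [3, 43]) (.cons 0 1 (mon [3, 59]) (.cons 0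
    1 (mon [3, 67]) .nil))))))))))))), ((.cons 1 0 16969 .nil), (.cons 4 0 (mon []) (.cons 0 2
    (mon [3]) (.cons 0 2 (mon [59]) (.cons 0 2 (mon [61]) (.cons 0 2 (mon [67]) (.cons 0 1 (mon
    [2, 59]) (.cons 1 0 (mon [3, 59]) (.cons 1 0 (mon [3, 61]) (.cons 1 0 (mon [3, 67])
    .nil)))))))))), ((.cons 1 0 17554 .nil), (.cons 0 2 (mon []) (.cons 2 0 (mon [3]) (.cons 2 0
    (mon [59]) (.cons 1 0 (mon [61]) (.cons 1 0 (mon [67]) (.cons 1 0 (mon [2, 59]) (.cons 0 1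
    (mon [3, 59]) (.cons 0 1 (mon [3, 61]) (.cons 0 1 (mon [3, 67]) .nil)))))))))), ((.cons 1 0
    22821 .nil), (.cons 2 0 (mon []) (.cons 0 2 (mon [2]) (.cons 2 0 (mon [43]) (.cons 0 1 (mon
    [61]) (.cons 0 1 (mon [67]) (.cons 0 1 (mon [2, 43]) (.cons 1 0 (mon [2, 61]) (.cons 1 0 (mon
    [2, 67]) .nil)))))))))] = true := by
  decide +kernel

end Elim

/-! ### The leading coefficients al, be, ga of a system with a symmetry -/

namespace Elim

theorem ev_const_of {x : ℕ → ℂ} {p n : ℕ} {c : ℂ} (h : c = p - n) : (Poly.const p n).ev x = c := by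
  rw [ev_const, h]

theorem ev_nil_of {x : ℕ → ℂ} {c : ℂ} (h : c = 0) : Poly.nil.ev x = c := h.symm

/-- If both were nonzero, one of the two generic certificates would apply except at (al, ga) = (-1,
1), and each certificate ends in a contradiction. -/
theorem Sol.al_eq_zero_or_ga_eq_zero {V : Pars ℂ} {g : List Bool → ℂ} (h : Sol V g) :
    V.al = 0 ∨ V.ga = 0 := by
  by_contra! hne
  obtain ⟨ha, hg⟩ := hne
  by_cases hg1 : V.ga = 1
  · by_cases ha1 : V.al = -1
    · obtain ⟨s, key⟩ := h.elim_exists special_check (fun s => by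
        obtain ⟨e1, e2, e3, e4⟩ := ev_gen V s
        exact ⟨ev_const_of (by simp [ha1]), e2, ev_const_of (by simp [hg1]), e4⟩) (by simp)
      simp only [AllZero, Poly.ev, mev_mon_nil] at key
      norm_num at key
    · obtain ⟨s, key⟩ := h.elim_exists genericGaAl_check (ev_gen V) (fun s => by
        have : 1 + V.al ≠ 0 := fun h0 => ha1 (by linear_combination h0)
        simp only [List.forall_mem_cons, Poly.ev, mev_asg, mev_mon_nil]
        simp [ha, hg, this])
      simp only [AllZero, Poly.ev, mev_mon_nil] at key
      norm_num at key
  · obtain ⟨s, key⟩ := h.elim_exists genericAlGa_check (ev_gen V) (fun s => by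
      have : 1 + -V.ga ≠ 0 := fun h0 => hg1 (by linear_combination -h0)
      simp only [List.forall_mem_cons, Poly.ev, mev_asg, mev_mon_nil]
      simp [ha, hg, this])
    simp only [AllZero, Poly.ev, mev_mon_nil] at key
    norm_num at key

theorem Sol.be_of_al_eq_zero {V : Pars ℂ} {g : List Bool → ℂ} (h : Sol V g) (ha : V.al = 0)
    (hg : V.ga = 0) : V.be = 0 ∨ V.be = 1 ∨ V.be = -1 ∨ V.be = 2 ∨ V.be = -2 := by
  by_contra! hne
  obtain ⟨h0, h1, h2, h3, h4⟩ := hne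
  obtain ⟨s, key⟩ := h.elim_exists edge_check (fun s => by
    obtain ⟨e1, e2, e3, e4⟩ := ev_gen V s
    exact ⟨ev_nil_of ha, e2, ev_nil_of hg, e4⟩) (fun s => by
    have l1 : 2 + -V.be ≠ 0 := fun h => h3 (by linear_combination -h)
    have l2 : -1 + -V.be ≠ 0 := fun h => h2 (by linear_combination -h)
    have l3 : 2 + V.be ≠ 0 := fun h => h4 (by linear_combination h)
    have l4 : 1 + V.be ≠ 0 := fun h => h2 (by linear_combination h)
    have l5 : 1 + -V.be ≠ 0 := fun h => h1 (by linear_combination -h)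
    simp only [List.forall_mem_cons, Poly.ev, mev_asg, mev_mon_nil]
    simp [h0, l1, l2, l3, l4, l5])
  simp only [AllZero, Poly.ev, mev_asg, mev_mon_nil] at key
  exact h0 (by linear_combination -key.1)

theorem Sol.be_eq_one {V : Pars ℂ} {g : List Bool → ℂ} (h : Sol V g) (ha : V.al ≠ 0)
    (hg : V.ga = 0) : V.be = 1 := by
  by_contra h1
  by_cases h2 : V.be = 2
  · obtain ⟨s, key⟩ := h.elim_exists edgeTwo_check (fun s => by
      obtain ⟨e1, e2, e3, e4⟩ := ev_gen V s
      exact ⟨e1, ev_const_of (by simp [h2]), ev_nil_of hg, e4⟩) (fun s => by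
      simp only [List.forall_mem_cons, Poly.ev, mev_asg, mev_mon_nil]
      simp [ha])
    simp only [AllZero, Poly.ev, mev_mon_nil] at key
    norm_num at key
  · have l1 : -1 + V.be ≠ 0 := fun h => h1 (by linear_combination h)
    obtain ⟨s, key⟩ := h.elim_exists face_check (fun s => by
      obtain ⟨e1, e2, e3, e4⟩ := ev_gen V s
      exact ⟨e1, e2, ev_nil_of hg, e4⟩) (fun s => by
      have l2 : 1 + -V.be ≠ 0 := fun h => h1 (by linear_combination -h)
      have l3 : 2 + -V.be ≠ 0 := fun h => h2 (by linear_combination -h)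
      simp only [List.forall_mem_cons, Poly.ev, mev_asg, mev_mon_nil]
      simp [ha, l1, l2, l3])
    simp only [AllZero, Poly.ev, mev_asg, mev_mon_nil] at key
    obtain ⟨k1, k2, k3, k4, k5, k6, k7, k8, k9, -⟩ := key
    push_cast at k1 k2 k3 k4 k5 k6 k7 k8 k9
    -- With t = s 7 the relations give s 0 = s 1 = s 3 = s 4 = -t, s 5 = s 6 = t and s 2 = 2t - 2.
    -- Then `k8` yields t = 1, and `k9` becomes be = 1, contrary to assumption.
    have r5 : s 4 = -s 7 := mul_left_cancel₀ ha (by linear_combination -k1)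
    have r4 : s 3 = -s 6 := mul_left_cancel₀ ha (by linear_combination -k2)
    have r2 : s 1 = -s 7 := mul_left_cancel₀ ha (by linear_combination -k3)
    have r1 : s 0 = -s 6 := mul_left_cancel₀ ha (by linear_combination -k4)
    have r3 : s 2 = s 6 + s 7 - 2 := mul_left_cancel₀ ha (by linear_combination -k5)
    have r7 : s 6 = -s 1 := mul_left_cancel₀ l1 (by linear_combination k6)
    have r6 : s 5 = -s 0 := mul_left_cancel₀ l1 (by linear_combination k7)
    rw [r2, neg_neg] at r7
    rw [r1, r7, neg_neg] at r6
    rw [r1, r2, r3, r4, r5, r6, r7] at k8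
    have r8 : s 7 = 1 := mul_left_cancel₀ ha (by linear_combination k8)
    rw [r3, r6, r7, r8] at k9
    exact h1 (by linear_combination -k9 / 2)

theorem Sol.al_of_be_eq_one {V : Pars ℂ} {g : List Bool → ℂ} (h : Sol V g) (ha : V.al ≠ 0)
    (hb : V.be = 1) (hg : V.ga = 0) : V.al = -1 ∨ V.al = 1 ∨ V.al = 2 := by
  obtain ⟨s, key⟩ := h.elim_exists edgeOne_check (fun s => by
    obtain ⟨e1, e2, e3, e4⟩ := ev_gen V s
    exact ⟨e1, ev_const_of (by simp [hb]), ev_nil_of hg, e4⟩) (fun s => by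
    simp only [List.forall_mem_cons, Poly.ev, mev_asg, mev_mon_nil]
    simp [ha])
  simp only [AllZero, Poly.ev, mev_asg, mev_mon_nil] at key
  obtain ⟨k1, k2, k3, k4, k5, k6, -⟩ := key
  push_cast at k1 k2 k3 k4 k5 k6
  have r4 : s 3 = 0 := by linear_combination k1 / 2
  by_cases h1 : V.al = -1
  · exact Or.inl h1
  by_cases h2 : V.al = 2
  · exact Or.inr (Or.inr h2)
  -- The factors al + 1 and al - 2 are the coefficients of s 0 and s 2 here. Outside their zeros the
  -- remaining unknowns become s 1 = 0 and s 4 = -1, and the last relation reads 2 - 2 al = 0.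
  have r1 : s 0 = 0 := mul_left_cancel₀ (sub_ne_zero.2 h1) (by linear_combination -k2 / 2)
  have r3 : s 2 = 0 := mul_left_cancel₀ (sub_ne_zero.2 h2) (by
    linear_combination -k3 / 2 + (V.al ^ 2 - 1) * r1)
  rw [r1, r3, r4] at k6
  rw [r1] at k4 k5
  have r5 : s 4 = -1 - s 1 := mul_left_cancel₀ ha (by linear_combination k4 / 2)
  have r2 : s 1 = 0 := by
    rw [r5] at k5
    linear_combination k5 / 2
  rw [r5, r2] at k6
  exact Or.inr (Or.inl (by linear_combination -k6 / 2))

end Elim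


/-! ### Certificates for the remaining coefficients -/

namespace Elim

/-- The parameters with `(al, be, ga) = (-1, 1, 0)`. -/
noncomputable def alNegOne : Pars Poly :=
  { Pars.gen with
    al := .const 0 1, be := .const 1 0, ga := .nil }

/-- The cubic coefficients are first seen by words of 11 letters. One unknown of degree 8 stays free
but drops out of the relations 6 mu = 0 and 2 nu = 0. -/
theorem alNegOne_check :
    check 6 (famRows alNegOne)
    []
    (symbols [[true, true, true, false, false, true, false, false, true]])
    (.rows [16903, 16907, 16924, 16940, 16948, 16952, 16972, 17427, 17457, 17484, 17489, 17505,
    17554, 17584, 17616, 17632, 17824, 17856, 17925, 17938, 17956, 17992, 18470, 18505, 18514,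
    18577, 18578, 18721, 18753, 18784, 18980, 19016, 19024, 19528, 19600, 20638, 20782, 20790,
    20794, 20796, 21070, 21082, 21084, 21100, 21108, 21112, 21142, 21322, 21394, 21646, 21654,
    21658, 21660, 21684, 21688, 21702, 21720, 21736, 21744, 21804, 21906, 22162, 22164, 22290,
    22308, 22828, 22836, 22840, 22854, 22888, 22896, 22918, 22922, 22924, 22960, 22992, 23008,
    23128, 23314, 23332, 23698, 23826, 23844, 23848, 24082, 24100, 24136, 22630, 22694, 22730,
    22698, 22732, 22826, 22834, 16910, 17458, 23081, 17553, 17700, 18722, 17712, 17937, 23587,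
    19490, 17604, 17445, 23589, 16915, 17170, 17481, 9361, 18978, 17732, 17681, 18756, 23075,
    17169, 17954, 22051, 21049, 16668, 21081, 16684, 22860, 16984, 21097, 22932, 17000, 22868,
    16692, 16696, 21105, 17008, 22936, 21857, 23233, 23313, 21897, 22089, 17188, 23186, 23697,
    23825, 22153, 22858, 16647, 21007, 16937, 22819, 17572, 17041, 21795, 17698, 23109, 22795,
    21639, 16922, 22053, 22585, 20709, 22617, 20837, 22633, 20901, 11666, 8996, 16585, 16996,
    21705, 17060, 21833, 22929, 23185, 21283, 17186, 16785, 8773, 21643, 16675, 22805, 22803,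
    16966, 21063, 16651, 21015, 16653, 21019, 11442, 8548, 22729, 8804, 16690, 16722, 8470, 8483,
    16661, 16659, 21645, 8774, 21035, 21031, 16665, 21043, 8331, 20651, 16538, 21605, 11405,
    11418, 8333, 10523, 11466, 8500, 11434, 11474, 8596, 8532, 8612] (.comb (.cons 0 1 16970
    (.cons 0 3 16969 .nil)) (.comb (.cons 1 0 16677 (.cons 0 1 16969 .nil)) (.rows [16459] (.comb
    (.cons 2 0 16681 (.cons 0 1 22825 .nil)) (.rows [16467] (.comb (.cons 1 0 16978 (.cons 3 0
    16681 (.cons 0 1 16677 (.cons 1 0 3079 .nil)))) (.rows [16533, 16681, 16978, 16714, 22857,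
    23113, 3599, 3079] (.comb (.cons 3 0 8339 (.cons 1 0 8486 .nil)) (.comb (.cons 2 0 8345
    (.cons 0 1 11417 .nil)) (.comb (.cons 1 0 11433 (.cons 0 2 8361 (.cons 0 1 11561 (.cons 0 2
    8498 (.cons 0 1 8786 (.cons 0 1 8521 (.cons 1 0 11045 (.cons 0 2 8393 (.cons 0 2 8485 (.cons
    0 4 8345 .nil)))))))))) (.rows [8393, 11045, 10443, 11465, 8850, 8777, 11417, 8786, 11593,
    11411, 11433, 10917] .nil))))))))))))
    [((.cons 0 1 8277 .nil), (.cons 6 0 (mon [7]) .nil)), ((.cons 1 0 8339 .nil), (.cons 2 0 (mon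
    [11]) .nil))] = true := by
  decide +kernel

/-- The parameters with `(al, be, ga) = (2, 1, 0)`. -/
noncomputable def alTwo : Pars Poly :=
  { Pars.gen with
    al := .const 2 0, be := .const 1 0, ga := .nil }

/-- Again the unknowns kept as variables cancel; what remains is 4 + mu = 0 and 4 nu = 0. -/
theorem alTwo_check :
    check 2 (famRows alTwo)
    []
    (symbols [[true, true, false, true, false, false, true, false, true], [true, true, false,
    false, true, false, true, false, true]])
    (.rows [16903, 16907, 16934, 16984, 17000, 17008, 17030, 17034, 17036, 17104, 17120, 17158,
    17162, 17164, 17172, 17176, 17248, 17312, 17344, 17427, 17554, 17584, 17925, 17938, 17956,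
    17992, 18505, 18577, 18578, 18721, 18724, 18753, 18962, 18980, 19016, 19024, 19474, 19492,
    19528, 19600, 21070, 21654, 21658, 21660, 21906, 22828, 22836, 22840, 23314, 23332, 23698,
    17048, 17192, 17064, 17200, 17449, 16921, 16937, 17042, 21891, 17170, 17682, 17481, 23625,
    18706, 9361, 17188, 17553, 23113, 16969, 17700, 17673, 17161, 16462, 22678, 16534, 16538,
    16540, 20793, 21081, 21681, 16684, 16692, 21097, 16696, 16786, 22089, 22930, 23186, 23697,
    16978, 16994, 17058, 17570, 17033, 9490, 16777, 8978, 22921, 23177, 22805, 9354, 8773, 21643,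
    9508, 21651, 9362, 22857, 16441, 20837, 16473, 16489, 11666, 22729, 8996, 21705, 16690,
    16722, 21833, 9378, 8546, 8802, 8866, 16675, 16531, 22675, 8850, 8594, 11849, 8370, 10953,
    16665, 8786, 8498, 8530, 11593, 11465, 10597, 8281, 16553, 10797] (.comb (.cons 0 1 16681
    (.cons 1 0 3079 .nil)) (.rows [3079, 16459, 16533, 16677, 16467, 16549, 11429, 11347, 8357,
    8489, 10835, 8361, 8341] .nil)))
    [((.cons 0 1 8345 .nil), (.cons 4 0 (mon []) (.cons 1 0 (mon [7]) .nil))), ((.cons 0 1 8267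
    .nil), (.cons 4 0 (mon [11]) .nil))] = true := by
  decide +kernel

/-- The parameters with `(al, be, ga) = (0, 1, 0)`. -/
noncomputable def alZero : Pars Poly :=
  { Pars.gen with
    al := .nil, be := .const 1 0, ga := .nil }

/-- At this point words of 11 letters are used only to find nu; mu is determined later, jointly with
ep. -/
theorem alZero_check :
    check 2 (famRows alZero)
    []
    (symbols [[true, true, false, true, false, true, false, false, true], [true, true, false,
    true, false, false, true, false, true], [true, true, false, false, true, true, false, false,
    true]])
    (.rows [16423, 16459, 16461, 16531, 16549, 16675, 16677, 16689, 16915, 16933, 16969, 16972,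
    16977, 16993, 17027, 17029, 17089, 17155, 17157, 17217, 17281, 17481, 17484, 17506, 17553,
    17569, 17584, 17616, 17632, 17676, 17684, 17824, 17856, 17956, 17992, 18470, 18505, 18514,
    18577, 18578, 18721, 18722, 18724, 18754, 18784, 18818, 18980, 19016, 19024, 19492, 19528,
    19600, 20775, 21067, 21070, 21654, 21658, 21660, 22828, 22836, 22840, 22858, 22930, 23698,
    16537, 16681, 21651, 22819, 17712, 17458, 23081, 17604, 23625, 17700, 9362, 17554, 17732,
    18756, 17682, 17730, 16462, 16534, 16540, 16684, 16692, 21097, 16696, 16984, 17000, 22977,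
    22089, 17188, 23186, 23697, 16678, 16966, 22805, 17170, 17572, 23113, 16970, 23177, 22633,
    8996, 16996, 21705, 17060, 23122, 21833, 11849, 16946, 9508, 8804, 16690, 22697, 8868] (.comb
    (.cons 0 1 22857 (.cons 1 0 3079 (.cons 1 0 22825 .nil))) (.rows [3079, 16682, 22825, 22693,
    9380, 11561, 11593, 11417, 11433, 8522, 11429, 8489] .nil)))
    [((.cons 1 0 8490 .nil), (.cons 2 0 (mon [11]) .nil))] = true := by
  decide +kernel

/-- The parameters with `(al, be, ga) = (1, 1, 0)`. -/
noncomputable def alOne : Pars Poly :=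
  { Pars.gen with
    al := .const 1 0, be := .const 1 0, ga := .nil }

theorem alOne_check :
    check 2 (famRows alOne)
    []
    (symbols [[true, true, false, true, false, false, true, false, true], [true, false, true,
    true, false, false, true, false, true], [true, false, true, false, true, false, false, true,
    true]])
    (.rows [16903, 16907, 16952, 17427, 17457, 17484, 17489, 17505, 17584, 17616, 17632, 17824,
    17856, 17925, 17956, 17992, 18470, 18505, 18577, 18578, 18721, 18724, 18753, 18784, 18962,
    18980, 19016, 19024, 19474, 19492, 19528, 19600, 10414, 21070, 21082, 21084, 21108, 21112,
    21142, 10586, 10588, 10598, 10646, 21394, 21646, 21654, 21658, 21684, 21688, 21736, 21744,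
    21804, 10932, 10936, 21906, 10956, 11052, 22162, 22290, 22308, 22567, 22681, 22918, 22960,
    23113, 23128, 23305, 23314, 23332, 23625, 23698, 23817, 23826, 23844, 23848, 24073, 24082,
    24100, 24136, 22629, 22693, 17712, 17604, 18506, 17445, 17446, 22603, 16915, 9289, 17481,
    22675, 18706, 9361, 22819, 17553, 17554, 22821, 17700, 21891, 18754, 17673, 17732, 17682,
    23077, 23171, 23173, 9746, 17938, 17169, 22051, 21094, 10842, 10830, 21049, 16668, 10902,
    21706, 11444, 11448, 11496, 11504, 11082, 11154, 16647, 21007, 22857, 16728, 22872, 21857,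
    23192, 21169, 17072, 21187, 22881, 23137, 21897, 16740, 21193, 22921, 23177, 17170, 23689,
    9764, 11657, 22089, 22930, 17188, 9800, 23186, 23201, 16801, 23713, 22945, 22153, 21321,
    16804, 9032, 12041, 11972, 12050, 12068, 16651, 21015, 16653, 21639, 21019, 8771, 11913,
    17482, 9490, 16933, 16934, 21063, 16675, 9508, 11922, 16969, 17572, 17041, 21139, 9538, 9410,
    10854, 11378, 16441, 11564, 8792, 23121, 16777, 17058, 21267, 16994, 8978, 11665, 11441,
    11569, 8996, 16585, 21705, 11843, 21833, 11489, 11873, 11937, 11145, 8420, 10697, 16473,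
    16489, 11399, 8401, 11601, 11473, 11541, 16523, 11845, 8773, 21645, 11846, 8774, 21043,
    21035, 21031, 16665, 16659, 8483, 16661, 11081, 21651, 9362, 11849, 16677, 21067, 9378,
    11857, 10595, 11561, 11027, 8866, 8802, 10953, 10469, 8327, 10511, 11403, 21605, 11405,
    20819, 20787, 10823, 10661, 8850, 8777, 11411, 10643, 11465, 10597, 10519, 8331, 10523, 8339,
    10535] (.comb (.cons 1 0 16681 (.cons 1 0 3079 .nil)) (.rows [3079, 16467, 16549, 20779,
    11429, 10645, 10853, 10917] (.comb (.cons 1 0 1807 (.cons 1 0 8235 (.cons 1 0 8275 (.cons 0 1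
    8357 .nil)))) (.rows [8267, 1807, 8275, 10901, 10413] .nil)))))
    [((.cons 0 1 8341 .nil), (.cons 1 0 (mon [11]) .nil))] = true := by
  decide +kernel

/-- The parameters with `(al, be, ga) = (0, 2, 0)`. -/
noncomputable def beTwo : Pars Poly :=
  { Pars.gen with
    al := .nil, be := .const 2 0, ga := .nil }

/-- One linear relation between mu and nu is obtained, 24 + 6 mu + 18 nu = 0. It is substituted
before shorter words are considered. -/
theorem beTwo_check :
    check 6 (famRows beTwo)
    []
    (symbols [[true, true, false, true, false, true, false, false, true]])
    (.rows [16423, 16459, 16461, 16531, 16549, 16675, 16677, 16689, 16977, 16993, 17027, 17029,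
    17089, 17155, 17157, 17217, 17281, 17481, 17553, 17569, 18470, 9237, 18505, 18514, 18532,
    18577, 18578, 18584, 18596, 18721, 18722, 18724, 18754, 18784, 9409, 18818, 18848, 18880,
    18980, 19016, 19024, 19492, 19528, 19600, 20559, 20631, 20713, 20775, 20811, 10414, 20841,
    21067, 21070, 21142, 10586, 10588, 10598, 10646, 21322, 21394, 21646, 21654, 21658, 21660,
    21684, 21804, 10932, 10936, 21906, 10956, 11052, 22162, 22164, 22290, 22308, 23571, 23728,
    23760, 23844, 23848, 24100, 24136, 16537, 16915, 16681, 16933, 16774, 22791, 22795, 9349,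
    9481, 22819, 23059, 8723, 23590, 9254, 17446, 9289, 8741, 17482, 23625, 9361, 23698, 23817,
    24073, 18756, 23826, 17682, 9490, 17730, 18768, 9538, 23173, 8969, 24082, 20787, 10319,
    16462, 20637, 8231, 21543, 10842, 10391, 21075, 20781, 21579, 16534, 8267, 16540, 22606,
    20793, 21094, 10830, 22812, 10902, 21081, 16684, 22678, 21670, 22828, 21097, 21674, 21706,
    22836, 16696, 11082, 11154, 11795, 9872, 18064, 22161, 17224, 23716, 23368, 12104, 12112,
    22177, 9888, 18080, 23720, 23376, 17232, 9298, 22803, 22797, 8841, 22805, 17956, 9764, 22089,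
    9800, 12068, 17992, 23332, 23177, 11913, 23305, 12041, 11399, 11403, 10553, 10854, 11420,
    16984, 16804, 16922, 8461, 17170, 11027, 23314, 22053, 8585, 8978, 11813, 12050, 16786,
    11153, 8648, 11720, 9104, 21905, 11976, 23240, 17808, 9616, 17732, 9540, 8610, 8732, 8748,
    8420, 17512, 10451, 20901, 22921, 11657, 22930, 23202, 11688, 11624, 10357, 10797, 11378,
    21701, 11461, 8900, 23140, 21705, 11876, 8880, 16996, 22834] (.comb (.cons 1 0 16678 (.cons 3
    0 16972 .nil)) (.rows [16538, 16690, 16934, 17484, 9292, 22681, 11814, 21581, 21093, 16938,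
    20821] (.comb (.cons 0 1 8473 (.cons 0 1 8467 (.cons 0 1 8345 .nil))) (.rows [8270, 8345,
    8467, 8742, 11539, 10547, 10791, 8469, 11405, 10413, 8756, 8298] (.comb (.cons 3 0 17700
    (.cons 1 0 17042 .nil)) (.rows [17736, 21833, 16722, 22865] (.comb (.cons 1 0 17572 (.cons 0
    1 22857 .nil)) (.rows [17704] (.comb (.cons 3 0 8996 (.cons 1 0 8594 .nil)) (.rows [8904,
    10953, 8370, 10841] (.comb (.cons 1 0 8804 (.cons 0 1 11465 .nil)) (.rows [8856] (.comb
    (.cons 1 0 10857 (.cons 0 3 8808 .nil)) (.rows [8402, 10857] (.comb (.cons 0 1 17554 (.cons 1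
    0 22821 .nil)) (.comb (.cons 0 1 17554 (.cons 1 0 3079 (.cons 1 0 22825 (.cons 0 1 17572
    .nil)))) (.rows [16682, 17556, 9364, 22825, 23186, 17554, 21653, 8485, 11666, 16978, 9508,
    8777, 10827, 8489, 11081, 9380, 11411, 10835, 11049, 8780, 11417, 11418, 8804, 8596] (.comb
    (.cons 0 1 8490 (.cons 0 3 11413 .nil)) (.rows [8362, 11433, 11604] (.comb (.cons 3 0 1807
    (.cons 1 0 8530 (.cons 3 0 1543 (.cons 1 0 8490 .nil)))) (.rows [1807, 8530, 11561]
    .nil))))))))))))))))))))))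
    [((.cons 0 1 8490 .nil), (.cons 24 0 (mon []) (.cons 6 0 (mon [7]) (.cons 18 0 (mon [11])
    .nil))))] = true := by
  decide +kernel

/-- The parameters with `(al, be, ga) = (-1, 1, 0)`
and `mu = 0`, `nu = 0`. -/
noncomputable def alNegOneMuNu : Pars Poly :=
  { Pars.gen with
    al := .const 0 1, be := .const 1 0, ga := .nil,
    mu := .nil, nu := .nil }

/-- Words of 10 letters are now included, because ep is a quadratic coefficient of the system. -/
theorem alNegOneMuNu_check :
    check 4 (famRows alNegOneMuNu)
    []
    (symbols [[true, true, true, false, false, true, false, false, true]])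
    (.rows [16903, 16907, 16924, 16940, 16948, 16952, 16971, 16972, 17427, 17447, 17457, 17483,
    17484, 17489, 17505, 17554, 17555, 17584, 17588, 17616, 17632, 8835, 17824, 17856, 17925,
    17938, 17956, 17992, 18068, 18212, 18470, 18505, 18514, 9266, 18577, 18578, 18721, 18726,
    18753, 18761, 18784, 9409, 9440, 9482, 9490, 18980, 19016, 19024, 19236, 9746, 19528, 19600,
    19748, 20638, 20782, 20790, 20794, 20796, 21070, 21082, 21084, 21100, 21108, 21112, 21142,
    21322, 21394, 21646, 21654, 21658, 21660, 21684, 21688, 21702, 21720, 21736, 21744, 21804,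
    21906, 22162, 22164, 22290, 22308, 22828, 22836, 22840, 22854, 22888, 22896, 22918, 22922,
    22924, 22960, 22992, 23008, 23128, 23314, 23332, 23698, 23826, 23844, 23848, 24082, 24100,
    24136, 9349, 22630, 22694, 22730, 22698, 22732, 22834, 22826, 16910, 8771, 22799, 17458,
    22807, 23081, 17553, 17700, 18722, 16974, 17712, 17716, 17812, 8455, 17937, 23587, 17604,
    17620, 17445, 23589, 16915, 17170, 9298, 17481, 9361, 22149, 17674, 23059, 18754, 17732,
    18788, 17764, 19044, 12037, 17169, 17954, 22051, 9800, 17225, 19108, 21049, 16668, 11414,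
    21081, 16684, 22860, 16984, 8792, 21097, 22932, 17000, 22868, 16692, 16696, 21105, 17008,
    22936, 21857, 23313, 21897, 11666, 22089, 17188, 23186, 23697, 8996, 22153, 8459, 22858,
    21007, 10887, 16655, 8730, 16663, 16937, 22819, 17572, 17041, 21795, 17698, 23109, 16679,
    21071, 8726, 8461, 22053, 18002, 17618, 22585, 20709, 22617, 20837, 22633, 20901, 16585,
    16996, 21705, 17060, 21833, 17186, 16785, 22929, 23185, 21283, 8593, 8994, 20527, 21019,
    16523, 22805, 16966, 21063, 16675, 8774, 22803, 22729, 16690, 16722, 21645, 21035, 16661,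
    16659, 21031, 21043, 16665, 21589, 21605, 21581] (.comb (.cons 2 0 16683 (.cons 0 1 22827
    .nil)) (.comb (.cons 2 0 16691 (.cons 0 1 22835 .nil)) (.comb (.cons 2 0 16697 (.cons 0 1
    22841 .nil)) (.rows [16499] (.comb (.cons 0 1 8485 (.cons 1 0 8777 .nil)) (.rows [16459]
    (.comb (.cons 1 0 16677 (.cons 0 1 16969 .nil)) (.comb (.cons 2 0 16681 (.cons 0 1 22825
    .nil)) (.rows [16467] (.comb (.cons 1 0 16978 (.cons 3 0 16681 (.cons 0 1 16677 (.cons 1 0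
    3079 .nil)))) (.rows [16533, 16681, 16978, 16714, 22857, 23113, 3599, 22821] (.comb (.cons 3
    0 8339 (.cons 1 0 8486 .nil)) (.comb (.cons 6 0 16535 (.cons 0 3 17049 (.cons 3 0 16985
    (.cons 0 1 17097 (.cons 1 0 17586 (.cons 2 0 17609 (.cons 0 2 17714 (.cons 1 0 17574 (.cons 3
    0 16979 (.cons 2 0 17610 .nil)))))))))) (.rows [16535] (.comb (.cons 6 0 16723 (.cons 0 4
    17097 (.cons 0 2 17586 (.cons 0 6 18762 (.cons 6 0 19026 (.cons 4 0 17737 (.cons 2 0 17578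
    (.cons 0 1 17746 (.cons 6 0 17705 (.cons 0 6 17573 .nil)))))))))) (.rows [16723] (.comb
    (.cons 3 0 17586 (.cons 6 0 23129 (.cons 6 0 16729 (.cons 0 3 18762 (.cons 0 3 17577 (.cons 2
    0 17610 (.cons 0 3 17705 (.cons 3 0 17573 (.cons 0 3 17714 (.cons 6 0 17574 .nil))))))))))
    (.rows [16729, 22873, 23129, 21107, 4396, 17586, 16985, 21907, 17810, 4452, 17609, 17737,
    17610, 17714, 18770, 19026, 17746, 22835, 17574, 17049, 17577, 4682, 17706, 22867, 17045,
    17065, 17061, 4297, 4498, 8777, 4390] .nil)))))))))))))))))))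
    [((.cons 0 1 8339 .nil), (.cons 1 0 (mon [13]) .nil))] = true := by
  decide +kernel

/-- The parameters with `(al, be, ga) = (2, 1, 0)`
and `mu = -4`, `nu = 0`. -/
noncomputable def alTwoMuNu : Pars Poly :=
  { Pars.gen with
    al := .const 2 0, be := .const 1 0, ga := .nil,
    mu := .const 0 4, nu := .nil }

theorem alTwoMuNu_check :
    check 6 (famRows alTwoMuNu)
    []
    (symbols [[true, true, false, true, false, false, true, false, true], [true, true, false,
    false, true, false, true, false, true]])
    (.rows [16903, 16907, 16934, 16984, 16986, 16988, 17000, 17004, 17008, 17012, 17030, 17034,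
    17036, 17104, 17120, 17158, 17162, 17164, 17172, 17176, 17248, 17312, 17344, 17427, 17554,
    8792, 17584, 17588, 8808, 17925, 17938, 17956, 17992, 18066, 18068, 18212, 18505, 18577,
    18578, 18721, 18724, 18753, 18761, 18962, 18980, 19016, 19024, 19236, 19474, 19492, 19528,
    19600, 19602, 19748, 21070, 21142, 21394, 21646, 21654, 21658, 21660, 21804, 21906, 22162,
    22308, 22828, 22830, 22836, 22838, 22840, 22842, 11564, 23128, 23130, 23314, 23332, 23442,
    23698, 23826, 23844, 23954, 24082, 24136, 24210, 17048, 17098, 17050, 17100, 17052, 17192,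
    17064, 17068, 17228, 17200, 17204, 17236, 17300, 17449, 16921, 16937, 17042, 8856, 21891,
    22889, 8872, 8900, 8904, 9289, 8978, 17170, 9298, 17682, 17481, 23625, 18706, 17188, 17553,
    23113, 16969, 17700, 8996, 17673, 9490, 9508, 17161, 23333, 24137, 17298, 17810, 18834,
    19090, 16462, 10830, 10902, 22678, 21670, 16534, 16538, 22682, 21674, 21706, 16540, 20793,
    21081, 16684, 22860, 21681, 21689, 16686, 21097, 22932, 22868, 16692, 21713, 21721, 16694,
    16696, 21737, 22986, 16698, 8364, 8536, 11618, 11620, 11666, 22089, 23186, 16786, 22930,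
    11922, 16978, 16745, 21925, 4900, 8741, 8802, 8546, 16994, 17058, 17570, 17033, 23077, 22921,
    22053, 16777, 23177, 22805, 9362, 21643, 21651, 22857, 8866, 9378, 8610, 4516, 17010, 22985,
    17586, 17074, 23241, 17202, 17714, 23753, 17234, 18770, 19026, 17746, 23881, 8270, 10585,
    11418, 16441, 20837, 16473, 16569, 16489, 20915, 16601, 16617, 6034, 8370, 10953, 11570,
    23122, 21833, 22729, 16722, 22834, 16690, 22866, 21705, 11081, 8402, 11602, 11858, 4708,
    4772, 4452, 4324, 21063, 16675, 21645, 8850, 11045, 8777, 8594, 4498, 16531, 20775, 22675,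
    4754, 8249, 5810, 10597, 8281, 21069, 10661, 8297, 21043, 16665, 21605, 8786, 11593, 11465,
    8498, 8530, 10797, 20819, 16553, 21157, 21035] (.comb (.cons 0 1 16681 (.cons 1 0 3079 .nil))
    (.rows [3079, 16459, 16533, 16677, 16467, 16549] (.comb (.cons 0 2 17049 (.cons 0 2 23141
    (.cons 1 0 16717 (.cons 1 0 16741 .nil)))) (.rows [4402] (.comb (.cons 1 0 17705 (.cons 0 1
    17573 (.cons 0 1 17577 .nil))) (.rows [4394, 17577] (.comb (.cons 0 1 17045 (.cons 0 1 16981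
    (.cons 2 0 16979 (.cons 0 2 17573 (.cons 2 0 17061 (.cons 0 4 16997 .nil)))))) (.rows [16539,
    16997, 4250, 17001, 16587, 4298, 20903, 17193, 17573, 21835, 17061, 21803, 21843, 17045,
    17065, 21675, 4266, 16981, 21813, 21909, 5785] (.comb (.cons 0 1 16729 (.cons 0 1 16723
    (.cons 2 0 23123 (.cons 0 1 16715 (.cons 2 0 16793 .nil))))) (.rows [16557, 16715, 4182,
    16729, 5465, 21861, 23125, 23123, 16697, 16809, 16793, 4185, 4153, 22117, 5477, 22181, 23205,
    5801, 23189, 4201, 5541] (.comb (.cons 1 0 4181 (.cons 2 0 8277 (.cons 0 8 8361 (.cons 0 2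
    5781 (.cons 0 2 5453 (.cons 4 0 8269 (.cons 0 8 8345 (.cons 4 0 8357 (.cons 0 2 4265 (.cons 0
    2 5797 (.cons 2 0 4197 (.cons 4 0 8293 (.cons 2 0 4393 .nil))))))))))))) (.rows [11429,
    10571, 11347, 8357, 8489, 10581, 10835, 8361, 10539, 8341, 4181, 10917, 5461, 10837] (.comb
    (.cons 0 1 5781 (.cons 1 0 4179 (.cons 0 1 4261 .nil))) (.rows [4245, 4261, 5419, 5781, 4249,
    5797] .nil)))))))))))))))
    [((.cons 0 1 4135 .nil), (.cons 0 6 (mon []) (.cons 6 0 (mon [13]) .nil)))] = true := by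
  decide +kernel

/-- The parameters with `(al, be, ga) = (0, 2, 0)`
and `mu = -4 - 3 nu`. -/
noncomputable def beTwoMu : Pars Poly :=
  { Pars.gen with
    al := .nil, be := .const 2 0, ga := .nil,
    mu := .cons 0 4 (mon []) (.cons 0 3 (mon [11]) .nil) }

/-- Two combinations of the same shorter equations isolate ep and 1 + nu; the denominators that
occur on the way divide 18. -/
theorem beTwoMu_check :
    check 18 (famRows beTwoMu)
    []
    (symbols [[true, true, false, true, false, true, false, false, true]])
    (.rows [16423, 16459, 16461, 16531, 16535, 16549, 16675, 16677, 16679, 16685, 16689, 16715,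
    16805, 16971, 16973, 16977, 16993, 16995, 17009, 17027, 17029, 17031, 17035, 17037, 17043,
    17089, 17093, 17155, 17157, 17163, 17189, 17217, 17219, 17221, 17225, 17281, 17313, 17481,
    17553, 17569, 17571, 17585, 18470, 9237, 18505, 18510, 18514, 18532, 18577, 18578, 18579,
    18582, 18584, 18596, 18597, 9305, 18660, 18721, 18722, 18723, 18724, 18726, 18754, 18784,
    18786, 18792, 9409, 18818, 18834, 18848, 18850, 18880, 18882, 18896, 18980, 9493, 19016,
    19024, 19025, 19032, 19236, 19492, 19528, 19529, 19538, 19600, 19601, 19748, 19752, 20004,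
    20040, 20559, 20601, 20631, 20635, 20665, 20697, 20713, 20775, 20796, 20811, 10414, 20841,
    21063, 21067, 21070, 21071, 21083, 21084, 21091, 21100, 21108, 21112, 21142, 21143, 10586,
    10588, 10598, 21225, 21273, 10646, 21322, 21394, 21646, 21654, 21658, 21660, 21662, 21684,
    21688, 21720, 21736, 21744, 21804, 21806, 10932, 10936, 21906, 10956, 11052, 22162, 22164,
    22166, 22290, 22308, 22418, 23571, 23591, 23628, 23699, 23715, 23728, 23760, 23776, 23844,
    23848, 23852, 24100, 24136, 24212, 24356, 16537, 16915, 16681, 16933, 16697, 16935, 16691,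
    21655, 16985, 16979, 16997, 21659, 17001, 16981, 16710, 16774, 17177, 17201, 22791, 22795,
    22799, 22807, 22811, 22823, 9349, 9481, 22819, 8851, 23059, 8723, 23590, 9254, 17446, 4643,
    9289, 8741, 23626, 17482, 23625, 17486, 23079, 9294, 8743, 9361, 23698, 23817, 23945, 24073,
    24137, 24201, 24329, 18756, 23826, 17682, 23077, 9490, 17730, 18768, 9538, 23173, 9545,
    18776, 9570, 19096, 23237, 17762, 18788, 19044, 8969, 24082, 19620, 24210, 18852, 19108,
    24338, 20787, 10319, 16462, 20637, 8231, 21543, 10842, 10391, 21075, 20781, 21579, 16534,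
    8267, 16540, 22606, 20793, 21094, 21095, 21583, 10830, 22812, 10902, 21081, 16684, 22678,
    21670, 22828, 21097, 21674, 21706, 22836, 21708, 16696, 21105, 22840, 21734, 5434, 22686,
    21710, 22844, 5422, 11082, 11154, 11795, 9872, 18064, 22161, 17224, 23716, 23368, 12104,
    12112, 22177, 9888, 18080, 23720, 23376, 17232, 22193, 23724, 18096, 17240, 23884, 9298,
    22830, 21085, 16686, 8343, 21683, 17049, 21707, 16694, 22838, 17193, 21715, 17045, 17065,
    17061, 17564, 8487, 4645, 4753, 22803, 22797, 8841, 22805, 17956, 23689, 9764, 22813, 22089,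
    23332, 12068, 17992, 9800, 17298, 10020, 17314, 23177, 11913, 23305, 23433, 23729, 12041,
    22345, 23762, 18836, 18772, 19028, 19092, 12169, 11399, 11403, 11407, 10553, 10854, 11420,
    16984, 16804, 16988, 22835, 4681, 22827, 21661, 10831, 16922, 8461, 17170, 11027, 23314,
    22053, 8585, 8978, 4489, 11813, 12050, 4882, 11549, 23098, 17188, 21905, 11976, 23240, 9616,
    17808, 11720, 11153, 9104, 8648, 23442, 12178, 17732, 9540, 11077, 5957, 21957, 17316, 23753,
    23849, 9156, 11534, 5767, 4235, 11542, 11550, 8420, 17512, 10451, 20901, 22898, 23132, 8499,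
    16998, 8491, 16982, 22842, 11422, 22921, 11657, 6025, 22930, 11209, 23202, 11089, 11624,
    6049, 18020, 9828, 18084, 9892, 8308, 5655, 8282, 11378, 11367, 22733, 10839, 11505, 21701,
    11461, 8900, 4322, 23140, 11876, 21705, 17202, 17100, 22937, 17612, 11161, 23252, 12114,
    22117, 8880, 5489, 16996, 17234, 23142, 22873, 9444, 8505, 22181, 22834, 8604, 9420] (.comb
    (.cons 1 0 8857 (.cons 0 1 8793 (.cons 0 1 8787 .nil))) (.rows [8787, 8793, 11415, 8494,
    11449, 11450] (.comb (.cons 1 0 17714 (.cons 0 1 17586 (.cons 0 1 17574 .nil))) (.rows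
    [17046, 17574, 17586, 22829, 23129, 23123, 17706, 16986, 8493, 9572, 17578, 23209, 22869,
    17738, 17746, 17588, 17066, 11355, 9548, 9388, 9516, 17050, 8501, 11882, 22101, 17098, 9636,
    22165, 8553, 8525, 11881, 9418, 9426, 10955, 9396, 9620, 9524, 11475, 9124, 9034, 11685,
    11865, 11565, 8502, 11497, 8810, 9002, 11689, 9042, 11477, 11669, 11573, 11597, 11574] (.comb
    (.cons 1 0 16678 (.cons 3 0 16972 .nil)) (.rows [16538, 16690, 16934, 17484, 9292, 22681,
    23078, 11814, 21581, 21093, 16938, 20821] (.comb (.cons 0 1 8473 (.cons 0 1 8467 (.cons 0 1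
    8345 .nil))) (.rows [8270, 8345, 8467, 4371, 8742, 11539, 10791, 10547, 8469, 11405, 5703,
    11307, 11546, 4380, 2119, 10453, 5405] (.comb (.cons 3 0 17700 (.cons 1 0 17042 .nil)) (.rows
    [17736, 21833, 21157, 22865] (.comb (.cons 1 0 17572 (.cons 0 1 22857 .nil)) (.rows [17704]
    (.comb (.cons 3 0 8996 (.cons 1 0 8594 .nil)) (.rows [8904, 10953, 8548, 11564] (.comb (.cons
    1 0 8804 (.cons 0 1 11465 .nil)) (.rows [8856] (.comb (.cons 1 0 10857 (.cons 0 3 8808 .nil))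
    (.rows [8402, 10857] (.comb (.cons 1 0 5433 (.cons 0 3 4408 .nil)) (.rows [4210, 5746] (.comb
    (.cons 0 1 17554 (.cons 1 0 22821 .nil)) (.comb (.cons 1 0 22825 (.cons 1 0 3079 (.cons 0 1
    17554 (.cons 0 1 17572 .nil)))) (.rows [16682, 17556, 9364, 22825, 23186, 17554, 21653, 8485,
    11666, 16978, 9508, 8777, 3599, 11339, 8489, 5925, 11081, 9380, 11411, 11430, 5577, 11668,
    11558, 4243, 11417, 11418, 4252, 8804, 4249, 8596, 4708, 5683, 5937] (.comb (.cons 0 1 8490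
    (.cons 0 3 11413 .nil)) (.rows [8362, 11433, 8532] (.comb (.cons 3 0 1807 (.cons 1 0 8530
    (.cons 3 0 1543 (.cons 1 0 8490 .nil)))) (.comb (.cons 0 1 4246 (.cons 0 3 5707 .nil)) (.rows
    [5721] (.comb (.cons 0 1 4250 (.cons 0 3 5709 .nil)) (.rows [5737] (.comb (.cons 0 1 2126
    (.cons 0 3 2855 .nil)) (.rows [2106, 2873, 2745, 1807, 8530, 11561, 4772, 4245, 4692, 4756,
    4265, 4261, 5929, 5715, 4426, 2468, 2123, 4436, 4394, 5801, 5717, 4434, 2164, 2839, 5797,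
    5781, 2137, 2356, 3018, 2727, 2867, 2918, 2969] .nil)))))))))))))))))))))))))))))))))
    [((.cons 1 0 4246 (.cons 1 0 4274 (.cons 21 0 2150 (.cons 42 0 2249 (.cons 9 0 2276
    .nil))))), (.cons 54 0 (mon [13]) .nil)), ((.cons 1 0 4246 (.cons 21 0 2150 (.cons 42 0 2249
    (.cons 9 0 2276 .nil)))), (.cons 72 0 (mon []) (.cons 72 0 (mon [11]) .nil)))] = true := by
  decide +kernel

/-- The parameters with `(al, be, ga) = (0, 0, 0)`. -/
noncomputable def center : Pars Poly :=
  { Pars.gen with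
    al := .nil, be := .nil, ga := .nil }

/-- At the origin ph can be found without knowing mu, nu and ep. -/
theorem center_check :
    check 1 (famRows center)
    []
    (symbols [])
    (.rows [16403, 16421, 16423, 16457, 16459, 16461, 16529, 16531, 16549, 16673, 16675, 16677,
    16689, 16961, 16963, 16965, 16969, 17025, 17027, 17029, 17089, 17153, 17155, 17157, 17217,
    17281, 17481, 17553, 17569, 18450, 18468, 18470, 18504, 18505, 18514, 18576, 18577, 18578,
    18584, 18720, 18721, 18722, 18724, 18752, 18754, 18784, 18816, 18818, 18848, 18880, 18980,
    19016, 19024, 19492, 19528, 19600, 20519, 20537, 20555, 20569, 20585, 20627, 20631, 20636,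
    10326, 20665, 20771, 20774, 20775, 20780, 20788, 20792, 20810, 10412, 20882, 21059, 21062,
    21066, 21067, 21068, 21070, 21080, 21096, 21138, 21140, 10584, 21266, 21284, 21638, 21642,
    21644, 21646, 21650, 21652, 21654, 21656, 21658, 21660, 21680, 21684, 21688, 21712, 21728,
    21778, 21796, 21800, 21804, 10928, 21906, 22034, 22052, 22088, 22162, 22164, 23588, 23624,
    23696, 23712, 23728, 23744, 23760, 23844, 23848, 24136, 16537, 16681, 21635, 21651, 22787,
    22795, 9233, 21779, 17033, 22819, 17057, 23561, 23570, 17426, 9234, 8713, 18508, 23059,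
    23590, 17446, 18580, 17482, 23625, 23698, 17554, 18756, 23826, 17682, 23077, 17730, 18768,
    23173, 10518, 10394, 10279, 16422, 8211, 20557, 16460, 20633, 22566, 20637, 16462, 10796,
    10548, 10534, 20777, 21075, 20781, 16534, 20785, 16536, 22604, 22606, 16540, 5198, 10840,
    10856, 10570, 10642, 10822, 22804, 22808, 10828, 5404, 10826, 22820, 21065, 21073, 22824,
    16680, 21081, 16684, 21670, 22832, 21089, 21674, 21706, 22836, 16696, 5432, 10898, 10900,
    11026, 11044, 17160, 23304, 9744, 22033, 12040, 23368, 17224, 18064, 17232, 22177, 18080,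
    23376, 22822, 21069, 16678, 22675, 4617, 16966, 23049, 22789, 11785, 11395, 22797, 22805,
    17956, 23689, 22089, 17992, 23332, 23113, 22821, 23177, 23305, 5398, 5402, 5420, 5428, 10393,
    11404, 11416, 10545, 8344, 16968, 11412, 10537, 16676, 5414, 5450, 5522, 16972, 16538, 22682,
    16692, 23078, 17484, 9476, 21765, 8453, 16906, 4868, 11013, 8454, 4227, 16938, 17170, 23314,
    22053, 16786, 17808, 23240, 17096, 17700, 23114, 17732, 23112, 21649, 17552, 9360, 11848,
    8265, 20773, 22674, 10387, 16530, 21657, 22809, 11680, 21825, 17568, 10763, 22549, 22569,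
    5569, 11616, 8800, 11290, 8242, 4124, 22921, 22930, 23185, 8337, 22818, 21061, 10531, 16674,
    22817, 21793, 11041, 11812, 22673, 23076, 17480, 9288, 21577, 11302, 22602, 22601, 5273,
    16690, 21701, 5732, 17060, 16964, 8481, 16962, 10787, 23074, 17476, 21573, 4642, 11810, 4369,
    8738, 9284, 16722, 5699, 11397, 11529, 5897, 5766, 8458, 4229, 8836, 4740, 4290, 4146, 5658,
    8234, 11305, 5165, 10913, 8784, 5840, 5808, 5729, 5682, 11540, 10833, 5730] (.comb (.cons 0 1
    17572 (.cons 1 0 16978 (.cons 1 0 3079 .nil))) (.rows [3079, 16714, 17572] (.comb (.cons 1 0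
    10825 (.cons 1 0 8484 (.cons 3 0 8338 .nil))) (.rows [8266] (.comb (.cons 1 0 11337 (.cons 1
    0 8338 .nil)) (.rows [8740, 4644, 11538, 8466, 10789, 5513, 11401, 8772, 4676, 11553, 1539,
    4241, 5922, 11556, 10533, 5702, 4386, 4233, 5267, 5701, 5769, 4372, 5445, 5653, 4264] (.comb
    (.cons 0 1 4244 (.cons 1 0 4170 .nil)) (.rows [4392, 5673] (.comb (.cons 1 0 903 (.cons 1 0
    4260 (.cons 1 0 771 (.cons 1 0 4170 .nil)))) (.comb (.cons 1 0 4242 (.cons 1 0 771 .nil))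
    (.rows [771, 4170, 5449] .nil))))))))))))
    [((.cons 0 1 4178 .nil), (.cons 1 0 (mon [17]) .nil))] = true := by
  decide +kernel

/-- The parameters with `(al, be, ga) = (1, 1, 0)`
and `nu = 0`. -/
noncomputable def alOneNu : Pars Poly :=
  { Pars.gen with
    al := .const 1 0, be := .const 1 0, ga := .nil,
    nu := .nil }

/-- Here ph is determined linearly, by 3 κ₁ + 3 ph = 0, so no square root of κ₃ is needed for these
systems. -/
theorem alOneNu_check_ph :
    check 1 (famRows alOneNu)
    []
    (symbols [])
    (.rows [16903, 16907, 16936, 16952, 17427, 17444, 17457, 17480, 17484, 17489, 17505, 17552,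
    17568, 17584, 17616, 17632, 17824, 17856, 17925, 17956, 17992, 18468, 18470, 18504, 18505,
    18576, 18577, 18578, 18720, 18721, 18724, 18753, 18784, 18962, 18980, 19016, 19024, 19474,
    19492, 19528, 19600, 21066, 21138, 21642, 21646, 21650, 21778, 21796, 21804, 21906, 22162,
    22567, 22601, 22674, 22681, 22820, 23049, 23058, 23076, 23112, 23113, 23128, 23305, 23332,
    23625, 23698, 23817, 23844, 22629, 22693, 17712, 17604, 17426, 22565, 9252, 16913, 18506,
    17445, 17446, 22603, 16915, 4648, 17481, 18706, 22675, 9360, 17553, 17700, 22821, 22819,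
    17554, 21891, 18754, 17673, 17732, 17682, 23077, 17938, 17169, 21033, 16660, 16668, 21049,
    10826, 10898, 16647, 16914, 22793, 22665, 22802, 16932, 8740, 16968, 8776, 16676, 21065,
    21123, 22849, 11529, 21769, 11538, 16708, 21129, 11556, 22857, 16728, 17072, 21187, 16740,
    21193, 22921, 23177, 17170, 22089, 22930, 17188, 23186, 16801, 16804, 21321, 8836, 8722,
    16645, 21003, 21015, 16651, 16653, 4644, 16933, 17482, 16934, 16713, 17041, 17572, 16675,
    21063, 16970, 4680, 16441, 21637, 11410, 16673, 21059, 21649, 20773, 11337, 16530, 21577,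
    11425, 8516, 8356, 10569, 23121, 16777, 17058, 16994, 16786, 21705, 21833, 16425, 20659,
    16489, 4420, 16523, 16665, 16659, 16661, 21043, 21031, 21035, 16677, 21651, 11397, 8484,
    4388, 8481, 16657, 16649, 21027, 21011, 21061, 10897, 16674, 11409, 5769, 8466, 4370, 5778,
    16537, 16553, 10825, 10507, 8337, 10531, 5713, 10821, 4258, 10533, 5705, 8338, 10323, 8329,
    4241, 10515, 5701, 5259] (.comb (.cons 1 0 16681 (.cons 1 0 3079 .nil)) (.rows [3079, 16467,
    16549, 4178, 20779, 4242, 5203, 4169, 5413] .nil)))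
    [((.cons 0 1 4170 .nil), (.cons 3 0 (mon [19]) (.cons 3 0 (mon [17]) .nil)))] = true := by
  decide +kernel

/-- The parameters with `(al, be, ga) = (-1, 1, 0)`
and `mu = 0`, `nu = 0`, `ep = 0`. -/
noncomputable def alNegOneMuNuEp : Pars Poly :=
  { Pars.gen with
    al := .const 0 1, be := .const 1 0, ga := .nil,
    mu := .nil, nu := .nil, ep := .nil }

/-- Words of 8 letters involve the constant terms of the system. The relation that results is
quadratic in ph and expresses κ₃ through ph and κ₁. -/
theorem alNegOneMuNuEp_check :
    check 12 (famRows alNegOneMuNuEp)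
    []
    (symbols [])
    (.rows [16899, 16903, 16907, 16916, 16920, 16936, 16940, 16944, 16948, 16952, 16972, 17409,
    8705, 17412, 8709, 17426, 17427, 17444, 17457, 17480, 17484, 17489, 17505, 17552, 17554,
    17568, 17584, 17616, 17632, 17824, 17856, 17925, 17938, 17956, 17992, 9234, 18470, 18504,
    18505, 18514, 18576, 18577, 18578, 18720, 18721, 18752, 18753, 18784, 9474, 18980, 19016,
    19024, 19528, 19600, 20554, 20626, 20628, 20632, 20772, 20774, 20776, 20780, 20792, 20810,
    20882, 21062, 21064, 21066, 21068, 21080, 21138, 21140, 10584, 21266, 21284, 21638, 21642,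
    21644, 21646, 21648, 21650, 21652, 21654, 21656, 21658, 21660, 21680, 21684, 21688, 21720,
    21778, 21796, 21800, 21804, 21906, 22034, 22052, 22088, 22162, 22816, 22820, 22824, 22828,
    22832, 22836, 22840, 22918, 22922, 23058, 23076, 23112, 23120, 23128, 23314, 23332, 23570,
    23588, 23624, 23696, 23698, 23826, 23844, 22694, 22698, 22730, 22826, 22834, 8451, 17425,
    16910, 16914, 17458, 23081, 17553, 17700, 18722, 17712, 17937, 19490, 17604, 9252, 17442,
    16913, 4617, 17445, 23589, 16915, 4648, 17170, 17481, 9360, 18978, 17732, 17681, 18756,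
    23075, 17169, 17954, 10314, 22546, 21522, 20754, 21010, 10392, 21028, 22564, 20553, 21540,
    16420, 10388, 10796, 10534, 10536, 16456, 22600, 20625, 21576, 16460, 20633, 11352, 10570,
    10642, 10822, 21033, 16660, 16664, 21041, 10828, 11404, 21049, 16668, 20769, 22672, 16528,
    10826, 22674, 11416, 5432, 10898, 10900, 11026, 11044, 16960, 16672, 4672, 8768, 21057,
    22818, 16968, 8776, 16676, 11412, 21065, 21073, 16976, 8784, 16680, 21081, 22860, 16984,
    16684, 16688, 16992, 16692, 21097, 17000, 22932, 22868, 16696, 17008, 21769, 23057, 4744,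
    11556, 11560, 21825, 4768, 21897, 5898, 11812, 11848, 22089, 17188, 23186, 23697, 22153,
    22858, 16647, 4626, 16937, 22819, 17572, 17041, 21795, 17698, 23109, 8721, 16906, 22795,
    16922, 22053, 4680, 10386, 5272, 10532, 20517, 21513, 5420, 16401, 22545, 16418, 10824,
    20581, 5414, 22569, 20645, 8268, 10393, 22585, 11408, 4644, 11538, 16932, 11338, 8740, 8344,
    5450, 5522, 11410, 21649, 22817, 8340, 10537, 20773, 22601, 21577, 8488, 22617, 20837, 4400,
    8496, 20901, 22633, 10913, 5906, 5924, 16585, 16996, 21705, 17060, 21833, 23185, 21283,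
    17186, 16785, 16675, 22805, 22803, 16966, 21063, 5780, 4392, 8453, 21003, 21015, 16651,
    16653, 21019, 10770, 11282, 5194, 10514, 5268, 10788, 10313, 11300, 8228, 1368, 11336, 10385,
    8264, 8242, 10341, 8480, 10529, 8336, 4384, 2336, 8484, 22673, 21061, 16529, 10897, 16674,
    20771, 11553, 16673, 21059, 4674, 8770, 22793, 11305, 10405, 16458, 20629, 21541, 5513, 5732,
    4296, 22729, 4196, 5682, 16690, 16722, 16661, 16659, 21645, 21031, 21035, 5266, 5412, 10277,
    10761, 5704, 8209, 11281, 8226, 10825, 11409, 4369, 8465, 4370, 8234, 16665, 21043, 20651,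
    16538, 21605, 5401, 2642, 5650, 5394, 5668, 2708, 5193, 4132, 5265, 4240, 2192, 4168, 10533,
    8338, 8482, 8337, 10531, 5765, 4146, 5221, 2706, 2852, 5157, 5385, 5697, 2113, 4130, 8229,
    10387, 10789, 4121, 2834, 2120, 2084, 2633, 2849, 2705, 2597, 2825, 2081] (.comb (.cons 0 1
    4234 (.cons 0 3 4233 .nil)) (.comb (.cons 1 0 4165 (.cons 0 1 4233 .nil)) (.rows [4107]
    (.comb (.cons 0 1 16970 (.cons 0 3 16969 .nil)) (.comb (.cons 1 0 16677 (.cons 0 1 16969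
    .nil)) (.rows [16459] (.comb (.cons 2 0 16681 (.cons 0 1 22825 .nil)) (.rows [16467] (.comb
    (.cons 1 0 16978 (.cons 3 0 16681 (.cons 0 1 16677 (.cons 1 0 3079 .nil)))) (.rows [16533,
    16681, 5706, 1354, 16978, 4244, 5714, 16714, 22857, 1428, 5283, 5417, 4260, 23113, 1361,
    5769, 5203, 5285, 4241, 22821] (.comb (.cons 3 0 5705 (.cons 4 0 4242 .nil)) (.rows [771,
    4242, 1426, 5197, 4170, 1060, 1058, 1042, 1041, 1417, 1317] .nil)))))))))))))
    [((.cons 1 0 1029 .nil), (.cons 0 24 (mon [29]) (.cons 0 6 (mon [19, 19]) (.cons 6 0 (mon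
    [17, 17]) .nil))))] = true := by
  decide +kernel

/-- The parameters with `(al, be, ga) = (2, 1, 0)`
and `mu = -4`, `nu = 0`, `ep = 1`. -/
noncomputable def alTwoMuNuEp : Pars Poly :=
  { Pars.gen with
    al := .const 2 0, be := .const 1 0, ga := .nil,
    mu := .const 0 4, nu := .nil, ep := .const 1 0 }

/-- As at al = -1, the shortest equations used bring in κ₃ and give κ₃ = (ph + κ₁)(ph + 2 κ₁). -/
theorem alTwoMuNuEp_check :
    check 1 (famRows alTwoMuNuEp)
    []
    (symbols [])
    (.rows [16408, 16432, 16472, 16480, 16560, 16592, 16704, 16736, 16774, 16778, 16780, 16898,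
    16899, 16903, 16907, 16914, 16932, 16934, 16968, 16976, 16984, 16992, 17000, 17008, 17024,
    17030, 17034, 17036, 17088, 17104, 17120, 17158, 17162, 17164, 17172, 17176, 17216, 17248,
    17312, 17344, 17426, 17427, 17444, 17480, 17552, 17554, 17568, 17584, 8800, 8832, 17925,
    17938, 17956, 17992, 18450, 18468, 18504, 18505, 18576, 18577, 18578, 18720, 18721, 18724,
    18753, 18962, 18980, 19016, 19024, 19474, 19492, 19528, 19600, 20626, 20772, 20774, 20882,
    21062, 21064, 21066, 21068, 21070, 21138, 21266, 21638, 21642, 21644, 21648, 21650, 21652,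
    21654, 21656, 21658, 21660, 21778, 21796, 21800, 22034, 22052, 22088, 22162, 11288, 11312,
    11360, 11368, 22786, 22802, 11404, 22820, 22824, 22828, 22832, 22836, 22840, 11456, 11472,
    23058, 23076, 23112, 23120, 23570, 23588, 23624, 23698, 23844, 24100, 11522, 8512, 9233,
    17048, 17192, 17064, 17200, 17449, 16921, 16937, 22793, 8722, 8740, 8776, 8784, 17042, 21763,
    4416, 21891, 4618, 9252, 4648, 17170, 17682, 17481, 23625, 18706, 9360, 17188, 17553, 23113,
    16969, 17700, 17673, 17161, 22546, 16402, 21522, 20754, 21010, 21028, 22564, 20553, 21540,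
    16420, 16422, 10534, 16456, 22600, 20625, 21576, 16458, 22602, 16460, 20633, 16462, 10822,
    10828, 20769, 22672, 16528, 10826, 22674, 16530, 22676, 20777, 16532, 16534, 21670, 22680,
    16536, 16538, 21706, 22682, 20793, 16540, 10898, 11026, 11044, 5272, 5424, 16672, 21633,
    21057, 21649, 16676, 21065, 21073, 21665, 16680, 21081, 16684, 5728, 16688, 16692, 21097,
    22932, 16696, 4304, 11538, 11556, 11560, 5898, 11812, 16786, 22089, 22930, 23186, 4617,
    16673, 21059, 21637, 8514, 8528, 16978, 4482, 2306, 4626, 4644, 16994, 17058, 17570, 17033,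
    16777, 22805, 4680, 21643, 21651, 22857, 11394, 4354, 8450, 5762, 10386, 10532, 20517, 16393,
    8230, 10824, 11340, 8268, 10393, 11410, 11338, 8466, 4370, 16658, 8266, 11412, 16425, 5414,
    16441, 5522, 21061, 21641, 22673, 16529, 8484, 20771, 16457, 20773, 22601, 20627, 16473,
    16489, 10897, 8356, 10569, 8360, 2946, 5906, 22729, 22834, 21705, 16690, 16722, 22866, 23122,
    21833, 4418, 1154, 4290, 4388, 16675, 21645, 16531, 8336, 10770, 11282, 10514, 8210, 10788,
    10313, 11300, 8228, 11336, 2760, 10529, 10817, 10385, 8264, 4258, 8338, 5682, 10825, 11409,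
    8233, 4194, 1476, 21069, 5778, 5706, 1104, 16665, 21605, 4134, 2192, 5698, 5266, 5412, 10277,
    8201, 4242, 8265, 10387, 10533, 11337, 10531, 8337, 10821, 5401, 1048, 16553, 21157, 5650,
    5394, 4114, 5668, 5265, 5193, 5409, 4132, 4121, 2120, 1096, 16661, 2850, 2706, 5189, 4129,
    2084, 2705, 2066, 2834, 2633, 1060, 2629] (.comb (.cons 0 1 16681 (.cons 1 0 3079 .nil))
    (.rows [3079, 16459, 16533, 16677, 4170, 21587, 22693, 5417, 1426, 5705, 5285, 4137, 4169,
    5413, 5267, 1042, 1353, 193, 1317] .nil)))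
    [((.cons 0 1 1029 .nil), (.cons 0 1 (mon [29]) (.cons 2 0 (mon [19, 19]) (.cons 3 0 (mon [17,
    19]) (.cons 1 0 (mon [17, 17]) .nil)))))] = true := by
  decide +kernel

/-- The parameters with `(al, be, ga) = (0, 1, 0)`
and `nu = 0`. -/
noncomputable def alZeroNu : Pars Poly :=
  { Pars.gen with
    al := .nil, be := .const 1 0, ga := .nil,
    nu := .nil }

/-- The relation κ₃ = ph² + κ₁ ph does not contain mu and ep and holds on all branches at this
point. -/
theorem alZeroNu_check_ph :
    check 1 (famRows alZeroNu)
    []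
    (symbols [])
    (.rows [16396, 16408, 16412, 16423, 16428, 16440, 16459, 16461, 16464, 16472, 16476, 16492,
    16531, 16549, 16560, 16564, 16568, 16600, 16675, 16677, 16689, 16915, 16916, 16933, 16936,
    16940, 16948, 16969, 16977, 16993, 17027, 17029, 17089, 17155, 17157, 17217, 17281, 17444,
    17480, 17481, 17484, 17506, 17552, 17553, 17569, 17584, 17616, 17632, 17676, 17684, 17824,
    17856, 17956, 17992, 18470, 18505, 18514, 18577, 18578, 18721, 18722, 18724, 18754, 18784,
    18818, 18980, 19016, 19024, 19492, 19528, 19600, 20626, 10326, 20772, 20774, 20775, 20810,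
    10412, 21062, 21064, 21066, 21067, 21068, 21070, 21138, 21140, 21142, 21266, 21284, 21638,
    21642, 21644, 21646, 21648, 21650, 21652, 21654, 21658, 21660, 21778, 21796, 21804, 22820,
    22824, 22828, 22836, 22840, 22930, 23058, 23076, 23112, 23698, 11270, 10764, 11286, 10796,
    16537, 16681, 22694, 22698, 22730, 21651, 22819, 17712, 17458, 23081, 17604, 23625, 17700,
    17554, 17732, 18756, 17682, 17730, 21522, 20754, 21010, 16420, 16456, 10404, 21028, 21540,
    16460, 16462, 10534, 10536, 16528, 21576, 20777, 16532, 20781, 16534, 16540, 5198, 10570,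
    10642, 10822, 10828, 5404, 16672, 10826, 22674, 16676, 21065, 16680, 21081, 16684, 16692,
    21097, 16696, 10898, 10900, 22818, 16968, 8776, 11412, 16976, 16984, 17000, 22977, 21769,
    11556, 22089, 17188, 23186, 5158, 5196, 5398, 5420, 16678, 16966, 22805, 17170, 17572, 10386,
    10532, 8268, 10824, 5414, 11538, 16932, 11338, 8740, 8340, 10537, 16530, 21577, 22633, 5450,
    11410, 21649, 8488, 16996, 21705, 17060, 23122, 21833, 1302, 1324, 16946, 10770, 10514, 8228,
    10788, 8264, 8336, 22601, 10889, 16658, 8484, 4388, 22673, 4172, 16690, 5778, 22697, 5266,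
    5412, 10825, 2642, 5394, 4132, 2708, 4168, 8338, 2706, 11337, 2084] (.comb (.cons 0 1 22857
    (.cons 1 0 3079 (.cons 1 0 22825 .nil))) (.rows [3079, 16682, 22825, 22693, 4260, 1354, 5449,
    5673] .nil)))
    [((.cons 1 0 1044 .nil), (.cons 0 2 (mon [29]) (.cons 2 0 (mon [17, 19]) (.cons 2 0 (mon [17,
    17]) .nil))))] = true := by
  decide +kernel

/-- The relations couple mu and ep with one surviving unknown, coded by 41; three of them suffice to
find the branches. -/
theorem alZeroNu_check_mu :
    check 12 (famRows alZeroNu)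
    []
    (symbols [[true, true, false, true, false, true, false, false, true], [true, true, false,
    true, false, false, true, false, true], [true, true, false, false, true, true, false, false,
    true]])
    (.rows [16423, 16459, 16461, 16500, 16531, 16535, 16539, 16549, 16564, 16675, 16677, 16679,
    16685, 16689, 16715, 16748, 16756, 16780, 16805, 16820, 16915, 16924, 16933, 16935, 16940,
    16948, 16952, 16956, 16969, 16972, 16977, 16987, 16989, 16993, 16995, 17005, 17009, 17027,
    17029, 17031, 17035, 17037, 17039, 17043, 17089, 17093, 17097, 17105, 17155, 17157, 17165,
    17189, 17191, 17217, 17221, 17225, 17281, 17481, 17484, 17506, 17553, 17569, 17571, 17584,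
    17585, 17588, 17592, 17596, 17616, 17624, 17628, 17632, 17640, 17644, 17652, 17676, 17684,
    17692, 17804, 17824, 17844, 17856, 17956, 17992, 18066, 18068, 18212, 18470, 18505, 18514,
    18577, 18578, 18579, 18582, 18597, 9305, 18721, 18722, 18723, 18724, 18726, 18754, 18758,
    18784, 18786, 9396, 18796, 18818, 18980, 19016, 19024, 19025, 9516, 19036, 19236, 19492,
    19528, 19529, 19600, 19601, 20631, 20635, 20775, 20791, 21063, 21067, 21070, 21071, 21083,
    10586, 10646, 21322, 21323, 21394, 21646, 21654, 21658, 21660, 21662, 21806, 21906, 11052,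
    22162, 22166, 22290, 22308, 22418, 22828, 22830, 22836, 22838, 22840, 22842, 22844, 22846,
    22858, 22930, 23078, 23130, 23132, 23134, 23148, 23180, 23314, 23332, 23370, 23442, 23627,
    23698, 23699, 23715, 23826, 23844, 11926, 23852, 23954, 16537, 10842, 16681, 16697, 16691,
    21639, 22630, 21643, 21647, 22694, 22730, 22698, 22734, 21651, 21687, 17051, 17113, 17107,
    17099, 17101, 17129, 17053, 17109, 17125, 21277, 17177, 17253, 17197, 21723, 17069, 17229,
    17257, 16910, 22795, 22799, 22807, 22811, 22815, 16974, 9349, 9481, 9316, 22819, 8851, 17712,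
    17716, 17812, 22889, 22905, 17724, 23017, 17458, 9266, 8729, 8745, 23081, 23097, 8761, 9330,
    23321, 18130, 17604, 9876, 17620, 18004, 9289, 9298, 23625, 23079, 9361, 9362, 17554, 17700,
    8777, 22149, 22213, 17732, 18756, 17682, 23077, 9490, 9512, 9508, 17730, 23173, 23181, 9548,
    9388, 18788, 17764, 19044, 19108, 8969, 9764, 23315, 9800, 20787, 16462, 20637, 8231, 10391,
    21075, 16534, 8267, 16540, 20793, 21107, 10830, 11406, 21081, 16684, 11414, 21097, 11418,
    16692, 16696, 21105, 11420, 16700, 5434, 11422, 21113, 11082, 11154, 22881, 11564, 8792,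
    22897, 11566, 8796, 11572, 22945, 22961, 22977, 8820, 22993, 17020, 11590, 23194, 21865,
    23244, 21881, 23138, 23313, 21897, 23338, 23146, 21929, 11666, 22089, 17188, 23186, 23697,
    8996, 23202, 22153, 23714, 11922, 11862, 23218, 22217, 23858, 11698, 23730, 9060, 5526,
    21069, 8339, 16678, 22675, 10535, 22839, 17590, 23131, 23973, 19274, 4645, 4753, 16966, 8483,
    22709, 16922, 11399, 11403, 22805, 22813, 11407, 18074, 18010, 18122, 17626, 8841, 17170,
    22053, 8585, 8774, 4387, 23113, 16970, 17572, 23177, 11913, 9380, 8978, 4489, 11813, 10553,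
    10854, 8348, 8492, 22633, 8500, 10451, 20901, 8297, 8508, 10937, 11497, 16850, 21413, 8425,
    10707, 16882, 21477, 11596, 11449, 21221, 8377, 10611, 16754, 11570, 22929, 16996, 21705,
    23122, 17060, 21833, 11849, 11665, 8804, 8868, 10953, 11081, 11602, 11858, 8409, 21349,
    22745, 10675, 5964, 21581, 10791, 8270, 10397, 4135, 4460, 23257, 17114, 23251, 23243, 23195,
    19050, 18794, 19282, 16946, 23861, 23733, 23957, 10725, 11381, 10613, 16690, 10547, 8345,
    21093, 8370, 10597, 10661, 8402, 8474, 5703, 23883, 22697, 8361, 21157] (.comb (.cons 0 1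
    22857 (.cons 1 0 3079 (.cons 1 0 22825 .nil))) (.rows [3079, 16682, 22825, 22693] (.comb
    (.cons 0 1 17018 (.cons 0 1 17778 (.cons 1 0 17710 (.cons 0 1 17227 (.cons 1 0 17003 (.cons 2
    0 17650 .nil)))))) (.comb (.cons 0 1 16981 (.cons 0 1 17061 (.cons 2 0 17573 (.cons 0 1 17045
    (.cons 2 0 16979 (.cons 2 0 16997 .nil)))))) (.rows [16726] (.comb (.cons 1 0 17063 (.cons 0
    2 16983 (.cons 0 2 16999 (.cons 0 2 17575 (.cons 1 0 17047 .nil))))) (.rows [16702, 16983,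
    16999, 17003, 17011, 17013, 17017, 17018, 17047, 21309, 17063, 21341, 17227, 17067, 17195,
    17075, 17235, 17203, 17317, 17237, 17301, 17077, 17205, 17305, 17241, 17081, 23013, 17209,
    17321, 22771, 4412, 23161, 17054, 23133, 23191, 17710, 17614, 23853, 18070, 23371, 23143,
    23155, 23197, 23269] (.comb (.cons 0 1 17065 (.cons 2 0 17001 (.cons 0 1 16981 (.cons 2 0
    16985 .nil)))) (.comb (.cons 2 0 17049 (.cons 0 2 17577 (.cons 1 0 17045 (.cons 0 4 16979
    (.cons 0 2 16985 .nil))))) (.rows [16686, 16979, 16981, 16985, 21675, 17045, 21149, 16997,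
    17001, 16742, 17049, 4185, 17573, 22827, 22731, 4297, 4201, 17193, 16806, 5299, 22835, 5659]
    (.comb (.cons 1 0 4761 (.cons 0 1 4697 (.cons 0 1 4691 .nil))) (.rows [4691, 4697, 4757,
    4693, 4777, 4773] (.comb (.cons 1 0 9522 (.cons 0 1 9382 (.cons 0 1 9394 .nil))) (.rows
    [9382, 2348, 9394, 2966, 11865] (.comb (.cons 0 1 8614 (.cons 2 0 11859 (.cons 0 1 8598
    (.cons 2 0 9001 .nil)))) (.rows [8410, 2156, 8626, 2870, 11481, 11109, 2777, 17010, 22873,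
    22953, 22937, 5689, 5349, 16730, 21333, 22733] (.comb (.cons 0 3 17194 (.cons 3 0 18002
    (.cons 0 3 17618 (.cons 0 4 17714 (.cons 0 1 17610 (.cons 3 0 18770 (.cons 0 3 19026 (.cons 3
    0 18762 (.cons 0 4 23141 (.cons 2 0 17050 (.cons 2 0 17098 .nil))))))))))) (.rows [23717]
    (.comb (.cons 0 4 16986 (.cons 2 0 18770 (.cons 0 1 17194 (.cons 0 2 17618 (.cons 0 4 17714
    (.cons 4 0 17586 (.cons 4 0 17574 (.cons 2 0 17610 (.cons 0 2 19026 (.cons 1 0 17226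
    .nil)))))))))) (.rows [16986, 22861, 22885, 5933, 21805, 4396, 5782, 23129, 8493, 21837,
    17714, 4428, 5798, 23193, 5721, 11355, 5301] (.comb (.cons 1 0 9001 (.cons 0 1 8809 (.cons 0
    1 8805 .nil))) (.rows [8502, 8805, 8809, 8598, 8614, 4299, 5527, 4313, 4251, 5555, 5431,
    2105, 8491, 8499, 2675, 8523, 10589, 8537, 8601, 10653, 8531, 8794, 4397, 8494, 4247] (.comb
    (.cons 1 0 18002 (.cons 0 1 17610 (.cons 0 1 17618 .nil))) (.rows [17002, 17050, 17610, 4404,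
    17618, 5786, 23145, 8501, 8858, 23141, 22101, 4502, 22165, 2228, 5843, 5737, 8914, 11625,
    8613, 8597, 9418, 5989, 11435, 23721, 17578, 18770, 4692, 5849, 5741, 4406, 1132, 4530,
    23125, 5787, 5333, 9554, 9034, 11685, 4329, 4517, 11925, 8854, 5783, 11565, 5963, 9513, 4427,
    1189, 11877, 11673, 4281, 2873, 4263, 11571, 4501, 5931, 5971, 1193, 1173, 2677, 11561,
    11593, 11417, 11433, 11465, 10549, 11349, 8522, 8394, 10901, 11429, 8489, 10835] (.comb
    (.cons 1 0 4265 (.cons 0 2 4249 (.cons 0 2 4245 (.cons 0 2 4393 (.cons 1 0 4261 .nil)))))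
    (.rows [4174, 4245, 4249, 4261, 4265, 5683, 5707, 2123, 2839] (.comb (.cons 0 1 4426 (.cons 2
    0 4690 .nil)) (.rows [4266] (.comb (.cons 2 0 4298 (.cons 0 4 4402 (.cons 0 2 5797 (.cons 0 1
    4426 (.cons 0 1 4394 .nil))))) (.rows [4250, 4262, 4394, 4402, 5785, 2125, 2727, 4690, 5929,
    5525, 2739, 2133, 2717, 2921, 2153, 2149, 1113, 1063, 2869, 2250, 1129, 2378, 2981, 1447,
    2198, 2893, 2969, 2765] .nil)))))))))))))))))))))))))))))))
    [((.cons 0 16 2138 (.cons 42 0 1075 (.cons 0 6 1077 (.cons 0 6 1081 (.cons 168 0 2201 (.cons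
    42 0 1101 (.cons 0 28 2213 (.cons 0 9 1109 (.cons 0 8 2226 (.cons 0 6 1125 (.cons 20 0 2386
    (.cons 0 12 1459 .nil)))))))))))), (.cons 120 0 (mon []) (.cons 192 0 (mon [13]) (.cons 288 0
    (mon [7]) (.cons 72 0 (mon [13, 13]) (.cons 288 0 (mon [7, 13]) (.cons 216 0 (mon [7, 7])
    (.cons 72 0 (mon [7, 7, 13]) (.cons 48 0 (mon [7, 7, 7]) .nil))))))))), ((.cons 0 1 1075
    (.cons 0 1 1081 .nil)), (.cons 0 18 (mon []) (.cons 18 0 (mon [13, 13]) (.cons 0 18 (mon [7,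
    41]) (.cons 18 0 (mon [7, 13, 41]) .nil))))), ((.cons 2 0 2201 (.cons 1 0 2213 .nil)), (.cons
    0 18 (mon [7]) (.cons 36 0 (mon [41]) (.cons 18 0 (mon [7, 13]) (.cons 36 0 (mon [13, 41])
    (.cons 72 0 (mon [7, 41]) (.cons 18 0 (mon [7, 7, 41]) .nil)))))))] = true := by
  decide +kernel

/-- One unknown, coded by 43, survives in the relations and is fixed by the first of them. -/
theorem alOneNu_check_mu :
    check 12 (famRows alOneNu)
    []
    (symbols [[true, true, false, true, false, false, true, false, true], [true, false, true,
    true, false, false, true, false, true], [true, false, true, false, true, false, false, true,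
    true]])
    (.rows [16903, 16907, 16924, 16927, 16940, 16951, 16952, 16971, 17427, 17447, 17457, 17483,
    17484, 17487, 17489, 17505, 17521, 17555, 17571, 17584, 17588, 17592, 17596, 17616, 17624,
    17628, 17632, 17640, 17644, 17648, 17652, 17804, 17824, 17840, 17844, 17856, 17872, 17925,
    17956, 17992, 18053, 18068, 18117, 18121, 18198, 18212, 18245, 18249, 18470, 18505, 9259,
    18577, 18578, 18579, 18582, 18597, 9305, 18721, 18723, 18724, 18726, 18753, 18757, 18758,
    18761, 9392, 18784, 18785, 9393, 9396, 18792, 18796, 9400, 18800, 18801, 18802, 18804, 9424,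
    9425, 18886, 9448, 9456, 18962, 18980, 19016, 19024, 19025, 19026, 9516, 19032, 19036, 19218,
    19236, 19474, 19492, 19528, 19529, 19600, 19601, 19602, 9816, 19730, 19748, 19752, 19986,
    20004, 20242, 20260, 20790, 10414, 21070, 21082, 21142, 10586, 10588, 10598, 10646, 21322,
    21394, 21646, 21654, 21658, 21662, 21684, 21686, 21688, 21690, 21702, 21804, 21806, 10932,
    10936, 21906, 10956, 11052, 22162, 22164, 22290, 22308, 22418, 22567, 22607, 22679, 22681,
    22823, 22855, 22889, 22902, 22905, 22922, 22924, 22969, 23001, 23017, 23113, 23128, 23129,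
    23130, 23132, 23305, 23314, 23332, 23370, 23433, 23442, 23625, 23698, 11864, 11880, 11888,
    23817, 23826, 23844, 23848, 23849, 11926, 23852, 23945, 23954, 24073, 24082, 24100, 24136,
    24137, 24201, 24210, 24356, 9349, 22629, 22693, 22757, 17712, 17716, 17812, 17816, 23653,
    23973, 17604, 18004, 18506, 17445, 8723, 9254, 17446, 22603, 16915, 9289, 17481, 22675,
    18706, 16935, 17486, 22683, 18585, 17485, 9365, 9377, 9361, 22819, 17553, 17554, 22821,
    17700, 21891, 17105, 23397, 4721, 23461, 23061, 18754, 17673, 17732, 17682, 23077, 9490,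
    9512, 9508, 23173, 23179, 17734, 9545, 17059, 19082, 17733, 18769, 18770, 23187, 17737, 9548,
    9556, 23237, 17778, 9570, 18786, 19042, 17764, 9572, 9746, 17938, 17169, 9764, 22051, 17801,
    9800, 17810, 9618, 23827, 19106, 17225, 9874, 17233, 18082, 21094, 11342, 10842, 10830,
    21049, 16668, 10902, 21674, 21706, 21734, 11444, 11448, 11450, 11462, 11082, 11154, 16647,
    21007, 4367, 21039, 8471, 16679, 21071, 22245, 22373, 22437, 22857, 8880, 16728, 23192,
    21169, 17072, 22873, 23193, 23242, 17076, 21865, 11625, 8884, 21873, 21177, 23244, 8888,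
    21187, 22881, 23137, 21897, 16740, 21193, 23338, 21929, 22890, 17108, 17170, 22921, 22053,
    23689, 23177, 11657, 11666, 22089, 17188, 23186, 22930, 8996, 2480, 23201, 16801, 4930,
    23713, 9026, 22945, 11913, 22153, 21321, 11922, 16804, 11924, 17234, 11689, 11942, 23857,
    21347, 11953, 22217, 11954, 9060, 12041, 12050, 12068, 11977, 5026, 23889, 4645, 23957,
    16651, 21015, 16653, 21639, 21019, 8741, 9290, 17482, 16933, 16934, 8742, 4646, 9362, 16669,
    21051, 16667, 4753, 21063, 16675, 16969, 17572, 17041, 21139, 21795, 23149, 23373, 22893,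
    23341, 23445, 9378, 11539, 8841, 11587, 9384, 9009, 8916, 9042, 21989, 4962, 4834, 4802,
    8898, 8978, 11813, 4882, 4900, 21925, 5430, 10854, 16441, 21413, 11173, 11564, 11566, 21221,
    16777, 21267, 16994, 11849, 22865, 23121, 17058, 11569, 11441, 16585, 21833, 21705, 8804,
    8548, 8868, 8593, 10953, 11043, 11601, 11857, 2466, 11473, 10659, 4514, 11081, 4520, 2472,
    11089, 11476, 10665, 11860, 8404, 8616, 11161, 8652, 5964, 4580, 6025, 6034, 16473, 16489,
    11399, 16523, 21645, 8850, 8777, 16617, 16601, 21043, 21035, 21031, 16665, 16659, 8483,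
    16661, 4387, 21651, 16677, 21067, 19274, 23371, 17590, 16987, 10981, 4490, 4450, 5909, 2402,
    4770, 4706, 8393, 11465, 11593, 10597, 10661, 10469, 10725, 2274, 2993, 4209, 5937, 5969,
    8327, 10511, 8470, 21605, 11405, 20819, 20787, 10823, 11411, 19050, 18794, 19242, 23339,
    22891, 23147, 17814, 17718, 17830, 17051, 17113, 17107, 17099, 4235, 10519, 21157, 4237,
    10523, 5703, 8339, 10535, 19030, 23127, 23861, 17005, 16819, 21351, 4167] (.comb (.cons 1 0
    16681 (.cons 1 0 3079 .nil)) (.rows [3079, 16467, 16549, 20779] (.comb (.cons 1 0 21853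
    (.cons 2 0 17710 (.cons 0 1 17739 .nil))) (.rows [16727, 17579, 17739, 21167, 21853, 16761,
    16747, 16743, 16755, 16719, 17594, 16989, 23133, 19029, 21807, 17047, 19027, 17709, 18763,
    23131, 19034, 19033, 17829, 17813, 17126, 17817, 17833, 17717, 17715, 17721, 17834, 17866,
    17818, 4466, 21229, 17101, 17129, 17109, 17125, 23269, 5817, 23213, 21875, 17082, 17081,
    17067, 21179, 17063, 22877, 23211, 16731, 23251, 17077, 23253, 23243, 17075, 23245, 21863,
    1250] (.comb (.cons 0 1 4697 (.cons 1 0 4761 (.cons 0 1 4691 .nil))) (.comb (.cons 0 1 4693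
    (.cons 0 2 4691 (.cons 1 0 4757 .nil))) (.rows [4709, 4773, 4693, 4757, 4697, 4681, 4713]
    (.comb (.cons 1 0 23141 (.cons 0 1 22861 (.cons 0 1 22885 .nil))) (.rows [22861, 22885, 5833]
    (.comb (.cons 0 4 23123 (.cons 2 0 23125 (.cons 0 1 23205 (.cons 2 0 23717 (.cons 0 1 23189
    .nil))))) (.comb (.cons 0 1 23205 (.cons 2 0 23717 (.cons 0 1 23189 .nil))) (.rows [23189,
    23205, 5929, 22949, 11685, 6053, 22933] (.comb (.cons 0 1 21813 (.cons 2 0 16551 (.cons 0 3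
    16979 (.cons 0 3 17574 (.cons 3 0 16685 (.cons 0 1 21909 (.cons 2 0 16563 (.cons 0 3 16741
    (.cons 0 2 17610 (.cons 1 0 17049 .nil)))))))))) (.rows [16475, 16565, 16741, 20839, 4274,
    17098, 11669] (.comb (.cons 0 2 16693 (.cons 2 0 17610 (.cons 0 2 16691 (.cons 0 1 16789
    (.cons 1 0 17193 (.cons 0 1 16805 .nil)))))) (.rows [16539] (.comb (.cons 0 1 17049 (.cons 1
    0 16717 .nil)) (.rows [16691, 16997, 17610, 21095, 21707, 17193, 16789, 21099, 22099] (.comb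
    (.cons 1 0 17065 (.cons 0 2 16723 (.cons 0 1 16725 .nil))) (.rows [16723] (.comb (.cons 3 0
    17062 (.cons 0 3 16729 (.cons 0 6 16717 (.cons 0 2 16793 (.cons 0 2 17194 (.cons 4 0 17577
    (.cons 0 4 17573 (.cons 4 0 17705 (.cons 0 2 17226 (.cons 4 0 16809 .nil)))))))))) (.rows
    [16551, 16717, 16979, 21671, 17574] (.comb (.cons 1 0 17062 (.cons 0 1 16729 (.cons 0 2 16793
    .nil))) (.rows [16499, 16613, 16729, 16793, 16809, 4210, 11109, 5477, 22117, 5605, 21861,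
    22181, 17226, 4306, 17194, 5349, 4938, 17738, 23125, 17705, 5541, 22867, 17577, 17065, 21843]
    (.comb (.cons 0 4 8493 (.cons 4 0 8343 (.cons 0 4 11443 (.cons 0 2 8549 (.cons 4 0 8371
    (.cons 0 1 4453 (.cons 1 0 4457 (.cons 2 0 8553 (.cons 0 2 8906 (.cons 0 1 4810
    .nil)))))))))) (.rows [8283] (.comb (.cons 1 0 10965 (.cons 2 0 9034 (.cons 0 1 8553 .nil)))
    (.rows [8373, 8553, 10603, 10965, 8377, 8371, 5725, 8549, 2226, 8550, 8906, 4453, 4906, 4810,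
    4454, 5307, 4282, 4281, 4277, 4275, 4329, 5581, 4517, 4521, 4505, 4501, 6037, 8613, 11083,
    11565, 5963, 4758, 4427, 1189, 9546, 8869, 4710, 9418, 8805, 5989, 11157, 3017, 11941, 8617,
    8597, 11051, 1193, 1173, 9514, 8853, 8874, 8533, 9386, 8789, 8501, 2789, 11925, 11605, 4309,
    8421, 4211, 11443, 8403, 10663, 8614, 11429, 2981, 8293, 10645, 10853, 10917] (.comb (.cons 1
    0 1807 (.cons 1 0 8235 (.cons 1 0 8275 (.cons 0 1 8357 .nil)))) (.rows [8267, 1807, 8275,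
    10901, 10579, 10413] (.comb (.cons 0 1 2773 (.cons 0 2 2153 (.cons 0 2 2378 (.cons 0 1 2669
    .nil)))) (.rows [2345, 2378, 2213, 2217] (.comb (.cons 0 2 4265 (.cons 0 2 5797 (.cons 0 2
    5525 (.cons 4 0 4147 (.cons 0 1 5461 (.cons 2 0 4139 (.cons 0 2 4426 .nil))))))) (.comb
    (.cons 0 1 4265 (.cons 1 0 4426 (.cons 0 2 4393 (.cons 1 0 4261 .nil)))) (.rows [4147] (.comb
    (.cons 0 3 4265 (.cons 0 3 5525 (.cons 0 4 4393 (.cons 3 0 4261 (.cons 0 2 5797 (.cons 1 0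
    5781 (.cons 0 2 4179 (.cons 1 0 5717 (.cons 0 2 5733 (.cons 0 2 4171 .nil)))))))))) (.rows
    [4265, 4426, 5459, 4261, 2346, 2197, 5525, 5461, 4394, 4245, 2765, 2149, 2917, 1226, 5733,
    1125, 2763, 2250, 1509, 5323, 4298, 4197, 5781, 2099, 1075, 2133, 2901, 1194, 5717, 1109,
    2218, 1493, 4266, 4181] .nil))))))))))))))))))))))))))))))))))))))
    [((.cons 0 1 2137 .nil), (.cons 0 16 (mon []) (.cons 8 0 (mon [43]) .nil))), ((.cons 0 8 2091
    (.cons 0 6 1051 (.cons 0 3 1067 (.cons 4 0 2137 (.cons 3 0 1077 (.cons 0 6 1174 (.cons 6 0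
    1491 .nil))))))), (.cons 0 64 (mon [7]) (.cons 32 0 (mon [7, 43]) .nil))), ((.cons 8 0 2091
    (.cons 16 0 2093 (.cons 16 0 2101 (.cons 30 0 1051 (.cons 0 9 1067 (.cons 0 36 2137 (.cons 0
    3 1077 (.cons 6 0 1174 (.cons 0 6 1491 .nil))))))))), (.cons 768 0 (mon []) (.cons 672 0 (mon
    [13]) (.cons 1152 0 (mon [7]) (.cons 0 144 (mon [13, 13]) (.cons 576 0 (mon [7, 13]) (.cons
    576 0 (mon [7, 7]) (.cons 144 0 (mon [7, 7, 13]) (.cons 96 0 (mon [7, 7, 7]) .nil))))))))),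
    ((.cons 0 120 2091 (.cons 16 0 2093 (.cons 16 0 2101 (.cons 0 54 1051 (.cons 16 0 2125 (.cons
    0 39 1067 (.cons 0 28 2137 (.cons 39 0 1077 (.cons 0 54 1174 (.cons 78 0 1491 .nil)))))))))),
    (.cons 1440 0 (mon [13]) (.cons 0 144 (mon [13, 13]) (.cons 576 0 (mon [7, 13]) (.cons 144 0
    (mon [7, 7, 13]) (.cons 144 0 (mon [7, 13, 43]) .nil))))))] = true := by
  decide +kernel

/-- The parameters with `(al, be, ga) = (0, 2, 0)`
and `mu = -1`, `nu = -1`, `ep = 0`. -/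
noncomputable def beTwoMuNuEp : Pars Poly :=
  { Pars.gen with
    al := .nil, be := .const 2 0, ga := .nil,
    mu := .const 0 1, nu := .const 0 1, ep := .nil }

/-- With mu, nu and ep known the only obstruction left is 6 (la - κ₁ - κ₂) = 0. -/
theorem beTwoMuNuEp_check :
    check 6 (famRows beTwoMuNuEp)
    []
    (symbols [[true, true, false, true, false, true, false, false, true]])
    (.rows [16403, 16421, 16423, 16457, 16459, 16461, 16529, 16531, 16535, 16549, 16673, 16675,
    16677, 16679, 16685, 16689, 16715, 16805, 16971, 16973, 16977, 16993, 16995, 17009, 17025,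
    17027, 17029, 17031, 17035, 17037, 17043, 17089, 17093, 17097, 17153, 17155, 17157, 17163,
    17165, 17189, 17217, 17219, 17225, 17281, 17481, 17553, 17569, 17571, 18450, 18468, 18470,
    9237, 18504, 18505, 18510, 18514, 18532, 18576, 18577, 18578, 18579, 18582, 18584, 18596,
    18642, 18720, 18721, 18722, 18724, 18726, 18752, 18754, 18758, 18784, 18786, 18816, 9409,
    18818, 18834, 18848, 18880, 18980, 19016, 19024, 19025, 19032, 19236, 19492, 19528, 19529,
    19600, 19748, 20004, 20559, 20627, 20631, 20635, 20697, 20713, 20774, 20775, 20783, 20795,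
    20811, 10414, 20841, 20882, 21062, 21063, 21066, 21067, 21068, 21070, 21071, 21083, 21091,
    21108, 21138, 21143, 10586, 10588, 10598, 21209, 21266, 21273, 21284, 10646, 21322, 21323,
    21394, 21642, 21644, 21646, 21650, 21652, 21654, 21656, 21658, 21660, 21662, 21684, 21778,
    21796, 21804, 10932, 10936, 21906, 10956, 22034, 11052, 22162, 22164, 22290, 22308, 23571,
    23588, 23591, 23624, 23627, 23628, 23696, 23728, 23760, 23844, 23848, 24100, 24136, 16905,
    16537, 16915, 16681, 16933, 16935, 21655, 16985, 16979, 16997, 21659, 17001, 16981, 16774,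
    17177, 17201, 22787, 22791, 22795, 22799, 22807, 9233, 9349, 9481, 22819, 23561, 23570,
    17426, 9234, 8713, 23059, 8723, 23590, 9254, 17446, 4643, 9289, 8741, 23626, 17482, 23625,
    23079, 23630, 9361, 23698, 23817, 24073, 18756, 23826, 17682, 9490, 17730, 18768, 9538,
    23173, 17734, 18776, 18788, 19044, 8969, 24082, 23315, 19620, 18852, 19108, 8211, 21523,
    20633, 22566, 20787, 10319, 16462, 20637, 8231, 21543, 10842, 10534, 20777, 10391, 21075,
    20781, 21579, 16534, 8267, 16536, 16540, 22606, 20793, 21094, 21107, 21095, 10642, 22804,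
    22808, 10828, 10830, 22812, 10826, 22820, 21065, 22824, 16680, 10902, 21081, 16684, 22678,
    21670, 22828, 22832, 16688, 21097, 21674, 21706, 22836, 16696, 22686, 10898, 11082, 11154,
    11795, 9744, 22033, 9872, 18064, 22161, 17224, 23716, 23368, 12104, 12112, 22177, 9888,
    18080, 23720, 23376, 17232, 9298, 21683, 21671, 17049, 16694, 17193, 21715, 17045, 17065,
    4617, 22803, 23049, 22789, 11785, 22797, 8841, 22805, 17956, 9764, 22089, 23332, 12068,
    17992, 9800, 23177, 11913, 23305, 12041, 18836, 18772, 19028, 19092, 11395, 11399, 10393,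
    16548, 11403, 11416, 8344, 5430, 10553, 10854, 11420, 16968, 11412, 10537, 16676, 16976,
    16984, 16804, 4681, 9476, 8453, 4289, 11802, 4365, 17170, 11027, 23314, 22053, 8585, 8978,
    4489, 11813, 12050, 8393, 21905, 11976, 23240, 9616, 17808, 11720, 11153, 9104, 8648, 17732,
    9540, 11077, 4620, 5902, 5767, 8292, 4235, 11542, 8496, 8420, 23112, 21649, 17552, 9360,
    11848, 8488, 8265, 20773, 22674, 16530, 8356, 17512, 10451, 20901, 22921, 11657, 22930,
    23202, 11089, 11624, 8308, 5655, 5211, 11378, 8337, 22818, 21061, 16674, 8481, 8784, 4688,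
    11812, 22673, 23076, 17480, 9288, 21577, 22601, 8274, 4137, 21701, 5731, 8900, 4804, 23140,
    11876, 21705, 11844, 16930, 17476, 8465, 4369, 8738, 9284, 8880, 16996, 2370, 22834] (.comb
    (.cons 1 0 8339 (.cons 0 1 16972 .nil)) (.rows [4135, 8345, 8467, 4646, 11539, 5907, 10791,
    10547, 8469, 11307] (.comb (.cons 0 3 4658 (.cons 3 0 4294 (.cons 0 3 16934 (.cons 1 0 8588
    (.cons 0 3 8473 (.cons 3 0 17484 .nil)))))) (.rows [8269, 16690, 16934, 8742, 17484, 9292,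
    22681, 11814, 21581, 21093, 16938, 11405, 20821, 4237, 5914, 5686, 10453] (.comb (.cons 3 0
    17700 (.cons 1 0 17042 .nil)) (.rows [17736, 21833, 10579, 22865] (.comb (.cons 1 0 17572
    (.cons 0 1 22857 .nil)) (.rows [17704] (.comb (.cons 1 0 8996 (.cons 0 1 4297 (.cons 0 1 9362
    .nil))) (.rows [8904, 10953, 5299, 4696] (.comb (.cons 1 0 8804 (.cons 0 1 11465 .nil))
    (.rows [8856] (.comb (.cons 3 0 8485 (.cons 0 3 17554 (.cons 0 3 4682 (.cons 3 0 4297 (.cons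
    1 0 8594 .nil))))) (.comb (.cons 0 3 4754 (.cons 3 0 17554 (.cons 0 3 8777 (.cons 1 0 17042
    .nil)))) (.rows [9032, 11081, 5331, 10857] (.comb (.cons 1 0 9380 (.cons 1 0 17572 .nil))
    (.rows [9000] (.comb (.cons 3 0 4900 (.cons 0 1 8594 .nil)) (.comb (.cons 1 0 4708 (.cons 1 0
    8804 .nil)) (.comb (.cons 3 0 10825 (.cons 3 0 8484 (.cons 5 0 8338 .nil))) (.rows [4133]
    (.comb (.cons 3 0 11337 (.cons 1 0 8338 .nil)) (.rows [8740, 4644, 8466, 11401, 8772, 4676,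
    11553, 1539, 11556, 10533] (.comb (.cons 1 0 22825 (.cons 1 0 3079 (.cons 0 1 17554 (.cons 0
    1 17572 .nil)))) (.rows [8341, 17556, 9364, 22825, 11922, 17554, 21653, 8485, 11666, 16978,
    4754, 4169, 11339, 8489, 11411, 2185, 4233, 5287, 4243, 8780, 11417, 11418, 4708, 4249, 8596]
    (.comb (.cons 0 1 4245 (.cons 1 0 11413 .nil)) (.comb (.cons 0 1 8490 (.cons 0 3 4245 .nil))
    (.rows [4181, 11433, 8532] (.comb (.cons 3 0 1807 (.cons 0 3 4245 (.cons 1 0 8530 (.cons 3 0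
    1543 .nil)))) (.comb (.cons 0 1 4242 (.cons 0 1 4388 .nil)) (.comb (.cons 1 0 4242 (.cons 3 0
    5705 .nil)) (.rows [4242, 2340, 2121, 1807, 4265, 8530, 11561, 4393]
    .nil)))))))))))))))))))))))))))))))))
    [((.cons 1 0 1097 .nil), (.cons 0 6 (mon [19]) (.cons 0 6 (mon [23]) (.cons 6 0 (mon [31])
    .nil))))] = true := by
  decide +kernel

/-- The parameters with `(al, be, ga) = (0, 0, 0)`
and `mu = -1`, `nu = -1`, `ep = 2`, `ph = 0`. -/
noncomputable def centerMuNuEpPh : Pars Poly :=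
  { Pars.gen with
    al := .nil, be := .nil, ga := .nil,
    mu := .const 0 1, nu := .const 0 1, ep := .const 2 0, ph := .nil }

/-- The branch mu = nu = -1, ep = 2 at the origin meets the same obstruction as (0, 2, 0). Locating
it requires long combinations of equations for words down to 6 letters. -/
theorem centerMuNuEpPh_check :
    check 4 (famRows centerMuNuEpPh)
    []
    (symbols [])
    (.rows [16403, 16421, 16423, 16457, 16459, 16461, 16463, 16529, 16531, 16535, 16539, 16549,
    16673, 16675, 16677, 16679, 16685, 16689, 16715, 16805, 16961, 16963, 16965, 16967, 16969,
    16971, 16973, 17025, 17027, 17029, 17031, 17035, 17043, 17089, 17093, 17097, 17105, 17153,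
    17155, 17157, 17163, 17189, 17217, 17221, 17225, 17281, 17481, 17553, 17569, 17571, 17585,
    18450, 18468, 18470, 9237, 18504, 18505, 18510, 18514, 18576, 18577, 18578, 18579, 18582,
    18584, 18597, 9305, 9317, 18642, 18720, 18721, 18722, 18723, 18724, 18726, 18752, 18754,
    18758, 18784, 9393, 18786, 18788, 18792, 18816, 9409, 18818, 9413, 18834, 18848, 9425, 18850,
    18852, 18864, 18880, 18882, 18896, 18980, 9493, 19016, 19024, 19025, 19032, 19492, 19528,
    19529, 19538, 19600, 19601, 19752, 20004, 20040, 20519, 20537, 20555, 20559, 20569, 20585,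
    20601, 20627, 20631, 20635, 20636, 20639, 10326, 20665, 20713, 20771, 20774, 20775, 20780,
    20783, 20788, 20792, 20795, 20810, 20811, 10412, 10414, 20841, 20882, 21059, 21062, 21063,
    21066, 21067, 21068, 21070, 21071, 21080, 21083, 21108, 21138, 21143, 10584, 10586, 10598,
    21209, 21225, 21266, 21284, 21322, 21394, 21638, 21642, 21644, 21646, 21650, 21652, 21654,
    21656, 21658, 21660, 21662, 21680, 21684, 21688, 21712, 21736, 21778, 21796, 21800, 21804,
    21806, 10932, 10936, 21906, 10956, 22034, 22052, 22088, 22162, 22164, 22166, 22290, 22308,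
    22418, 23571, 23588, 23624, 23627, 23628, 23696, 23699, 23712, 23715, 23728, 23744, 23760,
    23768, 23776, 23784, 23844, 23848, 23852, 24100, 24136, 24356, 16537, 16681, 16697, 16691,
    21635, 21639, 21643, 21647, 21651, 21655, 21659, 22787, 22791, 22795, 22799, 22807, 22823,
    9233, 9349, 9481, 21779, 17033, 22819, 21827, 17057, 17059, 8851, 17713, 17073, 23561, 23570,
    17426, 9234, 8713, 18508, 23059, 8723, 23590, 9254, 17446, 4643, 9289, 18580, 8741, 23626,
    17482, 23625, 18588, 17486, 23079, 9294, 23630, 8743, 9361, 9362, 23698, 17554, 8777, 23817,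
    23945, 23954, 24073, 24137, 24201, 24210, 24329, 18756, 23826, 17682, 23077, 9490, 17730,
    18768, 9538, 23173, 17734, 8867, 18776, 9570, 19096, 8881, 23237, 17762, 8969, 24082, 23315,
    11939, 24338, 10518, 10394, 10279, 16422, 8211, 20557, 16460, 20633, 22566, 20787, 10319,
    16462, 20637, 8231, 10796, 10548, 10842, 10534, 20777, 10391, 21075, 20781, 16534, 8267,
    20785, 16536, 22604, 16540, 22606, 5198, 20793, 21094, 21095, 10399, 8271, 10840, 10642,
    10822, 22804, 22808, 10828, 10830, 22812, 5406, 5404, 10826, 22820, 21065, 21073, 22824,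
    16680, 10902, 21081, 16684, 22678, 21670, 16984, 22832, 21097, 21674, 21706, 22836, 21708,
    16696, 21105, 17008, 16700, 5434, 22686, 5432, 10898, 10900, 5422, 11026, 11044, 11082,
    11154, 11795, 23304, 9744, 22033, 12040, 18064, 22161, 17224, 23716, 23368, 12104, 12112,
    22177, 9888, 18080, 23720, 23376, 17232, 22193, 18096, 17240, 12120, 21069, 8339, 22822,
    16678, 22675, 10535, 10543, 22830, 16686, 8343, 8347, 16694, 22838, 17564, 8487, 4617, 4753,
    16966, 8483, 23049, 22789, 11785, 11395, 11399, 22797, 2323, 9290, 8841, 11403, 22805, 17956,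
    23689, 9764, 22813, 11407, 2385, 22089, 23332, 12068, 17992, 9800, 23113, 22821, 9924, 22213,
    22217, 23396, 17298, 10020, 12101, 17314, 12196, 17316, 23177, 11913, 23305, 23433, 12041,
    12169, 5398, 5402, 5420, 5428, 10393, 2702, 11404, 11416, 10545, 8344, 10553, 10854, 11420,
    2716, 16968, 11412, 10537, 16676, 5414, 5450, 5522, 16972, 10395, 16538, 22682, 8269, 20789,
    16692, 11539, 21581, 9292, 8742, 23078, 11411, 4371, 4646, 11814, 17484, 10791, 5199, 8270,
    10397, 8348, 4135, 11342, 21661, 10831, 2337, 9476, 21765, 8453, 9236, 4868, 4289, 4620,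
    2179, 4235, 11542, 16938, 8469, 17170, 11027, 23314, 22053, 8585, 11849, 8978, 5907, 4489,
    11813, 12050, 4882, 9332, 11549, 11550, 8393, 21905, 11976, 17096, 23240, 9616, 17808, 11720,
    6088, 11153, 5008, 9104, 8648, 10899, 9508, 17556, 8485, 9432, 23442, 12178, 17732, 9540,
    11077, 5957, 11717, 21957, 9156, 2710, 2714, 23112, 21649, 17552, 9360, 11848, 8265, 20773,
    22674, 10387, 16530, 21657, 11405, 11558, 22809, 5703, 10555, 11680, 9376, 21825, 10763,
    8233, 22549, 2496, 4704, 11616, 11290, 8242, 2575, 5655, 5211, 20821, 11307, 22921, 11045,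
    11657, 6025, 16850, 22930, 23186, 11922, 16682, 11339, 17124, 11209, 23202, 11089, 11624,
    4328, 9400, 8337, 22818, 21061, 10531, 16674, 22817, 21793, 11041, 11812, 22673, 23076,
    17480, 9288, 21577, 11302, 22602, 22601, 16690, 10547, 8345, 21093, 5273, 2330, 5914, 10829,
    2332, 2119, 21701, 5731, 11666, 8900, 2915, 2500, 4322, 23140, 5732, 11876, 17060, 11081,
    16980, 8492, 16964, 8481, 16962, 10787, 23074, 17476, 21573, 4642, 11810, 4369, 8738, 9284,
    10453, 11418, 5405, 2078, 8548, 11620, 3042, 5489, 10579, 4201, 4696, 5699, 11397, 11529,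
    5897, 2115, 4230, 5898, 4229, 2370, 5443, 5509, 2436, 2695, 2073, 4148, 8234, 11305, 5165,
    5953, 4688, 10913, 5808, 5729, 3009, 5772, 11540, 10833, 5425] (.comb (.cons 0 1 17572 (.cons
    0 1 8489 (.cons 1 0 3079 .nil))) (.rows [3079, 8357, 17572, 9512] (.comb (.cons 0 1 10825
    (.cons 0 1 8484 (.cons 3 0 4169 .nil))) (.rows [2067] (.comb (.cons 1 0 8338 (.cons 1 0 4169
    .nil)) (.rows [4133] (.comb (.cons 1 0 11337 (.cons 0 1 4169 .nil)) (.rows [8740, 4644,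
    11538, 5395, 8466, 4233, 10789, 5906, 2185, 4370, 2322, 11401, 5769, 2953, 8772, 2193, 5445,
    2372, 2146, 11553, 1539, 2851, 3016, 5701, 4432, 2978, 2913, 4169, 11556, 2886, 4234, 2117,
    2100, 5653, 2699] (.comb (.cons 0 1 4244 (.cons 0 1 2085 .nil)) (.rows [4392, 5673] (.comb
    (.cons 1 0 903 (.cons 1 0 4260 (.cons 1 0 771 (.cons 0 1 2085 .nil)))) (.comb (.cons 1 0 4242
    (.cons 1 0 771 .nil)) (.rows [771, 2085, 5796] (.comb (.cons 1 0 17705 (.cons 0 1 17065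
    (.cons 2 0 17193 (.cons 0 1 17061 (.cons 2 0 17049 (.cons 1 0 8525 (.cons 1 0 9001 (.cons 0 1
    8805 (.cons 1 0 17050 (.cons 1 0 18002 (.cons 0 1 17610 (.cons 0 1 8553 (.cons 1 0 22889
    (.cons 0 1 17828 .nil)))))))))))))) (.rows [8363] (.comb (.cons 0 1 17577 (.cons 2 0 17049
    (.cons 0 1 17045 (.cons 0 1 17705 (.cons 2 0 17573 (.cons 2 0 17193 (.cons 0 1 17061 (.cons 0
    1 17065 .nil)))))))) (.comb (.cons 0 2 17573 (.cons 0 1 17098 (.cons 1 0 17050 (.cons 2 0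
    17049 (.cons 2 0 17705 (.cons 0 1 8549 (.cons 0 1 17577 (.cons 1 0 9001 (.cons 0 1 8809
    (.cons 1 0 8525 (.cons 0 1 17618 (.cons 1 0 18002 .nil)))))))))))) (.rows [8491, 17045,
    17573, 17577, 21803, 22867, 4243, 1059, 1105, 4425, 21835, 17705, 17061, 17049, 21811, 5671,
    655, 22099, 17193] (.comb (.cons 0 1 9394 (.cons 0 1 9522 (.cons 1 0 9382 (.cons 1 0 18764
    .nil)))) (.rows [9060] (.comb (.cons 2 0 23123 (.cons 0 1 17740 (.cons 2 0 17574 (.cons 2 0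
    17580 (.cons 6 0 8505 (.cons 0 1 17046 (.cons 2 0 18764 (.cons 0 1 17708 (.cons 2 0 17612
    (.cons 0 1 17062 .nil)))))))))) (.rows [8505, 17636, 21817, 1052, 4252, 10699, 4408, 5689]
    (.comb (.cons 0 2 8920 (.cons 2 0 8626 (.cons 0 1 8614 (.cons 1 0 9001 (.cons 1 0 9382 (.cons
    1 0 11859 (.cons 0 1 8598 (.cons 0 1 17196 (.cons 0 1 17228 (.cons 1 0 18764 .nil))))))))))
    (.rows [8920, 11481, 11109] (.comb (.cons 0 2 17100 (.cons 2 0 17612 (.cons 0 1 17062 (.cons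
    1 0 23123 (.cons 1 0 11670 (.cons 1 0 8598 (.cons 2 0 17196 (.cons 0 1 17708 (.cons 1 0 17580
    (.cons 1 0 17574 .nil)))))))))) (.rows [17100, 23142, 10651] (.comb (.cons 0 1 17062 (.cons 1
    0 17574 (.cons 0 1 17046 (.cons 1 0 23123 .nil)))) (.rows [8365, 17580, 23126] (.comb (.cons
    0 1 17708 (.cons 1 0 17046 .nil)) (.rows [17196, 18764, 9394, 23718, 9522] (.comb (.cons 1 0
    19092 (.cons 0 2 19028 (.cons 1 0 18762 (.cons 0 2 18770 (.cons 3 0 17714 (.cons 0 3 17586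
    (.cons 0 3 17574 (.cons 1 0 19026 (.cons 1 0 18772 (.cons 0 2 18836 .nil)))))))))) (.rows
    [8493, 17046, 17574, 17586, 23129, 23123, 17714, 23193] (.comb (.cons 1 0 19026 (.cons 0 1
    18770 (.cons 0 1 18762 .nil))) (.rows [18762, 18770, 23721, 23850, 17706, 19028, 23882,
    23722, 17578, 22869, 17738, 18772, 23209, 17746, 19092, 4498, 1122, 5577, 760] (.comb (.cons
    1 0 17716 (.cons 0 1 17050 (.cons 0 1 17106 .nil))) (.rows [8373, 17050, 17098, 17106, 9396,
    23130, 11866, 23125, 21845, 17066, 23205, 23189, 17748, 23210] (.comb (.cons 1 0 8805 (.cons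
    0 1 8549 (.cons 0 1 8525 .nil))) (.rows [8374, 8525, 8549, 8553, 8502, 9004, 11686] (.comb
    (.cons 0 1 8533 (.cons 0 1 8869 (.cons 2 0 8613 (.cons 2 0 8789 (.cons 0 4 8523 .nil)))))
    (.rows [8366, 8523, 8789, 8794, 8787, 8494, 8793, 8533, 8869, 8914, 8858, 8853, 10919, 8531,
    8857, 10931, 8537, 8873, 8906, 9514, 11595, 8854, 11565, 9516, 11926, 9034, 12106, 11925,
    9876, 11685, 11603, 11563, 8790, 10925, 8870, 11437, 8534, 10933, 11610, 11597, 8538, 8884,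
    11621, 9548, 8882, 9388, 11609, 11942, 11606] (.comb (.cons 0 1 8786 (.cons 2 0 4261 (.cons 1
    0 4245 (.cons 0 4 8868 (.cons 0 6 2354 (.cons 3 0 8852 (.cons 2 0 11433 (.cons 4 0 8522
    (.cons 0 6 2201 (.cons 6 0 2356 (.cons 6 0 2125 (.cons 6 0 2153 (.cons 6 0 4516 (.cons 4 0
    4249 (.cons 0 15 2345 (.cons 3 0 2348 (.cons 3 0 2123 (.cons 3 0 2386 (.cons 0 2 5834 (.cons
    12 0 4197 (.cons 0 4 9000 (.cons 6 0 4456 (.cons 3 0 2217 (.cons 1 0 4692 (.cons 2 0 4265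
    (.cons 0 5 4756 (.cons 3 0 4181 (.cons 2 0 5525 (.cons 6 0 2101 (.cons 0 1 4690 (.cons 0 6
    2727 (.cons 7 0 4179 (.cons 3 0 2380 (.cons 4 0 8856 (.cons 6 0 2094 (.cons 0 4 5453 (.cons 4
    0 2099 (.cons 3 0 4440 (.cons 1 0 5798 (.cons 0 3 2388 (.cons 1 0 8872 (.cons 0 3 2133 (.cons
    0 2 4504 (.cons 3 0 5721 (.cons 0 2 5802 (.cons 12 0 8804 (.cons 1 0 4393 (.cons 2 0 5461
    (.cons 4 0 2091 (.cons 4 0 4520 .nil)))))))))))))))))))))))))))))))))))))))))))))))))) (.rows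
    [2345] (.comb (.cons 2 0 2378 (.cons 3 0 8786 (.cons 0 4 8522 (.cons 1 0 4393 (.cons 3 0 4179
    (.cons 2 0 2213 (.cons 0 1 4245 (.cons 0 1 4690 (.cons 0 2 3018 (.cons 2 0 2280 (.cons 6 0
    8804 (.cons 2 0 2149 (.cons 6 0 4197 (.cons 4 0 9000 (.cons 0 1 2217 (.cons 1 0 4756 (.cons 0
    1 2386 (.cons 2 0 8868 (.cons 2 0 5453 (.cons 2 0 2093 (.cons 1 0 2380 (.cons 1 0 2123 (.cons
    0 1 2388 (.cons 0 1 8872 (.cons 0 1 2133 (.cons 0 3 4181 (.cons 1 0 2348 (.cons 2 0 8856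
    (.cons 2 0 4249 (.cons 0 2 11433 (.cons 2 0 2137 (.cons 2 0 4452 (.cons 2 0 4504 (.cons 1 0
    4440 (.cons 0 1 5721 (.cons 0 1 5798 (.cons 0 1 8852 (.cons 0 1 4692
    .nil)))))))))))))))))))))))))))))))))))))) (.rows [4179, 2121, 1043] (.comb (.cons 0 2 8852
    (.cons 3 0 8786 (.cons 2 0 2213 (.cons 3 0 2378 (.cons 2 0 2201 (.cons 0 3 11433 (.cons 0 4
    8522 (.cons 0 3 2386 (.cons 1 0 4756 (.cons 1 0 4393 (.cons 0 1 2217 (.cons 0 2 4690 (.cons 1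
    0 8868 (.cons 1 0 4692 (.cons 0 1 2197 (.cons 0 2 4245 (.cons 1 0 4265 (.cons 0 2 4261
    .nil)))))))))))))))))) (.rows [2276] (.comb (.cons 1 0 2386 (.cons 0 1 4690 (.cons 0 2 8804
    (.cons 1 0 2149 (.cons 0 2 4197 (.cons 1 0 9000 (.cons 1 0 11433 (.cons 1 0 8522 (.cons 0 1
    2378 (.cons 0 1 4756 (.cons 0 1 2153 (.cons 0 1 4516 (.cons 0 1 4265 (.cons 1 0 4261 (.cons 1
    0 5737 (.cons 0 1 5525 (.cons 0 1 2101 (.cons 0 2 2099 .nil)))))))))))))))))) (.rows [4516]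
    (.comb (.cons 1 0 4690 (.cons 1 0 3018 (.cons 0 1 2280 (.cons 0 4 8804 (.cons 0 3 4197 (.cons
    0 2 9000 (.cons 0 1 4249 (.cons 0 1 2356 (.cons 0 1 2125 (.cons 1 0 4306 (.cons 1 0 2153
    (.cons 1 0 2354 (.cons 0 1 4402 (.cons 0 1 2149 .nil)))))))))))))) (.rows [2280] (.comb
    (.cons 0 2 2198 (.cons 0 1 2153 (.cons 1 0 4393 (.cons 0 1 4690 (.cons 0 1 2201 (.cons 0 2
    2348 (.cons 6 0 2123 (.cons 2 0 2380 (.cons 0 1 2354 (.cons 1 0 2131 (.cons 1 0 2356 (.cons 1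
    0 2125 (.cons 0 1 4306 (.cons 1 0 8524 (.cons 1 0 4249 (.cons 3 0 8804 (.cons 1 0 2149 (.cons
    1 0 2137 (.cons 0 1 5721 (.cons 1 0 4452 (.cons 0 1 3018 (.cons 2 0 9000 (.cons 3 0 4197
    (.cons 0 1 4262 (.cons 0 1 2378 (.cons 1 0 2386 (.cons 0 1 4756 (.cons 1 0 8868 (.cons 0 1
    8786 .nil))))))))))))))))))))))))))))) (.comb (.cons 0 2 2380 (.cons 2 0 4262 (.cons 1 0 4756
    (.cons 0 1 8786 (.cons 1 0 8868 (.cons 0 1 11433 (.cons 2 0 8804 (.cons 0 1 2217 (.cons 0 1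
    4393 (.cons 0 2 4690 (.cons 2 0 2149 (.cons 2 0 2137 (.cons 0 2 5721 (.cons 2 0 4452 (.cons 0
    2 3018 (.cons 4 0 9000 (.cons 6 0 4197 (.cons 2 0 2741 (.cons 1 0 2388 (.cons 0 1 8872 (.cons
    1 0 2133 (.cons 1 0 4181 (.cons 0 4 2094 (.cons 0 4 4456 (.cons 0 2 2906 (.cons 0 4 2153
    (.cons 4 0 2093 (.cons 0 2 2386 (.cons 1 0 2378 .nil))))))))))))))))))))))))))))) (.rows
    [4197, 8804, 11417, 11570, 2124, 2200, 2713] (.comb (.cons 0 1 8852 (.cons 0 1 11433 (.cons 0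
    1 8522 (.cons 2 0 8786 .nil)))) (.comb (.cons 0 1 4265 (.cons 1 0 11433 (.cons 1 0 8522
    (.cons 1 0 4261 (.cons 1 0 2386 (.cons 0 1 2378 (.cons 0 1 4756 .nil))))))) (.rows [2099]
    (.comb (.cons 1 0 4402 (.cons 0 1 2201 (.cons 0 1 2137 (.cons 1 0 2131 (.cons 0 1 4452 (.cons
    0 1 4428 (.cons 1 0 4393 (.cons 1 0 2217 (.cons 1 0 4756 (.cons 2 0 4265 (.cons 0 2 11433
    (.cons 0 2 8522 (.cons 0 2 4261 (.cons 0 1 8868 (.cons 0 1 2213 (.cons 1 0 8786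
    .nil)))))))))))))))) (.comb (.cons 0 2 2131 (.cons 0 2 2733 (.cons 0 2 2091 (.cons 0 2 4265
    (.cons 2 0 11433 (.cons 4 0 8522 (.cons 0 2 8868 (.cons 2 0 5721 (.cons 0 5 2123 (.cons 1 0
    2197 (.cons 3 0 4245 (.cons 0 3 2213 (.cons 1 0 4690 (.cons 2 0 4440 (.cons 1 0 4262 (.cons 2
    0 4181 (.cons 0 1 8786 (.cons 1 0 4261 (.cons 0 2 2891 (.cons 0 1 4393 (.cons 1 0 2348 (.cons
    0 1 2380 .nil)))))))))))))))))))))) (.rows [2106, 2789, 2930] (.comb (.cons 1 0 5721 (.cons 0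
    1 4393 (.cons 0 2 2213 (.cons 1 0 2348 (.cons 0 1 2380 (.cons 1 0 2123 (.cons 0 1 2918 (.cons
    0 2 4300 (.cons 1 0 4428 (.cons 0 1 2150 .nil)))))))))) (.rows [2213, 2123, 2378, 2981]
    (.comb (.cons 1 0 4393 (.cons 0 1 2348 (.cons 0 1 4262 (.cons 1 0 2380 .nil)))) (.rows [2093,
    4396, 5782] (.comb (.cons 1 0 4402 (.cons 1 0 2201 (.cons 0 1 2137 (.cons 0 1 4274 (.cons 0 1
    4262 (.cons 0 1 2131 .nil)))))) (.rows [2094, 2198, 2861, 2891, 5962, 4756] (.comb (.cons 0 1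
    4261 (.cons 1 0 2733 (.cons 1 0 2091 (.cons 0 1 4181 (.cons 0 1 8522 .nil))))) (.rows [2091,
    4261, 2134, 2733, 4772, 8786, 2194, 11433, 11562, 2386, 8596, 2348, 4690, 1224, 5453, 2131,
    2217, 2346, 2452, 4692, 5781, 5930, 2859, 4426, 5709, 2899, 2905, 4402, 4436, 5802, 2218,
    4266, 5461, 2901, 2133] (.comb (.cons 1 0 387 (.cons 0 1 2857 .nil)) (.rows [1061, 2212]
    (.comb (.cons 0 4 588 (.cons 0 12 531 (.cons 2 0 553 (.cons 3 0 596 (.cons 3 0 1045 (.cons 0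
    1 594 (.cons 0 3 455 (.cons 2 0 550 (.cons 2 0 99 (.cons 0 3 1445 (.cons 0 3 1098
    .nil))))))))))) (.rows [525, 1433, 1369] (.comb (.cons 1 0 1074 (.cons 0 1 1098 (.cons 1 0
    596 (.cons 0 2 588 (.cons 0 3 531 (.cons 1 0 231 (.cons 1 0 1076 (.cons 0 1 523 (.cons 0 1
    594 (.cons 1 0 1045 (.cons 0 1 455 .nil))))))))))) (.comb (.cons 2 0 717 (.cons 0 1 1172
    (.cons 0 1 553 (.cons 2 0 531 (.cons 1 0 1065 (.cons 0 1 387 (.cons 1 0 549 (.cons 2 0 1074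
    (.cons 2 0 537 .nil))))))))) (.comb (.cons 0 3 1074 (.cons 0 1 537 (.cons 2 0 533 (.cons 0 2
    231 (.cons 0 3 1076 (.cons 3 0 523 (.cons 0 2 195 (.cons 5 0 1045 (.cons 0 1 538 (.cons 1 0
    586 (.cons 3 0 531 (.cons 0 1 119 (.cons 0 1 526 (.cons 0 1 568 (.cons 1 0 588 (.cons 1 0 685
    (.cons 0 1 553 .nil))))))))))))))))) (.rows [387, 1045, 2890] (.comb (.cons 0 1 549 (.cons 0
    1 531 (.cons 0 1 1065 (.cons 0 1 717 (.cons 0 1 1074 (.cons 0 1 537 .nil)))))) (.comb (.cons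
    1 0 99 (.cons 1 0 588 (.cons 1 0 531 (.cons 1 0 1065 (.cons 1 0 549 (.cons 1 0 1074 (.cons 1
    0 537 .nil))))))) (.comb (.cons 0 4 533 (.cons 1 0 554 .nil)) (.rows [99, 526, 537, 717, 697,
    562, 1357, 549, 1172, 1482, 1363, 741, 1098, 723, 1445]
    .nil))))))))))))))))))))))))))))))))))))))))))))))))))))))))))))))))))))))))))))))))
    [((.cons 0 1 1066 .nil), (.cons 0 6 (mon [19]) (.cons 0 6 (mon [23]) (.cons 6 0 (mon [31])
    .nil))))] = true := by
  decide +kernel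

/-- The parameters with `(al, be, ga) = (0, 0, 0)`
and `ph = 0`. -/
noncomputable def centerPh : Pars Poly :=
  { Pars.gen with
    al := .nil, be := .nil, ga := .nil,
    ph := .nil }

/-- The unknown kept is the coefficient of vvuvuvuvu in the v component. This word occurs in [v, [u,
v]⁴], the inner symmetry available when [u, v] is constant. The relations say that ep and mu + nu
annihilate it. -/
theorem centerPh_check :
    check 8 (famRows centerPh)
    []
    (symbols [[true, true, true, false, true, false, true, false, true, false]])
    (.rows [16679, 16685, 16715, 16805, 16971, 16973, 17035, 17037, 17043, 17093, 17105, 17189,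
    17221, 17225, 17571, 17585, 18579, 18582, 18597, 18642, 18723, 18726, 18758, 18786, 18788,
    18792, 18834, 18850, 18852, 19025, 19538, 21083, 21209, 21655, 21659, 22811, 22823, 8851,
    17689, 17713, 17486, 23945, 24137, 24201, 22830, 16686, 16694, 22838, 17564, 22213, 17298,
    17314, 23442, 17124] (.comb (.cons 1 0 17611 (.cons 0 1 17051 (.cons 0 1 17099 .nil))) (.rows
    [17051, 17099, 17107, 17113, 22839, 18069, 22955, 17621, 18089, 18085, 18005, 17109, 22875,
    17741, 17769, 17765, 17709, 19052, 19274, 17590, 23131, 19050, 18794, 19284, 19242, 19282,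
    17814, 17718, 17830, 19030, 18010] (.comb (.cons 0 1 17067 (.cons 2 0 17579 (.cons 0 4 17047
    (.cons 0 1 17739 (.cons 2 0 17227 .nil))))) (.rows [17047, 17594, 17593, 22831, 17579, 17589,
    17575, 17587, 17874, 17866, 17753, 17739, 17067, 17754, 17834, 17749, 17077, 17829, 17717,
    17722, 17721, 17707, 17813, 17715, 17817, 17747, 17710, 18250, 18070, 17582] (.comb (.cons 0
    1 4697 (.cons 1 0 4761 (.cons 0 1 4691 .nil))) (.comb (.cons 0 1 4693 (.cons 0 2 4691 (.cons
    1 0 4757 .nil))) (.rows [4709, 4773, 4693, 4757, 4697, 4713] (.comb (.cons 1 0 17065 (.cons 0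
    2 17193 (.cons 1 0 17061 (.cons 0 2 17045 (.cons 1 0 17577 (.cons 0 2 17049 (.cons 0 2 17705
    (.cons 1 0 17573 .nil)))))))) (.rows [16718] (.comb (.cons 0 2 18836 (.cons 1 0 18770 (.cons
    0 2 18762 (.cons 0 2 19092 (.cons 1 0 19028 (.cons 0 2 18764 (.cons 1 0 18772 (.cons 1 0
    19026 .nil)))))))) (.rows [18216] (.comb (.cons 0 2 17578 (.cons 0 1 18762 (.cons 0 1 19026
    (.cons 1 0 17716 (.cons 0 1 17050 (.cons 1 0 17098 (.cons 0 1 17812 (.cons 0 4 17049 (.cons 0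
    4 18836 (.cons 1 0 17577 (.cons 2 0 17045 (.cons 0 1 17705 (.cons 1 0 17573 (.cons 3 0 18770
    (.cons 2 0 17610 (.cons 2 0 17618 (.cons 0 2 18002 (.cons 0 2 17193 (.cons 0 2 17714 (.cons 2
    0 17586 (.cons 2 0 17574 (.cons 0 2 18764 (.cons 2 0 19028 (.cons 0 2 19092
    .nil)))))))))))))))))))))))) (.comb (.cons 0 1 18004 (.cons 2 0 17045 (.cons 0 1 17578 (.cons
    2 0 17573 (.cons 1 0 17618 (.cons 0 1 18836 (.cons 0 1 17706 (.cons 4 0 18762 (.cons 3 0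
    17574 (.cons 1 0 23717 (.cons 0 1 19026 (.cons 0 1 22953 (.cons 0 1 17226 (.cons 0 2 22937
    (.cons 0 1 17062 (.cons 2 0 17705 (.cons 1 0 23123 (.cons 0 1 17708 (.cons 0 1 22873 (.cons 0
    1 19028 (.cons 1 0 19092 (.cons 2 0 18764 (.cons 1 0 17610 (.cons 0 1 17577 (.cons 0 1 17061
    (.cons 1 0 17193 .nil)))))))))))))))))))))))))) (.rows [17010, 17636, 21817] (.comb (.cons 0
    1 17066 (.cons 1 0 17098 (.cons 0 1 17812 (.cons 0 1 22889 (.cons 0 2 17049 (.cons 2 0 17045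
    (.cons 1 0 17226 (.cons 0 3 17193 (.cons 1 0 17061 (.cons 0 1 18068 (.cons 0 1 22953 (.cons 0
    1 17708 (.cons 0 1 22873 (.cons 1 0 17046 (.cons 0 1 17578 (.cons 0 1 19028 (.cons 3 0 18762
    (.cons 1 0 19092 (.cons 0 1 19026 (.cons 2 0 18764 (.cons 1 0 17610 (.cons 1 0 17573 (.cons 1
    0 17618 (.cons 0 1 18002 (.cons 0 1 18836 (.cons 0 1 17706 (.cons 2 0 17574
    .nil))))))))))))))))))))))))))) (.rows [18088, 23882, 19026, 23850, 19028, 18762, 23718,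
    18764, 18770, 23722, 18772] (.comb (.cons 0 1 17061 (.cons 3 0 17573 (.cons 1 0 17045 (.cons
    2 0 17714 (.cons 0 2 17586 (.cons 0 2 17577 (.cons 2 0 17049 (.cons 2 0 17705 (.cons 0 2
    17706 (.cons 2 0 17574 .nil)))))))))) (.rows [17193] (.comb (.cons 1 0 17573 (.cons 0 1 17045
    (.cons 0 1 17061 .nil))) (.rows [16726, 17045, 17061, 22827, 17706, 17705, 17574, 22861,
    17065, 17577, 17738, 17578, 22869, 17586, 23129, 18002, 23337] (.comb (.cons 1 0 17708 (.cons
    0 1 17074 (.cons 0 1 17046 .nil))) (.rows [17046, 17074, 23126, 23125, 23123, 23141, 23194,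
    17716, 21813, 17050, 17740, 23189, 17062, 23205, 23210, 17748, 17066] (.comb (.cons 1 0 8805
    (.cons 0 1 8549 (.cons 0 1 8525 .nil))) (.rows [8374, 8525, 8549, 8553, 8502] (.comb (.cons 1
    0 9522 (.cons 0 1 9382 (.cons 0 1 9394 .nil))) (.rows [9382, 9394, 4698, 9396, 4453, 4810,
    4818, 4429, 4397, 5723, 9554, 9426, 8914, 8789, 8523, 8793, 9514, 9418, 9386, 8533, 4938,
    4517, 9034, 11685, 8854, 4758, 4427, 8810, 8554, 11573, 4458, 4277, 11563, 4438, 8534, 4267]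
    .nil)))))))))))))))))))))))))))
    [((.cons 2 0 8794 (.cons 0 5 4398 (.cons 20 0 8809 (.cons 0 1 4406 (.cons 80 0 8857
    .nil))))), (.cons 124 0 (mon [13, 37]) .nil)), ((.cons 0 1 8809 .nil), (.cons 16 0 (mon [7,
    37]) (.cons 16 0 (mon [11, 37]) .nil)))] = true := by
  decide +kernel

/-- Once that unknown vanishes, five others remain. The first relation eliminates one of them, the
second expresses ep, and the other seven are the equations treated in `center_points`. -/
theorem centerPh_check_zero :
    check 8 (zeroRows [true, true, true, false, true, false, true, false, true, false]
      centerPh)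
    []
    (symbols [[true, true, true, false, false, true, false, true, false], [true, true, false,
    true, false, true, false, true, false], [true, true, false, true, false, true, false, false,
    true], [true, true, false, true, false, false, true, true, false], [true, true, true, false,
    true, false, true, false]])
    (.rows [0, 16423, 16459, 16461, 16531, 16535, 16549, 16675, 16677, 16679, 16685, 16689,
    16715, 16963, 16965, 16967, 16969, 16971, 16973, 17027, 17029, 17031, 17035, 17037, 17043,
    17089, 17093, 17097, 17155, 17157, 17163, 17189, 17217, 17221, 17225, 17281, 17481, 17553,
    17569, 17571, 17585, 18470, 9237, 18505, 18514, 18577, 18578, 18579, 18584, 18597, 18642,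
    18721, 18722, 18723, 18724, 18726, 18754, 18758, 18784, 18786, 18788, 18792, 9409, 18818,
    18834, 18848, 18850, 18852, 18880, 18980, 19016, 19024, 19025, 19032, 19492, 19528, 19529,
    19538, 19600, 19601, 19752, 20004, 20559, 20631, 20635, 20665, 20775, 20811, 10414, 20841,
    21063, 21067, 21070, 21071, 21083, 21142, 21143, 10586, 10588, 10598, 10646, 21322, 21394,
    21646, 21654, 21658, 21660, 21662, 21684, 21688, 21804, 21806, 10932, 10936, 21906, 10956,
    11052, 22162, 22164, 22166, 22290, 22308, 23571, 23699, 23728, 23732, 23760, 23844, 23848,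
    23852, 24100, 24136, 24356, 16537, 16681, 16697, 21639, 21643, 21647, 21651, 21655, 21659,
    22791, 22795, 22799, 22807, 22811, 22823, 9349, 9481, 21779, 17033, 22819, 21827, 17057,
    17059, 8851, 17689, 17713, 17073, 18508, 23059, 8723, 23590, 9254, 17446, 9289, 18580, 8741,
    23626, 17482, 23625, 18588, 17486, 23079, 8743, 9361, 9362, 23698, 17554, 8777, 23817, 23945,
    23954, 24073, 24137, 24201, 24210, 18756, 23826, 17682, 23077, 9490, 17730, 18768, 9538,
    23173, 17734, 19084, 23237, 17762, 8969, 24082, 20787, 10319, 16462, 20637, 8231, 10842,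
    10391, 21075, 20781, 16534, 8267, 16540, 22606, 20793, 21094, 16542, 10830, 22812, 10902,
    21081, 16684, 22678, 21670, 16984, 21097, 21674, 21706, 16696, 21105, 22686, 5422, 11082,
    11154, 11795, 9872, 18064, 22161, 17224, 23716, 23368, 12104, 12112, 22177, 9888, 18080,
    23720, 23376, 17232, 22193, 21069, 8339, 22822, 16678, 22675, 10535, 22830, 16686, 8343,
    16694, 22838, 17564, 4645, 4753, 16966, 8483, 11399, 22797, 9290, 8841, 11403, 22805, 17956,
    23689, 9764, 22813, 11407, 22089, 23332, 12068, 17992, 9800, 23113, 22821, 22213, 22217,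
    23396, 17298, 23889, 17314, 17316, 23460, 23177, 11913, 23305, 23433, 12041, 10553, 10854,
    11420, 16972, 10395, 16538, 22682, 8269, 20789, 16692, 11539, 21581, 9292, 8742, 23078,
    11411, 4371, 11814, 17484, 10791, 8270, 10397, 8348, 11342, 4235, 11542, 16938, 8469, 17170,
    11027, 23314, 22053, 8585, 11849, 8978, 11813, 12050, 4882, 23098, 8478, 17188, 21905, 11976,
    17096, 23240, 9616, 17808, 11720, 11153, 9104, 8648, 21797, 9508, 17556, 8485, 22961, 23442,
    17732, 9540, 11077, 21957, 21657, 11405, 11558, 22809, 5703, 5655, 8282, 20821, 11307, 22921,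
    11045, 11657, 6025, 16850, 22930, 23186, 11922, 16682, 11339, 23268, 23202, 11089, 11624,
    16690, 10547, 8345, 21093, 11546, 10829, 4380, 21701, 11461, 11666, 8900, 4322, 23140, 11876,
    17060, 11081, 16980, 8492, 10453, 11418, 5988, 8548, 11620, 5489, 21157, 8402, 11441] (.comb
    (.cons 0 1 17572 (.cons 1 0 16978 (.cons 1 0 3079 .nil))) (.rows [3079, 16714, 17572, 21801]
    (.comb (.cons 1 0 17611 (.cons 0 1 17051 (.cons 0 1 17099 .nil))) (.rows [17051, 17099,
    17107, 17113, 22839, 18069, 22955, 17621, 18089, 18085, 18005, 17109, 22875, 17741, 17769,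
    17069, 17765, 17709, 19052, 19274, 17590, 23131, 23977, 19050, 18794, 19284, 19242, 19282,
    23257, 17814, 17718, 17842, 23243, 23195, 19030, 18010, 23341, 23883, 23723] (.comb (.cons 0
    1 17067 (.cons 2 0 17579 (.cons 0 4 17047 (.cons 0 1 17739 (.cons 2 0 17227 .nil))))) (.rows
    [17047, 17594, 17593, 22831, 17579, 17589, 17575, 17587, 17874, 17081, 17866, 17753, 17739,
    17067, 17754, 17749, 17077, 17833, 17829, 17717, 17722, 17721, 17063, 17707, 17813, 17075,
    17715, 17817, 17818, 17747, 20116, 19036, 23191, 17710, 19756, 18070, 18900, 19668, 23127,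
    17742, 17582, 23225, 17778] (.comb (.cons 0 1 4697 (.cons 1 0 4761 (.cons 0 1 4691 .nil)))
    (.comb (.cons 0 1 4693 (.cons 0 2 4691 (.cons 1 0 4757 .nil))) (.rows [4709, 4773, 4693,
    4757, 4697, 4681, 4713] (.comb (.cons 0 1 18772 (.cons 0 1 19028 (.cons 2 0 18764 (.cons 1 0
    18762 .nil)))) (.rows [18024] (.comb (.cons 0 1 19092 (.cons 2 0 19026 (.cons 0 2 18762
    (.cons 0 1 18770 (.cons 2 0 18836 .nil))))) (.rows [18762, 18772, 23722, 23850, 19026, 23849,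
    19028, 18770, 23882, 19092, 23721, 4900, 5860] (.comb (.cons 0 1 17061 (.cons 1 0 17045
    (.cons 0 1 17577 (.cons 1 0 17705 (.cons 0 1 17050 (.cons 1 0 23141 (.cons 0 1 17812 (.cons 1
    0 17714 (.cons 0 1 22889 (.cons 1 0 17610 .nil)))))))))) (.rows [16790, 17193, 22099] (.comb
    (.cons 1 0 9001 (.cons 0 1 8809 (.cons 0 1 8805 .nil))) (.rows [8502, 8805, 8809] (.comb
    (.cons 1 0 17577 (.cons 0 2 17049 (.cons 1 0 17065 (.cons 0 2 17705 (.cons 0 2 17045 (.cons 1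
    0 17573 (.cons 1 0 17061 .nil))))))) (.rows [16718, 4243] (.comb (.cons 1 0 17573 (.cons 0 1
    17045 (.cons 0 1 17061 .nil))) (.rows [16726, 17045, 17061, 22827, 17705, 17065, 21843,
    17577] (.comb (.cons 1 0 17714 (.cons 0 1 17586 (.cons 0 1 17574 .nil))) (.rows [16986,
    17574, 17586, 23129, 17706, 17578, 23209, 17738, 17746] (.comb (.cons 1 0 17716 (.cons 0 1
    17050 (.cons 0 1 17106 .nil))) (.rows [16746, 17050, 17098, 17106, 23130, 8525, 10907] (.comb
    (.cons 1 0 9522 (.cons 0 1 9382 (.cons 0 1 9394 .nil))) (.rows [9382, 9394, 4698, 9396,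
    11865, 4453, 4810, 4818, 4397, 5723, 4429, 9554, 9426, 8914, 8789, 8793, 9514, 9546, 9418,
    9386, 1189, 1193] (.comb (.cons 1 0 11859 (.cons 0 1 8598 (.cons 0 1 8614 .nil))) (.rows
    [8598, 8614, 4502, 9004, 11670, 4299, 4908, 8626, 8812, 11574, 4313, 4406, 4716, 5849, 4530,
    4324, 5689] (.comb (.cons 1 0 17708 (.cons 0 1 17074 (.cons 0 1 17046 .nil))) (.rows [16730,
    17046, 17074, 9388, 23126, 10903, 11595, 23125, 8523, 8854, 11565, 4427, 23123, 21845, 17066,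
    23205, 17748, 8533, 11563, 8874, 8876, 8534, 4269, 8538, 4267, 5719, 4441, 17740, 9548,
    11597, 21837, 11603, 8870, 8531, 23189, 17062, 11925, 5783, 9000, 8872, 8868, 8856, 11417,
    11433, 8804, 8532, 8596] (.comb (.cons 1 0 1543 (.cons 1 0 1807 (.cons 1 0 8852 (.cons 1 0
    8358 .nil)))) (.rows [8490, 11429, 11594, 11430, 4520, 5962, 4516, 4690, 4692, 5930] (.comb
    (.cons 0 1 4393 (.cons 0 1 4434 (.cons 1 0 4426 .nil))) (.rows [4452] (.comb (.cons 1 0 4428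
    (.cons 0 1 4262 (.cons 0 1 4274 .nil))) (.rows [4186, 4274, 5804] (.comb (.cons 0 1 4266
    (.cons 2 0 4393 (.cons 0 2 4261 (.cons 1 0 4436 (.cons 2 0 4298 (.cons 0 2 4265 (.cons 0 2
    4500 .nil))))))) (.rows [4182, 4261, 4396, 4393, 4265, 5459, 4434, 5785, 5453, 5781, 4436,
    5797, 4266, 5461] (.comb (.cons 1 0 2201 (.cons 0 1 2131 (.cons 0 1 2137 .nil))) (.rows
    [2094, 2131, 2137, 2197, 2213, 2217, 2133, 2198, 1431, 2348, 2891, 2378, 2214, 2905, 2226,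
    2220, 1067, 2134, 2899, 2218, 2965] .nil))))))))))))))))))))))))))))))))))))))))))
    [((.cons 8 0 4298 (.cons 9 0 2150 (.cons 0 9 2162 (.cons 9 0 2252 (.cons 9 0 2345 (.cons 0 18
    2354 .nil)))))), (.cons 0 192 (mon []) (.cons 0 48 (mon [7]) (.cons 0 48 (mon [11]) (.cons 48
    0 (mon [37]) (.cons 48 0 (mon [41]) (.cons 48 0 (mon [43]) (.cons 48 0 (mon [47])
    .nil)))))))), ((.cons 0 1 4298 .nil), (.cons 0 192 (mon []) (.cons 36 0 (mon [13]) (.cons 0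
    48 (mon [7]) (.cons 240 0 (mon [11]) (.cons 48 0 (mon [37]) (.cons 48 0 (mon [41]) (.cons 48
    0 (mon [43]) (.cons 48 0 (mon [47]) (.cons 72 0 (mon [7, 11]) (.cons 0 36 (mon [7, 37])
    (.cons 36 0 (mon [7, 43]) (.cons 72 0 (mon [11, 11]) (.cons 0 108 (mon [11, 37]) (.cons 0 72
    (mon [11, 41]) (.cons 0 36 (mon [11, 43]) (.cons 0 72 (mon [11, 47]) .nil))))))))))))))))),
    ((.cons 0 2 2150 (.cons 1 0 2154 (.cons 1 0 2162 (.cons 0 4 2345 .nil)))), (.cons 0 384 (mon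
    []) (.cons 48 0 (mon [13]) (.cons 0 64 (mon [7]) (.cons 640 0 (mon [11]) (.cons 96 0 (mon
    [37]) (.cons 96 0 (mon [41]) (.cons 96 0 (mon [43]) (.cons 96 0 (mon [47]) (.cons 0 12 (mon
    [7, 13]) (.cons 0 24 (mon [11, 13]) (.cons 8 0 (mon [13, 37]) (.cons 8 0 (mon [13, 41])
    (.cons 8 0 (mon [13, 43]) (.cons 8 0 (mon [13, 47]) (.cons 8 0 (mon [7, 7]) (.cons 112 0 (mon
    [7, 11]) (.cons 0 80 (mon [7, 37]) (.cons 0 16 (mon [7, 41]) (.cons 80 0 (mon [7, 43]) (.cons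
    0 16 (mon [7, 47]) (.cons 8 0 (mon [11, 11]) (.cons 0 256 (mon [11, 37]) (.cons 0 192 (mon
    [11, 41]) (.cons 0 96 (mon [11, 43]) (.cons 0 192 (mon [11, 47]) (.cons 0 24 (mon [7, 7, 11])
    (.cons 20 0 (mon [7, 7, 37]) (.cons 0 4 (mon [7, 7, 41]) (.cons 0 4 (mon [7, 7, 43]) (.cons 0
    4 (mon [7, 7, 47]) (.cons 0 72 (mon [7, 11, 11]) (.cons 60 0 (mon [7, 11, 37]) (.cons 24 0
    (mon [7, 11, 41]) (.cons 0 12 (mon [7, 11, 43]) (.cons 24 0 (mon [7, 11, 47]) (.cons 0 48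
    (mon [11, 11, 11]) (.cons 64 0 (mon [11, 11, 37]) (.cons 52 0 (mon [11, 11, 41]) (.cons 16 0
    (mon [11, 11, 43]) (.cons 52 0 (mon [11, 11, 47])
    .nil))))))))))))))))))))))))))))))))))))))))), ((.cons 1 0 2149 (.cons 1 0 2150 (.cons 0 1
    2153 (.cons 0 1 2154 (.cons 0 4 2162 (.cons 3 0 2252 (.cons 9 0 2345 .nil))))))), (.cons 256
    0 (mon []) (.cons 0 224 (mon [13]) (.cons 0 320 (mon [7]) (.cons 0 576 (mon [11]) (.cons 0 64
    (mon [37]) (.cons 0 64 (mon [41]) (.cons 0 64 (mon [43]) (.cons 0 64 (mon [47]) (.cons 0 24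
    (mon [11, 13]) (.cons 72 0 (mon [13, 37]) (.cons 48 0 (mon [13, 41]) (.cons 24 0 (mon [13,
    43]) (.cons 48 0 (mon [13, 47]) (.cons 0 104 (mon [7, 7]) (.cons 112 0 (mon [7, 11]) (.cons
    160 0 (mon [7, 37]) (.cons 96 0 (mon [7, 41]) (.cons 32 0 (mon [7, 43]) (.cons 96 0 (mon [7,
    47]) (.cons 24 0 (mon [11, 11]) (.cons 224 0 (mon [11, 37]) (.cons 160 0 (mon [11, 41])
    (.cons 96 0 (mon [11, 43]) (.cons 160 0 (mon [11, 47]) (.cons 96 0 (mon [7, 7, 11]) (.cons 0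
    40 (mon [7, 7, 37]) (.cons 0 4 (mon [7, 7, 41]) (.cons 56 0 (mon [7, 7, 43]) (.cons 0 4 (mon
    [7, 7, 47]) (.cons 144 0 (mon [7, 11, 11]) (.cons 0 152 (mon [7, 11, 37]) (.cons 0 104 (mon
    [7, 11, 41]) (.cons 0 8 (mon [7, 11, 43]) (.cons 0 104 (mon [7, 11, 47]) (.cons 48 0 (mon
    [11, 11, 11]) (.cons 0 64 (mon [11, 11, 37]) (.cons 0 52 (mon [11, 11, 41]) (.cons 0 16 (mon
    [11, 11, 43]) (.cons 0 52 (mon [11, 11, 47]) .nil)))))))))))))))))))))))))))))))))))))))),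
    ((.cons 3 0 2149 (.cons 0 3 2150 (.cons 1 0 2153 (.cons 1 0 2154 (.cons 0 2 2162 (.cons 3 0
    2252 (.cons 0 5 2345 .nil))))))), (.cons 0 384 (mon []) (.cons 96 0 (mon [13]) (.cons 640 0
    (mon [7]) (.cons 640 0 (mon [11]) (.cons 96 0 (mon [37]) (.cons 96 0 (mon [41]) (.cons 96 0
    (mon [43]) (.cons 96 0 (mon [47]) (.cons 0 144 (mon [7, 13]) (.cons 0 24 (mon [11, 13])
    (.cons 8 0 (mon [13, 37]) (.cons 0 16 (mon [13, 41]) (.cons 8 0 (mon [13, 43]) (.cons 0 16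
    (mon [13, 47]) (.cons 184 0 (mon [7, 7]) (.cons 0 720 (mon [7, 11]) (.cons 0 256 (mon [7,
    37]) (.cons 0 192 (mon [7, 41]) (.cons 0 96 (mon [7, 43]) (.cons 0 192 (mon [7, 47]) (.cons
    56 0 (mon [11, 11]) (.cons 0 256 (mon [11, 37]) (.cons 0 192 (mon [11, 41]) (.cons 0 96 (mon
    [11, 43]) (.cons 0 192 (mon [11, 47]) (.cons 0 264 (mon [7, 7, 11]) (.cons 128 0 (mon [7, 7,
    37]) (.cons 0 4 (mon [7, 7, 41]) (.cons 0 136 (mon [7, 7, 43]) (.cons 0 4 (mon [7, 7, 47])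
    (.cons 0 288 (mon [7, 11, 11]) (.cons 408 0 (mon [7, 11, 37]) (.cons 264 0 (mon [7, 11, 41])
    (.cons 120 0 (mon [7, 11, 43]) (.cons 264 0 (mon [7, 11, 47]) (.cons 0 24 (mon [11, 11, 11])
    (.cons 40 0 (mon [11, 11, 37]) (.cons 28 0 (mon [11, 11, 41]) (.cons 16 0 (mon [11, 11, 43])
    (.cons 28 0 (mon [11, 11, 47]) .nil))))))))))))))))))))))))))))))))))))))))), ((.cons 0 1
    2149 (.cons 5 0 2150 (.cons 1 0 2153 (.cons 0 2 2154 (.cons 0 1 2162 (.cons 0 3 2252 (.cons 9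
    0 2345 .nil))))))), (.cons 816 0 (mon []) (.cons 0 160 (mon [13]) (.cons 0 72 (mon [7])
    (.cons 0 1352 (mon [11]) (.cons 0 192 (mon [37]) (.cons 0 216 (mon [41]) (.cons 0 192 (mon
    [43]) (.cons 0 216 (mon [47]) (.cons 60 0 (mon [7, 13]) (.cons 24 0 (mon [11, 13]) (.cons 0
    64 (mon [7, 7]) (.cons 0 16 (mon [7, 11]) (.cons 272 0 (mon [7, 37]) (.cons 48 0 (mon [7,
    41]) (.cons 0 80 (mon [7, 43]) (.cons 48 0 (mon [7, 47]) (.cons 0 96 (mon [11, 11]) (.cons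
    544 0 (mon [11, 37]) (.cons 416 0 (mon [11, 41]) (.cons 192 0 (mon [11, 43]) (.cons 416 0
    (mon [11, 47]) (.cons 120 0 (mon [7, 7, 11]) (.cons 0 44 (mon [7, 7, 37]) (.cons 0 8 (mon [7,
    7, 41]) (.cons 52 0 (mon [7, 7, 43]) (.cons 0 8 (mon [7, 7, 47]) (.cons 192 0 (mon [7, 11,
    11]) (.cons 0 220 (mon [7, 11, 37]) (.cons 0 88 (mon [7, 11, 41]) (.cons 0 52 (mon [7, 11,
    43]) (.cons 0 88 (mon [7, 11, 47]) (.cons 72 0 (mon [11, 11, 11]) (.cons 0 104 (mon [11, 11,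
    37]) (.cons 0 80 (mon [11, 11, 41]) (.cons 0 32 (mon [11, 11, 43]) (.cons 0 80 (mon [11, 11,
    47]) .nil))))))))))))))))))))))))))))))))))))), ((.cons 18 0 2150 (.cons 0 9 2154 (.cons 0 17
    2162 (.cons 48 0 2345 .nil)))), (.cons 3520 0 (mon []) (.cons 0 624 (mon [13]) (.cons 0 32
    (mon [7]) (.cons 0 5600 (mon [11]) (.cons 0 880 (mon [37]) (.cons 0 880 (mon [41]) (.cons 0
    880 (mon [43]) (.cons 0 880 (mon [47]) (.cons 204 0 (mon [7, 13]) (.cons 120 0 (mon [11, 13])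
    (.cons 0 24 (mon [13, 37]) (.cons 0 24 (mon [13, 41]) (.cons 0 24 (mon [13, 43]) (.cons 0 24
    (mon [13, 47]) (.cons 0 216 (mon [7, 7]) (.cons 0 144 (mon [7, 11]) (.cons 816 0 (mon [7,
    37]) (.cons 240 0 (mon [7, 41]) (.cons 0 528 (mon [7, 43]) (.cons 240 0 (mon [7, 47]) (.cons
    0 144 (mon [7, 53]) (.cons 0 408 (mon [11, 11]) (.cons 2208 0 (mon [11, 37]) (.cons 1632 0
    (mon [11, 41]) (.cons 864 0 (mon [11, 43]) (.cons 1632 0 (mon [11, 47]) (.cons 0 144 (mon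
    [11, 53]) (.cons 480 0 (mon [7, 7, 11]) (.cons 0 252 (mon [7, 7, 37]) (.cons 12 0 (mon [7, 7,
    41]) (.cons 132 0 (mon [7, 7, 43]) (.cons 12 0 (mon [7, 7, 47]) (.cons 840 0 (mon [7, 11,
    11]) (.cons 0 876 (mon [7, 11, 37]) (.cons 0 504 (mon [7, 11, 41]) (.cons 0 132 (mon [7, 11,
    43]) (.cons 0 360 (mon [7, 11, 47]) (.cons 360 0 (mon [11, 11, 11]) (.cons 0 504 (mon [11,
    11, 37]) (.cons 0 396 (mon [11, 11, 41]) (.cons 0 144 (mon [11, 11, 43]) (.cons 0 252 (mon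
    [11, 11, 47]) .nil))))))))))))))))))))))))))))))))))))))))))), ((.cons 0 6 2149 (.cons 6 0
    2150 (.cons 0 6 2153 (.cons 0 3 2154 (.cons 23 0 2162 (.cons 0 18 2252 .nil)))))), (.cons
    1280 0 (mon []) (.cons 0 192 (mon [13]) (.cons 0 1600 (mon [7]) (.cons 0 2176 (mon [11])
    (.cons 0 320 (mon [37]) (.cons 0 320 (mon [41]) (.cons 0 320 (mon [43]) (.cons 0 320 (mon
    [47]) (.cons 372 0 (mon [7, 13]) (.cons 96 0 (mon [11, 13]) (.cons 0 48 (mon [13, 37]) (.cons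
    24 0 (mon [13, 41]) (.cons 0 48 (mon [13, 43]) (.cons 0 48 (mon [13, 47]) (.cons 0 480 (mon
    [7, 7]) (.cons 1680 0 (mon [7, 11]) (.cons 912 0 (mon [7, 37]) (.cons 576 0 (mon [7, 41])
    (.cons 144 0 (mon [7, 43]) (.cons 432 0 (mon [7, 47]) (.cons 144 0 (mon [7, 53]) (.cons 0 240
    (mon [11, 11]) (.cons 1056 0 (mon [11, 37]) (.cons 720 0 (mon [11, 41]) (.cons 288 0 (mon
    [11, 43]) (.cons 576 0 (mon [11, 47]) (.cons 144 0 (mon [11, 53]) (.cons 672 0 (mon [7, 7,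
    11]) (.cons 0 300 (mon [7, 7, 37]) (.cons 48 0 (mon [7, 7, 41]) (.cons 324 0 (mon [7, 7, 43])
    (.cons 0 24 (mon [7, 7, 47]) (.cons 744 0 (mon [7, 11, 11]) (.cons 0 1020 (mon [7, 11, 37])
    (.cons 0 600 (mon [7, 11, 41]) (.cons 0 324 (mon [7, 11, 43]) (.cons 0 744 (mon [7, 11, 47])
    (.cons 72 0 (mon [11, 11, 11]) (.cons 0 120 (mon [11, 11, 37]) (.cons 0 48 (mon [11, 11, 41])
    (.cons 0 48 (mon [11, 11, 43]) (.cons 0 120 (mon [11, 11, 47])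
    .nil))))))))))))))))))))))))))))))))))))))))))), ((.cons 1 0 1081 .nil), (.cons 4 0 (mon
    [13]) (.cons 0 12 (mon [7]) (.cons 0 4 (mon [11]) (.cons 4 0 (mon [13, 13]) (.cons 0 28 (mon
    [7, 13]) (.cons 12 0 (mon [11, 13]) (.cons 8 0 (mon [13, 53]) (.cons 0 30 (mon [7, 7]) (.cons
    0 56 (mon [7, 11]) (.cons 2 0 (mon [7, 37]) (.cons 2 0 (mon [7, 41]) (.cons 4 0 (mon [7, 43])
    (.cons 4 0 (mon [7, 47]) (.cons 6 0 (mon [11, 11]) (.cons 2 0 (mon [11, 37]) (.cons 2 0 (mon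
    [11, 41]) (.cons 0 10 (mon [7, 7, 13]) (.cons 0 8 (mon [7, 11, 13]) (.cons 18 0 (mon [7, 13,
    37]) (.cons 10 0 (mon [7, 13, 41]) (.cons 12 0 (mon [7, 13, 43]) (.cons 12 0 (mon [7, 13,
    47]) (.cons 0 2 (mon [11, 11, 13]) (.cons 2 0 (mon [11, 13, 37]) (.cons 2 0 (mon [11, 13,
    41]) (.cons 0 8 (mon [11, 13, 47]) (.cons 0 10 (mon [7, 7, 7]) (.cons 0 74 (mon [7, 7, 11])
    (.cons 36 0 (mon [7, 7, 37]) (.cons 4 0 (mon [7, 7, 41]) (.cons 16 0 (mon [7, 7, 43]) (.cons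
    12 0 (mon [7, 7, 47]) (.cons 26 0 (mon [7, 7, 53]) (.cons 38 0 (mon [7, 11, 11]) (.cons 32 0
    (mon [7, 11, 37]) (.cons 32 0 (mon [7, 11, 41]) (.cons 24 0 (mon [7, 11, 47]) (.cons 24 0
    (mon [7, 11, 53]) (.cons 0 2 (mon [11, 11, 11]) (.cons 0 4 (mon [11, 11, 37]) (.cons 0 4 (mon
    [11, 11, 41]) (.cons 0 4 (mon [11, 11, 47]) (.cons 0 2 (mon [11, 11, 53]) (.cons 0 17 (mon
    [7, 7, 7, 11]) (.cons 11 0 (mon [7, 7, 7, 37]) (.cons 0 3 (mon [7, 7, 7, 41]) (.cons 8 0 (mon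
    [7, 7, 7, 43]) (.cons 1 0 (mon [7, 7, 7, 47]) (.cons 0 7 (mon [7, 7, 11, 11]) (.cons 17 0
    (mon [7, 7, 11, 37]) (.cons 33 0 (mon [7, 7, 11, 41]) (.cons 12 0 (mon [7, 7, 11, 43]) (.cons
    1 0 (mon [7, 7, 11, 47]) (.cons 9 0 (mon [7, 11, 11, 11]) (.cons 0 9 (mon [7, 11, 11, 37])
    (.cons 0 11 (mon [7, 11, 11, 41]) (.cons 0 33 (mon [7, 11, 11, 47]) (.cons 0 1 (mon [11, 11,
    11, 11]) (.cons 1 0 (mon [11, 11, 11, 37]) (.cons 1 0 (mon [11, 11, 11, 41]) (.cons 3 0 (mon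
    [11, 11, 11, 47]) .nil))))))))))))))))))))))))))))))))))))))))))))))))))))))))))))))] = true := by
  decide +kernel

end Elim

/-! ### The remaining polynomial equations, and the values of mu, nu, ep, ph -/

namespace Elim

/-- The points of the curves cut out by the equations for the unknowns in the symmetric case. -/
theorem center_points {S d r w p q : ℂ} (hS : S ≠ 0)
    (ha : -8 / 3 * S - 1 / 3 * S ^ 2 * d + 2 / 3 * S ^ 2 * r - 2 * S * d + S * d * w
      + 4 / 3 * S * w = 0)
    (hb : -S ^ 2 - 1 / 6 * S ^ 3 + 1 / 2 * S ^ 2 * w + 4 / 3 * S * r + S * r ^ 2 = 0)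
    (hc : -4 / 3 * S - S ^ 2 - 1 / 6 * S ^ 2 * d - 7 / 6 * S ^ 2 * r - 2 * S * r + S * r * w
      + 2 / 3 * S * w = 0)
    (hd : -8 / 3 + 2 / 3 * S ^ 2 + 2 / 9 * S ^ 3 - 1 / 3 * S ^ 2 * w - 4 / 3 * S * d
      - 2 / 3 * S * d ^ 2 + 2 / 3 * S * d * r + 8 / 9 * S * r - 16 / 3 * d - 2 * d ^ 2 + d ^ 2 * w
      + 8 / 3 * d * w + 4 / 3 * w = 0)
    (he : 2 / 3 * S + 2 * S ^ 2 + 5 / 6 * S ^ 3 - 2 / 3 * S ^ 2 * d - 2 / 3 * S ^ 2 * r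
      - S ^ 2 * p - S ^ 2 * w - S * d + 1 / 2 * S * d * r + S * d * p - 2 / 3 * S * r - 2 * S * q
      - 4 / 3 * S * w = 0)
    (hf : -8 / 3 * S - 2 * S ^ 2 - 1 / 2 * S ^ 3 + 1 / 6 * S ^ 2 * d + 1 / 6 * S ^ 2 * r
      + S ^ 2 * p + 1 / 2 * S ^ 2 * w + S * r * p + 2 * S * p + 2 * S * q + 4 / 3 * S * w = 0)
    (hk : 1 / 2 * S * r + 3 / 4 * S ^ 2 * r ^ 2 + 3 / 4 * S ^ 2 * r + 13 / 4 * S * d * r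
      + 29 / 32 * S ^ 2 * d * r + 3 / 4 * S ^ 2 * r * w - 3 / 8 * S * d * r * w
      + 1 / 8 * S * d * r ^ 2 + 1 / 2 * S ^ 2 * r * p - 3 / 4 * S * d * r * p - 3 / 8 * S ^ 3 * r
      + S * r * q + 1 / 2 * d + 7 / 4 * S ^ 2 - d ^ 2 - 3 / 2 * S ^ 3 + 5 / 8 * S ^ 2 * d
      + 9 / 4 * S * d ^ 2 - 5 / 8 * d ^ 3 - 9 / 16 * S ^ 4 + 1 / 16 * S ^ 3 * d - 1 / 8 * S * d ^ 3
      + 3 / 4 * S ^ 3 * w + 9 / 32 * S ^ 2 * d * w - 3 / 8 * S * d ^ 2 * w + 13 / 32 * d ^ 3 * w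
      - 3 / 32 * d ^ 3 * r + 3 / 4 * S ^ 3 * p + 1 / 16 * S ^ 2 * d * p - 9 / 8 * S * d ^ 2 * p
      - 3 / 16 * d ^ 3 * p + 3 / 4 * S ^ 2 * d ^ 2 + 1 / 4 * S ^ 2 * w + 3 / 4 * S * d * w
      + 3 / 4 * d ^ 2 * w - 1 / 4 * d ^ 2 * r - 1 / 2 * S * d * p - 1 / 2 * d ^ 2 * p
      + 3 / 2 * S ^ 2 * q + 7 / 4 * S * d * q + 2 * S * d - 1 / 8 * d * w - 1 / 8 * d * r
      - 1 / 4 * d * p = 0) :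
    r = -1 ∧ (d = -1 ∧ (S = 1 ∨ S = -1) ∨ d = 0 ∧ (S = 2 ∨ S = -2)) := by
  have hSS : S ^ 2 ≠ 0 := pow_ne_zero 2 hS
  -- As S ≠ 0, `hb` determines w; this eliminates w from `ha` and `hc` and leaves the relations `a'`
  -- and `c'` between S², d and r.
  have b' : S * (w - 2) = S ^ 2 / 3 - 2 * r ^ 2 - 8 / 3 * r :=
    mul_left_cancel₀ hS (by linear_combination 2 * hb)
  have a' : 2 * r * (r + 4 / 3) * (d + 4 / 3) = 2 / 3 * S ^ 2 * (r + 2 / 3) := by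
    linear_combination -ha + (d + 4 / 3) * b'
  have c' : -2 * r * (r + 4 / 3) * (r + 2 / 3) = S ^ 2 * (7 / 9 + d / 6 + 5 / 6 * r) := by
    linear_combination hc - (r + 2 / 3) * b'
  have hr : r ≠ 0 := by
    rintro rfl
    exact hSS (by linear_combination -9 / 4 * a')
  -- Eliminating r (r + 4/3) between `a'` and `c'` leaves S² times a quadratic polynomial in d and
  -- r, which splits into two lines.
  have hq : (d + r + 2) * (d + 4 * r + 4) = 0 :=
    mul_left_cancel₀ hSS (by linear_combination -6 * (d + 4 / 3) * c' - 6 * (r + 2 / 3) * a')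
  -- In the sum of `he` and `hf` the unknown q cancels.
  have hsum : -2 + S ^ 2 / 3 - S * (d + r + w) / 2 - d + d * r / 2 - 2 / 3 * r
      + p * (r + d + 2) = 0 := mul_left_cancel₀ hS (by linear_combination he + hf)
  -- On the first line the points lie on a conic. After w and q are eliminated there, `hk` reduces
  -- to S r (r + 1)² = 0, and p cancels as well.
  have onCurve : d = -2 - r → S ^ 2 = -3 * r ^ 2 - 4 * r → r = -1 ∧ d = -1 ∧ (S = 1 ∨ S = -1) := by
    intro h1 h2
    have hw : w = S + 2 := mul_left_cancel₀ hS (by linear_combination b' - 2 / 3 * h2)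
    have hq : q = (8 / 3 + 2 * S + 1 / 2 * S ^ 2 - 1 / 6 * S * d - 1 / 6 * S * r - S * p
        - 1 / 2 * S * w - r * p - 2 * p - 4 / 3 * w) / 2 :=
      mul_left_cancel₀ hS (by linear_combination hf / 2)
    have h3 : r = -1 := by
      subst h1 hw hq
      have h4 : (r + 1) ^ 2 = 0 := by
        refine mul_left_cancel₀ (mul_ne_zero hS hr) ?_
        linear_combination -2 * hk - (1 / 4 + 7 / 8 * S - 3 / 8 * S ^ 2 - 1 / 16 * S * r
          - 1 / 16 * r ^ 2 - 1 / 8 * r * p - 1 / 4 * p) * h2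
      linear_combination pow_eq_zero_iff (two_ne_zero) |>.1 h4
    subst h3
    refine ⟨rfl, by linear_combination h1, ?_⟩
    rw [← sq_eq_sq_iff_eq_or_eq_neg]
    linear_combination h2
  -- The two lines meet at r = -2/3, where `a'` does not determine S².
  by_cases hx : r = -(2 / 3)
  · subst hx
    have hd' : d = -(4 / 3) := by
      have : d + 4 / 3 = 0 := by
        have h1 : (d + 4 / 3) ^ 2 = 0 := by linear_combination hq
        exact pow_eq_zero_iff (two_ne_zero) |>.1 h1
      linear_combination this
    subst hd'
    have h3 : (S ^ 2 + 8 / 3) * (S ^ 2 - 4 / 3) = 0 := by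
      linear_combination 9 * S * hd - 9 * (-4 / 9 - S ^ 2 / 3) * b'
    rcases mul_eq_zero.1 h3 with h | h
    -- On this factor S² = -8/3. The coefficient r + d + 2 of p in `hsum` is zero at the
    -- intersection point, so `hsum` becomes a numerical contradiction.
    · have : (-2 / 3 : ℂ) = 0 := by linear_combination hsum + b' / 2 - h / 6
      norm_num at this
    · obtain ⟨h1, h2⟩ := onCurve (by norm_num) (by linear_combination h)
      exact ⟨h1, Or.inl h2⟩
  have hx' : r + 2 / 3 ≠ 0 := fun h => hx (by linear_combination h)
  rcases mul_eq_zero.1 hq with h | h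
  · obtain ⟨h1, h2⟩ := onCurve (by linear_combination h) (mul_left_cancel₀ hx' (by
      have : d = -2 - r := by linear_combination h
      subst this
      linear_combination -3 / 2 * a'))
    exact ⟨h1, Or.inl h2⟩
  -- On the second line `a'` gives another conic, and `hd` cuts out r = -1 and r = -1/3 on it.
  · have h1 : d = -4 - 4 * r := by linear_combination h
    subst h1
    have h2 : S ^ 2 = -12 * r ^ 2 - 16 * r :=
      mul_left_cancel₀ hx' (by linear_combination -3 / 2 * a')
    have hw : w = S / 2 + 2 := mul_left_cancel₀ hS (by linear_combination b' - 1 / 6 * h2)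
    subst hw
    have h3 : (r + 1) * (r + 1 / 3) = 0 :=
      mul_left_cancel₀ hS (by linear_combination -1 / 6 * hd + 1 / 108 * S * h2)
    rcases mul_eq_zero.1 h3 with h | h
    · have h4 : r = -1 := by linear_combination h
      subst h4
      refine ⟨rfl, Or.inr ⟨by norm_num, ?_⟩⟩
      rw [← sq_eq_sq_iff_eq_or_eq_neg]
      linear_combination h2
    -- At r = -1/3 one has S = ±2; `hsum` gives p, and then `hk` and `hf` are incompatible for
    -- either sign.
    · exfalso
      have h4 : r = -(1 / 3) := by linear_combination h
      subst h4
      have h5 : S = 2 ∨ S = -2 := by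
        rw [← sq_eq_sq_iff_eq_or_eq_neg]
        linear_combination h2
      have h6 : p = 5 / 3 + S / 2 := by linear_combination -hsum + 1 / 12 * h2
      subst h6
      rcases h5 with rfl | rfl
      · have : (-4 / 27 : ℂ) = 0 := by linear_combination hk + hf
        norm_num at this
      · have : (4 / 27 : ℂ) = 0 := by linear_combination hk + 4 * hf
        norm_num at this

/-- The certificates are applied in stages: values found at one stage enter the next one as
constants, which keeps the polynomials small. -/
theorem Sol.alNegOne {V : Pars ℂ} {g : List Bool → ℂ} (h : Sol V g) (ha : V.al = -1) (hb : V.be = 1)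
    (hg : V.ga = 0) :
    V.mu = 0 ∧ V.nu = 0 ∧ V.ep = 0 ∧ V.ph ^ 2 = V.k₁ ^ 2 + 4 * V.k₃ := by
  have hmu : V.mu = 0 ∧ V.nu = 0 := by
    obtain ⟨s, key⟩ := h.elim_exists alNegOne_check (fun s => by
      obtain ⟨-, -, -, e⟩ := ev_gen V s
      exact ⟨ev_const_of (by simp [ha]), ev_const_of (by simp [hb]), ev_nil_of hg, e⟩) (by simp)
    simpa [AllZero, Poly.ev, mev_asg, mev_mon_nil] using key
  have hep : V.ep = 0 := by
    obtain ⟨s, key⟩ := h.elim_exists alNegOneMuNu_check (fun s => by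
      obtain ⟨-, -, -, -, -, e⟩ := ev_gen V s
      exact ⟨ev_const_of (by simp [ha]), ev_const_of (by simp [hb]), ev_nil_of hg,
        ev_nil_of hmu.1, ev_nil_of hmu.2, e⟩) (by simp)
    simpa [AllZero, Poly.ev, mev_asg, mev_mon_nil] using key
  refine ⟨hmu.1, hmu.2, hep, ?_⟩
  obtain ⟨s, key⟩ := h.elim_exists alNegOneMuNuEp_check (fun s => by
    obtain ⟨-, -, -, -, -, -, e⟩ := ev_gen V s
    exact ⟨ev_const_of (by simp [ha]), ev_const_of (by simp [hb]), ev_nil_of hg,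
      ev_nil_of hmu.1, ev_nil_of hmu.2, ev_nil_of hep, e⟩) (by simp)
  simp only [AllZero, Poly.ev, mev_asg, mev_mon_nil] at key
  linear_combination key.1 / 6

theorem Sol.alTwo {V : Pars ℂ} {g : List Bool → ℂ} (h : Sol V g) (ha : V.al = 2) (hb : V.be = 1)
    (hg : V.ga = 0) :
    V.mu = -4 ∧ V.nu = 0 ∧ V.ep = 1 ∧
      V.ph ^ 2 + 3 * V.k₁ * V.ph + 2 * V.k₁ ^ 2 = V.k₃ := by
  have hmu : V.mu = -4 ∧ V.nu = 0 := by
    obtain ⟨s, key⟩ := h.elim_exists alTwo_check (fun s => by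
      obtain ⟨-, -, -, e⟩ := ev_gen V s
      exact ⟨ev_const_of (by simp [ha]), ev_const_of (by simp [hb]), ev_nil_of hg, e⟩) (by simp)
    simp only [AllZero, Poly.ev, mev_asg, mev_mon_nil] at key
    exact ⟨by linear_combination key.1, by linear_combination key.2.1 / 4⟩
  have hep : V.ep = 1 := by
    obtain ⟨s, key⟩ := h.elim_exists alTwoMuNu_check (fun s => by
      obtain ⟨-, -, -, -, -, e⟩ := ev_gen V s
      exact ⟨ev_const_of (by simp [ha]), ev_const_of (by simp [hb]), ev_nil_of hg,
        ev_const_of (by simp [hmu]), ev_nil_of hmu.2, e⟩) (by simp)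
    simp only [AllZero, Poly.ev, mev_asg, mev_mon_nil] at key
    linear_combination key.1 / 6
  refine ⟨hmu.1, hmu.2, hep, ?_⟩
  obtain ⟨s, key⟩ := h.elim_exists alTwoMuNuEp_check (fun s => by
    obtain ⟨-, -, -, -, -, -, e⟩ := ev_gen V s
    exact ⟨ev_const_of (by simp [ha]), ev_const_of (by simp [hb]), ev_nil_of hg,
      ev_const_of (by simp [hmu]), ev_nil_of hmu.2, ev_const_of (by simp [hep]), e⟩) (by simp)
  simp only [AllZero, Poly.ev, mev_asg, mev_mon_nil] at key
  linear_combination key.1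

theorem Sol.alZero {V : Pars ℂ} {g : List Bool → ℂ} (h : Sol V g) (ha : V.al = 0) (hb : V.be = 1)
    (hg : V.ga = 0) :
    V.nu = 0 ∧ (V.mu = -2 ∧ V.ep = 1 ∨ V.mu = -1 ∧ V.ep = 0 ∨ V.mu = 0 ∧ V.ep = -1) ∧
      V.ph ^ 2 + V.k₁ * V.ph = V.k₃ := by
  have hnu : V.nu = 0 := by
    obtain ⟨s, key⟩ := h.elim_exists alZero_check (fun s => by
      obtain ⟨-, -, -, e⟩ := ev_gen V s
      exact ⟨ev_nil_of ha, ev_const_of (by simp [hb]), ev_nil_of hg, e⟩) (by simp)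
    simpa [AllZero, Poly.ev, mev_asg, mev_mon_nil] using key
  have hP (s : ℕ → ℂ) : alZeroNu.Ev (asg V s) V := by
    obtain ⟨-, -, -, e1, -, e2⟩ := ev_gen V s
    exact ⟨ev_nil_of ha, ev_const_of (by simp [hb]), ev_nil_of hg, e1, ev_nil_of hnu, e2⟩
  refine ⟨hnu, ?_, ?_⟩
  · obtain ⟨s, key⟩ := h.elim_exists alZeroNu_check_mu hP (by simp)
    simp only [AllZero, Poly.ev, mev_asg, mev_mon_nil] at key
    obtain ⟨k1, k2, k3, -⟩ := key
    push_cast at k1 k2 k3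
    -- The relation `k2` is 18 (ep - 1)(mu s 1 + ep + 1) = 0.
    by_cases he : V.ep = 1
    · rw [he] at k1
      have h3 : (V.mu + 2) ^ 3 = 0 := by linear_combination k1 / 48
      have h4 : V.mu + 2 = 0 := pow_eq_zero_iff (three_ne_zero) |>.1 h3
      exact Or.inl ⟨by linear_combination h4, he⟩
    · have h1 : V.mu * s 1 = -(1 + V.ep) :=
        mul_left_cancel₀ (sub_ne_zero.2 he) (by linear_combination k2 / 18)
      -- After multiplication of `k3` by mu, the unknown s 1 occurs only in the product mu s 1 = -(1
      -- + ep), and the result is a square.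
      have h2 : (V.ep + V.mu + 1) ^ 2 = 0 := by
        linear_combination -V.mu / 36 * k3
          + (V.ep + V.mu ^ 2 / 2 + 2 * V.mu + 1) * h1
      have h3 : V.ep = -1 - V.mu := by
        linear_combination pow_eq_zero_iff (two_ne_zero) |>.1 h2
      rw [h3] at k1
      have h4 : (V.mu + 1) * (V.mu * (V.mu + 2)) = 0 := by linear_combination -k1 / 24
      rcases mul_eq_zero.1 h4 with h5 | h5
      · exact Or.inr (Or.inl ⟨by linear_combination h5, by linear_combination h3 - h5⟩)
      rcases mul_eq_zero.1 h5 with h6 | h6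
      · exact Or.inr (Or.inr ⟨h6, by linear_combination h3 - h6⟩)
      · exact absurd (by linear_combination h3 - h6) he
  · obtain ⟨s, key⟩ := h.elim_exists alZeroNu_check_ph hP (by simp)
    simp only [AllZero, Poly.ev, mev_asg, mev_mon_nil] at key
    linear_combination key.1 / 2

theorem Sol.alOne {V : Pars ℂ} {g : List Bool → ℂ} (h : Sol V g) (ha : V.al = 1) (hb : V.be = 1)
    (hg : V.ga = 0) :
    V.nu = 0 ∧ (V.mu = -3 ∧ V.ep = 1 ∨ V.mu = -2 ∧ V.ep = 0 ∨ V.mu = -4 ∧ V.ep = 2) ∧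
      V.ph = -V.k₁ := by
  have hnu : V.nu = 0 := by
    obtain ⟨s, key⟩ := h.elim_exists alOne_check (fun s => by
      obtain ⟨-, -, -, e⟩ := ev_gen V s
      exact ⟨ev_const_of (by simp [ha]), ev_const_of (by simp [hb]), ev_nil_of hg, e⟩) (by simp)
    simpa [AllZero, Poly.ev, mev_asg, mev_mon_nil] using key
  have hP (s : ℕ → ℂ) : alOneNu.Ev (asg V s) V := by
    obtain ⟨-, -, -, e1, -, e2⟩ := ev_gen V s
    exact ⟨ev_const_of (by simp [ha]), ev_const_of (by simp [hb]), ev_nil_of hg, e1,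
      ev_nil_of hnu, e2⟩
  refine ⟨hnu, ?_, ?_⟩
  · obtain ⟨s, key⟩ := h.elim_exists alOneNu_check_mu hP (by simp)
    simp only [AllZero, Poly.ev, mev_asg, mev_mon_nil] at key
    obtain ⟨k1, k2, k3, k4, -⟩ := key
    push_cast at k1 k2 k3 k4
    have h1 : s 2 = 2 := by linear_combination k1 / 8
    rw [h1] at k4
    -- With s 2 = 2 the relation `k4` factors, and on each of its branches `k3` becomes a product of
    -- linear factors in mu alone.
    have h2 : V.ep * (10 - V.ep + 6 * V.mu + V.mu ^ 2) = 0 := by linear_combination k4 / 144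
    rcases mul_eq_zero.1 h2 with h3 | h3
    · rw [h3] at k3
      have h4 : (V.mu + 2) ^ 3 = 0 := by linear_combination k3 / 96
      exact Or.inr (Or.inl ⟨by linear_combination pow_eq_zero_iff (three_ne_zero) |>.1 h4, h3⟩)
    · have h4 : V.ep = 10 + 6 * V.mu + V.mu ^ 2 := by linear_combination -h3
      rw [h4] at k3
      have h5 : (V.mu + 3) ^ 2 * (V.mu + 4) = 0 := by linear_combination -k3 / 192
      rcases mul_eq_zero.1 h5 with h6 | h6
      · have h7 : V.mu = -3 := by linear_combination pow_eq_zero_iff (two_ne_zero) |>.1 h6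
        exact Or.inl ⟨h7, by rw [h4, h7]; norm_num⟩
      · have h7 : V.mu = -4 := by linear_combination h6
        exact Or.inr (Or.inr ⟨h7, by rw [h4, h7]; norm_num⟩)
  · obtain ⟨s, key⟩ := h.elim_exists alOneNu_check_ph hP (by simp)
    simp only [AllZero, Poly.ev, mev_asg, mev_mon_nil] at key
    linear_combination key.1 / 3

/-- Three stages fix mu in terms of nu, then nu and ep, and finally force the equality below. By the
definition of la it means κ₄z = 0, so this point contributes nothing to the list. -/
theorem Sol.beTwo {V : Pars ℂ} {g : List Bool → ℂ} (h : Sol V g) (ha : V.al = 0) (hb : V.be = 2)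
    (hg : V.ga = 0) : V.la = V.k₁ + V.k₂ := by
  have hmu : V.mu = -4 - 3 * V.nu := by
    obtain ⟨s, key⟩ := h.elim_exists beTwo_check (fun s => by
      obtain ⟨-, -, -, e⟩ := ev_gen V s
      exact ⟨ev_nil_of ha, ev_const_of (by simp [hb]), ev_nil_of hg, e⟩) (by simp)
    simp only [AllZero, Poly.ev, mev_asg, mev_mon_nil] at key
    linear_combination key.1 / 6
  have hnu : V.ep = 0 ∧ V.nu = -1 := by
    obtain ⟨s, key⟩ := h.elim_exists beTwoMu_check (fun s => by
      obtain ⟨-, -, -, -, e⟩ := ev_gen V s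
      refine ⟨ev_nil_of ha, ev_const_of (by simp [hb]), ev_nil_of hg, ?_, e⟩
      simp only [Elim.beTwoMu, Poly.ev, mev_asg, mev_mon_nil, hmu]
      push_cast
      ring) (by simp)
    simp only [AllZero, Poly.ev, mev_asg, mev_mon_nil] at key
    exact ⟨by linear_combination key.1 / 54, by linear_combination key.2.1 / 72⟩
  obtain ⟨s, key⟩ := h.elim_exists beTwoMuNuEp_check (fun s => by
    obtain ⟨-, -, -, -, -, -, e⟩ := ev_gen V s
    exact ⟨ev_nil_of ha, ev_const_of (by simp [hb]), ev_nil_of hg,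
      ev_const_of (by rw [hmu, hnu.2]; norm_num), ev_const_of (by simp [hnu.2]),
      ev_nil_of hnu.1, e⟩) (by simp)
  simp only [AllZero, Poly.ev, mev_asg, mev_mon_nil] at key
  linear_combination key.1 / 6

theorem Sol.center_ph {V : Pars ℂ} {g : List Bool → ℂ} (h : Sol V g) (ha : V.al = 0)
    (hb : V.be = 0) (hg : V.ga = 0) : V.ph = 0 := by
  obtain ⟨s, key⟩ := h.elim_exists center_check (fun s => by
    obtain ⟨-, -, -, e⟩ := ev_gen V s
    exact ⟨ev_nil_of ha, ev_nil_of hb, ev_nil_of hg, e⟩) (by simp)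
  simpa [AllZero, Poly.ev, mev_asg, mev_mon_nil] using key

/-- This removes a solution of the equations in `center_points` that exists only for κ₄z = 0. -/
theorem Sol.center_la {V : Pars ℂ} {g : List Bool → ℂ} (h : Sol V g) (ha : V.al = 0)
    (hb : V.be = 0) (hg : V.ga = 0) (hmu : V.mu = -1) (hnu : V.nu = -1) (hep : V.ep = 2) :
    V.la = V.k₁ + V.k₂ := by
  obtain ⟨s, key⟩ := h.elim_exists centerMuNuEpPh_check (fun s => by
    obtain ⟨-, -, -, -, -, -, -, e⟩ := ev_gen V s
    exact ⟨ev_nil_of ha, ev_nil_of hb, ev_nil_of hg, ev_const_of (by simp [hmu]),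
      ev_const_of (by simp [hnu]), ev_const_of (by simp [hep]),
      ev_nil_of (h.center_ph ha hb hg), e⟩) (by simp)
  simp only [AllZero, Poly.ev, mev_asg, mev_mon_nil] at key
  linear_combination key.1 / 6

theorem Sol.center {V : Pars ℂ} {g : List Bool → ℂ} (h : Sol V g) (ha : V.al = 0)
    (hb : V.be = 0) (hg : V.ga = 0) :
    V.ep = 0 ∧ V.mu + V.nu = 0 ∨ V.mu = -1 ∧ V.nu = 0 ∧ V.ep = 1 ∨
      V.mu = 0 ∧ V.nu = 1 ∧ V.ep = -1 ∨ V.mu = -1 ∧ V.nu = -1 ∧ V.ep = 2 ∨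
      V.mu = 1 ∧ V.nu = 1 ∧ V.ep = -2 := by
  by_cases hS : V.ep = 0 ∧ V.mu + V.nu = 0
  · exact Or.inl hS
  have hP (s : ℕ → ℂ) : centerPh.Ev (asg V s) V := by
    obtain ⟨-, -, -, e1, e2, e3, -, e4⟩ := ev_gen V s
    exact ⟨ev_nil_of ha, ev_nil_of hb, ev_nil_of hg, e1, e2, e3,
      ev_nil_of (h.center_ph ha hb hg), e4⟩
  -- If the coefficient of the inner symmetry of [u, v]⁴ were nonzero, ep and mu + nu would vanish,
  -- which is the Hamiltonian case already set aside.
  have hz : g [true, true, true, false, true, false, true, false, true, false] = 0 := by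
    have key := h.elim centerPh_check hP (by simp)
    simp only [AllZero, Poly.ev, mev_asg, mev_mon_nil, List.getD_cons_zero] at key
    by_contra hne
    exact hS ⟨mul_right_cancel₀ hne (by linear_combination key.1 / 124),
      mul_right_cancel₀ hne (by linear_combination key.2.1 / 16)⟩
  obtain ⟨s, key⟩ := h.elim_zero hz centerPh_check_zero hP (by simp)
  simp only [AllZero, Poly.ev, mev_asg, mev_mon_nil] at key
  obtain ⟨k1, k2, k3, k4, k5, k6, k7, k8, k9, -⟩ := key
  push_cast at k1 k2 k3 k4 k5 k6 k7 k8 k9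
  generalize V.mu = μ, V.nu = ν, V.ep = ε, s 0 = s₁, s 1 = s₂, s 2 = s₃, s 3 = s₄, s 4 = s₅ at *
  have h4 : s₄ = 4 + μ + ν - s₁ - s₂ - s₃ := by linear_combination k1 / 48
  subst h4
  have hε : ε = (μ + ν) * (s₁ - s₃) := by linear_combination k2 / 36
  subst hε
  have hμ : μ + ν ≠ 0 := fun h0 => hS ⟨by rw [h0, zero_mul], h0⟩
  -- Transposition sends (μ, ν) to (-ν, -μ), hence S to -S and d to d; the solutions come in pairs
  -- accordingly.
  have := center_points (S := μ + ν) (d := μ - ν) (r := s₁ - s₃) (w := s₁ + s₃) (p := s₂) (q := s₅)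
    hμ (by linear_combination k3 / 12) (by linear_combination k4 / 24)
    (by linear_combination k5 / 24) (by linear_combination k6 / 18)
    (by linear_combination k7 / 72) (by linear_combination k8 / 72)
    (by linear_combination k9 / 8)
  obtain ⟨hr, ⟨hd, hS1 | hS1⟩ | ⟨hd, hS1 | hS1⟩⟩ := this
  · refine Or.inr (Or.inr (Or.inl ⟨?_, ?_, ?_⟩))
    · linear_combination (hS1 + hd) / 2
    · linear_combination (hS1 - hd) / 2
    · rw [hS1, hr]; norm_num
  · refine Or.inr (Or.inl ⟨?_, ?_, ?_⟩)
    · linear_combination (hS1 + hd) / 2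
    · linear_combination (hS1 - hd) / 2
    · rw [hS1, hr]; norm_num
  · refine Or.inr (Or.inr (Or.inr (Or.inr ⟨?_, ?_, ?_⟩)))
    · linear_combination (hS1 + hd) / 2
    · linear_combination (hS1 - hd) / 2
    · rw [hS1, hr]; norm_num
  · refine Or.inr (Or.inr (Or.inr (Or.inl ⟨?_, ?_, ?_⟩)))
    · linear_combination (hS1 + hd) / 2
    · linear_combination (hS1 - hd) / 2
    · rw [hS1, hr]; norm_num

end Elim

/-! ### Comparison with the list, up to transposition -/

namespace Elim

open NCPoly PainleveFive

/-- The coefficients of the transposed system. -/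
def transposeCoeffs (C : Coeffs) (κ : Params) : Coeffs where
  a₁ := 2 - (C.a₁ + C.a₂ + C.a₃)
  a₂ := C.a₃
  a₃ := C.a₂
  b₁ := -3 - (C.b₁ + C.b₂ + C.b₃ + C.b₄ + C.b₅)
  b₂ := C.b₅
  b₃ := C.b₃
  b₄ := C.b₄
  b₅ := C.b₂
  c₁ := C.c₂
  c₂ := C.c₁
  d₁ := C.d₂
  d₂ := C.d₁
  e₁ := 2 - C.e₁
  f₁ := 2 * κ.κ₁ - C.f₁

theorem system_transpose (C : Coeffs) (κ : Params) (z : ℂ) :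
    (system C κ z).transpose = system (transposeCoeffs C κ) κ z := by
  have hu : NCPoly.transpose u = u := transpose_gen false
  have hv : NCPoly.transpose v = v := transpose_gen true
  have hneg (p : NCPoly) : (-p).transpose = -p.transpose := map_neg transposeL p
  have hp (p : NCPoly) (n : ℕ) : (p ^ n).transpose = p.transpose ^ n := by
    induction n with
    | zero => simp [transpose_one]
    | succ n ih => rw [pow_succ, transpose_mul, ih, pow_succ']
  ext
  · simp only [NCSystem.transpose, system, transposeCoeffs, sub_eq_add_neg, hneg, transpose_add,
      transpose_smul, transpose_mul, transpose_one, hu, hv, hp, ← mul_assoc]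
    module
  · simp only [NCSystem.transpose, system, transposeCoeffs, sub_eq_add_neg, hneg, transpose_add,
      transpose_smul, transpose_mul, transpose_one, hu, hv, hp, ← mul_assoc]
    module

theorem HasIntegrals.transpose {C : Coeffs} (h : HasIntegrals C) (κ : Params) :
    HasIntegrals (transposeCoeffs C κ) := by
  obtain ⟨h1, h2, h3, h4, h5, h6, h7⟩ := h
  refine ⟨?_, ?_, ?_, ?_, ?_, ?_, ?_⟩ <;> simp only [transposeCoeffs, h1, h2, h3, h4, h5, h6, h7] <;>
    ring

/-- The parameters of the listed systems. -/
def Pars.Listed (V : Pars ℂ) : Prop :=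
  V.ga = 0 ∧
  (V.al = -1 ∧ V.be = 1 ∧ V.mu = 0 ∧ V.nu = 0 ∧ V.ep = 0 ∧ V.ph ^ 2 = V.k₁ ^ 2 + 4 * V.k₃ ∨
  V.al = 2 ∧ V.be = 1 ∧ V.mu = -4 ∧ V.nu = 0 ∧ V.ep = 1 ∧
    V.ph ^ 2 + 3 * V.k₁ * V.ph + 2 * V.k₁ ^ 2 = V.k₃ ∨
  V.al = 0 ∧ V.be = 1 ∧ V.nu = 0 ∧
    (V.mu = -2 ∧ V.ep = 1 ∨ V.mu = -1 ∧ V.ep = 0 ∨ V.mu = 0 ∧ V.ep = -1) ∧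
    V.ph ^ 2 + V.k₁ * V.ph = V.k₃ ∨
  V.al = 1 ∧ V.be = 1 ∧ V.nu = 0 ∧
    (V.mu = -3 ∧ V.ep = 1 ∨ V.mu = -2 ∧ V.ep = 0 ∨ V.mu = -4 ∧ V.ep = 2) ∧ V.ph = -V.k₁ ∨
  V.al = 0 ∧ V.be = 0 ∧ V.ph = 0 ∧
    (V.ep = 0 ∧ V.mu + V.nu = 0 ∨ V.mu = -1 ∧ V.nu = 0 ∧ V.ep = 1))

/-- The parameters of systems that are replaced by the transposed ones. -/
def Pars.Flipped (V : Pars ℂ) : Prop :=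
  V.al = 0 ∧ V.ga ≠ 0 ∨ V.al = 0 ∧ V.ga = 0 ∧ (V.be = -1 ∨ V.be = -2) ∨
    V.al = 0 ∧ V.be = 0 ∧ V.ga = 0 ∧ (V.mu = 0 ∧ V.nu = 1 ∨ V.mu = 1 ∧ V.nu = 1)

/-- The hypothesis on la removes be = 2 and the solution (mu, nu, ep) = (-1, -1, 2) at the origin.
Their transposes are counted as flipped and get excluded after transposition. -/
theorem Sol.listed_or_flipped {V : Pars ℂ} {g : List Bool → ℂ} (h : Sol V g)
    (hla : V.la ≠ V.k₁ + V.k₂) : V.Listed ∨ V.Flipped := by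
  by_cases hg : V.ga = 0
  · by_cases ha : V.al = 0
    · rcases h.be_of_al_eq_zero ha hg with hb | hb | hb | hb | hb
      · rcases h.center ha hb hg with h1 | h1 | h1 | h1 | h1
        · exact Or.inl ⟨hg, Or.inr <| Or.inr <| Or.inr <| Or.inr
            ⟨ha, hb, h.center_ph ha hb hg, Or.inl h1⟩⟩
        · exact Or.inl ⟨hg, Or.inr <| Or.inr <| Or.inr <| Or.inr
            ⟨ha, hb, h.center_ph ha hb hg, Or.inr h1⟩⟩
        · exact Or.inr (Or.inr (Or.inr ⟨ha, hb, hg, Or.inl ⟨h1.1, h1.2.1⟩⟩))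
        · exact absurd (h.center_la ha hb hg h1.1 h1.2.1 h1.2.2) hla
        · exact Or.inr (Or.inr (Or.inr ⟨ha, hb, hg, Or.inr ⟨h1.1, h1.2.1⟩⟩))
      · exact Or.inl ⟨hg, Or.inr <| Or.inr <| Or.inl ⟨ha, hb, h.alZero ha hb hg⟩⟩
      · exact Or.inr (Or.inr (Or.inl ⟨ha, hg, Or.inl hb⟩))
      · exact absurd (h.beTwo ha hb hg) hla
      · exact Or.inr (Or.inr (Or.inl ⟨ha, hg, Or.inr hb⟩))
    · have hb := h.be_eq_one ha hg
      rcases h.al_of_be_eq_one ha hb hg with h1 | h1 | h1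
      · exact Or.inl ⟨hg, Or.inl ⟨h1, hb, h.alNegOne h1 hb hg⟩⟩
      · exact Or.inl ⟨hg, Or.inr <| Or.inr <| Or.inr <| Or.inl ⟨h1, hb, h.alOne h1 hb hg⟩⟩
      · exact Or.inl ⟨hg, Or.inr <| Or.inl ⟨h1, hb, h.alTwo h1 hb hg⟩⟩
  · exact Or.inr (Or.inl ⟨h.al_eq_zero_or_ga_eq_zero.resolve_right hg, hg⟩)

/-- Transposition replaces (al, be, ga, mu, nu) by (-ga, -be, -al, -nu, -mu), and the conditions in
`Pars.Flipped` single out only one member of each pair that they concern. -/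
theorem not_flipped_transpose {C : Coeffs} {κ : Params} {z : ℂ} (h : (parsOf C κ z).Flipped) :
    ¬ (parsOf (transposeCoeffs C κ) κ z).Flipped := by
  have e1 : (parsOf (transposeCoeffs C κ) κ z).al = -(parsOf C κ z).ga := by
    simp only [parsOf, transposeCoeffs]; ring
  have e2 : (parsOf (transposeCoeffs C κ) κ z).be = -(parsOf C κ z).be := by
    simp only [parsOf, transposeCoeffs]; ring
  have e3 : (parsOf (transposeCoeffs C κ) κ z).ga = -(parsOf C κ z).al := by
    simp only [parsOf, transposeCoeffs]; ring
  have e4 : (parsOf (transposeCoeffs C κ) κ z).mu = -(parsOf C κ z).nu := by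
    simp only [parsOf, transposeCoeffs]; ring
  have e5 : (parsOf (transposeCoeffs C κ) κ z).nu = -(parsOf C κ z).mu := by
    simp only [parsOf, transposeCoeffs]
  unfold Pars.Flipped at h ⊢
  rw [e1, e2, e3, e4, e5]
  rcases h with ⟨h1, h2⟩ | ⟨h1, h2, h3 | h3⟩ | ⟨h1, h2, h3, ⟨h4, h5⟩ | ⟨h4, h5⟩⟩
  · simp [h1, h2]
  all_goals rw [h1]
  · rw [h2, h3]; norm_num
  · rw [h2, h3]; norm_num
  · rw [h2, h3, h4, h5]; norm_num
  · rw [h2, h3, h4, h5]; norm_num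

/-- Within the family the numbers al, be, ga, mu, nu, ep and ph are coordinates; inverting the
defining formulas recovers all coefficients. -/
theorem Coeffs.eq_of_parsOf {C : Coeffs} {κ : Params} {z : ℂ} {al be mu nu ep ph : ℂ}
    (hC : HasIntegrals C) (hga : (parsOf C κ z).ga = 0) (hal : (parsOf C κ z).al = al)
    (hbe : (parsOf C κ z).be = be) (hmu : (parsOf C κ z).mu = mu) (hnu : (parsOf C κ z).nu = nu)
    (hep : (parsOf C κ z).ep = ep) (hph : (parsOf C κ z).ph = ph) :
    C = ⟨al, 1 + be - al, 1 - be, -al, -1 - be, 0, al - 1, be - 1, mu, -nu, -mu, nu, 1 + ep,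
      κ.κ₁ - ph⟩ := by
  obtain ⟨h1, h2, h3, h4, h5, h6, h7⟩ := hC
  obtain ⟨a₁, a₂, a₃, b₁, b₂, b₃, b₄, b₅, c₁, c₂, d₁, d₂, e₁, f₁⟩ := C
  simp only [parsOf] at *
  subst hal hbe hmu hnu hep hph h1 h2 h3 h4 h5 h6 h7
  have : a₃ = 2 - a₁ - a₂ := by linear_combination hga
  subst this
  congr 1 <;> ring

theorem isListed_of_listed {C : Coeffs} {κ : Params} {z : ℂ} (hC : HasIntegrals C)
    (h : (parsOf C κ z).Listed) : IsListed (system C κ z) κ z := by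
  obtain ⟨hga, ⟨hal, hbe, hmu, hnu, hep, hph⟩ | ⟨hal, hbe, hmu, hnu, hep, hph⟩ |
    ⟨hal, hbe, hnu, hme, hph⟩ | ⟨hal, hbe, hnu, hme, hph⟩ | ⟨hal, hbe, hph, hme⟩⟩ := h
  · have := Coeffs.eq_of_parsOf hC hga hal hbe hmu hnu hep rfl
    refine Or.inr (Or.inr (Or.inr (Or.inr (Or.inr ⟨(parsOf C κ z).ph, ?_, ?_⟩))))
    · simp only [parsOf] at hph ⊢
      linear_combination hph / (-4)
    · refine Or.inr (Or.inr (Or.inl ?_))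
      generalize (parsOf C κ z).ph = h at *
      subst this
      ext <;> simp only [system, newSystem1, tailU, tailV] <;> module
  · have := Coeffs.eq_of_parsOf hC hga hal hbe hmu hnu hep rfl
    -- Comparing the coefficient κ₁ - ph of uv with (5κ₁ - h)/2 gives this h, and the quadratic
    -- relation for ph becomes κ₃ = (h² - κ₁²)/4 by completing the square.
    refine Or.inr (Or.inr (Or.inr (Or.inr (Or.inr ⟨3 * κ.κ₁ + 2 * (parsOf C κ z).ph, ?_, ?_⟩))))
    · simp only [parsOf] at hph ⊢
      linear_combination -hph
    · refine Or.inr (Or.inr (Or.inr (Or.inl ?_)))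
      generalize (parsOf C κ z).ph = h at *
      subst this
      ext <;> simp only [system, newSystem3, tailU, tailV] <;> module
  -- All three systems at this point have the coefficient (3κ₁ - h)/2 at uv, which gives the same h
  -- for each of them.
  · refine Or.inr (Or.inr (Or.inr (Or.inr (Or.inr ⟨κ.κ₁ + 2 * (parsOf C κ z).ph, ?_, ?_⟩))))
    · simp only [parsOf] at hph ⊢
      linear_combination -hph
    · rcases hme with ⟨hmu, hep⟩ | ⟨hmu, hep⟩ | ⟨hmu, hep⟩ <;>
        have := Coeffs.eq_of_parsOf hC hga hal hbe hmu hnu hep rfl <;>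
        generalize (parsOf C κ z).ph = h at * <;> subst this
      · left
        ext <;> simp only [system, okamotoSystem3, tailU, tailV] <;> module
      · right; left
        ext <;> simp only [system, okamotoSystem4, tailU, tailV] <;> module
      · right; right; right; right
        ext <;> simp only [system, newSystem4, tailU, tailV] <;> module
  · have hph' : (parsOf C κ z).ph = -κ.κ₁ := hph
    rcases hme with ⟨hmu, hep⟩ | ⟨hmu, hep⟩ | ⟨hmu, hep⟩ <;>
      have := Coeffs.eq_of_parsOf hC hga hal hbe hmu hnu hep hph' <;> subst this
    · right; left
      ext <;> simp only [system, okamotoSystem1, tailU, tailV] <;> module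
    · right; right; left
      ext <;> simp only [system, okamotoSystem2, tailU, tailV] <;> module
    · right; right; right; right; left
      ext <;> simp only [system, newSystem2, tailU, tailV] <;> module
  · rcases hme with ⟨hep, hmn⟩ | ⟨hmu, hnu, hep⟩
    -- The free number mu = -nu is the constant c of the Hamiltonian systems.
    · have := Coeffs.eq_of_parsOf (nu := -(parsOf C κ z).mu) hC hga hal hbe rfl
        (by linear_combination hmn) hep hph
      left
      refine ⟨(parsOf C κ z).mu, ?_⟩
      generalize (parsOf C κ z).mu = c at *
      subst this
      ext <;> simp only [system, hamiltonianSystem, tailU, tailV] <;> module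
    · have := Coeffs.eq_of_parsOf hC hga hal hbe hmu hnu hep hph
      right; right; right; left
      subst this
      ext <;> simp only [system, okamotoSystem5, tailU, tailV] <;> module

/-- The classification of the systems with the integrals and the symmetry. -/
theorem exists_isListed {C : Coeffs} {κ : Params} {z : ℂ} (hC : HasIntegrals C) (hz : κ.κ₄ * z ≠ 0)
    (h : (system C κ z).AdmitsSymmetry (hamiltonian κ z) 1) :
    ∃ F : NCSystem, IsListed F κ z ∧ (system C κ z = F ∨ system C κ z = F.transpose) := by
  have hla (C : Coeffs) : (parsOf C κ z).la ≠ (parsOf C κ z).k₁ + (parsOf C κ z).k₂ := by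
    intro h
    simp only [parsOf] at h
    exact hz (by linear_combination h)
  obtain ⟨g, hg⟩ := exists_sol hC h
  rcases hg.listed_or_flipped (hla C) with h1 | h1
  · exact ⟨_, isListed_of_listed hC h1, Or.inl rfl⟩
  -- The transposed system again has the integrals and the symmetry, and it is not flipped, so it is
  -- in the list.
  have ht := h.transpose
  rw [system_transpose] at ht
  obtain ⟨g', hg'⟩ := exists_sol (hC.transpose κ) ht
  refine ⟨_, isListed_of_listed (hC.transpose κ) ((hg'.listed_or_flipped (hla _)).resolve_right
    (not_flipped_transpose h1)), Or.inr ?_⟩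
  rw [← system_transpose, NCSystem.transpose_transpose]

end Elim


/-! ### Trace integrals -/

namespace NCPoly

/-- The rotations of a word are periodic in the rotation number with period its length, so a sum
over a full period does not depend on where it starts. -/
theorem sum_rotate_add {M : Type*} [AddCommMonoid M] (f : List Bool → M) (w : List Bool) (m : ℕ) :
    ∑ j ∈ Finset.range w.length, f (w.rotate (j + m)) =
      ∑ j ∈ Finset.range w.length, f (w.rotate j) := by
  induction m with
  | zero => rfl
  | succ m ih =>
    rw [← ih]
    rcases Nat.eq_zero_or_pos w.length with h0 | hpos
    · rw [h0]; rfl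
    · obtain ⟨n, hn⟩ := Nat.exists_eq_succ_of_ne_zero hpos.ne'
      rw [hn, Finset.sum_range_succ, Finset.sum_range_succ' (fun j => f (w.rotate (j + m)))]
      congr 1
      · exact Finset.sum_congr rfl fun j _ => by rw [show j + (m + 1) = j + 1 + m by omega]
      · rw [show n + (m + 1) = n.succ + m by omega, ← hn, ← List.rotate_rotate, List.rotate_length,
          zero_add]

/-- The sum of a function over the rotations of a word. -/
noncomputable def cycSum (f : List Bool → ℂ) (w : List Bool) : ℂ :=
  ∑ j ∈ Finset.range w.length, f (w.rotate j)

theorem cycSum_rotate (f : List Bool → ℂ) (w : List Bool) (m : ℕ) :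
    cycSum f (w.rotate m) = cycSum f w := by
  unfold cycSum
  rw [List.length_rotate, ← sum_rotate_add f w m]
  exact Finset.sum_congr rfl fun j _ => by rw [List.rotate_rotate, add_comm]

theorem cycSum_of_length_eq {f : List Bool → ℂ} {w : List Bool}
    (h : ∀ v, v.length = w.length → f v = 0) : cycSum f w = 0 :=
  Finset.sum_eq_zero fun _ _ => h _ (List.length_rotate _ _)

/-- The sum of the coefficients of all rotations of a word. -/
noncomputable def cycCoeff (w : List Bool) : NCPoly →ₗ[ℂ] ℂ where
  toFun p := cycSum (coeff p) w
  map_add' p q := by simp [cycSum, Finset.sum_add_distrib]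
  map_smul' c p := by simp [cycSum, Finset.mul_sum]

theorem cycCoeff_apply (w : List Bool) (p : NCPoly) : cycCoeff w p = cycSum (coeff p) w := rfl

/-- For words v and w the products vw and wv are rotations of each other, and the functional depends
on a word only up to rotation. -/
theorem cycCoeff_mul_comm (W : List Bool) (p q : NCPoly) :
    cycCoeff W (p * q) = cycCoeff W (q * p) := by
  have h : ((LinearMap.mul ℂ NCPoly).compr₂ (cycCoeff W)) =
      ((LinearMap.mul ℂ NCPoly).flip.compr₂ (cycCoeff W)) := by
    apply linearMap_ext
    intro v
    apply linearMap_ext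
    intro w
    simp only [LinearMap.compr₂_apply, LinearMap.mul_apply', LinearMap.flip_apply]
    rw [← word_append, ← word_append, cycCoeff_apply, cycCoeff_apply, cycSum, cycSum,
      ← sum_rotate_add _ W w.length]
    refine Finset.sum_congr rfl fun j _ => ?_
    rw [coeff_word, coeff_word]
    congr 1
    rw [← List.rotate_rotate, ← List.rotate_append_length_eq w v, eq_iff_iff]
    exact (List.rotate_injective w.length).eq_iff
  exact LinearMap.congr_fun (LinearMap.congr_fun h p) q

theorem sum_rotate_eq (v w : List Bool) :
    (∑ k ∈ Finset.range w.length, if w.rotate k = v then (1 : ℂ) else 0) =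
      cycSum (fun y => if w = y then 1 else 0) v := by
  by_cases hl : v.length = w.length
  -- The rotations by k + 1 and by |w| - 1 - k are inverse to each other. The shift by one is needed
  -- because reflecting the range of summation sends k to |w| - 1 - k.
  · rw [cycSum, hl, ← sum_rotate_add (fun y => if y = v then (1 : ℂ) else 0) w 1,
      ← Finset.sum_range_reflect (fun j => if w = v.rotate j then (1 : ℂ) else 0)]
    refine Finset.sum_congr rfl fun k hk => ?_
    have hk' := Finset.mem_range.1 hk
    congr 1
    rw [eq_iff_iff, ← (List.rotate_injective (w.length - 1 - k)).eq_iff, List.rotate_rotate,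
      show k + 1 + (w.length - 1 - k) = w.length by omega, List.rotate_length]
  · rw [cycSum, Finset.sum_eq_zero, Finset.sum_eq_zero]
    · intro k _
      rw [if_neg]
      rintro rfl
      exact hl (by simp)
    · intro k _
      rw [if_neg]
      rintro rfl
      exact hl (by simp)

theorem conv_sum_right {ι : Type*} (s : Finset ι) (f : List Bool → ℂ) (h : ι → List Bool → ℂ)
    (w : List Bool) : conv f (fun y => ∑ i ∈ s, h i y) w = ∑ i ∈ s, conv f (h i) w := by
  classical
  induction s using Finset.induction_on with
  | empty => simp [conv_zero_right]
  | insert i s hi ih => simp only [Finset.sum_insert hi, conv_add_right, ih]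

/-- Only splittings at whose second part `h` is nonzero matter; with a degree bound on `h`, only the
long words of `f` have to be known. -/
theorem conv_congr_left {f f' h : List Bool → ℂ} {w : List Bool}
    (H : ∀ s y, w = s ++ y → h y ≠ 0 → f s = f' s) : conv f h w = conv f' h w := by
  induction w generalizing f f' with
  | nil =>
    by_cases h0 : h [] = 0
    · simp [conv, h0]
    · rw [conv, conv, H [] [] rfl h0]
  | cons a w ih =>
    rw [conv, conv, ih (f := fun y => f (a :: y)) (f' := fun y => f' (a :: y))]
    · by_cases h0 : h (a :: w) = 0
      · simp [h0]
      · rw [H [] _ rfl h0]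
    · intro s y e hy
      exact H (a :: s) y (by rw [e]; rfl) hy

theorem mul_mem_degreeLE {m n : ℕ} {p q : NCPoly} (hp : p ∈ degreeLE m) (hq : q ∈ degreeLE n) :
    p * q ∈ degreeLE (m + n) := by
  have h := Submodule.mul_mem_mul hp hq
  rw [degreeLE, degreeLE, Submodule.span_mul_span] at h
  refine Submodule.span_mono ?_ h
  rintro _ ⟨_, ⟨k, hk, rfl⟩, _, ⟨l, hl, rfl⟩, rfl⟩
  exact ⟨k ++ l, by rw [List.length_append]; omega, by simp⟩

/-- Each of the i + j rotations permutes the words with these numbers of letters, so every rotation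
contributes the commutative coefficient once. -/
theorem sum_cycSum_wordsOf (p : NCPoly) (i j : ℕ) :
    ((wordsOf (i + j) j).map (cycSum (coeff p))).sum =
      (i + j) * MvPolynomial.coeff (expo i j) (abelianize p) := by
  have h1 : ((wordsOf (i + j) j).map (cycSum (coeff p))).sum =
      ((wordsOf (i + j) j).map fun w =>
        ∑ k ∈ Finset.range (i + j), coeff p (w.rotate k)).sum := by
    congr 1
    refine List.map_congr_left fun w hw => ?_
    rw [cycSum, (mem_wordsOf.1 hw).1]
  have h2 : ∀ k, ((wordsOf (i + j) j).map fun w => coeff p (w.rotate k)).sum =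
      ((wordsOf (i + j) j).map (coeff p)).sum := by
    intro k
    have hp : ((wordsOf (i + j) j).map fun w => w.rotate k).Perm (wordsOf (i + j) j) := by
      rw [List.perm_ext_iff_of_nodup ((nodup_wordsOf _ _).map (List.rotate_injective k))
        (nodup_wordsOf _ _)]
      intro w
      simp only [List.mem_map, mem_wordsOf]
      constructor
      · rintro ⟨v, ⟨h3, h4⟩, rfl⟩
        exact ⟨by simpa using h3, by rw [(List.rotate_perm v k).count_eq, h4]⟩
      · rintro ⟨h3, h4⟩
        obtain ⟨n, hn⟩ := List.IsRotated.symm ⟨k, (rfl : w.rotate k = w.rotate k)⟩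
        refine ⟨w.rotate n, ⟨by simpa using h3, by rw [(List.rotate_perm w n).count_eq, h4]⟩, ?_⟩
        rw [List.rotate_rotate, add_comm, ← List.rotate_rotate, hn]
    rw [← (hp.map (coeff p)).sum_eq, List.map_map]
    rfl
  rw [h1, ← sum_wordsOf]
  have h3 : ∀ (L : List (List Bool)) (n : ℕ),
      (L.map fun w => ∑ k ∈ Finset.range n, coeff p (w.rotate k)).sum =
        ∑ k ∈ Finset.range n, (L.map fun w => coeff p (w.rotate k)).sum := by
    intro L n
    induction L with
    | nil => simp
    | cons w L ih => simp [ih, Finset.sum_add_distrib]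
  rw [h3, Finset.sum_congr rfl fun k _ => h2 k]
  simp

/-- The matrices of a cyclic word: the letter `a` takes the `i`-th vertex of a cycle to the next one
if the `i`-th letter is `a`. -/
noncomputable def cycleMatrix (w : List Bool) (a : Bool) :
    Matrix (Fin w.length) (Fin w.length) ℂ :=
  fun i j => if j.val = (i.val + 1) % w.length ∧ w[i.val]? = some a then 1 else 0

/-- Starting from the vertex `i`, the only way along the cycle reads the letters of `W`
periodically; a word survives if it agrees with this reading. -/
theorem evalMatrix_cycleMatrix_word (W w : List Bool) (i j : Fin W.length) :
    evalMatrix (cycleMatrix W false) (cycleMatrix W true) (word w) i j =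
      if (i.val + w.length) % W.length = j ∧
        ∀ k < w.length, w[k]? = W[(i.val + k) % W.length]? then 1 else 0 := by
  induction w generalizing i with
  | nil =>
    simp only [word_nil, map_one, Matrix.one_apply, List.length_nil, add_zero, Nat.not_lt_zero,
      false_implies, implies_true, and_true, Nat.mod_eq_of_lt i.isLt, Fin.ext_iff]
  | cons a w ih =>
    have hpos : 0 < W.length := i.pos
    set i' : Fin W.length := ⟨(i.val + 1) % W.length, Nat.mod_lt _ hpos⟩ with hi'
    rw [word_cons, map_mul, evalMatrix_gen (cycleMatrix W), Matrix.mul_apply,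
      Finset.sum_eq_single i']
    · rw [ih, cycleMatrix]
      by_cases ha : W[i.val]? = some a
      · rw [if_pos ⟨rfl, ha⟩, one_mul]
        congr 1
        rw [eq_iff_iff]
        simp only [hi', List.length_cons, Nat.mod_add_mod]
        rw [show i.val + 1 + w.length = i.val + (w.length + 1) by omega]
        refine and_congr_right fun _ => ⟨fun h k hk => ?_, fun h k hk => ?_⟩
        · cases k with
          | zero => rw [add_zero, Nat.mod_eq_of_lt i.isLt, ha]; rfl
          | succ k =>
            rw [List.getElem?_cons_succ, h k (by omega)]
            congr 2; omega
        · have := h (k + 1) (by omega)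
          rw [List.getElem?_cons_succ] at this
          rw [this]
          congr 2; omega
      · rw [if_neg fun h => ha h.2, zero_mul, if_neg]
        rintro ⟨_, h⟩
        have := h 0 (by simp)
        rw [add_zero, Nat.mod_eq_of_lt i.isLt] at this
        exact ha this.symm
    · intro k _ hk
      rw [cycleMatrix, if_neg, zero_mul]
      rintro ⟨h, _⟩
      exact hk (Fin.ext h)
    · simp

/-- A nonempty word contributes to the diagonal only if it goes around the cycle a whole number of
times. The degree bound allows a single turn, and then the word is a rotation of `W`; the empty word
contributes the trace of the identity. -/
theorem trace_cycleMatrix {W : List Bool} {n : ℕ} (hn : n < 2 * W.length) {p : NCPoly}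
    (hp : p ∈ degreeLE n) :
    (evalMatrix (cycleMatrix W false) (cycleMatrix W true) p).trace =
      W.length * coeff p [] + cycCoeff W p := by
  induction hp using Submodule.span_induction with
  | mem q hq =>
    obtain ⟨l, hl, rfl⟩ := hq
    rw [prod_map_ι]
    have hw : (l.map (· == 1)).length ≤ n := by simpa using hl
    generalize l.map (· == 1) = w at hw
    rw [Matrix.trace, cycCoeff_apply, cycSum]
    simp only [Matrix.diag_apply, evalMatrix_cycleMatrix_word, coeff_word]
    rcases eq_or_ne w [] with rfl | hne
    · have h0 : ∀ k, ¬([] = W.rotate k ∧ 0 < W.length) := by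
        rintro k ⟨h, h'⟩
        have := congrArg List.length h
        simp at this
        simp [this] at h'
      simp only [List.length_nil, add_zero, Nat.not_lt_zero, false_implies, implies_true, and_true,
        if_true]
      rw [Finset.sum_congr rfl fun i _ => if_pos (Nat.mod_eq_of_lt i.isLt),
        Finset.sum_eq_zero (s := Finset.range W.length)]
      · simp
      · intro k hk
        exact if_neg fun h => h0 k ⟨h, by have := Finset.mem_range.1 hk; omega⟩
    · rw [if_neg hne, mul_zero, zero_add,
        Finset.sum_range (fun k => if w = W.rotate k then (1 : ℂ) else 0)]
      refine Finset.sum_congr rfl fun i _ => ?_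
      have hwpos : 0 < w.length := List.length_pos_iff.2 hne
      congr 1
      rw [eq_iff_iff]
      constructor
      · rintro ⟨h1, h2⟩
        have hlen : w.length = W.length := by
          have h3 : (i.val + w.length) ≡ i.val + 0 [MOD W.length] := by
            rw [Nat.ModEq, h1, add_zero, Nat.mod_eq_of_lt i.isLt]
          have h4 := (Nat.modEq_zero_iff_dvd.1 (Nat.ModEq.add_left_cancel' _ h3))
          obtain ⟨c, hc⟩ := h4
          rcases c with _ | _ | c
          · omega
          · omega
          · nlinarith
        apply List.ext_getElem?
        intro k
        by_cases hk : k < w.length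
        · rw [h2 k hk, List.getElem?_rotate (by omega), add_comm]
        · rw [List.getElem?_eq_none (by omega), List.getElem?_eq_none (by simp; omega)]
      · intro h
        have hlen : w.length = W.length := by rw [h]; simp
        refine ⟨by rw [hlen, Nat.add_mod_right, Nat.mod_eq_of_lt i.isLt], fun k hk => ?_⟩
        rw [h, List.getElem?_rotate (by omega), add_comm]
  | zero => simp
  | add p q _ _ hp hq => simp only [map_add, Matrix.trace_add, Pi.add_apply, hp, hq]; ring
  | smul c p _ hp => simp only [map_smul, Matrix.trace_smul, Pi.smul_apply, hp, smul_eq_mul]; ring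

end NCPoly

/-! ### The derivative of a trace in terms of cyclic words -/

namespace NCSystem

open NCPoly

/-- The value of a linear form with the property of a trace on the derivative of a word. -/
theorem apply_timeDeriv_word_mul {T : NCPoly →ₗ[ℂ] ℂ} (hT : ∀ p q, T (p * q) = T (q * p))
    (F : NCSystem) (w q : List Bool) : T (F.timeDeriv (word w) * word q) =
      ∑ k ∈ Finset.range w.length,
        List.rec 0 (fun a x _ => T (F.rhs a * word x)) ((w ++ q).rotate k) := by
  induction w generalizing q with
  | nil => simp [timeDeriv_one]
  | cons a w ih =>
    rw [List.length_cons, Finset.sum_range_succ', word_cons, timeDeriv_mul, timeDeriv_gen, add_mul,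
      map_add, mul_assoc, mul_assoc, hT (gen a), mul_assoc, add_comm]
    congr 1
    -- The trace property moves the first letter behind `q`, which brings the next letter to be
    -- differentiated to the front.
    · have h := ih (q ++ [a])
      rw [word_append, word_cons, word_nil, mul_one] at h
      rw [h]
      refine Finset.sum_congr rfl fun k _ => ?_
      rw [List.cons_append, List.rotate_cons_succ, List.append_assoc]
    · rw [List.rotate_zero, List.cons_append]
      change _ = T (F.rhs a * word (w ++ q))
      rw [word_append]

/-- Under a trace the differentiated letter can always be rotated to the front. So only the cyclic
sums of the coefficients of `p` enter, and they are the proper unknowns for a trace integral. -/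
theorem cycCoeff_timeDeriv (F : NCSystem) (W : List Bool) (p : NCPoly) :
    cycCoeff W (F.timeDeriv p) = ∑ j ∈ Finset.range W.length,
      (conv (F.cf false) (fun y => cycSum (coeff p) (false :: y)) (W.rotate j) +
        conv (F.cf true) (fun y => cycSum (coeff p) (true :: y)) (W.rotate j)) := by
  have hlin : (cycCoeff W ∘ₗ F.derivL : NCPoly →ₗ[ℂ] ℂ) =
      { toFun := fun p => ∑ j ∈ Finset.range W.length,
          (conv (F.cf false) (fun y => cycSum (coeff p) (false :: y)) (W.rotate j) +
            conv (F.cf true) (fun y => cycSum (coeff p) (true :: y)) (W.rotate j))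
        map_add' := fun p q => by
          have h : ∀ v, cycSum (coeff (p + q)) v = cycSum (coeff p) v + cycSum (coeff q) v :=
            fun v => (cycCoeff v).map_add p q
          simp only [h, conv_add_right, ← Finset.sum_add_distrib]
          exact Finset.sum_congr rfl fun _ _ => by ring
        map_smul' := fun c p => by
          have h : ∀ v, cycSum (coeff (c • p)) v = c * cycSum (coeff p) v :=
            fun v => (cycCoeff v).map_smul c p
          simp only [h, smul_eq_mul, conv_smul_right, Finset.mul_sum, RingHom.id_apply]
          exact Finset.sum_congr rfl fun _ _ => by ring } := by
    apply linearMap_ext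
    intro w
    have h := apply_timeDeriv_word_mul (cycCoeff_mul_comm W) F w []
    rw [word_nil, mul_one] at h
    simp only [LinearMap.comp_apply, derivL_apply, LinearMap.coe_mk, AddHom.coe_mk]
    rw [h]
    have e : ∀ (l : Bool) (y : List Bool), cycSum (coeff (word w)) (l :: y) =
        ∑ k ∈ Finset.range w.length, if w.rotate k = l :: y then (1 : ℂ) else 0 := by
      intro l y
      rw [sum_rotate_eq]
      congr 1
      funext y
      exact coeff_word w y
    simp only [e, conv_sum_right, ← Finset.sum_add_distrib]
    rw [Finset.sum_comm]
    refine Finset.sum_congr rfl fun k hk => ?_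
    rw [List.append_nil]
    cases hv : w.rotate k with
    | nil =>
      have := congrArg List.length hv
      simp at this
      simp [this] at hk
    | cons a x =>
      change cycCoeff W (F.rhs a * word x) = _
      rw [cycCoeff_apply, cycSum]
      refine Finset.sum_congr rfl fun j _ => ?_
      rw [coeff_mul]
      have ex : coeff (word x) = fun y => if x = y then (1 : ℂ) else 0 := by
        funext y; exact coeff_word x y
      rw [ex]
      cases a <;> simp [conv_zero_right, cf]
  exact LinearMap.congr_fun hlin p

theorem timeDeriv_mem_degreeLE {F : NCSystem} {m : ℕ} (hF : ∀ a, F.rhs a ∈ degreeLE (m + 1)) {n : ℕ}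
    {p : NCPoly} (hp : p ∈ degreeLE n) : F.timeDeriv p ∈ degreeLE (n + m) := by
  induction hp using Submodule.span_induction with
  | mem q hq =>
    obtain ⟨l, hl, rfl⟩ := hq
    rw [prod_map_ι]
    have hw : (l.map (· == 1)).length ≤ n := by simpa using hl
    generalize l.map (· == 1) = w at hw
    refine degreeLE_mono (Nat.add_le_add_right hw m) ?_
    clear hl hw
    induction w with
    | nil => rw [word_nil, timeDeriv_one]; exact Submodule.zero_mem _
    | cons a w ih =>
      rw [word_cons, timeDeriv_mul, timeDeriv_gen, List.length_cons]
      refine Submodule.add_mem _ ?_ ?_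
      · refine degreeLE_mono (le_of_eq ?_) (mul_mem_degreeLE (hF a) (word_mem_degreeLE le_rfl))
        omega
      · have h1 : gen a ∈ degreeLE 1 := by
          have := word_mem_degreeLE (w := [a]) (n := 1) (by simp)
          simpa using this
        exact degreeLE_mono (le_of_eq (by omega)) (mul_mem_degreeLE h1 ih)
  | zero => rw [← derivL_apply, map_zero]; exact Submodule.zero_mem _
  | add p q _ _ hp hq => rw [timeDeriv_add]; exact Submodule.add_mem _ hp hq
  | smul c p _ hp => rw [timeDeriv_smul]; exact Submodule.smul_mem _ _ hp

theorem IsTraceIntegral.cycCoeff_eq_zero {F : NCSystem} {S : NCPoly} (h : F.IsTraceIntegral S)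
    {m n : ℕ} (hF : ∀ a, F.rhs a ∈ degreeLE (m + 1)) (hS : S ∈ degreeLE n) {W : List Bool}
    (hW : n + m < 2 * W.length) : cycCoeff W (F.timeDeriv S) = 0 := by
  have h1 := trace_cycleMatrix hW (timeDeriv_mem_degreeLE hF hS)
  have h2 := evalMatrix_pathMatrix [] (F.timeDeriv S) 0
  -- For the empty word these are zero matrices of size 1, at which the trace is the constant term.
  have h3 := h _ (pathMatrix [] false) (pathMatrix [] true)
  rw [h _ _ _] at h1
  have h0 : coeff (F.timeDeriv S) [] = 0 := by
    rw [← h3, Matrix.trace]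
    exact (h2.trans (by simp)).symm.trans (by simp [Matrix.diag])
  rw [h0, mul_zero, zero_add] at h1
  exact h1.symm

end NCSystem


namespace Elim

open NCPoly PainleveFive

/-! ### The integrals of the systems in the family -/

/-- A non-abelian Hamiltonian. -/
noncomputable def lax (κ : Params) (z : ℂ) : NCPoly :=
  u * u * v * u * v + (-2 : ℂ) • (u * v * u * v) + v * u * v + (-κ.κ₁) • (u * u * v) +
    (κ.κ₁ + κ.κ₂ + κ.κ₄ * z) • (u * v) + (-κ.κ₂) • v + (-κ.κ₃) • u

/-- The second member of the Lax pair. -/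
noncomputable def laxDual (C : Coeffs) (κ : Params) : NCPoly :=
  (C.a₁ - 1) • (u * u * v) + (C.a₁ + C.a₂ - 2) • (u * v * u) +
    (C.a₁ + C.a₂ + C.a₃ - 2) • (v * u * u) + (2 + C.c₁) • (u * v) + (-C.c₂) • (v * u) +
    (C.e₁ - 1) • v + (2 * κ.κ₁ - C.f₁) • u

/-- After expansion into words the conditions on the coefficients make both sides agree. A Lax
equation makes the traces of powers of `lax` constant, which gives the integrals for H and H² at
once. -/
theorem timeDeriv_lax {C : Coeffs} (hC : HasIntegrals C) (κ : Params) (z : ℂ) :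
    (system C κ z).timeDeriv (lax κ z) =
      lax κ z * laxDual C κ - laxDual C κ * lax κ z := by
  obtain ⟨h1, h2, h3, h4, h5, h6, h7⟩ := hC
  have hu : (system C κ z).timeDeriv u = (system C κ z).rhsU := NCSystem.timeDeriv_gen _ false
  have hv : (system C κ z).timeDeriv v = (system C κ z).rhsV := NCSystem.timeDeriv_gen _ true
  simp only [lax, NCSystem.timeDeriv_add, NCSystem.timeDeriv_smul, NCSystem.timeDeriv_mul, hu, hv]
  simp only [laxDual, system, h1, h2, h3, h4, h5, h6, h7]
  simp only [pow_succ, pow_zero, one_mul, mul_add, add_mul, mul_sub, sub_mul, smul_mul_assoc,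
    mul_smul_comm, mul_assoc, mul_one]
  module

theorem isTraceIntegral_of_timeDeriv_eq {F : NCSystem} {S q : NCPoly}
    (h : F.timeDeriv S = S * q - q * S) : F.IsTraceIntegral S := by
  intro m U V
  rw [h, map_sub, map_mul, map_mul, Matrix.trace_sub, Matrix.trace_mul_comm, sub_self]

theorem abelianize_lax (κ : Params) (z : ℂ) : abelianize (lax κ z) = hamiltonian κ z := by
  have hu : abelianize u = MvPolynomial.X 0 := abelianize_gen false
  have hv : abelianize v = MvPolynomial.X 1 := abelianize_gen true
  simp only [lax, map_add, map_smul, map_mul, hu, hv, hamiltonian]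
  have c2 : (MvPolynomial.C 2 : MvPolynomial (Fin 2) ℂ) = 2 := map_ofNat _ 2
  simp only [MvPolynomial.smul_eq_C_mul, map_neg, map_add, map_mul, c2]
  ring

theorem lax_mem_degreeLE (κ : Params) (z : ℂ) : lax κ z ∈ degreeLE 5 := by
  have h : ∀ (c : ℂ) (w : List Bool), w.length ≤ 5 → c • word w ∈ degreeLE 5 :=
    fun c w hw => Submodule.smul_mem _ _ (word_mem_degreeLE hw)
  have e : lax κ z = (1 : ℂ) • word [false, false, true, false, true] +
      (-2 : ℂ) • word [false, true, false, true] + (1 : ℂ) • word [true, false, true] +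
      (-κ.κ₁) • word [false, false, true] + (κ.κ₁ + κ.κ₂ + κ.κ₄ * z) • word [false, true] +
      (-κ.κ₂) • word [true] + (-κ.κ₃) • word [false] := by
    simp [lax, u_eq_gen, v_eq_gen, mul_assoc]
  rw [e]
  refine Submodule.add_mem _ (Submodule.add_mem _ (Submodule.add_mem _ (Submodule.add_mem _
    (Submodule.add_mem _ (Submodule.add_mem _ ?_ ?_) ?_) ?_) ?_) ?_) ?_ <;>
    exact h _ _ (by simp)

theorem hamiltonian_eq_toMv (κ : Params) (z : ℂ) :
    ∃ (x : ℕ → ℂ), hamiltonian κ z = (hamTab Pars.gen).toMv x :=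
  ⟨_, (toMv_hamTab (C := ⟨0, 0, 0, 0, 0, 0, 0, 0, 0, 0, 0, 0, 0, 0⟩) (ev_gen _ fun _ => 0)).symm⟩

/-- The constant polynomial. -/
noncomputable def CTab.one : CTab := .cons 0 0 (.const 1 0) .nil

theorem toMv_one (x : ℕ → ℂ) : CTab.one.toMv x = 1 := by
  simp [CTab.one, CTab.toMv, ev_const, expo]

theorem coeff_hamiltonian (κ : Params) (z : ℂ) :
    MvPolynomial.coeff (expo 3 2) (hamiltonian κ z) = 1 := by
  obtain ⟨x, h⟩ := hamiltonian_eq_toMv κ z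
  -- The factor 1 brings the coefficient into the form of `coeffProd`, whose value is found by
  -- reduction.
  rw [h, ← mul_one ((hamTab Pars.gen).toMv x), ← toMv_one x, ← ev_coeffProd]
  change (Poly.cons 1 0 1 .nil).ev x = 1
  simp [Poly.ev, Poly.mev_one]

theorem coeff_hamiltonian_sq (κ : Params) (z : ℂ) :
    MvPolynomial.coeff (expo 6 4) (hamiltonian κ z ^ 2) = 1 := by
  obtain ⟨x, h⟩ := hamiltonian_eq_toMv κ z
  rw [h, sq, ← ev_coeffProd]
  change (Poly.cons 1 0 1 .nil).ev x = 1
  simp [Poly.ev, Poly.mev_one]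

theorem degree_le_totalDegree {p : MvPolynomial (Fin 2) ℂ} {i j : ℕ}
    (h : MvPolynomial.coeff (expo i j) p ≠ 0) : i + j ≤ p.totalDegree := by
  refine le_trans (le_of_eq ?_) (MvPolynomial.le_totalDegree (MvPolynomial.mem_support_iff.2 h))
  rw [expo, Finsupp.sum_add_index' (by simp) (by simp)]
  simp

theorem totalDegree_hamiltonian_le (κ : Params) (z : ℂ) : (hamiltonian κ z).totalDegree ≤ 5 := by
  obtain ⟨x, h⟩ := hamiltonian_eq_toMv κ z
  rw [h]
  exact totalDegree_toMv_le x _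

theorem admitsIntegral_of_hasIntegrals {C : Coeffs} (hC : HasIntegrals C) (κ : Params) (z : ℂ) :
    (system C κ z).AdmitsIntegral (hamiltonian κ z) ∧
      (system C κ z).AdmitsIntegral (hamiltonian κ z ^ 2) := by
  have hd := timeDeriv_lax hC κ z
  refine ⟨⟨lax κ z, ⟨abelianize_lax κ z, degreeLE_mono ?_ (lax_mem_degreeLE κ z)⟩,
    isTraceIntegral_of_timeDeriv_eq hd⟩,
    ⟨lax κ z * lax κ z, ⟨?_, degreeLE_mono ?_
      (mul_mem_degreeLE (lax_mem_degreeLE κ z) (lax_mem_degreeLE κ z))⟩,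
      isTraceIntegral_of_timeDeriv_eq (q := laxDual C κ) ?_⟩⟩
  · exact degree_le_totalDegree (i := 3) (j := 2) (by rw [coeff_hamiltonian]; exact one_ne_zero)
  · rw [map_mul, abelianize_lax, sq]
  · exact degree_le_totalDegree (i := 6) (j := 4) (by rw [coeff_hamiltonian_sq]; exact one_ne_zero)
  -- The square of a solution of the Lax equation satisfies the same equation.
  · rw [NCSystem.timeDeriv_mul, hd]
    noncomm_ring

end Elim


namespace Elim

open NCPoly PainleveFive

/-! ### The equations for the coefficients of a trace integral -/

noncomputable def snoc (a : Bool) (w : List Bool) : List Bool :=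
  List.rec [a] (fun b _ ih => b :: ih) w

/-- The rotation of a word by one letter. -/
noncomputable def rot (w : List Bool) : List Bool := List.rec [] (fun a w _ => snoc a w) w

/-- The lexicographic order. -/
noncomputable def less (v : List Bool) : List Bool → Bool :=
  List.rec (fun _ => false) (fun a _ ih w => List.rec false (fun b w' _ =>
    Bool.rec (Bool.rec (ih w') true b) (Bool.rec false (ih w') b) a) w) v

noncomputable def leastRot (k : List Bool) : List Bool → List Bool → List Bool :=
  List.rec (fun _ best => best)
    (fun _ _ ih w best => ih (rot w) (Bool.rec best w (less w best))) k

/-- The least rotation of a word. -/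
noncomputable def canon (w : List Bool) : List Bool := leastRot w w w

/-- The list `k` only counts the rotations still to be processed. Unknowns are labelled by the least
rotation, so that words of the same cyclic class share one unknown. -/
noncomputable def rotLin (T : WTrie) (n k : List Bool) : List Bool → Lin → Lin :=
  List.rec (fun _ R => R) (fun _ _ ih w R => walk T canon n w (ih (rot w) R)) k

/-- The equations for the sums of the coefficients over rotations. The first one belongs to the
monomial `u ^ i * v ^ j`, the others to the words of length at least `N`. The unknowns are cyclic
words. -/
noncomputable def cycRows (T : WTrie) (n : List Bool) (N i j m : ℕ) : Row :=
  Nat.rec ⟨.const 0 (Nat.add i j), sumWords (Nat.add i j) j canon .nil⟩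
    (fun _ _ => Bool.rec ⟨.nil, .nil⟩ ⟨.nil, rotLin T n (bits 20 m []) (bits 20 m []) .nil⟩
      (Nat.ble N (bits 20 m []).length)) m

theorem snoc_eq (a : Bool) (w : List Bool) : snoc a w = w ++ [a] := by
  induction w with
  | nil => rfl
  | cons b w ih => rw [List.cons_append, ← ih]; rfl

theorem rot_eq (w : List Bool) : rot w = w.rotate 1 := by
  cases w with
  | nil => rfl
  | cons a w => rw [List.rotate_cons_succ, List.rotate_zero, ← snoc_eq]; rfl

theorem leastRot_eq (k y : List Bool) (a b : ℕ) :
    ∃ c, leastRot k (y.rotate a) (y.rotate b) = y.rotate c := by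
  induction k generalizing a b with
  | nil => exact ⟨b, rfl⟩
  | cons _ k ih =>
    change ∃ c, leastRot k (rot (y.rotate a))
      (Bool.rec (y.rotate b) (y.rotate a) (less (y.rotate a) (y.rotate b))) = _
    rw [rot_eq, List.rotate_rotate]
    cases less (y.rotate a) (y.rotate b)
    · exact ih _ _
    · exact ih _ _

theorem cycSum_canon (f : List Bool → ℂ) (w : List Bool) : cycSum f (canon w) = cycSum f w := by
  obtain ⟨c, hc⟩ := leastRot_eq w w 0 0
  rw [List.rotate_zero] at hc
  rw [canon, hc, cycSum_rotate]

theorem ev_rotLin {x : ℕ → ℂ} (f : List Bool → ℂ) (T : WTrie) (n k w : List Bool)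
    (R : Lin) (hf : ∀ l y, n ≠ [] → w.length < y.length + n.length → cycSum f (l :: y) = 0) :
    (rotLin T n k w R).ev x (cycSum f) =
      ∑ j ∈ Finset.range k.length,
        (conv (T.val x false) (fun y => cycSum f (false :: y)) (w.rotate j) +
          conv (T.val x true) (fun y => cycSum f (true :: y)) (w.rotate j)) +
        R.ev x (cycSum f) := by
  induction k generalizing w with
  | nil => simp [rotLin]
  | cons _ k ih =>
    change (walk T canon n w (rotLin T n k (rot w) R)).ev x (cycSum f) = _
    rw [ev_walk, ih, rot_eq, List.length_cons, Finset.sum_range_succ']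
    · simp only [cycSum_canon, List.rotate_rotate, List.rotate_zero, add_comm 1]
      ring
    · rw [rot_eq, List.length_rotate]; exact hf
    · intro l y hn h
      rw [cycSum_canon]
      exact hf l y hn h

/-- The coefficients of a trace integral satisfy the equations. -/
theorem ev_cycRows {x : ℕ → ℂ} {F : NCSystem} {S : NCPoly} (hF : ∀ a, F.rhs a ∈ degreeLE 4)
    (hS : F.IsTraceIntegral S) {T : WTrie} {n : List Bool} {t : ℂ}
    (hT : ∀ b w, n.length ≤ w.length → T.val x b w = t * F.cf b w)
    {d N i j : ℕ} (hd : S ∈ degreeLE d) (hN : d + n.length ≤ N + 1) (hN' : d + 3 < 2 * N)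
    (hc : MvPolynomial.coeff (expo i j) (abelianize S) = 1) (m : ℕ) :
    (cycRows T n N i j m).ev x (cycSum (coeff S)) = 0 := by
  have h0 : (Row.mk Poly.nil Lin.nil).ev x (cycSum (coeff S)) = 0 := by
    simp [Row.ev, Poly.ev, Lin.ev]
  cases m with
  | zero =>
    change (Poly.const 0 (i + j)).ev x + (sumWords (i + j) j canon .nil).ev x _ = 0
    rw [ev_sumWords, ev_const]
    simp only [cycSum_canon]
    rw [sum_cycSum_wordsOf, hc, Lin.ev]
    push_cast
    ring
  | succ m =>
    unfold cycRows
    simp only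
    generalize bits 20 (m + 1) [] = W
    cases hb : Nat.ble N W.length with
    | false => exact h0
    | true =>
      have hW : N ≤ W.length := Nat.le_of_ble_eq_true hb
      have hdeg : ∀ l (y : List Bool), W.length + 1 < y.length + 1 + n.length →
          cycSum (coeff S) (l :: y) = 0 := by
        intro l y h
        apply cycSum_of_length_eq
        intro w hw
        apply coeff_eq_zero_of_mem_degreeLE hd
        rw [hw, List.length_cons]
        omega
      change Poly.nil.ev x + (rotLin T n W W .nil).ev x _ = 0
      rw [ev_rotLin _ _ _ _ _ _ fun l y _ h => hdeg l y (by omega), Lin.ev, Poly.ev, zero_add,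
        add_zero]
      have hz := hS.cycCoeff_eq_zero (m := 3) hF hd (W := W) (by omega)
      rw [NCSystem.cycCoeff_timeDeriv] at hz
      -- A word s of the system that is too short to be recorded correctly in `T` would leave a
      -- cyclic word longer than `d`, whose sum is zero; `hN` is the bound that guarantees this.
      have hconv : ∀ (b : Bool) (k : ℕ),
          conv (T.val x b) (fun y => cycSum (coeff S) (b :: y)) (W.rotate k) =
            t * conv (F.cf b) (fun y => cycSum (coeff S) (b :: y)) (W.rotate k) := by
        intro b k
        rw [← conv_smul_left]
        apply conv_congr_left
        intro s y e hy
        apply hT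
        by_contra hlt
        have hl := congrArg List.length e
        rw [List.length_rotate, List.length_append] at hl
        exact hy (hdeg b y (by omega))
      simp only [hconv, ← mul_add, ← Finset.mul_sum, hz, mul_zero]

/-- The terms of degree at least 3 of the general system, multiplied by `t`. -/
noncomputable def topTab (t : ℕ) (a₁ a₂ a₃ b₁ b₂ b₃ b₄ b₅ c₁ c₂ d₁ d₂ : Poly) : WTrie :=
  sysTab a₁ a₂ a₃ (.add (.const (Nat.mul 2 t) 0) (.neg (.add a₁ (.add a₂ a₃))))
    b₁ b₂ b₃ b₄ b₅
    (.add (.const 0 (Nat.mul 3 t)) (.neg (.add b₁ (.add b₂ (.add b₃ (.add b₄ b₅))))))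
    c₁ (.add (.const 0 (Nat.mul 4 t)) (.neg (.add c₁ c₂))) c₂
    d₁ (.add (.const (Nat.mul 4 t) 0) (.neg (.add d₁ d₂))) d₂
    .nil .nil .nil .nil .nil .nil .nil .nil

theorem val_topTab (C : Coeffs) (κ : Params) (z : ℂ) (x : ℕ → ℂ) (t : ℕ)
    {a₁ a₂ a₃ b₁ b₂ b₃ b₄ b₅ c₁ c₂ d₁ d₂ : Poly}
    (ha₁ : a₁.ev x = t * C.a₁) (ha₂ : a₂.ev x = t * C.a₂) (ha₃ : a₃.ev x = t * C.a₃)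
    (hb₁ : b₁.ev x = t * C.b₁) (hb₂ : b₂.ev x = t * C.b₂)
    (hb₃ : b₃.ev x = t * C.b₃) (hb₄ : b₄.ev x = t * C.b₄) (hb₅ : b₅.ev x = t * C.b₅)
    (hc₁ : c₁.ev x = t * C.c₁) (hc₂ : c₂.ev x = t * C.c₂) (hd₁ : d₁.ev x = t * C.d₁)
    (hd₂ : d₂.ev x = t * C.d₂) (b : Bool) (w : List Bool) (hw : 3 ≤ w.length) :
    (topTab t a₁ a₂ a₃ b₁ b₂ b₃ b₄ b₅ c₁ c₂ d₁ d₂).val x b w = t * (system C κ z).cf b w := by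
  have hnil : Poly.ev x .nil = 0 := rfl
  cases b
  · rw [cf_system_false]
    rcases w with _ | ⟨_ | _, _ | ⟨_ | _, _ | ⟨_ | _, _ | ⟨_ | _, _ | ⟨_, w⟩⟩⟩⟩⟩ <;>
      simp [topTab, sysTab, val_nil, Poly.ev_neg, Poly.ev_add, ev_const, *] at hw ⊢ <;> ring
  · rw [cf_system_true]
    rcases w with _ | ⟨_ | _, _ | ⟨_ | _, _ | ⟨_ | _, _ | ⟨_ | _, _ | ⟨_, w⟩⟩⟩⟩⟩ <;>
      simp [topTab, sysTab, val_nil, Poly.ev_neg, Poly.ev_add, ev_const, *] at hw ⊢ <;> ring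

theorem rhs_system_mem_degreeLE (C : Coeffs) (κ : Params) (z : ℂ) (a : Bool) :
    (system C κ z).rhs a ∈ degreeLE 4 := by
  have h : ∀ (c : ℂ) (w : List Bool), w.length ≤ 4 → c • word w ∈ degreeLE 4 :=
    fun c w hw => Submodule.smul_mem _ _ (word_mem_degreeLE hw)
  have h' : ∀ w : List Bool, w.length ≤ 4 → word w ∈ degreeLE 4 := fun w => word_mem_degreeLE
  cases a
  · rw [rhs_system_false]
    repeat first | refine Submodule.sub_mem _ ?_ ?_ | refine Submodule.add_mem _ ?_ ?_
    all_goals exact h _ _ (by decide)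
  · rw [rhs_system_true]
    repeat first | refine Submodule.sub_mem _ ?_ ?_ | refine Submodule.add_mem _ ?_ ?_
    all_goals first | exact h _ _ (by decide) | exact h' _ (by decide)

/-- The assignment of values to the variables: the coefficients of the system belong to the first
primes, then follow further numbers. -/
noncomputable def point (C : Coeffs) (s : ℕ → ℂ) : ℕ → ℂ
  | 2 => C.a₁
  | 3 => C.a₂
  | 5 => C.a₃
  | 7 => C.c₁
  | 11 => C.c₂
  | 13 => C.d₁
  | 17 => C.d₂
  | 19 => C.b₁
  | 23 => C.b₂
  | 29 => C.b₃
  | 31 => C.b₄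
  | 37 => C.b₅
  | 41 => s 0
  | 43 => s 1
  | 47 => s 2
  | 53 => s 3
  | _ => 0

theorem mev_point (C : Coeffs) (s : ℕ → ℂ) (l : List ℕ) :
    Poly.mev (point C s) (mon (2 :: l)) = C.a₁ * Poly.mev (point C s) (mon l) ∧
    Poly.mev (point C s) (mon (3 :: l)) = C.a₂ * Poly.mev (point C s) (mon l) ∧
    Poly.mev (point C s) (mon (5 :: l)) = C.a₃ * Poly.mev (point C s) (mon l) ∧
    Poly.mev (point C s) (mon (7 :: l)) = C.c₁ * Poly.mev (point C s) (mon l) ∧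
    Poly.mev (point C s) (mon (11 :: l)) = C.c₂ * Poly.mev (point C s) (mon l) ∧
    Poly.mev (point C s) (mon (13 :: l)) = C.d₁ * Poly.mev (point C s) (mon l) ∧
    Poly.mev (point C s) (mon (17 :: l)) = C.d₂ * Poly.mev (point C s) (mon l) ∧
    Poly.mev (point C s) (mon (19 :: l)) = C.b₁ * Poly.mev (point C s) (mon l) ∧
    Poly.mev (point C s) (mon (23 :: l)) = C.b₂ * Poly.mev (point C s) (mon l) ∧
    Poly.mev (point C s) (mon (29 :: l)) = C.b₃ * Poly.mev (point C s) (mon l) ∧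
    Poly.mev (point C s) (mon (31 :: l)) = C.b₄ * Poly.mev (point C s) (mon l) ∧
    Poly.mev (point C s) (mon (37 :: l)) = C.b₅ * Poly.mev (point C s) (mon l) ∧
    Poly.mev (point C s) (mon (41 :: l)) = s 0 * Poly.mev (point C s) (mon l) ∧
    Poly.mev (point C s) (mon (43 :: l)) = s 1 * Poly.mev (point C s) (mon l) ∧
    Poly.mev (point C s) (mon (47 :: l)) = s 2 * Poly.mev (point C s) (mon l) ∧
    Poly.mev (point C s) (mon (53 :: l)) = s 3 * Poly.mev (point C s) (mon l) := by
  refine ⟨?_, ?_, ?_, ?_, ?_, ?_, ?_, ?_, ?_, ?_, ?_, ?_, ?_, ?_, ?_, ?_⟩ <;>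
    exact mev_mon_cons _ (by norm_num) l

theorem ev_var_point (C : Coeffs) (s : ℕ → ℂ) :
    (Poly.var 2).ev (point C s) = C.a₁ ∧
    (Poly.var 3).ev (point C s) = C.a₂ ∧
    (Poly.var 5).ev (point C s) = C.a₃ ∧
    (Poly.var 7).ev (point C s) = C.c₁ ∧
    (Poly.var 11).ev (point C s) = C.c₂ ∧
    (Poly.var 13).ev (point C s) = C.d₁ ∧
    (Poly.var 17).ev (point C s) = C.d₂ ∧
    (Poly.var 19).ev (point C s) = C.b₁ ∧
    (Poly.var 23).ev (point C s) = C.b₂ ∧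
    (Poly.var 29).ev (point C s) = C.b₃ ∧
    (Poly.var 31).ev (point C s) = C.b₄ ∧
    (Poly.var 37).ev (point C s) = C.b₅ ∧
    (Poly.var 41).ev (point C s) = s 0 ∧
    (Poly.var 43).ev (point C s) = s 1 ∧
    (Poly.var 47).ev (point C s) = s 2 ∧
    (Poly.var 53).ev (point C s) = s 3 := by
  refine ⟨?_, ?_, ?_, ?_, ?_, ?_, ?_, ?_, ?_, ?_, ?_, ?_, ?_, ?_, ?_, ?_⟩ <;>
    exact ev_var _ (by norm_num)

/-- The results of elimination in the equations for a trace integral. -/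
theorem allZero_of_isTraceIntegral {C : Coeffs} {κ : Params} {z : ℂ} {x : ℕ → ℂ} {S : NCPoly}
    (hS : (system C κ z).IsTraceIntegral S) {d i j : ℕ} (hd : S ∈ degreeLE d)
    (hc : MvPolynomial.coeff (expo i j) (abelianize S) = 1) {T : WTrie} {n : List Bool} {t : ℂ}
    (hT : ∀ b w, 3 ≤ w.length → T.val x b w = t * (system C κ z).cf b w) {N D : ℕ}
    {units : List Poly} {symb : List (List Bool × ℕ)} {script : Script} {out : List (Comb × Poly)}
    (h : check D (cycRows T n N i j) units symb script out = true) (hn : 3 ≤ n.length)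
    (hN : d + n.length ≤ N + 1) (hN' : d + 3 < 2 * N) (hunits : ∀ p ∈ units, Poly.ev x p ≠ 0)
    (hsymb : ∀ s ∈ symb, Poly.mev x s.2 = cycSum (coeff S) s.1) : AllZero x out :=
  allZero_iff.2 (check_sound (ev_cycRows (rhs_system_mem_degreeLE C κ z) hS
    (fun b w hw => hT b w (hn.trans hw)) hd hN hN' hc) hunits hsymb h)

end Elim

namespace Elim

/-! ### Certificates for the trace integrals -/

/-- The general system. -/
noncomputable def generalTab : WTrie :=
  topTab 1 (.var 2) (.var 3) (.var 5) (.var 19) (.var 23) (.var 29) (.var 31) (.var 37) (.var 7)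
    (.var 11) (.var 13) (.var 17)

/-- The cyclic words with three u and two v are uuuvv and uuvuv, coded by 41 and 43. Words of 8
letters see only the quartic part of the system, and the last relation says that the two sums add up
to 1. -/
theorem hamiltonian_check :
    check 1 (cycRows generalTab [false, false, false, false] 8 3 2)
    []
    [([false, false, false, true, true], 41), ([false, false, true, false, true], 43)]
    .nil
    [((.cons 1 0 263 .nil), (.cons 0 1 (mon [3, 41]) (.cons 0 1 (mon [5, 41]) (.cons 0 1 (mon
    [23, 41]) (.cons 0 1 (mon [29, 41]) (.cons 0 1 (mon [31, 41]) (.cons 0 1 (mon [37, 41])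
    (.cons 0 1 (mon [41]) .nil)))))))), ((.cons 1 0 267 .nil), (.cons 1 0 (mon [2, 41]) (.cons 0
    1 (mon [2, 43]) (.cons 1 0 (mon [3, 41]) (.cons 0 1 (mon [3, 43]) (.cons 0 1 (mon [5, 43])
    (.cons 0 1 (mon [19, 43]) (.cons 1 0 (mon [23, 41]) (.cons 0 1 (mon [23, 43]) (.cons 1 0
    (mon [29, 41]) (.cons 0 1 (mon [29, 43]) (.cons 0 1 (mon [31, 43]) (.cons 0 1 (mon [37, 43])
    (.cons 0 1 (mon [43]) .nil)))))))))))))), ((.cons 1 0 269 .nil), (.cons 0 1 (mon [2, 41])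
    (.cons 1 0 (mon [2, 43]) (.cons 0 1 (mon [3, 41]) (.cons 1 0 (mon [19, 43]) (.cons 1 0 (mon
    [29, 41]) (.cons 1 0 (mon [37, 41]) (.cons 2 0 (mon [41]) .nil)))))))), ((.cons 1 0 275
    .nil), (.cons 1 0 (mon [2, 41]) (.cons 0 1 (mon [2, 43]) (.cons 1 0 (mon [3, 41]) (.cons 0 1
    (mon [3, 43]) (.cons 1 0 (mon [5, 41]) (.cons 0 1 (mon [5, 43]) (.cons 1 0 (mon [19, 41])
    (.cons 0 1 (mon [19, 43]) (.cons 0 1 (mon [23, 43]) (.cons 1 0 (mon [31, 41]) (.cons 0 1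
    (mon [31, 43]) (.cons 0 1 (mon [37, 43]) (.cons 0 1 (mon [43]) .nil)))))))))))))), ((.cons 1
    0 277 .nil), (.cons 1 0 (mon [23, 41]) (.cons 1 0 (mon [23, 43]) (.cons 1 0 (mon [37, 41])
    (.cons 1 0 (mon [37, 43]) (.cons 2 0 (mon [43]) .nil)))))), ((.cons 1 0 281 .nil), (.cons 0
    1 (mon [2, 41]) (.cons 1 0 (mon [2, 43]) (.cons 0 1 (mon [19, 41]) (.cons 1 0 (mon [19, 43])
    (.cons 0 1 (mon [23, 41]) (.cons 0 1 (mon [29, 41]) (.cons 1 0 (mon [29, 43]) (.cons 0 1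
    (mon [37, 41]) (.cons 0 1 (mon [41]) .nil)))))))))), ((.cons 1 0 293 .nil), (.cons 2 0 (mon
    [3, 43]) (.cons 2 0 (mon [5, 43]) (.cons 1 0 (mon [23, 43]) (.cons 2 0 (mon [31, 43]) (.cons
    1 0 (mon [37, 43]) .nil)))))), ((.cons 1 0 0 .nil), (.cons 0 5 (mon []) (.cons 5 0 (mon
    [41]) (.cons 5 0 (mon [43]) .nil))))] = true := by
  decide +kernel

/-- Words of 7 letters also involve the cubic part of the system and the cyclic words uuvv and uvuv
of the integral, coded by 47 and 53. -/
theorem hamiltonian_check_cubic :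
    check 1 (cycRows generalTab [false, false, false] 7 3 2)
    []
    [([false, false, false, true, true], 41), ([false, false, true, false, true], 43), ([false,
    false, true, true], 47), ([false, true, false, true], 53)]
    .nil
    [((.cons 1 0 139 .nil), (.cons 1 0 (mon [2, 47]) (.cons 0 1 (mon [2, 53]) (.cons 1 0 (mon
    [3, 47]) (.cons 0 1 (mon [3, 53]) (.cons 0 1 (mon [5, 53]) (.cons 0 1 (mon [19, 53]) (.cons
    1 0 (mon [23, 47]) (.cons 0 1 (mon [23, 53]) (.cons 1 0 (mon [29, 47]) (.cons 0 1 (mon [29,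
    53]) (.cons 0 1 (mon [31, 53]) (.cons 0 1 (mon [37, 53]) (.cons 0 1 (mon [11, 41]) (.cons 1
    0 (mon [11, 43]) (.cons 0 1 (mon [17, 41]) (.cons 1 0 (mon [17, 43]) (.cons 0 1 (mon [53])
    .nil)))))))))))))))))), ((.cons 1 0 141 .nil), (.cons 0 1 (mon [2, 47]) (.cons 1 0 (mon [2,
    53]) (.cons 0 1 (mon [3, 47]) (.cons 1 0 (mon [19, 53]) (.cons 1 0 (mon [29, 47]) (.cons 1 0
    (mon [37, 47]) (.cons 0 1 (mon [7, 41]) (.cons 1 0 (mon [7, 43]) (.cons 0 1 (mon [13, 41])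
    (.cons 1 0 (mon [13, 43]) (.cons 2 0 (mon [47]) .nil))))))))))))] = true := by
  decide +kernel

/-- The family without `uuuvv` in the Hamiltonian. -/
noncomputable def plainTab : WTrie :=
  topTab 1 (.var 2) (.var 3) (.var 5) (.neg (.var 2)) (.add (.var 41) (.neg (.add (.var 2) (.var 3))))
    .nil (.add (.const 1 0) (.neg (.add (.var 3) (.var 5))))
    (.add (.const 0 2) (.neg (.add (.var 41) (.neg (.add (.var 2) (.var 3)))))) (.var 7) (.var 11)
    (.var 13) (.var 17)

/-- The integral of H leaves the sum a₁ + a₂ + b₂ undetermined; it is the parameter 41. Of the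
cyclic words of degree 10 one is kept as the variable 43. -/
theorem plain_check :
    check 2 (cycRows plainTab [false, false, false, false] 13 6 4)
    []
    [([false, false, true, false, true, false, false, true, false, true], 43)]
    (.rows [8271, 8347, 8487, 8649, 8775, 8803, 9363, 9381, 8499, 8349, 8471, 8905, 8781, 8857,
    8793, 8537, 8501, 8749, 8805, 8809, 0] .nil)
    [((.cons 1 0 8853 .nil), (.cons 0 2 (mon []) (.cons 0 2 (mon [41, 43]) (.cons 1 0 (mon [43])
    .nil)))), ((.cons 1 0 8869 .nil), (.cons 0 2 (mon []) (.cons 2 0 (mon [41, 43]) (.cons 1 0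
    (mon [43]) .nil)))), ((.cons 1 0 8789 .nil), (.cons 2 0 (mon []) (.cons 2 0 (mon [41])
    (.cons 0 1 (mon [41, 43]) (.cons 0 1 (mon [43]) .nil)))))] = true := by
  decide +kernel

/-- The family with `p` times `uuuvv` in the Hamiltonian. -/
noncomputable def shiftTab (p : Poly) : WTrie :=
  topTab 1 (.var 2) (.var 3) (.var 5) (.neg (.var 2)) (.add p (.neg (.add (.var 2) (.var 3))))
    (.neg p) (.add (.add (.const 1 0) (.neg p)) (.neg (.add (.var 3) (.var 5))))
    (.add (.add (.const 0 2) (.add p p)) (.neg (.add p (.neg (.add (.var 2) (.var 3)))))) (.var 7)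
    (.var 11) (.var 13) (.var 17)

/-- For p different from 0, 1 and 2 the elimination reduces the normalization, equation 0, to -10 =
0; 10 is the number of letters in a word of bidegree (6, 4). -/
theorem shift_check :
    check 1 (cycRows (shiftTab (.var 41)) [false, false, false, false] 13 6 4)
    [(.cons 1 0 (mon [41]) .nil), (.cons 0 1 (mon [41]) .nil), (.cons 0 1 (mon []) (.cons 1 0
    (mon [41]) .nil)), (.cons 0 2 (mon [41]) .nil), (.cons 0 2 (mon []) (.cons 2 0 (mon [41])
    .nil)), (.cons 2 0 (mon []) (.cons 0 1 (mon [41]) .nil)), (.cons 2 0 (mon []) (.cons 0 2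
    (mon [41]) .nil)), (.cons 1 0 (mon []) (.cons 0 1 (mon [41]) .nil))]
    []
    (.rows [8239, 8343, 8391, 8419, 8425, 8583, 9381, 8299, 9365, 8779, 9033, 8493, 8491, 8787,
    8781, 9001, 8617, 8905, 8755, 8803, 8851, 8789] .nil)
    [((.cons 1 0 0 .nil), (.cons 0 10 (mon []) .nil))] = true := by
  decide +kernel

/-- At p = 1 the expressions 1 - p and 2 - 2p inverted in `shift_check` vanish. -/
theorem shift_check_one :
    check 1 (cycRows (shiftTab (.const 1 0)) [false, false, false, false] 13 6 4)
    []
    []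
    (.rows [8239, 8279, 8299, 8309, 8349, 8377, 8533, 8583, 8873, 8869, 9363, 8985, 8805, 8857,
    8779, 8905, 8803, 8597, 8499, 8501, 8755, 8611] .nil)
    [((.cons 1 0 0 .nil), (.cons 0 10 (mon []) .nil))] = true := by
  decide +kernel

/-- At p = 2 the expression 2 - p inverted in `shift_check` vanishes. -/
theorem shift_check_two :
    check 1 (cycRows (shiftTab (.const 2 0)) [false, false, false, false] 13 6 4)
    []
    []
    (.rows [8239, 8343, 8391, 8419, 8425, 8583, 8779, 9381, 8299] (.comb (.cons 1 0 8523 (.cons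
    2 0 8787 .nil)) (.rows [8365, 8395, 8491, 8373, 8537, 8553, 8499, 8523, 8587, 8533, 8549,
    8851] .nil)))
    [((.cons 1 0 0 .nil), (.cons 0 10 (mon []) .nil))] = true := by
  decide +kernel

/-- The exceptional family, multiplied by two. -/
noncomputable def halfTab : WTrie :=
  topTab 2 (.smul 2 0 (.var 2)) (.smul 2 0 (.var 3)) (.smul 2 0 (.var 5))
    (.smul 2 0 (.add (.var 41) (.neg (.var 2))))
    (.add (.const 1 0) (.smul 2 0 (.add (.var 41) (.neg (.add (.var 2) (.var 3))))))
    (.const 0 1) (.add (.const 1 0) (.neg (.smul 2 0 (.add (.var 3) (.var 5)))))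
    (.add (.const 0 3) (.neg (.smul 2 0 (.add (.var 41) (.neg (.add (.var 2) (.var 3)))))))
    (.smul 2 0 (.var 7)) (.smul 2 0 (.var 11)) (.smul 2 0 (.var 13)) (.smul 2 0 (.var 17))

/-- At p = 1/2 the sum a₁ + b₁ is not determined by the first integral and becomes the parameter 41.
The first two relations force the unknown coded by 43 to vanish, and the third then reads -300 = 0.
-/
theorem half_check :
    check 30 (cycRows halfTab [false, false, false, false] 13 6 4)
    []
    [([false, false, true, false, true, false, false, true, false, true], 43)]
    (.rows [9363, 9365, 8851, 8997, 8853, 8787, 8867, 9001, 8595, 8805, 8857, 8523, 8775, 8613,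
    8499, 8395, 8525, 8761, 8359, 8299, 8405] .nil)
    [((.cons 1 0 8985 .nil), (.cons 60 0 (mon [41, 43]) .nil)), ((.cons 1 0 8781 .nil), (.cons 0
    60 (mon [41, 43]) (.cons 0 90 (mon [43]) .nil))), ((.cons 1 0 0 .nil), (.cons 0 300 (mon [])
    (.cons 1840 0 (mon [41, 41, 41, 43]) (.cons 0 6340 (mon [41, 41, 43]) (.cons 2700 0 (mon
    [41, 43]) (.cons 0 1050 (mon [43]) .nil))))))] = true := by
  decide +kernel

end Elim

/-! ### Necessity of the conditions for two trace integrals -/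

namespace Elim

open NCPoly PainleveFive

theorem mev_point_prime (C : Coeffs) (s : ℕ → ℂ) :
    Poly.mev (point C s) 41 = s 0 ∧ Poly.mev (point C s) 43 = s 1 ∧
      Poly.mev (point C s) 47 = s 2 ∧ Poly.mev (point C s) 53 = s 3 := by
  refine ⟨?_, ?_, ?_, ?_⟩ <;> exact Poly.mev_prime _ (by norm_num)

theorem val_generalTab (C : Coeffs) (κ : Params) (z : ℂ) (s : ℕ → ℂ) (b : Bool) (w : List Bool)
    (hw : 3 ≤ w.length) :
    generalTab.val (point C s) b w = ((1 : ℕ) : ℂ) * (system C κ z).cf b w := by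
  refine val_topTab C κ z _ 1 ?_ ?_ ?_ ?_ ?_ ?_ ?_ ?_ ?_ ?_ ?_ ?_ b w hw <;>
    simp only [ev_var_point, Nat.cast_one, one_mul]

section Quadratic

variable {C : Coeffs} {κ : Params} {z : ℂ} {S : NCPoly}

/-- The condition on the coefficients if `uuuvv` does not occur in the first integral. -/
theorem b₂_eq_of_isTraceIntegral (hS : (system C κ z).IsTraceIntegral S) (hd : S ∈ degreeLE 10)
    (hc : MvPolynomial.coeff (expo 6 4) (abelianize S) = 1)
    (h1 : C.b₁ = -C.a₁) (h3 : C.b₃ = 0) (h4 : C.b₄ = 1 - C.a₂ - C.a₃) (h5 : C.b₂ + C.b₅ = -2) :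
    C.b₂ = -C.a₁ - C.a₂ := by
  -- The first value is the deviation from the desired condition on the coefficients; only the
  -- second one is an unknown of the integral.
  obtain ⟨s, hs⟩ : ∃ s : ℕ → ℂ, s = fun i => if i = 0 then C.a₁ + C.a₂ + C.b₂ else
    cycSum (coeff S) [false, false, true, false, true, false, false, true, false, true] := ⟨_, rfl⟩
  have h0 : s 0 = C.a₁ + C.a₂ + C.b₂ := by simp [hs]
  have hT : ∀ b w, 3 ≤ w.length →
      plainTab.val (point C s) b w = ((1 : ℕ) : ℂ) * (system C κ z).cf b w := by
    intro b w hw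
    refine val_topTab C κ z _ 1 ?_ ?_ ?_ ?_ ?_ ?_ ?_ ?_ ?_ ?_ ?_ ?_ b w hw <;>
      simp only [ev_var_point, Poly.ev_add, Poly.ev_neg, ev_const, Nat.cast_one, one_mul, h0]
    · rw [h1]
    · ring
    · rw [h3]; rfl
    · rw [h4]; push_cast; ring
    · push_cast; linear_combination -h5
  have key := allZero_of_isTraceIntegral hS hd hc hT plain_check (by decide) (by decide)
    (by decide) (by simp) (by simp [mev_point_prime, hs])
  simp only [AllZero, Poly.ev, mev_point, mev_mon_nil] at key
  obtain ⟨k1, k2, k3, -⟩ := key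
  push_cast at k1 k2 k3
  -- The first two relations give s 1 = 2 and s 0 s 1 = 0, and the third one is consistent with s 0
  -- = 0 only.
  linear_combination -h0 + k3 / 2 + (k2 - k1) / 8 + (k1 + k2) / 4

/-- The equations for words of at least 13 letters make the cyclic sums of bidegree (6, 4) add up to
zero, which is incompatible with the leading coefficient 1 of H². -/
theorem not_shift (hS : (system C κ z).IsTraceIntegral S) (hd : S ∈ degreeLE 10)
    (hc : MvPolynomial.coeff (expo 6 4) (abelianize S) = 1) {p : ℂ} (hp : p ≠ 0)
    (h1 : C.b₁ = -C.a₁) (h2 : C.b₂ = p - C.a₁ - C.a₂) (h3 : C.b₃ = -p)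
    (h4 : C.b₄ = 1 - p - C.a₂ - C.a₃) (h5 : C.b₂ + C.b₅ = -2 + 2 * p) : False := by
  have hT : ∀ q : Poly, q.ev (point C fun _ => p) = p → ∀ b w, 3 ≤ w.length →
      (shiftTab q).val (point C fun _ => p) b w = ((1 : ℕ) : ℂ) * (system C κ z).cf b w := by
    intro q hq b w hw
    refine val_topTab C κ z _ 1 ?_ ?_ ?_ ?_ ?_ ?_ ?_ ?_ ?_ ?_ ?_ ?_ b w hw <;>
      simp only [ev_var_point, Poly.ev_add, Poly.ev_neg, ev_const, Nat.cast_one, one_mul, hq]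
    · rw [h1]
    · rw [h2]; ring
    · rw [h3]
    · rw [h4]; push_cast; ring
    · push_cast; linear_combination h2 - h5
  by_cases hp1 : p = 1
  · have key := allZero_of_isTraceIntegral hS hd hc
      (hT (.const 1 0) (by rw [ev_const, hp1]; simp)) shift_check_one (by decide) (by decide)
      (by decide) (by simp) (by simp)
    simp only [AllZero, Poly.ev, mev_mon_nil] at key
    norm_num at key
  by_cases hp2 : p = 2
  · have key := allZero_of_isTraceIntegral hS hd hc
      (hT (.const 2 0) (by rw [ev_const, hp2]; simp)) shift_check_two (by decide) (by decide)
      (by decide) (by simp) (by simp)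
    simp only [AllZero, Poly.ev, mev_mon_nil] at key
    norm_num at key
  have l1 : 1 + -p ≠ 0 := fun h => hp1 (by linear_combination -h)
  have l2 : 2 + -p ≠ 0 := fun h => hp2 (by linear_combination -h)
  have l3 : -1 + p ≠ 0 := fun h => hp1 (by linear_combination h)
  have l4 : -2 + 2 * p ≠ 0 := fun h => hp1 (by linear_combination h / 2)
  have l5 : 2 + -(2 * p) ≠ 0 := fun h => hp1 (by linear_combination -h / 2)
  have key := allZero_of_isTraceIntegral hS hd hc (hT (.var 41) (by simp only [ev_var_point]))
    shift_check (by decide) (by decide) (by decide) (by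
      simp only [List.forall_mem_cons, Poly.ev, mev_point, mev_mon_nil]
      simp [hp, l1, l2, l3, l4, l5]) (by simp)
  simp only [AllZero, Poly.ev, mev_mon_nil] at key
  norm_num at key

theorem not_half (hS : (system C κ z).IsTraceIntegral S) (hd : S ∈ degreeLE 10)
    (hc : MvPolynomial.coeff (expo 6 4) (abelianize S) = 1)
    (h2 : C.b₂ = C.b₁ + 1 / 2 - C.a₂) (h3 : C.b₃ = -1 / 2)
    (h4 : C.b₄ = 1 / 2 - C.a₂ - C.a₃) (h5 : C.b₂ + C.b₅ = -1) : False := by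
  obtain ⟨s, hs⟩ : ∃ s : ℕ → ℂ, s = fun i => if i = 0 then C.a₁ + C.b₁ else
    cycSum (coeff S) [false, false, true, false, true, false, false, true, false, true] := ⟨_, rfl⟩
  have h0 : s 0 = C.a₁ + C.b₁ := by simp [hs]
  have hT : ∀ b w, 3 ≤ w.length →
      halfTab.val (point C s) b w = ((2 : ℕ) : ℂ) * (system C κ z).cf b w := by
    intro b w hw
    refine val_topTab C κ z _ 2 ?_ ?_ ?_ ?_ ?_ ?_ ?_ ?_ ?_ ?_ ?_ ?_ b w hw <;>
      simp only [ev_var_point, Poly.ev_add, Poly.ev_neg, Poly.ev_smul, ev_const, h0] <;> push_cast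
    all_goals try ring1
    · rw [h2]; ring
    · rw [h3]; ring
    · rw [h4]; ring
    · linear_combination 2 * h2 - 2 * h5
  have key := allZero_of_isTraceIntegral hS hd hc hT half_check (by decide) (by decide)
    (by decide) (by simp) (by simp [mev_point_prime, hs])
  simp only [AllZero, Poly.ev, mev_point, mev_mon_nil] at key
  obtain ⟨k1, k2, k3, -⟩ := key
  push_cast at k1 k2 k3
  -- The terms with s 0 s 1 cancel in the sum of the two relations.
  have hz : s 1 = 0 := by linear_combination -(k1 + k2) / 90
  rw [hz] at k3
  norm_num at k3

end Quadratic

theorem hasIntegrals_of_admitsIntegral {C : Coeffs} {κ : Params} {z : ℂ}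
    (h1 : (system C κ z).AdmitsIntegral (hamiltonian κ z))
    (h2 : (system C κ z).AdmitsIntegral (hamiltonian κ z ^ 2)) : HasIntegrals C := by
  obtain ⟨S, ⟨hS1, hS2⟩, hS⟩ := h1
  obtain ⟨R, ⟨hR1, hR2⟩, hR⟩ := h2
  have hSd : S ∈ degreeLE 5 := degreeLE_mono (totalDegree_hamiltonian_le κ z) hS2
  have hSc : MvPolynomial.coeff (expo 3 2) (abelianize S) = 1 := by rw [hS1, coeff_hamiltonian]
  have hRd : R ∈ degreeLE 10 := degreeLE_mono ((MvPolynomial.totalDegree_pow _ _).trans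
    (Nat.mul_le_mul_left 2 (totalDegree_hamiltonian_le κ z))) hR2
  have hRc : MvPolynomial.coeff (expo 6 4) (abelianize R) = 1 := by
    rw [hR1, coeff_hamiltonian_sq]
  obtain ⟨s, hs⟩ : ∃ s : ℕ → ℂ, s = fun i => cycSum (coeff S)
    ([[false, false, false, true, true], [false, false, true, false, true],
      [false, false, true, true], [false, true, false, true]].getD i []) := ⟨_, rfl⟩
  have key := allZero_of_isTraceIntegral hS hSd hSc (val_generalTab C κ z s) hamiltonian_check
    (by decide) (by decide) (by decide) (by simp) (by simp [mev_point_prime, hs])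
  have key' := allZero_of_isTraceIntegral hS hSd hSc (val_generalTab C κ z s)
    hamiltonian_check_cubic (by decide) (by decide) (by decide) (by simp)
    (by simp [mev_point_prime, hs])
  simp only [AllZero, Poly.ev, mev_point, mev_mon_nil] at key key'
  obtain ⟨r1, r2, r3, r4, r5, r6, r7, r8, -⟩ := key
  obtain ⟨c1, c2, -⟩ := key'
  clear hs
  push_cast at r1 r2 r3 r4 r5 r6 r7 r8 c1 c2
  generalize s 0 = p at *
  have hq : s 1 = 1 - p := by linear_combination r8 / 5
  rw [hq] at r2 r3 r4 r5 r6 r7 c1 c2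
  have hb : C.b₂ + C.b₅ = -2 + 2 * p := by linear_combination r5
  -- Only p = 0 agrees with `lax`, whose leading word uuvuv is not a rotation of uuuvv.
  by_cases hp : p = 0
  · subst hp
    have e1 : C.b₁ = -C.a₁ := by linear_combination r3
    have e3 : C.b₃ = 0 := by linear_combination r6 - e1
    have e4 : C.b₄ = 1 - C.a₂ - C.a₃ := by linear_combination (r7 - hb) / 2
    have e2 := b₂_eq_of_isTraceIntegral hR hRd hRc e1 e3 e4 (by linear_combination hb)
    have e5 : C.b₅ = -2 + C.a₁ + C.a₂ := by linear_combination hb - e2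
    -- With p = 0 the word uuvuv has the cyclic coefficient 1, and the conditions on the quartic
    -- part cancel the terms with s 2 and s 3. The two relations from 7 letters become c₁ + d₁ = 0
    -- and c₂ + d₂ = 0.
    exact ⟨e1, e2, e3, e4, e5,
      by linear_combination c2 - s 3 * e1 - s 2 * (e3 + e5),
      by linear_combination c1 - s 2 * (e2 + e3) + s 3 * (e1 + e2 + e3 + e4 + e5)⟩
  · exfalso
    have f1 : C.a₂ + C.a₃ + C.b₄ = -1 - (C.b₂ + C.b₅) - C.b₃ := by
      refine mul_right_cancel₀ hp ?_
      linear_combination -r1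
    have f6 : (1 - 2 * p) * (C.a₁ + C.b₁ + C.b₃ + p) = 0 := by linear_combination r6 + p * hb
    -- The value of b₄ is found from a relation with the factor 1 - p, so p = 1 needs another
    -- combination of the relations.
    by_cases hq0 : p = 1
    · subst hq0
      have e6 : C.a₁ + C.b₁ + C.b₃ + 1 = 0 := by linear_combination -f6
      have e4 : C.a₁ + C.b₁ = 0 := by linear_combination (r4 - f1 + hb + e6) / 2
      refine not_shift hR hRd hRc hp (by linear_combination e4)
        (by linear_combination r2 - e6 + e4) (by linear_combination e6 - e4)
        (by linear_combination f1 - hb - e6 + e4) hb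
    · have hq1 : 1 - p ≠ 0 := fun h => hq0 (by linear_combination -h)
      have e4 : C.b₄ = 1 - p - C.a₂ - C.a₃ := by
        refine mul_right_cancel₀ hq1 ?_
        linear_combination r7 / 2 - (1 - p) * hb / 2
      have e3 : C.b₃ = -p := by linear_combination f1 - e4 - hb
      have f6' : (1 - 2 * p) * (C.a₁ + C.b₁) = 0 := by linear_combination f6 - (1 - 2 * p) * e3
      have e2 : p * (C.a₁ + C.a₂ + C.b₂ - p) = (1 - p) * (C.a₁ + C.b₁) := by
        linear_combination r2 - p * e3 + (1 - p) * (hb + e3 + e4)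
      -- Either p = 1/2, with a₁ + b₁ undetermined, or a₁ + b₁ = 0, and then the system belongs to
      -- the family of `not_shift`.
      rcases mul_eq_zero.1 f6' with h | h
      · have hp2 : p = 1 / 2 := by linear_combination -h / 2
        subst hp2
        exact not_half hR hRd hRc (by linear_combination 2 * e2) (by linear_combination e3)
          (by linear_combination e4) (by linear_combination hb)
      · refine not_shift hR hRd hRc hp (by linear_combination h) ?_ e3 e4 hb
        refine mul_left_cancel₀ hp ?_
        linear_combination e2 + (1 - p) * h

theorem admitsIntegral_iff (C : Coeffs) (κ : Params) (z : ℂ) :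
    ((system C κ z).AdmitsIntegral (hamiltonian κ z) ∧
      (system C κ z).AdmitsIntegral (hamiltonian κ z ^ 2)) ↔ HasIntegrals C :=
  ⟨fun h => hasIntegrals_of_admitsIntegral h.1 h.2,
    fun h => admitsIntegral_of_hasIntegrals h κ z⟩

end Elim

theorem mainTheorem3 (C : PainleveFive.Coeffs) (κ : PainleveFive.Params) (z : ℂ) :
    (((PainleveFive.system C κ z).AdmitsIntegral (PainleveFive.hamiltonian κ z) ∧
        (PainleveFive.system C κ z).AdmitsIntegral (PainleveFive.hamiltonian κ z ^ 2)) ↔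
      (C.b₁ = -C.a₁ ∧ C.b₂ = -C.a₁ - C.a₂ ∧ C.b₃ = 0 ∧ C.b₄ = 1 - C.a₂ - C.a₃ ∧
        C.b₅ = -2 + C.a₁ + C.a₂ ∧ C.d₁ = -C.c₁ ∧ C.d₂ = -C.c₂)) ∧
    (κ.κ₄ * z ≠ 0 →
      (PainleveFive.system C κ z).AdmitsIntegral (PainleveFive.hamiltonian κ z) →
      (PainleveFive.system C κ z).AdmitsIntegral (PainleveFive.hamiltonian κ z ^ 2) →
      (PainleveFive.system C κ z).AdmitsSymmetry (PainleveFive.hamiltonian κ z) 1 →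
      ∃ F : NCSystem, PainleveFive.IsListed F κ z ∧
        (PainleveFive.system C κ z = F ∨ PainleveFive.system C κ z = F.transpose)) := by
  have key := Elim.admitsIntegral_iff C κ z
  exact ⟨key, fun hz h1 h2 h3 => Elim.exists_isListed (key.1 ⟨h1, h2⟩) hz h3⟩
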